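/- **Bifurcation patterns of $D_6$.** Consider a smooth one-parameter family ($\xi\in J$, $J\subseteq\mathbb R$ open) of Lagrangian systems $L=\frac12\sum_i m_i\dot q_i^2+U(q)$, with masses $m_i>0$, period $T>0$ and potential $U$ (smooth on an open set $\Omega\subseteq\mathbb R^N$) that may depend smoothly on $\xi$. Let $S[q]=\int_0^T L\,dt$ be the action on smooth $T$-periodic functions, and let $q_o=q_o(\xi)$ be a smooth family of $T$-periodic solutions of $m_i\ddot q_i=\partial U/\partial q_i$. Periodic functions are written in terms of the phase $t/T$. Let $D_6=\langle B,S\mid B^6=S^2=1,\ BS=SB^{-1}\rangle$ act on them by linear operators, independent of $\xi$, that preserve the $L^2$ inner product, take $\Omega$-valued functions to $\Omega$-valued functions, and satisfy $S[gq]=S[q]$ and $gq_o=q_o$. Put $C=B^2$, $M=B^3$. Let $\mathcal H=-m_i\delta_{ij}\frac{d^2}{dt^2}+\frac{\partial^2U}{\partial q_i\partial q_j}(q_o)$ be the Hessian of the action. Eigenfunctions are always taken orthogonal to the zero modes that come from conservation laws, i.e. to $\dot q_o$ and to all $a+Aq_o$ where $x\mapsto a+Ax$ is an infinitesimal symmetry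 of the Lagrangian for all $\xi\in J$. Let $\kappa(\xi)$ be an eigenvalue of $\mathcal H$ with $\kappa(\xi)\to0=\kappa(\xi_0)$ for $\xi\to\xi_0\in J$, whose eigenspace is an irreducible representation of $D_6$ for every $\xi\in J$, while all other eigenvalues satisfy $|\lambda|\ge\delta$ for some $\delta>0$ independent of $\xi$. (a) For $\xi$ near $\xi_0$ the eigenspace has an orthonormal basis, depending smoothly on $\xi$, in which $B,S$ act by exactly one of the following: I: $B=1,S=1$; II: $B=1,S=-1$; III: $B=-1,S=1$; IV: $B=-1,S=-1$; V: $B$ = rotation by $2\pi/3$, $S=\mathrm{diag}(1,-1)$; VI: $B$ = rotation by $\pi/3$, $S=\mathrm{diag}(1,-1)$. In V and VI the basis is written $\phi_+,\phi_-$, and $\phi(\theta)=\cos\theta\,\phi_++\sin\theta\,\phi_-$. (b) For each such basis the Lyapunov–Schmidt reduction exists: there is a small correction $w(\xi,u)$, orthogonal to the eigenspace and the above zero modes, that makes the action at $q_o+\sum u_i\phi_i+w$ stationary in all directions orthogonal to the eigenspace and the zero modes. For every such $w$, one has $w=O(|u|^2)$, and the reduced action $S_{LS}(\xi,u)=S[q_o+\sum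 u_i\phi_i+w]-S[q_o]$ is smooth near $(\xi_0,0)$. Along a unit vector $e$, $S_{LS}(re)=\frac\kappa2r^2+\sum_{n\ge3}\frac{A_n}{n!}r^n$ as a Taylor expansion, where $A_3=\int_0^T\sum\frac{\partial^3U}{\partial q_i\partial q_j\partial q_k}f_if_jf_k\,dt$ with $f=\sum e_i\phi_i$. A *branch of order $n$ along $e$ with symmetry group $G\subseteq D_6$* means bifurcated solutions $q_b=q_o+r\sum e_i\phi_i+w(\xi,re)$ of the equations of motion with $0\ne r=r(\xi)\to0$, with $\{g\in D_6: gq_b=q_b\}=G$, with $A_3=\dots=A_{n+1}=0\ne A_{n+2}$ along $e$ and $\kappa=-A_{n+2}r^n/(n+1)!+O(r^{n+1})$, and with second derivative of $S_{LS}$ along $e$ at $re$ equal to $-n\kappa+O(\kappa^2)$. Nondegeneracy conditions are imposed at $\xi_0$. "No others" means: for $\xi$ near $\xi_0$, every solution uniformly $\varepsilon$-close to $q_o$ (with $\varepsilon>0$ independent of $\xi$) and differing from $q_o$ by a function orthogonal to the above zero modes is $q_o$ or one of those listed. * **I.** If $A_3\ne0$: a branch of order 1 with group $D_6$, for both signs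 of $\kappa$; no others. * **II, III, IV.** If $A_4\ne0$: a branch of order 2 on the side $\kappa A_4<0$ only, with group $C_6=\{B^k\}$ for II, $D_3=\{1,C,C^2,S,SC,SC^2\}$ for III, $D_3'=\{1,C,C^2,MS,MSC,MSC^2\}$ for IV. There are two copies, $q_b$ and $bq_b\neq q_b$, with $b=S,M,M$ respectively; no others. * **V.** $A_3(\theta)=A_3(0)\cos3\theta$ and $A_4(\theta)=A_4(0)$. If $A_3(0)\ne0$: a branch of order 1 along $\phi_+$ with group $D_2=\{1,M,S,SM\}$, for both signs of $\kappa$, with exactly three copies $q_b,Cq_b,C^2q_b$, located at $\theta=4\pi k/3$; no others. All three are saddles of $S_{LS}$; at $q_b$ its second derivatives along $\phi_+$ and $\phi_-$ are $-\kappa+O(\kappa^2)$ and $3\kappa+O(\kappa^2)$. * **VI.** $A_4(\theta)=A_4(0)$ and $A_6(\theta)=A_{6+}\cos^23\theta+A_{6-}\sin^23\theta$. If $A_4(0)\ne0$: on the side $\kappa A_4(0)<0$ only, there are two branches of order 2, $q_{b+}$ along $\phi_+$ with group $D_1=\{1,S\}$ and $q_{b-}$ along $\phi_-$ with group $D_1'=\{1,MS\}$,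 each with six distinct copies $B^kq_{b\pm}$, located at $\theta=\pi k/3$ and $\theta=\pi/2+\pi k/3$. If moreover $A_{6+}\ne A_{6-}$, there are no others, and one family consists of nondegenerate local extrema of $S_{LS}$ (minima if $A_4(0)>0$, maxima if $A_4(0)<0$) and the other one of saddles: the extrema are $B^kq_{b+}$ if $A_4(0)(A_{6-}-A_{6+})>0$, and $B^kq_{b-}$ if it is $<0$. -/

import Mathlib

open Filter Topology Asymptotics MeasureTheory
open scoped ContDiff

noncomputable section

namespace D6Bifurcation

/-! ### Dihedral group and its irreducible representations -/

/-- The dihedral group of the regular hexagon; `r i` is `B ^ i` and `sr i` is `S B ^ i`. -/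
abbrev D6 : Type := DihedralGroup 6

/-- The rotation `B` of order six. -/
def B : D6 := DihedralGroup.r 1

/-- The reflection `S`; one has `B S = S B⁻¹`. -/
def S : D6 := DihedralGroup.sr 0

/-- `C = B²`. -/
def C : D6 := B ^ 2

/-- `M = B³`, the nontrivial central element. -/
def M : D6 := B ^ 3

/-- The names of the six irreducible representations of `D6`. -/
inductive Irrep : Type
  | I | II | III | IV | V | VI

/-- Dimension of the representation. -/
abbrev Irrep.dim : Irrep → ℕ
  | .I => 1
  | .II => 1
  | .III => 1
  | .IV => 1
  | .V => 2
  | .VI => 2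

/-- The matrix of the rotation by the angle `α`. -/
def rotMatrix (α : ℝ) : Matrix (Fin 2) (Fin 2) ℝ :=
  !![Real.cos α, -Real.sin α; Real.sin α, Real.cos α]

/-- The matrix representing `B`. -/
def Irrep.matB : (t : Irrep) → Matrix (Fin t.dim) (Fin t.dim) ℝ
  | .I => (1 : Matrix (Fin 1) (Fin 1) ℝ)
  | .II => (1 : Matrix (Fin 1) (Fin 1) ℝ)
  | .III => (-1 : Matrix (Fin 1) (Fin 1) ℝ)
  | .IV => (-1 : Matrix (Fin 1) (Fin 1) ℝ)
  | .V => rotMatrix (2 * Real.pi / 3)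
  | .VI => rotMatrix (Real.pi / 3)

/-- The matrix representing `S`. -/
def Irrep.matS : (t : Irrep) → Matrix (Fin t.dim) (Fin t.dim) ℝ
  | .I => (1 : Matrix (Fin 1) (Fin 1) ℝ)
  | .II => (-1 : Matrix (Fin 1) (Fin 1) ℝ)
  | .III => (1 : Matrix (Fin 1) (Fin 1) ℝ)
  | .IV => (-1 : Matrix (Fin 1) (Fin 1) ℝ)
  | .V => !![1, 0; 0, -1]
  | .VI => !![1, 0; 0, -1]

/-- `C₆ = {1, B, …, B⁵}`. -/
def C6 : Set D6 := {g | ∃ k : ℕ, g = B ^ k}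

/-- `D₃ = {1, C, C², S, SC, SC²}`. -/
def D3 : Set D6 := {1, C, C ^ 2, S, S * C, S * C ^ 2}

/-- `D₃′ = {1, C, C², MS, MSC, MSC²}`. -/
def D3' : Set D6 := {1, C, C ^ 2, M * S, M * S * C, M * S * C ^ 2}

/-- `D₂ = {1, M, S, SM}`. -/
def D2 : Set D6 := {1, M, S, S * M}

/-- `D₁ = {1, S}`. -/
def D1 : Set D6 := {1, S}

/-- `D₁′ = {1, MS}`. -/
def D1' : Set D6 := {1, M * S}

/-! ### Stationary points of functions on a finite dimensional space -/

section Stationary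

variable {W : Type*} [NormedAddCommGroup W] [NormedSpace ℝ W]

/-- Second derivative of `f` at `a` in the direction `v`. -/
def hess (f : W → ℝ) (a v : W) : ℝ := iteratedDeriv 2 (fun s : ℝ => f (a + s • v)) 0

/-- A saddle: a stationary point at which the second derivative takes both signs. -/
def IsSaddle (f : W → ℝ) (a : W) : Prop :=
  HasFDerivAt f (0 : W →L[ℝ] ℝ) a ∧ (∃ v, hess f a v < 0) ∧ ∃ v, 0 < hess f a v

/-- A nondegenerate local minimum. -/
def IsNondegMin (f : W → ℝ) (a : W) : Prop :=
  HasFDerivAt f (0 : W →L[ℝ] ℝ) a ∧ IsLocalMin f a ∧ ∀ v, v ≠ 0 → 0 < hess f a v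

/-- A nondegenerate local maximum. -/
def IsNondegMax (f : W → ℝ) (a : W) : Prop :=
  HasFDerivAt f (0 : W →L[ℝ] ℝ) a ∧ IsLocalMax f a ∧ ∀ v, v ≠ 0 → hess f a v < 0

end Stationary

/-! ### Periodic functions and the action -/

/-- Configuration space. -/
abbrev Conf (N : ℕ) : Type := EuclideanSpace ℝ (Fin N)

/-- Smooth periodic functions, written in terms of the phase `s = t / T`: the element `x`
stands for the `T`-periodic function `q(t) = x (t / T)`. -/
def Loop (N : ℕ) : Submodule ℝ (ℝ → Conf N) where
  carrier := {x | ContDiff ℝ ∞ x ∧ Function.Periodic x 1}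
  add_mem' := fun hx hy => ⟨hx.1.add hy.1, hx.2.add hy.2⟩
  zero_mem' := ⟨contDiff_const, fun _ => rfl⟩
  smul_mem' := fun c _ hx => ⟨contDiff_const.smul hx.1, hx.2.smul c⟩

/-- A smooth one-parameter family of Lagrangian systems `½ ∑ mᵢ q̇ᵢ² + U(q)`, considered on
functions of period `T`. Masses, potential and period may all depend on the parameter `ξ`,
which ranges over the open set `J`; the potential is smooth on the open set `Ω`. -/
structure LagrangianFamily (N : ℕ) where
  J : Set ℝ
  isOpen_J : IsOpen J
  Ω : Set (Conf N)
  isOpen_Ω : IsOpen Ω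
  mass : ℝ → Fin N → ℝ
  mass_pos : ∀ ξ ∈ J, ∀ i, 0 < mass ξ i
  mass_smooth : ∀ i, ContDiffOn ℝ ∞ (fun ξ => mass ξ i) J
  T : ℝ → ℝ
  T_pos : ∀ ξ ∈ J, 0 < T ξ
  T_smooth : ContDiffOn ℝ ∞ T J
  U : ℝ → Conf N → ℝ
  U_smooth : ContDiffOn ℝ ∞ (fun p : ℝ × Conf N => U p.1 p.2) (J ×ˢ Ω)

namespace LagrangianFamily

variable {N : ℕ} (F : LagrangianFamily N)

/-- The function `q(t) = x (t / T)` of time. -/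
def traj (ξ : ℝ) (x : ℝ → Conf N) : ℝ → Conf N := fun t => x (t / F.T ξ)

/-- The action `S[q] = ∫₀ᵀ (½ ∑ mᵢ q̇ᵢ² + U(q)) dt`. -/
def action (ξ : ℝ) (x : ℝ → Conf N) : ℝ :=
  ∫ t in (0 : ℝ)..F.T ξ,
    ((1 / 2) * ∑ i, F.mass ξ i * (deriv (F.traj ξ x) t i) ^ 2 + F.U ξ (F.traj ξ x t))

/-- The inner product `∫₀ᵀ ∑ fᵢ gᵢ dt`. -/
def ip (ξ : ℝ) (x y : ℝ → Conf N) : ℝ :=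
  ∫ t in (0 : ℝ)..F.T ξ, ∑ i, F.traj ξ x t i * F.traj ξ y t i

/-- The function takes its values in the domain of the potential. -/
def Admissible (x : ℝ → Conf N) : Prop := ∀ s, x s ∈ F.Ω

/-- Equations of motion `mᵢ q̈ᵢ = ∂U/∂qᵢ`. -/
def IsSolution (ξ : ℝ) (x : Loop N) : Prop :=
  F.Admissible x ∧ ∀ t i,
    F.mass ξ i * deriv (deriv (F.traj ξ x)) t i = gradient (F.U ξ) (F.traj ξ x t) i

/-- `h` is an eigenfunction, or zero, of the Hessian operator
`-mᵢ δᵢⱼ d²/dt² + ∂²U/∂qᵢ∂qⱼ` at `x`, with eigenvalue `μ`. -/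
def HessianEq (ξ : ℝ) (x h : Loop N) (μ : ℝ) : Prop :=
  ∀ t i, -(F.mass ξ i * deriv (deriv (F.traj ξ h)) t i)
      + fderiv ℝ (gradient (F.U ξ)) (F.traj ξ x t) (F.traj ξ h t) i
    = μ * F.traj ξ h t i

/-- The infinitesimal symmetries `x ↦ a + A x` of the Lagrangians of the family (translations
and rotations in an N-body problem, for instance). A vector field on configuration space
that preserves the kinetic energy is of this form. -/
def infSymm : Set (Conf N × (Conf N →L[ℝ] Conf N)) :=
  {p | ∀ ξ ∈ F.J, (∀ v : Conf N, ∑ i, F.mass ξ i * (v i * p.2 v i) = 0) ∧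
    ∀ x ∈ F.Ω, fderiv ℝ (F.U ξ) x (p.1 + p.2 x) = 0}

/-- `h` is orthogonal to the zero modes at `x` that come from conservation laws: `dx/dt`
(time translation, energy) and `a + A x` (spatial symmetries). These are the
eigenfunctions that are left out of every expansion. -/
def Transverse (ξ : ℝ) (x h : Loop N) : Prop :=
  F.ip ξ h (deriv (x : ℝ → Conf N)) = 0 ∧
    ∀ p ∈ F.infSymm, F.ip ξ h (fun s => p.1 + p.2 ((x : ℝ → Conf N) s)) = 0

end LagrangianFamily

/-- A smooth family of periodic solutions `q ξ` with symmetry group `D6`: the group acts by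
linear operators on periodic functions which preserve the inner product, `g q = q` and
`S[g x] = S[x]` for every periodic function `x`. -/
structure SymmetricFamily (N : ℕ) extends LagrangianFamily N where
  q : ℝ → Loop N
  q_smooth : ContDiffOn ℝ ∞ (fun p : ℝ × ℝ => (q p.1 : ℝ → Conf N) p.2) (J ×ˢ Set.univ)
  q_sol : ∀ ξ ∈ J, toLagrangianFamily.IsSolution ξ (q ξ)
  ρ : Representation ℝ D6 (Loop N)
  ρ_ip : ∀ ξ ∈ J, ∀ (g : D6) (x y : Loop N),
    toLagrangianFamily.ip ξ (ρ g x) (ρ g y) = toLagrangianFamily.ip ξ x y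
  ρ_admissible : ∀ (g : D6) (x : Loop N),
    toLagrangianFamily.Admissible x → toLagrangianFamily.Admissible (ρ g x)
  ρ_action : ∀ ξ ∈ J, ∀ (g : D6) (x : Loop N), toLagrangianFamily.Admissible x →
    toLagrangianFamily.action ξ (ρ g x) = toLagrangianFamily.action ξ x
  ρ_q : ∀ ξ ∈ J, ∀ g : D6, ρ g (q ξ) = q ξ

namespace SymmetricFamily

variable {N : ℕ} (F : SymmetricFamily N)

/-- `h` is an eigenfunction, or zero, of the Hessian at `q ξ` with eigenvalue `μ`, and it is
orthogonal to the zero modes that come from conservation laws. -/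
def IsMode (ξ : ℝ) (h : Loop N) (μ : ℝ) : Prop :=
  F.HessianEq ξ (F.q ξ) h μ ∧ F.Transverse ξ (F.q ξ) h

/-- `κ ξ` is the critical eigenvalue at `ξ₀`: it tends to `0` for `ξ → ξ₀`, its eigenfunctions
form an irreducible representation of `D6`, and all other eigenvalues (zero modes from
conservation laws excluded) stay away from zero. -/
structure IsCritical (ξ₀ : ℝ) (κ : ℝ → ℝ) : Prop where
  mem : ξ₀ ∈ F.J
  zero : κ ξ₀ = 0
  tendsto : Tendsto κ (𝓝 ξ₀) (𝓝 0)
  irreducible : ∀ ξ ∈ F.J, ∃ E : Subrepresentation F.ρ,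
    (∀ h : Loop N, h ∈ E ↔ F.IsMode ξ h (κ ξ)) ∧
    Representation.IsIrreducible (k := ℝ) (G := D6) (V := E.toSubmodule) E.toRepresentation
  gap : ∃ δ > 0, ∀ ξ ∈ F.J, ∀ (h : Loop N) (μ : ℝ), h ≠ 0 → F.IsMode ξ h μ →
    μ = κ ξ ∨ δ ≤ |μ|

/-- The functions `φ ξ i` form, for `ξ` in the neighbourhood `J₁` of `ξ₀`, an orthonormal set
of critical eigenfunctions, smooth in the parameter, that belongs to the irreducible
representation `t`: `B φⱼ = ∑ᵢ φᵢ Bᵢⱼ` and `S φⱼ = ∑ᵢ φᵢ Sᵢⱼ`. In the two-dimensional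
representations `φ₀` and `φ₁` are `φ₊` and `φ₋`, with `S φ± = ± φ±`. -/
structure IsCriticalFrame (ξ₀ : ℝ) (κ : ℝ → ℝ) (t : Irrep) (J₁ : Set ℝ)
    (φ : ℝ → Fin t.dim → Loop N) : Prop where
  isOpen : IsOpen J₁
  subset : J₁ ⊆ F.J
  mem : ξ₀ ∈ J₁
  smooth : ∀ i, ContDiffOn ℝ ∞ (fun p : ℝ × ℝ => (φ p.1 i : ℝ → Conf N) p.2)
    (J₁ ×ˢ Set.univ)
  mode : ∀ ξ ∈ J₁, ∀ i, F.IsMode ξ (φ ξ i) (κ ξ)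
  orthonormal : ∀ ξ ∈ J₁, ∀ i j, F.ip ξ (φ ξ i) (φ ξ j) = if i = j then 1 else 0
  act_B : ∀ ξ ∈ J₁, ∀ j, F.ρ B (φ ξ j) = ∑ i, t.matB i j • φ ξ i
  act_S : ∀ ξ ∈ J₁, ∀ j, F.ρ S (φ ξ j) = ∑ i, t.matS i j • φ ξ i

/-! ### Lyapunov–Schmidt reduction -/

section Reduction

variable {d : ℕ} (φ : ℝ → Fin d → Loop N) (w : ℝ → EuclideanSpace ℝ (Fin d) → Loop N)

/-- The element `∑ uᵢ φᵢ` of the critical eigenspace. -/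
def crit (ξ : ℝ) (u : EuclideanSpace ℝ (Fin d)) : Loop N := ∑ i, u i • φ ξ i

/-- The periodic function `q + ∑ uᵢ φᵢ + w(u)`. -/
def point (ξ : ℝ) (u : EuclideanSpace ℝ (Fin d)) : Loop N := F.q ξ + crit φ ξ u + w ξ u

/-- `h` is a superposition of noncritical eigenfunctions: it is orthogonal to the zero modes
from conservation laws and to the critical eigenfunctions. -/
def IsNoncritical (ξ : ℝ) (h : Loop N) : Prop :=
  F.Transverse ξ (F.q ξ) h ∧ ∀ i, F.ip ξ h (φ ξ i) = 0

/-- `w` is the Lyapunov–Schmidt correction `r ∑ ε_α ψ_α` as a function of the coordinates `u`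
of the critical part: it is a superposition of noncritical eigenfunctions, it solves the
stationarity condition in all noncritical directions, and it is small for small `u`. -/
structure IsLyapunovSchmidt (ξ₀ : ℝ) : Prop where
  small : ∀ ε > 0, ∀ᶠ p in 𝓝 (ξ₀, (0 : EuclideanSpace ℝ (Fin d))),
    ∀ s, ‖(w p.1 p.2 : ℝ → Conf N) s‖ < ε
  noncritical : ∀ᶠ p in 𝓝 (ξ₀, (0 : EuclideanSpace ℝ (Fin d))),
    F.IsNoncritical φ p.1 (w p.1 p.2)
  stationary : ∀ᶠ p in 𝓝 (ξ₀, (0 : EuclideanSpace ℝ (Fin d))),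
    ∀ h : Loop N, F.IsNoncritical φ p.1 h →
      HasDerivAt (fun s : ℝ => F.action p.1 (F.point φ w p.1 p.2 + s • h : Loop N)) 0 0

/-- The reduced action `S_LS(u) = S[q + ∑ uᵢ φᵢ + w(u)] - S[q]`. -/
def SLS (ξ : ℝ) (u : EuclideanSpace ℝ (Fin d)) : ℝ :=
  F.action ξ (F.point φ w ξ u) - F.action ξ (F.q ξ)

/-- The coefficient `A_n` in `S_LS(r e) = ∑ A_n r^n / n!`. -/
def coeff (n : ℕ) (ξ : ℝ) (e : EuclideanSpace ℝ (Fin d)) : ℝ :=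
  iteratedDeriv n (fun r : ℝ => F.SLS φ w ξ (r • e)) 0

/-- The expansion of the reduced action: it is smooth, `w = O(|u|²)`, and
`S_LS(r e) = κ r² / 2 + A₃ r³ / 3! + …` with
`A₃ = ∫ ∑ (∂³U/∂qᵢ∂qⱼ∂qₖ) fᵢ fⱼ fₖ dt` for `f = ∑ eᵢ φᵢ`. -/
structure ReducedExpansion (ξ₀ : ℝ) (κ : ℝ → ℝ) : Prop where
  smooth : ContDiffAt ℝ ∞ (fun p : ℝ × EuclideanSpace ℝ (Fin d) => F.SLS φ w p.1 p.2) (ξ₀, 0)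
  second_order : ∃ c : ℝ, ∀ᶠ p in 𝓝 (ξ₀, (0 : EuclideanSpace ℝ (Fin d))),
    ∀ s, ‖(w p.1 p.2 : ℝ → Conf N) s‖ ≤ c * ‖p.2‖ ^ 2
  coeffs : ∀ᶠ ξ in 𝓝 ξ₀, ∀ e : EuclideanSpace ℝ (Fin d), ‖e‖ = 1 →
    F.coeff φ w 0 ξ e = 0 ∧ F.coeff φ w 1 ξ e = 0 ∧ F.coeff φ w 2 ξ e = κ ξ ∧
    F.coeff φ w 3 ξ e = ∫ t in (0 : ℝ)..F.T ξ,
      iteratedFDeriv ℝ 3 (F.U ξ) (F.traj ξ (F.q ξ) t)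
        (fun _ => F.traj ξ (crit φ ξ e) t)

/-- The solutions of the equations of motion that are uniformly `ε`-close to `q ξ` and do not
differ from it along the zero modes of the conservation laws. -/
def nearSolutions (ξ ε : ℝ) : Set (Loop N) :=
  {x | F.IsSolution ξ x ∧ (∀ s, ‖(x : ℝ → Conf N) s - (F.q ξ : ℝ → Conf N) s‖ < ε) ∧
    F.Transverse ξ (F.q ξ) (x - F.q ξ)}

/-- For `ξ → ξ₀` along the filter `l` there is a branch of bifurcated solutions
`q_b = q + r φ_e + w` in the direction `e` of the critical eigenspace. Its symmetry group
is exactly `G`. The bifurcation has order `n`: `A₃ = … = A_{n+1} = 0 ≠ A_{n+2}` and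
`κ = -A_{n+2} r^n / (n+1)! + O(r^{n+1})`. The second derivative of the reduced action along
the branch direction is `-n κ + O(κ²)`. -/
structure IsBranch (ξ₀ : ℝ) (κ : ℝ → ℝ) (l : Filter ℝ) (n : ℕ) (e : EuclideanSpace ℝ (Fin d))
    (G : Set D6) (r : ℝ → ℝ) : Prop where
  tendsto : Tendsto r l (𝓝 0)
  solution : ∀ᶠ ξ in l, r ξ ≠ 0 ∧ F.IsSolution ξ (F.point φ w ξ (r ξ • e))
  symmetry : ∀ᶠ ξ in l, ∀ g : D6,
    F.ρ g (F.point φ w ξ (r ξ • e)) = F.point φ w ξ (r ξ • e) ↔ g ∈ G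
  lower : ∀ m, 3 ≤ m → m < n + 2 → ∀ᶠ ξ in 𝓝 ξ₀, F.coeff φ w m ξ e = 0
  leading : F.coeff φ w (n + 2) ξ₀ e ≠ 0
  order : (fun ξ => κ ξ + F.coeff φ w (n + 2) ξ e * r ξ ^ n / (n + 1).factorial)
    =O[l] fun ξ => r ξ ^ (n + 1)
  radial : (fun ξ => hess (F.SLS φ w ξ) (r ξ • e) e + n * κ ξ) =O[l] fun ξ => κ ξ ^ 2

end Reduction

/-! ### The bifurcation patterns -/

/-- The parameter tends to `ξ₀` within the set where `P` holds. -/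
abbrev along (ξ₀ : ℝ) (P : ℝ → Prop) : Filter ℝ := 𝓝[{ξ | P ξ}] ξ₀

/-- The unit vector of the one-dimensional space. -/
def e₁ : EuclideanSpace ℝ (Fin 1) := EuclideanSpace.single 0 1

/-- The direction `(cos θ, sin θ)`, which corresponds to `cos θ φ₊ + sin θ φ₋`. -/
def dir (θ : ℝ) : EuclideanSpace ℝ (Fin 2) := !₂[Real.cos θ, Real.sin θ]

/-- Representation I. If `A₃ ≠ 0`, there is an order `1` branch with symmetry `D₆`, for both
signs of `κ`, and it is the only one. -/
def PatternI (ξ₀ : ℝ) (κ : ℝ → ℝ) (φ : ℝ → Fin 1 → Loop N)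
    (w : ℝ → EuclideanSpace ℝ (Fin 1) → Loop N) : Prop :=
  F.coeff φ w 3 ξ₀ e₁ ≠ 0 → ∃ r : ℝ → ℝ,
    F.IsBranch φ w ξ₀ κ (along ξ₀ fun ξ => κ ξ ≠ 0) 1 e₁ Set.univ r ∧
    ∃ ε > 0,
      (∀ᶠ ξ in along ξ₀ fun ξ => κ ξ ≠ 0,
        F.nearSolutions ξ ε = {F.q ξ, F.point φ w ξ (r ξ • e₁)}) ∧
      ∀ᶠ ξ in along ξ₀ fun ξ => κ ξ = 0, F.nearSolutions ξ ε = {F.q ξ}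

/-- Representations II, III and IV. If `A₄ ≠ 0`, there is an order `2` branch with symmetry
group `G`, on the side `κ A₄ < 0` only, and there it consists of two copies `q_b`, `b q_b`,
where `b` is a broken symmetry. -/
def PatternOneSide (G : Set D6) (b : D6) (ξ₀ : ℝ) (κ : ℝ → ℝ) (φ : ℝ → Fin 1 → Loop N)
    (w : ℝ → EuclideanSpace ℝ (Fin 1) → Loop N) : Prop :=
  F.coeff φ w 4 ξ₀ e₁ ≠ 0 → ∃ r : ℝ → ℝ,
    F.IsBranch φ w ξ₀ κ (along ξ₀ fun ξ => κ ξ * F.coeff φ w 4 ξ₀ e₁ < 0) 2 e₁ G r ∧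
    ∃ ε > 0,
      (∀ᶠ ξ in along ξ₀ fun ξ => κ ξ * F.coeff φ w 4 ξ₀ e₁ < 0,
        F.ρ b (F.point φ w ξ (r ξ • e₁)) ≠ F.point φ w ξ (r ξ • e₁) ∧
        F.nearSolutions ξ ε =
          {F.q ξ, F.point φ w ξ (r ξ • e₁), F.ρ b (F.point φ w ξ (r ξ • e₁))}) ∧
      ∀ᶠ ξ in along ξ₀ fun ξ => 0 ≤ κ ξ * F.coeff φ w 4 ξ₀ e₁, F.nearSolutions ξ ε = {F.q ξ}

/-- Representation V. If `A₃(0) ≠ 0`, there is an order `1` branch in the direction `φ₊`, with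
symmetry group `D₂`, for both signs of `κ`. It has the three copies `Cᵏ q_b`; there are no
other bifurcated solutions. All copies are saddles of the reduced action, whose second
derivatives there are `-κ + O(κ²)` and `3κ + O(κ²)`. -/
def PatternV (ξ₀ : ℝ) (κ : ℝ → ℝ) (φ : ℝ → Fin 2 → Loop N)
    (w : ℝ → EuclideanSpace ℝ (Fin 2) → Loop N) : Prop :=
  (∀ᶠ ξ in 𝓝 ξ₀, ∀ θ : ℝ,
    F.coeff φ w 3 ξ (dir θ) = F.coeff φ w 3 ξ (dir 0) * Real.cos (3 * θ) ∧
    F.coeff φ w 4 ξ (dir θ) = F.coeff φ w 4 ξ (dir 0)) ∧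
  (F.coeff φ w 3 ξ₀ (dir 0) ≠ 0 → ∃ r : ℝ → ℝ,
    F.IsBranch φ w ξ₀ κ (along ξ₀ fun ξ => κ ξ ≠ 0) 1 (dir 0) D2 r ∧
    (∀ᶠ ξ in along ξ₀ fun ξ => κ ξ ≠ 0,
      (Function.Injective fun k : Fin 3 =>
        F.ρ (C ^ (k : ℕ)) (F.point φ w ξ (r ξ • dir 0))) ∧
      ∀ k : ℕ,
        F.ρ (C ^ k) (F.point φ w ξ (r ξ • dir 0)) =
          F.point φ w ξ (r ξ • dir (4 * Real.pi / 3 * k)) ∧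
        IsSaddle (F.SLS φ w ξ) (r ξ • dir (4 * Real.pi / 3 * k))) ∧
    ((fun ξ => hess (F.SLS φ w ξ) (r ξ • dir 0) (dir (Real.pi / 2)) - 3 * κ ξ)
      =O[along ξ₀ fun ξ => κ ξ ≠ 0] fun ξ => κ ξ ^ 2) ∧
    ∃ ε > 0,
      (∀ᶠ ξ in along ξ₀ fun ξ => κ ξ ≠ 0,
        F.nearSolutions ξ ε = insert (F.q ξ)
          (Set.range fun k : Fin 3 => F.ρ (C ^ (k : ℕ)) (F.point φ w ξ (r ξ • dir 0)))) ∧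
      ∀ᶠ ξ in along ξ₀ fun ξ => κ ξ = 0, F.nearSolutions ξ ε = {F.q ξ})

/-- Nondegenerate local minimum if `0 < a`, nondegenerate local maximum if `a < 0`. -/
def IsExtremal {W : Type*} [NormedAddCommGroup W] [NormedSpace ℝ W] (a : ℝ) (f : W → ℝ)
    (x : W) : Prop :=
  (0 < a → IsNondegMin f x) ∧ (a < 0 → IsNondegMax f x)

/-- Representation VI. If `A₄(0) ≠ 0`, there are two order `2` branches, on the side
`κ A₄(0) < 0` only: one in the direction `φ₊`, with symmetry group `D₁`, and one in the
direction `φ₋`, with symmetry group `D₁′`. Each has the six copies `Bᵏ q_b`. If moreover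
`A₆₊ ≠ A₆₋`, there are no other bifurcated solutions, and the copies of one of the branches
are extrema and those of the other one saddles of the reduced action. -/
def PatternVI (ξ₀ : ℝ) (κ : ℝ → ℝ) (φ : ℝ → Fin 2 → Loop N)
    (w : ℝ → EuclideanSpace ℝ (Fin 2) → Loop N) : Prop :=
  (∀ᶠ ξ in 𝓝 ξ₀, ∀ θ : ℝ,
    F.coeff φ w 4 ξ (dir θ) = F.coeff φ w 4 ξ (dir 0) ∧
    F.coeff φ w 6 ξ (dir θ) = F.coeff φ w 6 ξ (dir 0) * Real.cos (3 * θ) ^ 2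
      + F.coeff φ w 6 ξ (dir (Real.pi / 2)) * Real.sin (3 * θ) ^ 2) ∧
  (F.coeff φ w 4 ξ₀ (dir 0) ≠ 0 → ∃ r₁ r₂ : ℝ → ℝ,
    let a₄ := F.coeff φ w 4 ξ₀ (dir 0)
    let a₆p := F.coeff φ w 6 ξ₀ (dir 0)
    let a₆m := F.coeff φ w 6 ξ₀ (dir (Real.pi / 2))
    let l := along ξ₀ fun ξ => κ ξ * a₄ < 0
    let θ₁ : ℕ → ℝ := fun k => Real.pi / 3 * k
    let θ₂ : ℕ → ℝ := fun k => Real.pi / 2 + Real.pi / 3 * k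
    let q₁ := fun ξ => F.point φ w ξ (r₁ ξ • dir 0)
    let q₂ := fun ξ => F.point φ w ξ (r₂ ξ • dir (Real.pi / 2))
    F.IsBranch φ w ξ₀ κ l 2 (dir 0) D1 r₁ ∧
    F.IsBranch φ w ξ₀ κ l 2 (dir (Real.pi / 2)) D1' r₂ ∧
    (∀ᶠ ξ in l,
      (Function.Injective fun k : Fin 6 => F.ρ (B ^ (k : ℕ)) (q₁ ξ)) ∧
      (Function.Injective fun k : Fin 6 => F.ρ (B ^ (k : ℕ)) (q₂ ξ)) ∧
      ∀ k : ℕ, F.ρ (B ^ k) (q₁ ξ) = F.point φ w ξ (r₁ ξ • dir (θ₁ k)) ∧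
        F.ρ (B ^ k) (q₂ ξ) = F.point φ w ξ (r₂ ξ • dir (θ₂ k))) ∧
    ∃ ε > 0,
      (∀ᶠ ξ in along ξ₀ fun ξ => 0 ≤ κ ξ * a₄, F.nearSolutions ξ ε = {F.q ξ}) ∧
      (a₆p ≠ a₆m → ∃ ε₁ > 0, ∀ᶠ ξ in l,
        F.nearSolutions ξ ε₁ = insert (F.q ξ)
          ((Set.range fun k : Fin 6 => F.ρ (B ^ (k : ℕ)) (q₁ ξ)) ∪
            Set.range fun k : Fin 6 => F.ρ (B ^ (k : ℕ)) (q₂ ξ))) ∧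
      (0 < a₄ * (a₆m - a₆p) → ∀ᶠ ξ in l, ∀ k : ℕ,
        IsExtremal a₄ (F.SLS φ w ξ) (r₁ ξ • dir (θ₁ k)) ∧
        IsSaddle (F.SLS φ w ξ) (r₂ ξ • dir (θ₂ k))) ∧
      (a₄ * (a₆m - a₆p) < 0 → ∀ᶠ ξ in l, ∀ k : ℕ,
        IsSaddle (F.SLS φ w ξ) (r₁ ξ • dir (θ₁ k)) ∧
        IsExtremal a₄ (F.SLS φ w ξ) (r₂ ξ • dir (θ₂ k))))

/-- The bifurcation pattern of each of the six representations. -/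
def Pattern (ξ₀ : ℝ) (κ : ℝ → ℝ) : (t : Irrep) → (φ : ℝ → Fin t.dim → Loop N) →
    (w : ℝ → EuclideanSpace ℝ (Fin t.dim) → Loop N) → Prop
  | .I, φ, w => F.PatternI ξ₀ κ φ w
  | .II, φ, w => F.PatternOneSide C6 S ξ₀ κ φ w
  | .III, φ, w => F.PatternOneSide D3 M ξ₀ κ φ w
  | .IV, φ, w => F.PatternOneSide D3' M ξ₀ κ φ w
  | .V, φ, w => F.PatternV ξ₀ κ φ w
  | .VI, φ, w => F.PatternVI ξ₀ κ φ w

end SymmetricFamily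

end D6Bifurcation

end

noncomputable section

open scoped Real
open Real (cos sin dist_eq norm_eq_abs sin_sq_add_cos_sq cos_zero)
open Metric (ball ball_mem_nhds mem_ball eventually_nhds_iff_ball)
open Finset (sum_congr sum_eq_zero sum_range_succ mul_sum smul_sum)
open Set (univ mem_univ mem_singleton_iff)
open Function (Injective Periodic iterate_succ_apply comp_apply)
open Subsingleton (elim)
open intervalIntegral (integral_congr integral_mono_on)
open ContinuousLinearMap (fst snd)
open EuclideanSpace (norm_eq)
open IsBigO (of_bound)
open Module.End (mul_apply)
open Sum (inl inr)
open ContinuousMap (evalCLM)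
open HasFDerivAt (comp_hasDerivAt_of_eq)
open Matrix (one_apply toEuclideanLin)
open Submodule (span subset_span)
open Continuous (intervalIntegrable)
open Filter.Eventually (of_forall)
local notation "Per(" E ")" => C(UnitAddCircle, E)
local notation "SmoothOn" => ContDiffOn ℝ ∞
local notation "SmoothAt" => ContDiffAt ℝ ∞
local notation "Smooth" => ContDiff ℝ ∞
local notation "O₂" => (0 : EuclideanSpace ℝ (Fin 2) →L[ℝ] ℝ)

set_option linter.unusedSectionVars false

lemma _root_.ContDiffAt.toFDeriv {E F : Type*} [NormedAddCommGroup E] [NormedSpace ℝ E]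
    [NormedAddCommGroup F] [NormedSpace ℝ F] {f : E → F} {x : E} {n : WithTop ℕ∞}
    (h : ContDiffAt ℝ n f x) (hn : n ≠ 0 := by simp) : HasFDerivAt f (fderiv ℝ f x) x :=
  (h.differentiableAt hn).hasFDerivAt

namespace PeriodicODE

/-- The continuous function on the circle induced by a continuous `1`-periodic function. -/
def toCircle {F : Type*} [TopologicalSpace F] [Zero F] (x : ℝ → F) : Per(F) :=
  open Classical in
  if h : Continuous x ∧ Periodic x 1 then ⟨h.2.lift, h.1.quotient_liftOn' _⟩ else 0

section

variable {F : Type*}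
include F

lemma toCircle_coe [TopologicalSpace F] [Zero F] {x : ℝ → F} (hc : Continuous x) (hp :
    Periodic x 1) (t : ℝ) : toCircle x t = x t := by
  rw [toCircle, dif_pos ⟨hc, hp⟩]
  exact hp.lift_coe t

lemma continuous_coe_circle [TopologicalSpace F] (X : Per(F)) : Continuous fun t : ℝ => X t :=
    X.continuous.comp (AddCircle.continuous_mk' 1)

lemma periodic_coe_circle [TopologicalSpace F] (X : Per(F)) : Periodic (fun t : ℝ => X t) 1 := fun t => by
  simp

lemma circle_ext [TopologicalSpace F] {X Y : Per(F)} (h : ∀ t : ℝ, X t = Y t) : X = Y := by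
  ext t
  induction t using QuotientAddGroup.induction_on with
  | H t => exact h t

end

section Calculus

variable {X F K : Type} [NormedAddCommGroup X] [NormedSpace ℝ X] [NormedAddCommGroup F]
  [NormedSpace ℝ F] [TopologicalSpace K] [CompactSpace K]

lemma hasFDerivAt_of_pointwise {N : X → C(K, F)} {D : X → X →L[ℝ] C(K, F)} {x0 : X} (hD :
    ContinuousAt D x0) (h : ∀ᶠ x in 𝓝 x0, ∀ k : K, HasFDerivAt (fun x => N x k) ((evalCLM ℝ k).comp
    (D x)) x) : HasFDerivAt N (D x0) x0 := by
  refine HasFDerivAt.of_isLittleO (isLittleO_iff.2 fun c hc => ?_)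
  obtain ⟨r, hr, hball⟩ := eventually_nhds_iff_ball.1 (h.and (Metric.continuousAt_iff'.1 hD c hc))
  filter_upwards [ball_mem_nhds x0 hr] with x hx
  refine (ContinuousMap.norm_le _ (by positivity)).2 fun k => ?_
  have := (convex_ball x0 r).norm_image_sub_le_of_norm_hasFDerivWithin_le' (f := fun x => N x k) (f'
    := fun x => (evalCLM ℝ k).comp (D x)) (φ := (evalCLM ℝ k).comp (D x0)) (C := c) (fun y hy =>
    ((hball y hy).1 k).hasFDerivWithinAt) (fun y hy => ?_) (Metric.mem_ball_self hr) hx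
  · simpa using this
  · rw [← ContinuousLinearMap.comp_sub]
    refine ContinuousLinearMap.opNorm_le_bound _ hc.le fun v => ?_; have h2 := (hball y hy).2
    rw [dist_eq_norm] at h2
    calc ‖((D y - D x0) v) k‖ ≤ ‖(D y - D x0) v‖ := ContinuousMap.norm_coe_le_norm _ k
      _ ≤ ‖D y - D x0‖ * ‖v‖ := ContinuousLinearMap.le_opNorm _ _
      _ ≤ c * ‖v‖ := by gcongr

end Calculus

section Nemytskii

variable {P E F : Type} [NormedAddCommGroup P] [NormedSpace ℝ P] [NormedAddCommGroup E]
  [NormedSpace ℝ E] [NormedAddCommGroup F] [NormedSpace ℝ F]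

def nem (g : (P × E) × ℝ → F) (z : P × Per(E)) : Per(F) :=
  toCircle fun t : ℝ => g ((z.1, z.2 t), t)

/-- The pairs for which the superposition operator only sees values in `O`. -/
def nemDom (O : Set (P × E)) : Set (P × Per(E)) :=
  {z | ∀ t : UnitAddCircle, (z.1, z.2 t) ∈ O}

lemma isOpen_nemDom {O : Set (P × E)} (hO : IsOpen O) : IsOpen (nemDom O) := by
  have h1 : Continuous fun z : P × Per(E) =>
      (ContinuousMap.const UnitAddCircle z.1).prodMk z.2 := by
    refine ContinuousMap.continuous_of_continuous_uncurry _ ?_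
    change Continuous fun q : (P × Per(E)) × UnitAddCircle => (q.1.1, q.1.2 q.2); fun_prop
  convert ((ContinuousMap.isOpen_setOfPred_mapsTo isCompact_univ hO).preimage h1) using 1
  ext z
  simp [nemDom, Set.MapsTo]

section

variable {g : (P × E) × ℝ → F} {O : Set (P × E)} (hg : ContinuousOn g (O ×ˢ univ))
  (hper : ∀ y ∈ O, ∀ t, g (y, t + 1) = g (y, t))
include g O hg hper

lemma nem_coe {z : P × Per(E)} (hz : z ∈ nemDom O) (t : ℝ) : nem g z t = g ((z.1, z.2 t), t) := by
  refine toCircle_coe ?_ ?_ t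
  · refine hg.comp_continuous ?_ ?_
    · exact (continuous_const.prodMk (continuous_coe_circle z.2)).prodMk continuous_id
    · exact fun t => ⟨hz t, trivial⟩
  · intro t; have := hper _ (hz t) t; simpa using this

lemma continuousOn_nem : ContinuousOn (nem g) (nemDom O) := by
  rw [continuousOn_iff_continuous_domRestrict]
  refine ContinuousMap.continuous_of_continuous_uncurry _ ?_
  rw [(IsOpenQuotientMap.id.prodMap QuotientAddGroup.isOpenQuotientMap_mk).isQuotientMap.continuous_iff]
  have : (Function.uncurry fun (x : nemDom O) y =>
      (nemDom O).domRestrict (nem g) x y) ∘ (Prod.map id (fun t : ℝ => t))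
      = fun q : nemDom O × ℝ => g ((q.1.1.1, q.1.1.2 (q.2 : UnitAddCircle)), q.2) := by
    ext q; exact nem_coe hg hper q.1.2 q.2
  rw [this]
  refine hg.comp_continuous ?_ (fun q => ⟨q.1.2 _, trivial⟩)
  have h3 : Continuous fun q : nemDom O × ℝ => (q.2 : UnitAddCircle) :=
    (AddCircle.continuous_mk' 1).comp continuous_snd
  fun_prop

end

/-- Pointwise application of a continuous family of linear maps. -/
def mulFun (W : Per((P × E) →L[ℝ] F)) (z : P × Per(E)) :
    Per(F) := ⟨fun t => W t (z.1, z.2 t), by fun_prop⟩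

def mulOp : Per((P × E) →L[ℝ] F) →L[ℝ]
    (P × Per(E) →L[ℝ] Per(F)) :=
  LinearMap.mkContinuous₂ (E := Per((P × E) →L[ℝ] F))
    (F := P × Per(E)) (G := Per(F))
    (LinearMap.mk₂ ℝ mulFun
      (fun _ _ _ => by ext; simp [mulFun]) (fun _ _ _ => by ext; simp [mulFun])
      (fun W z z' => by
        ext t
        simpa [mulFun] using (W t).map_add (z.1, z.2 t) (z'.1, z'.2 t))
      (fun c W z => by
        ext t
        simpa [mulFun] using (W t).map_smul c (z.1, z.2 t))) 1
    (fun W z => by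
      refine (ContinuousMap.norm_le _ (by positivity)).2 fun t => ?_
      calc ‖W t (z.1, z.2 t)‖ ≤ ‖W t‖ * ‖(z.1, z.2 t)‖ := (W t).le_opNorm _
        _ ≤ 1 * ‖W‖ * ‖z‖ := by
          rw [one_mul]
          gcongr
          · exact W.norm_coe_le_norm t
          · exact max_le_max le_rfl (z.2.norm_coe_le_norm t))

lemma mulOp_apply (W : Per((P × E) →L[ℝ] F)) (z : P × Per(E))
    t : mulOp W z t = W t (z.1, z.2 t) := rfl

def spatialDeriv (g : (P × E) × ℝ → F) (q : (P × E) × ℝ) : (P × E) →L[ℝ] F :=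
  (fderiv ℝ g q).comp (ContinuousLinearMap.inl ℝ (P × E) ℝ)

section

variable {g : (P × E) × ℝ → F} {O : Set (P × E)} (hO : IsOpen O)
  (hg : SmoothOn g (O ×ˢ univ))
include g O hO hg

lemma contDiffOn_spatialDeriv : SmoothOn (spatialDeriv g) (O ×ˢ univ) := by
  exact (hg.fderiv_of_isOpen (hO.prod isOpen_univ) (by simp)).clm_comp contDiffOn_const

lemma hasFDerivAt_spatial {y : P × E} (hy : y ∈ O) (t : ℝ) : HasFDerivAt (fun y => g (y, t))
    (spatialDeriv g (y, t)) y := by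
  exact (((hg.contDiffAt ((hO.prod isOpen_univ).mem_nhds ⟨hy, trivial⟩)).toFDeriv)).comp y (hasFDerivAt_prodMk_left y t)

lemma periodic_spatialDeriv (hper : ∀ y ∈ O, ∀ t, g (y, t + 1) = g (y, t)) : ∀ y ∈ O, ∀ t,
    spatialDeriv g (y, t + 1) = spatialDeriv g (y, t) := by
  intro y hy t
  refine (hasFDerivAt_spatial hO hg hy (t + 1)).unique ((hasFDerivAt_spatial hO hg hy t).congr_of_eventuallyEq ?_)
  filter_upwards [hO.mem_nhds hy] with y' hy'
  exact hper y' hy' t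

lemma hasFDerivAt_nem (hper : ∀ y ∈ O, ∀ t, g (y, t + 1) = g (y, t)) {z : P × Per(E)}
    (hz : z ∈ nemDom O) : HasFDerivAt (nem g) (mulOp (nem (spatialDeriv g) z)) z := by
  have hg' := contDiffOn_spatialDeriv hO hg
  have hper' := periodic_spatialDeriv hO hg hper
  have hopen := isOpen_nemDom hO
  refine hasFDerivAt_of_pointwise (D := fun z => mulOp (nem (spatialDeriv g) z)) ?_ ?_
  · exact mulOp.continuous.continuousAt.comp
      ((continuousOn_nem hg'.continuousOn hper').continuousAt (hopen.mem_nhds hz))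
  · filter_upwards [hopen.mem_nhds hz] with z' hz' k
    induction k using QuotientAddGroup.induction_on with
    | H t =>
    let ev : P × Per(E) →L[ℝ] P × E :=
      (ContinuousLinearMap.id ℝ P).prodMap (evalCLM ℝ (t : UnitAddCircle))
    refine ((HasFDerivAt.comp z' (hasFDerivAt_spatial hO hg (hz' t) t) ev.hasFDerivAt).congr_of_eventuallyEq ?_).congr_fderiv ?_
    · filter_upwards [hopen.mem_nhds hz'] with z'' hz''; exact nem_coe hg.continuousOn hper hz'' t
    · ext v
      · simp
        rw [show ((t : ℝ) : ℝ ⧸ _) = (t : UnitAddCircle) from rfl, mulOp_apply,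
          nem_coe hg'.continuousOn hper' hz' t]
        rfl
      · simp
        rw [show ((t : ℝ) : ℝ ⧸ _) = (t : UnitAddCircle) from rfl, mulOp_apply,
          nem_coe hg'.continuousOn hper' hz' t]
        rfl

lemma contDiffOn_nem (hper : ∀ y ∈ O, ∀ t, g (y, t + 1) = g (y, t)) : SmoothOn (nem g) (nemDom
    O) := by
  rw [contDiffOn_infty]
  intro n
  induction n generalizing F with
  | zero => exact contDiffOn_zero.2 (continuousOn_nem hg.continuousOn hper)
  | succ n ih =>
    push_cast; rw [contDiffOn_succ_iff_fderiv_of_isOpen (isOpen_nemDom hO)]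
    refine ⟨fun z hz => (hasFDerivAt_nem hO hg hper hz).differentiableAt.differentiableWithinAt,
      by simp, ?_⟩
    have hm : ContDiff ℝ n fun W =>
        (mulOp W : P × Per(E) →L[ℝ] Per(F)) := by fun_prop
    have h2 := hm.comp_contDiffOn (ih (contDiffOn_spatialDeriv hO hg) (periodic_spatialDeriv hO hg hper))
    exact h2.congr fun z hz => (hasFDerivAt_nem hO hg hper hz).fderiv

end

lemma contDiffOn_toCircle {b : P → ℝ → F} {O : Set P} (hO : IsOpen O) (hb : SmoothOn (fun q : P × ℝ
    => b q.1 q.2) (O ×ˢ univ)) (hper : ∀ p ∈ O, Periodic (b p) 1) : SmoothOn (fun p => toCircle (b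
    p)) O := by
  let g : (P × ℝ) × ℝ → F := fun q => b q.1.1 q.2
  have hg : SmoothOn g ((O ×ˢ (univ : Set ℝ)) ×ˢ univ) := by
    refine hb.comp (f := fun q : (P × ℝ) × ℝ => (q.1.1, q.2)) (by fun_prop) ?_
    rintro q ⟨⟨h1, -⟩, -⟩; exact ⟨h1, trivial⟩
  have h2 : SmoothOn (fun p => ((p, 0) : P × Per(ℝ))) O := by fun_prop
  exact (contDiffOn_nem (hO.prod isOpen_univ) hg (fun y hy t => hper y.1 hy.1 t)).comp h2 fun p hp t => ⟨hp, trivial⟩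

end Nemytskii

section Primitive

variable {F : Type} [NormedAddCommGroup F] [NormedSpace ℝ F] [CompleteSpace F]

def mean : Per(F) →L[ℝ] F :=
  LinearMap.mkContinuous
    { toFun := fun X => ∫ s in (0 : ℝ)..1, X s
      map_add' := fun X Y => by
        simpa using intervalIntegral.integral_add
          ((continuous_coe_circle X).intervalIntegrable 0 1)
          ((continuous_coe_circle Y).intervalIntegrable 0 1)
      map_smul' := fun c X => by simp } 1
    (fun X => by
      have := intervalIntegral.norm_integral_le_of_norm_le_const (a := 0) (b := 1) (C := ‖X‖)
        (f := fun s : ℝ => X s) (fun s _ => X.norm_coe_le_norm _)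
      simpa [mul_comm] using this)

lemma mean_apply (X : Per(F)) : mean X = ∫ s in (0 : ℝ)..1, X s := rfl

def constC : F →L[ℝ] Per(F) :=
  LinearMap.mkContinuous
    { toFun := fun a => ContinuousMap.const _ a
      map_add' := fun _ _ => rfl
      map_smul' := fun _ _ => rfl } 1
    (fun a => (ContinuousMap.norm_le _ (by positivity)).2 fun t => by rw [one_mul]; exact le_rfl)

@[simp] lemma constC_apply (a : F) t : constC a t = a := rfl

@[simp] lemma mean_constC (a : F) : mean (constC a) = a := by simp [mean_apply]

def shift (σ : ℝ) : Per(F) →L[ℝ] Per(F) :=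
  LinearMap.mkContinuous
    { toFun := fun X => ⟨fun t => X (t + σ), by fun_prop⟩
      map_add' := fun _ _ => rfl
      map_smul' := fun _ _ => rfl } 1
    (fun X => (ContinuousMap.norm_le _ (by positivity)).2 fun t => by
      simpa using X.norm_coe_le_norm _)

@[simp] lemma shift_apply (σ : ℝ) (X : Per(F)) t : shift σ X t = X (t + σ) := rfl

@[simp] lemma shift_constC (σ : ℝ) (a : F) : shift σ (constC a) = constC a := rfl

lemma shift_shift (σ τ : ℝ) (X : Per(F)) : shift σ (shift τ X) = shift τ (shift σ X) := by
  ext t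
  simp [add_right_comm]

lemma shift_neg_shift (σ : ℝ) (X : Per(F)) : shift σ (shift (-σ) X) = X := by
  ext t
  simp

lemma integral_circle_shift (X : Per(F)) (σ : ℝ) : ∫ s in (0 : ℝ)..1, X (s + σ) = ∫ s in (0 : ℝ)..1,
    X s := by
  have h := (periodic_coe_circle X).intervalIntegral_add_eq σ 0
  simp at h
  rw [← h]
  have h2 := intervalIntegral.integral_comp_add_right (a := 0) (b := 1) (fun s => X s) σ
  simp only [AddCircle.coe_add] at h2
  rw [h2, zero_add, add_comm]

@[simp] lemma mean_shift (σ : ℝ) (X : Per(F)) : mean (shift σ X) = mean X :=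
  integral_circle_shift X σ

lemma continuous_shift (X : Per(F)) : Continuous fun σ => shift σ X := by
  refine ContinuousMap.continuous_of_continuous_uncurry _ ?_
  have h1 : Continuous fun q : ℝ × UnitAddCircle => (q.1 : UnitAddCircle) :=
    (AddCircle.continuous_mk' 1).comp continuous_fst
  change Continuous fun q : ℝ × UnitAddCircle => X (q.2 + (q.1 : UnitAddCircle))
  fun_prop

lemma continuous_primKernel (X : Per(F)) : Continuous fun s : ℝ => (s - 1 / 2) • shift s X :=
    (continuous_id.sub continuous_const).smul (continuous_shift X)

/-- The primitive with mean value zero of the oscillating part of a periodic function. -/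
def prim : Per(F) →L[ℝ] Per(F) :=
  LinearMap.mkContinuous
    { toFun := fun X => ∫ s in (0 : ℝ)..1, (s - 1 / 2) • shift s X
      map_add' := fun X Y => by
        rw [← intervalIntegral.integral_add ((continuous_primKernel X).intervalIntegrable 0 1)
          ((continuous_primKernel Y).intervalIntegrable 0 1)]
        simp
      map_smul' := fun c X => by
        simp only [map_smul, RingHom.id_apply]
        rw [← intervalIntegral.integral_smul]
        simp only [smul_comm c] } 1
    (fun X => by
      have := intervalIntegral.norm_integral_le_of_norm_le_const (a := 0) (b := 1) (C := ‖X‖)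
        (f := fun s : ℝ => (s - 1 / 2) • shift s X) (fun s hs => by
          rw [Set.uIoc_of_le zero_le_one] at hs
          have h1 : ‖s - 1 / 2‖ ≤ 1 := by
            rw [norm_eq_abs, abs_le]
            constructor <;> linarith [hs.1, hs.2]
          have h2 : ‖shift s X‖ ≤ ‖X‖ :=
            (ContinuousMap.norm_le _ (by positivity)).2 fun t => X.norm_coe_le_norm _
          rw [norm_smul]
          calc ‖s - 1 / 2‖ * ‖shift s X‖ ≤ 1 * ‖X‖ := by gcongr
            _ = ‖X‖ := one_mul _)
      simpa [mul_comm] using this)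

lemma prim_def (X : Per(F)) : prim X = ∫ s in (0 : ℝ)..1, (s - 1 / 2) • shift s X := rfl

lemma prim_apply (X : Per(F)) t : prim X t = ∫ s in (0 : ℝ)..1, (s - 1 / 2) • X (t + s) := by
  have := (evalCLM ℝ t).intervalIntegral_comp_comm
    ((continuous_primKernel X).intervalIntegrable (μ := volume) 0 1)
  rw [prim_def]
  exact this.symm

@[simp] lemma mean_prim (X : Per(F)) : mean (prim X) = 0 := by
  rw [prim_def, ← ContinuousLinearMap.intervalIntegral_comp_comm _
    ((continuous_primKernel X).intervalIntegrable (μ := volume) 0 1)]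
  simp only [map_smul, mean_shift]
  rw [intervalIntegral.integral_smul_const]
  have : ∫ s in 0..1, (s - 1 / 2) = 0 := by
    rw [intervalIntegral.integral_sub (by simp) (by simp), integral_id]
    norm_num
  rw [this, zero_smul]

lemma prim_shift (σ : ℝ) (X : Per(F)) : prim (shift σ X) = shift σ (prim X) := by
  ext t
  simp only [shift_apply, prim_apply]
  refine integral_congr fun s _ => ?_
  simp only [add_right_comm]

lemma hasDerivAt_prim (X : Per(F)) (t : ℝ) :
    HasDerivAt (fun t : ℝ => prim X t) (X t - mean X) t := by
  set x : ℝ → F := fun s => X s with hx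
  have hxc : Continuous x := continuous_coe_circle X
  have hxp : Periodic x 1 := periodic_coe_circle X
  have hf : Continuous fun s => s • x s := by fun_prop
  have e : (fun t : ℝ => prim X t) = fun t =>
      ((∫ s in 0..(t + 1), s • x s) - ∫ s in 0..t, s • x s)
        - (t + 1 / 2) • ((∫ s in 0..(t + 1), x s) - ∫ s in 0..t, x s) := by
    funext t; rw [intervalIntegral.integral_interval_sub_left (hf.intervalIntegrable _ _)
      (hf.intervalIntegrable _ _), intervalIntegral.integral_interval_sub_left
      (hxc.intervalIntegrable _ _) (hxc.intervalIntegrable _ _), prim_apply]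
    have hg : Continuous fun s => (t + 1 / 2) • x s := by fun_prop
    have h3 : ∀ s : ℝ, (s - 1 / 2) • X (t + s) = (t + s - t - 1 / 2) • x (t + s) := by
      intro s; rw [hx]; simp
    simp only [h3]
    rw [intervalIntegral.integral_comp_add_left (fun s => (s - t - 1 / 2) • x s) t, ← intervalIntegral.integral_smul, ← intervalIntegral.integral_sub
      (hf.intervalIntegrable _ _)
      (hg.intervalIntegrable _ _)]
    simp; refine integral_congr fun s _ => ?_
    simp only [← sub_smul]; ring_nf
  rw [e]
  have hA : ∀ (f : ℝ → F), Continuous f → ∀ t : ℝ, HasDerivAt (fun t => ∫ s in 0..t, f s) (f t) t :=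
    fun f hf t =>
    intervalIntegral.integral_hasDerivAt_right (hf.intervalIntegrable _ _)
      (hf.stronglyMeasurableAtFilter _ _) hf.continuousAt
  have hB : ∀ (f : ℝ → F), Continuous f → ∀ t : ℝ, HasDerivAt (fun t => ∫ s in 0..(t + 1), f s) (f
    (t + 1)) t := fun f hf t =>
    (hA f hf (t + 1)).comp_add_const t 1
  have hM : (∫ s in 0..(t + 1), x s) - ∫ s in 0..t, x s = mean X := by
    rw [intervalIntegral.integral_interval_sub_left (hxc.intervalIntegrable _ _)
      (hxc.intervalIntegrable _ _), hxp.intervalIntegral_add_eq t 0, zero_add]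
    rfl
  refine (((hB _ hf t).sub (hA _ hf t)).sub (((hasDerivAt_id t).add_const (1 / 2)).smul ((hB _ hxc t).sub (hA _ hxc t)))).congr_deriv ?_
  simp only [hM, hxp t, id, Pi.sub_apply]
  module

section

variable {X Y : Per(F)} (h : ∀ t : ℝ, HasDerivAt (fun t : ℝ => X t) (Y t) t)
include X Y h

lemma hasDerivAt_mean_zero : mean Y = 0 := by
  have := intervalIntegral.integral_eq_sub_of_hasDerivAt
    (fun t _ => h t) ((continuous_coe_circle Y).intervalIntegrable 0 1)
  rw [mean_apply, this]
  have := periodic_coe_circle X 0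
  simp only [zero_add] at this
  rw [this, sub_self]

lemma prim_of_hasDerivAt : prim Y = X - constC (mean X) := by
  have hd : ∀ t : ℝ, HasDerivAt (fun t : ℝ => X t - prim Y t) 0 t := fun t => by
    have := (h t).sub (hasDerivAt_prim Y t); rw [hasDerivAt_mean_zero h] at this
    exact this.congr_deriv (by simp)
  have h1 : X - prim Y = constC (X (0 : UnitAddCircle) - prim Y (0 : UnitAddCircle)) :=
    circle_ext (fun t => is_const_of_deriv_eq_zero (fun s => (hd s).differentiableAt) (fun s => (hd s).deriv) t 0)
  have h2 := congrArg mean h1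
  rw [map_sub, mean_prim, sub_zero, mean_constC] at h2
  rw [h2, ← h1]
  abel

end

lemma contDiff_prim {X : Per(F)} {n : ℕ} (h : ContDiff ℝ n fun t : ℝ => X t) : ContDiff ℝ (n + 1 :
    ℕ) fun t : ℝ => prim X t := by
  push_cast
  rw [contDiff_succ_iff_deriv]
  refine ⟨fun t => (hasDerivAt_prim X t).differentiableAt, by simp, ?_⟩
  have : deriv (fun t : ℝ => prim X t) = fun t : ℝ => X t - mean X :=
    funext fun t => (hasDerivAt_prim X t).deriv
  rw [this]
  exact h.sub contDiff_const

lemma isCompactOperator_prim [FiniteDimensional ℝ F] :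
    IsCompactOperator (prim : Per(F) →L[ℝ] Per(F)) := by
  have : ProperSpace F := FiniteDimensional.proper ℝ F
  let e := ContinuousMap.isometryEquivBoundedOfCompact UnitAddCircle F
  let A : Set Per(F) := prim '' Metric.closedBall 0 1
  have hA : IsCompact (closure (e '' A)) := by
    refine BoundedContinuousFunction.arzela_ascoli (Metric.closedBall 0 ‖(prim (F := F))‖)
      (isCompact_closedBall _ _) _ ?_ ?_
    · rintro _ t ⟨_, ⟨X, hX, rfl⟩, rfl⟩; rw [mem_closedBall_zero_iff] at hX ⊢
      calc ‖prim X t‖ ≤ ‖prim X‖ := (prim X).norm_coe_le_norm t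
        _ ≤ ‖(prim)‖ * ‖X‖ := prim.le_opNorm X
        _ ≤ ‖(prim)‖ := mul_le_of_le_one_right (ContinuousLinearMap.opNorm_nonneg _) hX
    · intro t; induction t using QuotientAddGroup.induction_on with
      | H t =>
      rw [Metric.equicontinuousAt_iff_right]; intro ε hε
      rw [QuotientAddGroup.nhds_eq, eventually_map]
      filter_upwards [ball_mem_nhds t (show 0 < ε / 4 by positivity)] with s hs
      rintro ⟨_, _, ⟨X, hX, rfl⟩, rfl⟩; rw [mem_closedBall_zero_iff] at hX
      rw [mem_ball, dist_eq_norm] at hs; have hb : ∀ r : ℝ, ‖X r - mean X‖ ≤ 2 := fun r => by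
        have h1 : ‖mean X‖ ≤ 1 * ‖X‖ := LinearMap.mkContinuous_norm_le _ zero_le_one _ |>
          fun h => (mean.le_opNorm X).trans (by gcongr; exact h)
        calc _ ≤ ‖X r‖ + ‖mean X‖ := norm_sub_le _ _
          _ ≤ 2 := by linarith [X.norm_coe_le_norm r]
      have := convex_univ.norm_image_sub_le_of_norm_hasDerivWithin_le (fun r _ => (hasDerivAt_prim X
        r).hasDerivWithinAt) (fun r _ => hb r) (mem_univ s) (mem_univ t)
      change dist (prim X t) (prim X s) < ε; rw [dist_eq_norm]; rw [norm_sub_rev] at hs; linarith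
  rw [show (prim : Per(F) →L[ℝ] Per(F)) = ⇑(prim : Per(F) →L[ℝ] Per(F)).toLinearMap from rfl,
    isCompactOperator_iff_isCompact_closure_image_closedBall _ one_pos]
  have h2 : closure (e '' A) = e '' closure A := (e.toHomeomorph.image_closure A).symm
  rw [h2] at hA
  exact (e.toHomeomorph.isCompact_image).1 hA

end Primitive

section Pairing

variable {E : Type} [NormedAddCommGroup E] [InnerProductSpace ℝ E] [CompleteSpace E]

lemma continuous_inner_circle (X Y : Per(E)) : Continuous fun s : ℝ => inner ℝ (X s) (Y s) :=
    (continuous_coe_circle X).inner (continuous_coe_circle Y)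

def pair : Per(E) →L[ℝ] Per(E) →L[ℝ] ℝ :=
  LinearMap.mkContinuous₂ (E := Per(E)) (F := Per(E)) (G := ℝ)
    (LinearMap.mk₂ ℝ (fun X Y => ∫ s in (0 : ℝ)..1,
        inner ℝ (X s) (Y s))
      (fun X Y Z => by
        rw [← intervalIntegral.integral_add
          ((continuous_inner_circle X Z).intervalIntegrable 0 1)
          ((continuous_inner_circle Y Z).intervalIntegrable 0 1)]
        simp [inner_add_left])
      (fun c X Y => by simp [inner_smul_left])
      (fun X Y Z => by
        rw [← intervalIntegral.integral_add
          ((continuous_inner_circle X Y).intervalIntegrable 0 1)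
          ((continuous_inner_circle X Z).intervalIntegrable 0 1)]
        simp [inner_add_right])
      (fun c X Y => by simp [inner_smul_right])) 1
    (fun X Y => by
      have := intervalIntegral.norm_integral_le_of_norm_le_const (a := 0) (b := 1)
        (C := ‖X‖ * ‖Y‖)
        (f := fun s : ℝ => inner ℝ (X s) (Y s))
        (fun s _ => (norm_inner_le_norm _ _).trans (by
          gcongr
          · exact X.norm_coe_le_norm _
          · exact Y.norm_coe_le_norm _))
      simpa using this)

lemma pair_apply (X Y : Per(E)) : pair X Y = ∫ s in (0 : ℝ)..1, inner ℝ (X s) (Y s) := rfl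

lemma pair_comm (X Y : Per(E)) : pair X Y = pair Y X := by
  simp only [pair_apply, real_inner_comm]

lemma pair_shift (σ : ℝ) (X Y : Per(E)) : pair (shift σ X) (shift σ Y) = pair X Y :=
  integral_circle_shift ⟨fun t => inner ℝ (X t) (Y t), by fun_prop⟩ σ

lemma pair_self_eq_zero {X : Per(E)} (h : pair X X = 0) : X = 0 := by
  rw [pair_apply] at h
  have h1 := (intervalIntegral.integral_eq_zero_iff_of_nonneg_ae (μ := volume) (of_forall fun s =>
    real_inner_self_nonneg) ((continuous_inner_circle X X).intervalIntegrable 0 1)).1 h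
  by_contra hX
  obtain ⟨t, ht⟩ : ∃ t : ℝ, X t ≠ 0 := by
    by_contra hh
    push Not at hh
    exact hX (circle_ext fun t => by simpa using hh t)
  have hpos : 0 < ∫ s in (t - 1 / 2)..(t + 1 / 2), inner ℝ (X s) (X s) := by
    refine intervalIntegral.integral_pos (by linarith) (continuous_inner_circle X X).continuousOn
      (fun s _ => real_inner_self_nonneg) ⟨t, ⟨by linarith, by linarith⟩, ?_⟩
    exact lt_of_le_of_ne real_inner_self_nonneg (fun h => ht (inner_self_eq_zero.1 h.symm))
  have hper : Periodic (fun s : ℝ => inner ℝ (X s) (X s)) 1 := fun s => by simp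
  have h2 := hper.intervalIntegral_add_eq (t - 1 / 2) 0
  rw [zero_add, h, show t - 1 / 2 + 1 = t + 1 / 2 by ring] at h2
  linarith

lemma pair_by_parts {X X' Y Y' : Per(E)} (hX : ∀ t : ℝ, HasDerivAt (fun t : ℝ => X t) (X' t) t) (hY
    : ∀ t : ℝ, HasDerivAt (fun t : ℝ => Y t) (Y' t) t) : pair X' Y = -pair X Y' := by
  have h1 := hasDerivAt_mean_zero (X := ⟨fun t => inner ℝ (X t) (Y t), by fun_prop⟩) (Y := ⟨fun t =>
    inner ℝ (X t) (Y' t) + inner ℝ (X' t) (Y t), by fun_prop⟩) (fun t => (hX t).inner ℝ (hY t))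
  rw [mean_apply] at h1
  have h3 : pair X Y' + pair X' Y = 0 := by
    rw [pair_apply, pair_apply, ← (intervalIntegral.integral_add (μ := volume) ((continuous_inner_circle X Y').intervalIntegrable 0 1) ((continuous_inner_circle X' Y).intervalIntegrable 0 1))]
    exact h1
  linarith

end Pairing

section Bordered

variable {E F : Type} [NormedAddCommGroup E] [NormedAddCommGroup F] [NormedSpace ℝ F]

section Mul
variable [NormedSpace ℝ E]

/-- Pointwise application of a continuous family of linear maps. -/
def mulFunC (V : Per(E →L[ℝ] F)) (X : Per(E)) :
    Per(F) := ⟨fun t => V t (X t), by fun_prop⟩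

def mulC : Per(E →L[ℝ] F) →L[ℝ] Per(E) →L[ℝ] Per(F) :=
  LinearMap.mkContinuous₂ (E := Per(E →L[ℝ] F)) (F := Per(E))
    (G := Per(F))
    (LinearMap.mk₂ ℝ mulFunC
      (fun _ _ _ => by ext; simp [mulFunC]) (fun _ _ _ => by ext; simp [mulFunC])
      (fun _ _ _ => by ext; simp [mulFunC]) (fun _ _ _ => by ext; simp [mulFunC])) 1
    (fun V X => by
      refine (ContinuousMap.norm_le _ (by positivity)).2 fun t => ?_
      calc ‖V t (X t)‖ ≤ ‖V t‖ * ‖X t‖ := (V t).le_opNorm _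
        _ ≤ 1 * ‖V‖ * ‖X‖ := by
          rw [one_mul]
          gcongr
          · exact V.norm_coe_le_norm t
          · exact X.norm_coe_le_norm t)

@[simp] lemma mulC_apply (V : Per(E →L[ℝ] F)) (X : Per(E)) t : mulC V X t = V t (X t) := rfl

end Mul

variable [InnerProductSpace ℝ E] [CompleteSpace E] {ι : Type} [Fintype ι] [DecidableEq ι]

/-- The integral operator `f ↦ mean f + J² f`, where `J` is the periodic primitive. It inverts
the second derivative in the sense that `x = mean x + R f` if and only if `x'' = f`. -/
def resolv : Per(E) →L[ℝ] Per(E) :=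
  (constC (F := E)).comp (mean (F := E)) + (prim (F := E)).comp (prim (F := E))

lemma resolv_apply (X : Per(E)) : resolv X = constC (mean X) + prim (prim X) := rfl

lemma mean_resolv (X : Per(E)) : mean (resolv X) = mean X := by
  rw [resolv_apply, map_add, mean_constC, mean_prim, add_zero]

lemma resolv_shift (σ : ℝ) (X : Per(E)) : resolv (shift σ X) = shift σ (resolv X) := by
  rw [resolv_apply, resolv_apply, map_add, prim_shift, prim_shift, mean_shift, shift_constC]

/-- The data of a bordered operator: the potential and two families of functions. -/
abbrev BorderedData (E ι : Type) [NormedAddCommGroup E] [InnerProductSpace ℝ E] : Type :=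
  Per(E →L[ℝ] E) × (ι → Per(E)) × (ι → Per(E))

/-- The bordered operator, which sends `(h, c)` to the left hand sides of the equations
`h'' = V h + ∑ cⱼ b'ⱼ`, `⟨h, bⱼ⟩ = 0`, the first one in integrated form. -/
def bordered (D : BorderedData E ι) :
    (Per(E) × (ι → ℝ)) →L[ℝ] (Per(E) × (ι → ℝ)) :=
  let fst := fst ℝ Per(E) (ι → ℝ)
  let snd := snd ℝ Per(E) (ι → ℝ)
  let inl := ContinuousLinearMap.inl ℝ Per(E) (ι → ℝ)
  let inr := ContinuousLinearMap.inr ℝ Per(E) (ι → ℝ)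
  inl.comp (fst - ((constC (F := E)).comp (mean (F := E))).comp fst
      - resolv.comp ((mulC D.1).comp fst
        + ∑ j, ((ContinuousLinearMap.proj (R := ℝ) (φ := fun _ : ι => ℝ) j).comp snd).smulRight
            (D.2.2 j)))
    + inr.comp (∑ j, ((pair (D.2.1 j)).comp fst).smulRight (Pi.single j (1 : ℝ)))

section

variable (D : BorderedData E ι) (h : Per(E)) (c : ι → ℝ)
include D h c

lemma bordered_fst : (bordered D (h, c)).1 = h - constC (mean h) - resolv (mulC D.1 h + ∑ j, c j •
    D.2.2 j) := by
  simp [bordered, Prod.fst_sum]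

lemma bordered_snd (j : ι) : (bordered D (h, c)).2 j = pair (D.2.1 j) h := by
  simp [bordered, Prod.snd_sum, Finset.sum_apply, Pi.single_apply]

end

lemma contDiff_bordered : Smooth (bordered : BorderedData E ι → _) := by
  unfold bordered
  fun_prop

lemma bordered_bijective [FiniteDimensional ℝ E] (D : BorderedData E ι)
    (h : Injective (bordered D)) : Function.Bijective (bordered D) := by
  let T := ContinuousLinearMap.id ℝ (Per(E) × (ι → ℝ)) - bordered D
  have hT : IsCompactOperator T := by
    have hR : IsCompactOperator (resolv : Per(E) →L[ℝ] Per(E)) := by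
      have h2 := isCompactOperator_prim.comp_clm (prim (F := E))
      exact ((isCompactOperator_of_locallyCompactSpace_dom (mean)).clm_comp (constC)).add h2
    let W : (Per(E) × (ι → ℝ)) →L[ℝ] Per(E) := (mulC D.1).comp (fst ℝ Per(E) (ι
      → ℝ)) + ∑ j, ((ContinuousLinearMap.proj (φ := fun _ => ℝ) j).comp (snd ℝ
      Per(E) (ι → ℝ))).smulRight (D.2.2 j)
    let T₂ : (Per(E) × (ι → ℝ)) →L[ℝ] (ι → ℝ) := (snd ℝ Per(E) (ι → ℝ)).comp T
    let T₁ : (Per(E) × (ι → ℝ)) →L[ℝ] E := (mean).comp (fst ℝ Per(E) (ι → ℝ))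
    have h1 : IsCompactOperator ((ContinuousLinearMap.inl ℝ Per(E) (ι → ℝ)) ∘ (constC) ∘ T₁) :=
      ((isCompactOperator_of_locallyCompactSpace_dom T₁).clm_comp _).clm_comp _
    have h2 : IsCompactOperator ((ContinuousLinearMap.inl ℝ Per(E) (ι → ℝ)) ∘ ((resolv : Per(E)
      →L[ℝ] Per(E)) ∘ W)) := (hR.comp_clm W).clm_comp _
    have h3 : IsCompactOperator ((ContinuousLinearMap.inr ℝ Per(E) (ι → ℝ)) ∘ T₂) :=
      (isCompactOperator_of_locallyCompactSpace_dom T₂).clm_comp _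
    refine (congrArg IsCompactOperator (funext fun v => ?_)).mp ((h1.add h2).add h3)
    obtain ⟨v, c⟩ := v; symm; refine Prod.ext ?_ ?_
    · have := bordered_fst D v c; simp [T, T₁, W, this, Prod.fst_sum]; abel
    · simp [T, T₂]
  rcases hT.hasEigenvalue_or_mem_resolventSet one_ne_zero with h1 | h1
  · obtain ⟨v, hv⟩ := h1.exists_hasEigenvector; have h2 : bordered D v = 0 := by
      have := hv.apply_eq_smul; simpa [T] using this
    exact absurd (h (h2.trans (map_zero _).symm)) hv.2
  · rw [spectrum.mem_resolventSet_iff, ContinuousLinearMap.isUnit_iff_bijective] at h1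
    have : (algebraMap ℝ _ 1 - T : (Per(E) × (ι → ℝ)) →L[ℝ] _) = bordered D := by
      refine ContinuousLinearMap.ext fun v => ?_; simp [T]
    rwa [this] at h1

lemma bordered_isInvertible [FiniteDimensional ℝ E] (D : BorderedData E ι)
    (h : Injective (bordered D)) : (bordered D).IsInvertible := by
  have h1 := bordered_bijective D h
  exact ⟨ContinuousLinearEquiv.ofBijective (bordered D) (LinearMap.ker_eq_bot.2 h1.1)
    (LinearMap.range_eq_top.2 h1.2), ContinuousLinearEquiv.coe_ofBijective _ _ _⟩

def solve (D : BorderedData E ι) (r : Per(E) × (ι → ℝ)) :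
    Per(E) × (ι → ℝ) := (bordered D).inverse r

lemma bordered_solve [FiniteDimensional ℝ E] {D : BorderedData E ι} (h : Injective (bordered D)) (r
    : Per(E) × (ι → ℝ)) : bordered D (solve D r) = r := by
  obtain ⟨e, he⟩ := bordered_isInvertible D h
  rw [solve, ← he, ContinuousLinearMap.inverse_equiv]
  simp

lemma eq_solve [FiniteDimensional ℝ E] {D : BorderedData E ι} (h : Injective (bordered D)) {v r :
    Per(E) × (ι → ℝ)} (hv : bordered D v = r) : v = solve D r := h (hv.trans (bordered_solve h
    r).symm)

lemma contDiffAt_solve [FiniteDimensional ℝ E] {D : BorderedData E ι} (h : Injective (bordered D))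
    (r : Per(E) × (ι → ℝ)) : SmoothAt (fun D => solve D r) D := by
  obtain ⟨e, he⟩ := bordered_isInvertible D h
  have h1 := contDiffAt_map_inverse (n := ∞) e
  rw [he] at h1
  exact (h1.comp D contDiff_bordered.contDiffAt).clm_apply contDiffAt_const

lemma eventually_bordered_injective [FiniteDimensional ℝ E] {D : BorderedData E ι}
    (h : Injective (bordered D)) : ∀ᶠ D' in 𝓝 D, Injective (bordered D') := by
  obtain ⟨e, he⟩ := bordered_isInvertible D h
  have h1 := e.nhds
  rw [he] at h1
  filter_upwards [(contDiff_bordered (E := E) (ι := ι)).continuous.continuousAt.preimage_mem_nhds h1]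
    with D' hD'
  obtain ⟨e', he'⟩ := hD'
  rw [← he']
  exact e'.injective

def shiftData (σ : ℝ) (D : BorderedData E ι) : BorderedData E ι :=
  (shift σ D.1, fun j => shift σ (D.2.1 j), fun j => shift σ (D.2.2 j))

lemma bordered_shift (σ : ℝ) (D : BorderedData E ι) (h : Per(E)) (c : ι → ℝ) : bordered (shiftData σ
    D) (shift σ h, c) = (shift σ (bordered D (h, c)).1, (bordered D (h, c)).2) := by
  refine Prod.ext ?_ (funext fun j => ?_)
  · have h1 : mulC (shiftData σ D).1 (shift σ h) + ∑ j, c j • (shiftData σ D).2.2 j = shift σ (mulC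
      D.1 h + ∑ j, c j • D.2.2 j) := by
      rw [map_add, map_sum]; simp; rfl
    rw [bordered_fst, bordered_fst, h1, map_sub, map_sub, shift_constC, mean_shift, resolv_shift]
  · rw [bordered_snd, bordered_snd]; exact pair_shift σ _ _

lemma bordered_shift_injective (σ : ℝ) {D : BorderedData E ι}
    (h : Injective (bordered D)) : Injective (bordered (shiftData σ D)) := by
  rw [injective_iff_map_eq_zero]
  rintro ⟨X, c⟩ hX
  have h1 := bordered_shift σ D (shift (-σ) X) c
  rw [shift_neg_shift, hX, Prod.ext_iff] at h1
  have h2 : (bordered D (shift (-σ) X, c)).1 = 0 := by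
    have := congrArg (shift (-σ)) h1.1; rw [shift_shift, shift_neg_shift] at this
    simpa using this.symm
  have h3 : bordered D (shift (-σ) X, c) = 0 := Prod.ext h2 h1.2.symm
  have h4 := h (h3.trans (map_zero _).symm)
  have h5 : shift (-σ) X = 0 := congrArg Prod.fst h4
  have h6 : c = 0 := congrArg Prod.snd h4
  rw [← shift_neg_shift σ X, h5, h6, map_zero]
  rfl

lemma solve_shift [FiniteDimensional ℝ E] (σ : ℝ) {D : BorderedData E ι}
    (h : Injective (bordered D)) (a : ι → ℝ) :
    solve (shiftData σ D) (0, a) = (shift σ (solve D (0, a)).1, (solve D (0, a)).2) := by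
  symm
  refine eq_solve (bordered_shift_injective σ h) ?_
  rw [bordered_shift, bordered_solve h, map_zero]

end Bordered

section SecondOrder

variable {E : Type} [NormedAddCommGroup E] [InnerProductSpace ℝ E] [CompleteSpace E]

section

variable {X Y : Per(E)} (h : X = constC (mean X) + resolv Y)
include X Y h

lemma mean_eq_zero_of_resolv : mean Y = 0 := by
  have := congrArg mean h
  rw [map_add, mean_constC, mean_resolv] at this
  simpa using this

lemma hasDerivAt_of_resolv (t : ℝ) : HasDerivAt (fun t : ℝ => X t) (prim Y t) t := by
  have h1 := (hasDerivAt_prim (prim Y) t).const_add (mean X)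
  rw [mean_prim, sub_zero] at h1
  refine h1.congr_of_eventuallyEq (of_forall fun s => ?_)
  have := congrArg (fun Z => Z s) h
  simpa [resolv_apply, mean_eq_zero_of_resolv h] using this

lemma hasDerivAt_prim_of_resolv (t : ℝ) : HasDerivAt (fun t : ℝ => prim Y t) (Y t) t := by
  have h1 := hasDerivAt_prim Y t
  rwa [mean_eq_zero_of_resolv h, sub_zero] at h1

end

lemma resolv_of_hasDerivAt {X X' Y : Per(E)} (hX : ∀ t : ℝ, HasDerivAt (fun t : ℝ => X t) (X' t) t)
    (hX' : ∀ t : ℝ, HasDerivAt (fun t : ℝ => X' t) (Y t) t) : X = constC (mean X) + resolv Y := by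
  have h1 := prim_of_hasDerivAt hX'
  rw [hasDerivAt_mean_zero hX, map_zero, sub_zero] at h1
  rw [resolv_apply, hasDerivAt_mean_zero hX', h1, prim_of_hasDerivAt hX, map_zero]
  abel

lemma contDiff_of_resolv {X Y : Per(E)} (h : X = constC (mean X) + resolv Y) (hY : ∀ n : ℕ,
    (ContDiff ℝ n fun t : ℝ => X t) → ContDiff ℝ n fun t : ℝ => Y t) : Smooth fun t : ℝ => X t := by
  rw [contDiff_infty]
  intro n
  induction n with
  | zero => exact contDiff_zero.2 (continuous_coe_circle X)
  | succ n ih =>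
    have h2 : (fun t : ℝ => X t) = fun t : ℝ => mean X + prim (prim Y) t := by
      funext t; have := congrArg (fun Z : Per(E) => Z t) h
      simpa [resolv_apply, mean_eq_zero_of_resolv h] using this
    rw [h2]
    exact contDiff_const.add ((contDiff_prim (contDiff_prim (hY n ih))).of_le (by norm_cast; omega))

end SecondOrder

end PeriodicODE

namespace D6Bifurcation

open PeriodicODE

abbrev CLoop (N : ℕ) : Type := Per(Conf N)

/-- Generators `(c, a, A)` of zero modes: a time shift and the vector field `a + A x`. -/
abbrev Gen (N : ℕ) : Type := ℝ × (Conf N × (Conf N →L[ℝ] Conf N))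

section LoopBasics

variable {N : ℕ}

section

variable (x : Loop N)
include x

lemma loop_contDiff : Smooth x.1 := x.2.1

lemma loop_periodic : Periodic x.1 1 := x.2.2

lemma loop_continuous : Continuous x.1 := (loop_contDiff x).continuous

lemma loop_differentiable : Differentiable ℝ x.1 := (loop_contDiff x).differentiable (by simp)

end

def circ : Loop N →ₗ[ℝ] CLoop N where
  toFun x := toCircle x.1
  map_add' x y := circle_ext fun t => by
    rw [toCircle_coe (loop_continuous (x + y)) (loop_periodic (x + y)), ContinuousMap.add_apply,
      toCircle_coe (loop_continuous x) (loop_periodic x), toCircle_coe (loop_continuous y) (loop_periodic y)]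
    rfl
  map_smul' c x := circle_ext fun t => by
    rw [toCircle_coe (loop_continuous (c • x)) (loop_periodic (c • x)), RingHom.id_apply,
      ContinuousMap.smul_apply, toCircle_coe (loop_continuous x) (loop_periodic x)]
    rfl

@[simp] lemma circ_coe (x : Loop N) (t : ℝ) : circ x t = x.1 t := toCircle_coe (loop_continuous x)
    (loop_periodic x) t

lemma circ_injective : Injective (circ (N := N)) := fun x y h =>
  Subtype.ext (funext fun t => by rw [← circ_coe, h, circ_coe])

lemma exists_loop_of_contDiff {X : CLoop N} (h : Smooth fun t : ℝ => X t) : ∃ x : Loop N, circ x = X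
    := ⟨⟨fun t => X t, h, periodic_coe_circle X⟩, circle_ext fun t => circ_coe _ t⟩

def dLoop : Loop N →ₗ[ℝ] Loop N where
  toFun x := ⟨deriv x.1,
    (contDiff_infty_iff_deriv.1 (loop_contDiff x)).2, fun t => by
      have h : (fun s => x.1 (s + 1)) = x.1 := funext (loop_periodic x)
      rw [← deriv_comp_add_const, h]⟩
  map_add' x y := Subtype.ext (funext fun t =>
    deriv_add ((loop_differentiable x) t) ((loop_differentiable y) t))
  map_smul' c x := Subtype.ext (funext fun t => deriv_const_smul c ((loop_differentiable x) t))

@[simp] lemma coe_dLoop (x : Loop N) : (dLoop x : ℝ → Conf N) = deriv x.1 := rfl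

lemma hasDerivAt_circ (x : Loop N) (t : ℝ) :
    HasDerivAt (fun t : ℝ => circ x t) (circ (dLoop x) t) t := by
  simp only [circ_coe, coe_dLoop]
  exact ((loop_differentiable x) t).hasDerivAt

lemma circ_dLoop_of_hasDerivAt {x : Loop N} {Y : CLoop N} (h : ∀ t : ℝ, HasDerivAt (fun t : ℝ =>
    circ x t) (Y t) t) : circ (dLoop x) = Y := circle_ext fun t => (hasDerivAt_circ x t).unique (h
    t)

def affLoop (p : Conf N × (Conf N →L[ℝ] Conf N)) (x : Loop N) : Loop N :=
  ⟨fun s => p.1 + p.2 (x.1 s), by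
    have := (loop_contDiff x)
    fun_prop, fun s => by simp only [(loop_periodic x) s]⟩

def opLoop (V : ℝ → Conf N →L[ℝ] Conf N) (hV : Smooth V) (hp : Periodic V 1) :
    Loop N →ₗ[ℝ] Loop N where
  toFun x := ⟨fun s => V s (x.1 s), hV.clm_apply (loop_contDiff x), fun s => by
    simp only [hp s, (loop_periodic x) s]⟩
  map_add' x y := Subtype.ext (funext fun t => map_add (V t) _ _)
  map_smul' c x := Subtype.ext (funext fun t => map_smul (V t) _ _)

/-- The `L²` inner product of two loops, with respect to the phase. -/
def l2 : LinearMap.BilinForm ℝ (Loop N) :=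
  LinearMap.mk₂ ℝ (fun x y => pair (circ x) (circ y)) (by simp) (by simp) (by simp) (by simp)

lemma l2_apply (x y : Loop N) : l2 x y = pair (circ x) (circ y) := rfl

lemma l2_eq_integral (x y : Loop N) : l2 x y = ∫ s in (0 : ℝ)..1, inner ℝ (x.1 s) (y.1 s) := by
  simp [l2_apply, pair_apply]

lemma l2_comm (x y : Loop N) : l2 x y = l2 y x := pair_comm _ _

lemma l2_self_eq_zero {x : Loop N} (h : l2 x x = 0) : x = 0 :=
  circ_injective ((pair_self_eq_zero h).trans (map_zero _).symm)

lemma l2_self_nonneg (x : Loop N) : 0 ≤ l2 x x := by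
  rw [l2_eq_integral]
  exact intervalIntegral.integral_nonneg zero_le_one fun s _ => real_inner_self_nonneg

lemma l2_self_pos {x : Loop N} (h : x ≠ 0) : 0 < l2 x x :=
  lt_of_le_of_ne (l2_self_nonneg x) fun h' => h (l2_self_eq_zero h'.symm)

lemma exists_proj {ι : Type} [Fintype ι] (b : ι → Loop N) (x : Loop N) :
    ∃ c : ι → ℝ, ∀ j, l2 (x - ∑ i, c i • b i) (b j) = 0 := by
  let W : Submodule ℝ (Loop N) := span ℝ (Set.range b)
  have hW := FiniteDimensional.span_of_finite ℝ (Set.finite_range b)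
  have hrefl : (l2 (N := N)).IsRefl := fun x y h => by rw [l2_comm, h]
  have hnd : (l2.restrict W).Nondegenerate := by
    have key : ∀ v : W, (∀ u : W, l2.restrict W v u = 0) → v = 0 := fun v hv =>
      Subtype.ext (l2_self_eq_zero (hv v))
    refine ⟨key, fun v hv => key v fun u => ?_⟩; have := hv u; exact (l2_comm _ _).trans this
  let f : Module.Dual ℝ W := (l2 x).comp W.subtype
  let y : W := (LinearMap.BilinForm.toDual (l2.restrict W) hnd).symm f
  obtain ⟨c, hc⟩ := (Submodule.mem_span_range_iff_exists_fun ℝ).1 y.2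
  refine ⟨c, fun j => ?_⟩
  have h1 : l2 (y : Loop N) (b j) = l2 x (b j) :=
    LinearMap.BilinForm.apply_toDual_symm_apply (V := W) (hB := hnd) f ⟨b j, subset_span ⟨j, rfl⟩⟩
  rw [hc, map_sub, LinearMap.sub_apply, h1, sub_self]

lemma zero_smul_cLoop (X : CLoop N) : (0 : ℝ) • X = 0 := ContinuousMap.ext fun _ => zero_smul ℝ _

def diagOp (d : Fin N → ℝ) : Conf N →L[ℝ] Conf N :=
  ∑ i, d i • (EuclideanSpace.proj (𝕜 := ℝ) i).smulRight (EuclideanSpace.single i (1 : ℝ))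

@[simp] lemma diagOp_apply (d : Fin N → ℝ) (v : Conf N) (i : Fin N) : diagOp d v i = d i * v i := by
  simp [diagOp, Finset.sum_apply, Pi.single_apply]

lemma inner_diagOp (d : Fin N → ℝ) (v u : Conf N) :
    inner ℝ (diagOp d v) u = ∑ i, d i * (v i * u i) := by
  rw [PiLp.inner_apply]
  refine sum_congr rfl fun i _ => ?_
  simp
  ring

lemma inner_diagOp_comm (d : Fin N → ℝ) (v u : Conf N) :
    inner ℝ (diagOp d v) u = inner ℝ v (diagOp d u) := by
  rw [inner_diagOp, real_inner_comm, inner_diagOp]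
  simp only [mul_comm (v _)]

end LoopBasics

namespace LagrangianFamily

variable {N : ℕ} (F : LagrangianFamily N) {ξ : ℝ}

lemma T_ne (hξ : ξ ∈ F.J) : F.T ξ ≠ 0 := (F.T_pos ξ hξ).ne'

section

variable {x : ℝ → Conf N} (hx : Differentiable ℝ x) (t : ℝ)
include ξ x hx t

lemma hasDerivAt_traj : HasDerivAt (F.traj ξ x) ((F.T ξ)⁻¹ • deriv x (t / F.T ξ)) t := by
  have h1 : HasDerivAt (fun t => t / F.T ξ) (F.T ξ)⁻¹ t := by
    simpa using (hasDerivAt_id t).div_const (F.T ξ)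
  exact (hx (t / F.T ξ)).hasDerivAt.scomp t h1

lemma deriv_traj : deriv (F.traj ξ x) t = (F.T ξ)⁻¹ • deriv x (t / F.T ξ) :=
  (F.hasDerivAt_traj hx t).deriv

end

lemma deriv_deriv_traj (ξ : ℝ) (x : Loop N) (t : ℝ) : deriv (deriv (F.traj ξ x)) t = ((F.T ξ)⁻¹ *
    (F.T ξ)⁻¹) • (dLoop (dLoop x) : ℝ → Conf N) (t / F.T ξ) := by
  have h1 : deriv (F.traj ξ x) = (F.T ξ)⁻¹ • F.traj ξ (dLoop x : Loop N) := by
    funext t; exact F.deriv_traj (loop_differentiable x) t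
  rw [h1, deriv_const_smul _ (F.hasDerivAt_traj (loop_differentiable (dLoop x)) t).differentiableAt,
    F.deriv_traj (loop_differentiable (dLoop x)), smul_smul]
  rfl

section

variable (hξ : ξ ∈ F.J)
include ξ hξ

lemma integral_traj (f : ℝ → ℝ) : ∫ t in (0 : ℝ)..F.T ξ, f (t / F.T ξ) = F.T ξ * ∫ s in (0 : ℝ)..1,
    f s := by
  rw [intervalIntegral.integral_comp_div _ (F.T_ne hξ), zero_div, div_self (F.T_ne hξ), smul_eq_mul]

lemma ip_eq (x y : Loop N) : F.ip ξ x y = F.T ξ * l2 x y := by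
  rw [l2_eq_integral]
  refine (F.integral_traj hξ fun s => ∑ i, x.1 s i * y.1 s i).trans ?_
  congr 1
  refine integral_congr fun s _ => ?_
  simp only [PiLp.inner_apply, RCLike.inner_apply, conj_trivial]
  grind

lemma ip_eq_zero (x y : Loop N) : F.ip ξ x y = 0 ↔ l2 x y = 0 := by
  rw [F.ip_eq hξ, mul_eq_zero, or_iff_right (F.T_ne hξ)]

lemma transverse_iff (x h : Loop N) : F.Transverse ξ x h ↔ l2 h (dLoop x) = 0 ∧ ∀ p ∈ F.infSymm, l2
    h (affLoop p x) = 0 := by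
  rw [← F.ip_eq_zero hξ h (dLoop x)]
  simp only [← F.ip_eq_zero hξ h (affLoop _ x)]
  rfl

end

/-- The mass matrix divided by the square of the period. -/
def massOp (ξ : ℝ) : Conf N →L[ℝ] Conf N := diagOp fun i => F.mass ξ i / F.T ξ ^ 2

def massInv (ξ : ℝ) : Conf N →L[ℝ] Conf N := diagOp fun i => F.T ξ ^ 2 / F.mass ξ i

section

variable (hξ : ξ ∈ F.J) (v : Conf N)
include ξ hξ v

lemma massOp_massInv : F.massOp ξ (F.massInv ξ v) = v := by
  ext i
  have h1 := F.T_ne hξ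
  have h2 := (F.mass_pos ξ hξ i).ne'
  simp only [massOp, massInv, diagOp_apply]
  field_simp

lemma massInv_massOp : F.massInv ξ (F.massOp ξ v) = v := by
  ext i
  have h1 := F.T_ne hξ
  have h2 := (F.mass_pos ξ hξ i).ne'
  simp only [massOp, massInv, diagOp_apply]
  field_simp

end

lemma contDiffOn_massOp : SmoothOn F.massOp F.J := by
  unfold massOp diagOp
  refine ContDiffOn.sum fun i _ => ?_
  exact ((F.mass_smooth i).div (F.T_smooth.pow 2) fun ξ hξ => pow_ne_zero 2 (F.T_ne hξ)).smul contDiffOn_const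

lemma contDiffOn_massInv : SmoothOn F.massInv F.J := by
  unfold massInv diagOp
  refine ContDiffOn.sum fun i _ => ?_
  exact ((F.T_smooth.pow 2).div (F.mass_smooth i) fun ξ hξ => (F.mass_pos ξ hξ i).ne').smul contDiffOn_const

def mLoop (ξ : ℝ) : Loop N →ₗ[ℝ] Loop N := opLoop (fun _ => F.massOp ξ) contDiff_const fun _ => rfl

def mC (ξ : ℝ) : CLoop N →L[ℝ] CLoop N := mulC (constC (F.massOp ξ))

lemma pair_mC_comm (ξ : ℝ) (X Y : CLoop N) : pair (F.mC ξ X) Y = pair X (F.mC ξ Y) := by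
  simp only [pair_apply]
  exact integral_congr fun s _ => inner_diagOp_comm _ _ _

lemma contDiffOn_mC : SmoothOn F.mC F.J := by
  unfold mC
  have h1 : Smooth fun A =>
      (mulC (constC A) : CLoop N →L[ℝ] CLoop N) := by fun_prop
  exact h1.comp_contDiffOn F.contDiffOn_massOp

lemma isOpen_dom : IsOpen (F.J ×ˢ F.Ω) := F.isOpen_J.prod F.isOpen_Ω

section

variable {x : Conf N} (hξ : ξ ∈ F.J) (hx : x ∈ F.Ω)
include ξ x hξ hx

lemma hasFDerivAt_U : HasFDerivAt (fun p : ℝ × Conf N => F.U p.1 p.2) (fderiv ℝ (fun p : ℝ × Conf N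
    => F.U p.1 p.2) (ξ, x)) (ξ, x) :=
  ((F.U_smooth.contDiffAt (F.isOpen_dom.mem_nhds ⟨hξ, hx⟩)).toFDeriv)

lemma hasFDerivAt_U_right : HasFDerivAt (F.U ξ) ((fderiv ℝ (fun p : ℝ × Conf N => F.U p.1 p.2) (ξ,
    x)).comp (ContinuousLinearMap.inr ℝ ℝ (Conf N))) x :=
  (F.hasFDerivAt_U hξ hx).comp x (hasFDerivAt_prodMk_right ξ x)

end

lemma contDiffOn_fderiv_U :
    SmoothOn (fun p : ℝ × Conf N => fderiv ℝ (F.U p.1) p.2) (F.J ×ˢ F.Ω) := by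
  refine ((F.U_smooth.fderiv_of_isOpen F.isOpen_dom (m := ∞) (by simp)).clm_comp (contDiffOn_const (c := ContinuousLinearMap.inr ℝ ℝ (Conf N)))).congr ?_
  rintro ⟨ξ, x⟩ ⟨hξ, hx⟩
  exact (F.hasFDerivAt_U_right hξ hx).fderiv

lemma contDiffOn_gradient : SmoothOn (fun p : ℝ × Conf N => gradient (F.U p.1) p.2) (F.J ×ˢ F.Ω) :=
    (InnerProductSpace.toDual ℝ (Conf N)).symm.toContinuousLinearEquiv.contDiff.comp_contDiffOn
    F.contDiffOn_fderiv_U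

lemma inner_gradient (ξ : ℝ) (x v : Conf N) :
    inner ℝ (gradient (F.U ξ) x) v = fderiv ℝ (F.U ξ) x v := by simp

lemma hasFDerivAt_gradient {x : Conf N} (hξ : ξ ∈ F.J) (hx : x ∈ F.Ω) :
    HasFDerivAt (gradient (F.U ξ)) (fderiv ℝ (gradient (F.U ξ)) x) x := by
  exact (((F.contDiffOn_gradient.contDiffAt (F.isOpen_dom.mem_nhds ⟨hξ, hx⟩)).differentiableAt (by simp)).comp x (hasFDerivAt_prodMk_right ξ x).differentiableAt).hasFDerivAt

lemma contDiffOn_hessian :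
    SmoothOn (fun p : ℝ × Conf N => fderiv ℝ (gradient (F.U p.1)) p.2) (F.J ×ˢ F.Ω) := by
  refine ((F.contDiffOn_gradient.fderiv_of_isOpen F.isOpen_dom (m := ∞) (by simp)).clm_comp (contDiffOn_const (c := ContinuousLinearMap.inr ℝ ℝ (Conf N)))).congr ?_
  rintro ⟨ξ, x⟩ ⟨hξ, hx⟩
  exact ((((F.contDiffOn_gradient.contDiffAt (F.isOpen_dom.mem_nhds ⟨hξ, hx⟩)).toFDeriv)).comp x (hasFDerivAt_prodMk_right ξ x)).fderiv

section

variable {x : Conf N} (hξ : ξ ∈ F.J) (hx : x ∈ F.Ω)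
include ξ x hξ hx

lemma contDiffAt_U : SmoothAt (F.U ξ) x :=
  (F.U_smooth.contDiffAt (F.isOpen_dom.mem_nhds ⟨hξ, hx⟩)).comp (f := fun x => (ξ, x)) x
    (by fun_prop)

lemma fderiv_gradient_eq (u v : Conf N) : inner ℝ (fderiv ℝ (gradient (F.U ξ)) x u) v = fderiv ℝ
    (fderiv ℝ (F.U ξ)) x u v := by
  have h2 := (F.hasFDerivAt_gradient hξ hx).inner ℝ (hasFDerivAt_const v x)
  simp at h2
  have h3 := (((F.contDiffAt_U hξ hx).fderiv_right (m := ∞) (by simp)).differentiableAt (by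
    simp)).hasFDerivAt
  have := congrArg (fun L => L u) ((h3.clm_apply (hasFDerivAt_const v x)).unique h2)
  simpa using this.symm

lemma inner_hessian_comm (u v : Conf N) : inner ℝ (fderiv ℝ (gradient (F.U ξ)) x u) v = inner ℝ u
    (fderiv ℝ (gradient (F.U ξ)) x v) := by
  rw [F.fderiv_gradient_eq hξ hx, real_inner_comm, F.fderiv_gradient_eq hξ hx]
  exact ((F.contDiffAt_U hξ hx).isSymmSndFDerivAt (by
    rw [minSmoothness_of_isRCLikeNormedField]; exact WithTop.coe_le_coe.2 le_top)).eq u v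

end

def potC (ξ : ℝ) (X : CLoop N) : Per(ℝ) :=
  nem (fun q : (ℝ × Conf N) × ℝ => F.U q.1.1 q.1.2) (ξ, X)

def gradC (ξ : ℝ) (X : CLoop N) : CLoop N :=
  nem (fun q : (ℝ × Conf N) × ℝ => gradient (F.U q.1.1) q.1.2) (ξ, X)

def hessC (ξ : ℝ) (X : CLoop N) : Per(Conf N →L[ℝ] Conf N) :=
  nem (fun q : (ℝ × Conf N) × ℝ => fderiv ℝ (gradient (F.U q.1.1)) q.1.2) (ξ, X)

/-- The pairs `(ξ, X)` such that `ξ ∈ J` and `X` takes its values in `Ω`. -/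
def domC : Set (ℝ × CLoop N) := nemDom (F.J ×ˢ F.Ω)

lemma mem_domC {X : CLoop N} : (ξ, X) ∈ F.domC ↔ ξ ∈ F.J ∧ ∀ t : ℝ, X t ∈ F.Ω := by
  constructor
  · exact fun h => ⟨(h 0).1, fun t => (h t).2⟩
  · rintro ⟨h1, h2⟩ t; induction t using QuotientAddGroup.induction_on with
    | H t => exact ⟨h1, h2 t⟩

lemma isOpen_domC : IsOpen F.domC := isOpen_nemDom F.isOpen_dom

lemma mem_domC_circ (hξ : ξ ∈ F.J) {x : Loop N} (hx : F.Admissible x) : (ξ, circ x) ∈ F.domC := F.mem_domC.2 ⟨hξ, fun t => by rw [circ_coe]; exact hx t⟩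

lemma contDiffOn_lift {G : Type} [NormedAddCommGroup G] [NormedSpace ℝ G] {f : ℝ × Conf N → G} (hf :
    SmoothOn f (F.J ×ˢ F.Ω)) : SmoothOn (fun q : (ℝ × Conf N) × ℝ => f q.1) ((F.J ×ˢ F.Ω) ×ˢ univ)
    := hf.comp contDiffOn_fst fun _ h => h.1

lemma contDiffOn_potC : SmoothOn (fun z : ℝ × CLoop N => F.potC z.1 z.2) F.domC := contDiffOn_nem
    F.isOpen_dom (F.contDiffOn_lift F.U_smooth) fun _ _ _ => rfl

lemma contDiffOn_gradC : SmoothOn (fun z : ℝ × CLoop N => F.gradC z.1 z.2) F.domC := contDiffOn_nem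
    F.isOpen_dom (F.contDiffOn_lift F.contDiffOn_gradient) fun _ _ _ => rfl

section

variable {X : CLoop N} (h : (ξ, X) ∈ F.domC)
include ξ X h

lemma potC_coe (t : ℝ) : F.potC ξ X t = F.U ξ (X t) :=
  nem_coe (F.contDiffOn_lift F.U_smooth).continuousOn (fun _ _ _ => rfl) h t

lemma gradC_coe (t : ℝ) : F.gradC ξ X t = gradient (F.U ξ) (X t) :=
  nem_coe (F.contDiffOn_lift F.contDiffOn_gradient).continuousOn (fun _ _ _ => rfl) h t

lemma hessC_coe (t : ℝ) : F.hessC ξ X t = fderiv ℝ (gradient (F.U ξ)) (X t) :=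
  nem_coe (F.contDiffOn_lift F.contDiffOn_hessian).continuousOn (fun _ _ _ => rfl) h t

lemma hasFDerivAt_potC : HasFDerivAt (F.potC ξ) (mulC (nem (fun q : (ℝ × Conf N) × ℝ => fderiv ℝ
    (F.U q.1.1) q.1.2) (ξ, X))) X := by
  refine ((hasFDerivAt_nem F.isOpen_dom (F.contDiffOn_lift F.U_smooth) (fun _ _ _ => rfl) h).comp X (hasFDerivAt_prodMk_right ξ X)).congr_fderiv (ContinuousLinearMap.ext fun Y => circle_ext fun t => ?_)
  rw [mulC_apply, nem_coe (F.contDiffOn_lift F.contDiffOn_fderiv_U).continuousOn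
    (fun _ _ _ => rfl) h]
  have hξ := F.mem_domC.1 h
  rw [(F.hasFDerivAt_U_right hξ.1 (hξ.2 t)).fderiv]
  change mulOp _ (0, Y) _ = _
  rw [mulOp_apply, nem_coe (contDiffOn_spatialDeriv F.isOpen_dom
    (F.contDiffOn_lift F.U_smooth)).continuousOn (periodic_spatialDeriv F.isOpen_dom
    (F.contDiffOn_lift F.U_smooth) fun _ _ _ => rfl) h]
  exact congrArg (fun L => L (0, Y t)) ((hasFDerivAt_spatial F.isOpen_dom (F.contDiffOn_lift F.U_smooth) (h t) t).unique (F.hasFDerivAt_U hξ.1 (hξ.2 t)))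

lemma hasFDerivAt_gradC : HasFDerivAt (F.gradC ξ) (mulC (F.hessC ξ X)) X := by
  have hg := F.contDiffOn_lift F.contDiffOn_gradient
  refine ((hasFDerivAt_nem F.isOpen_dom hg (fun _ _ _ => rfl) h).comp X (hasFDerivAt_prodMk_right ξ X)).congr_fderiv (ContinuousLinearMap.ext fun Y => circle_ext fun t => ?_)
  rw [mulC_apply, F.hessC_coe h]
  have hξ := F.mem_domC.1 h
  change mulOp _ (0, Y) _ = _
  rw [mulOp_apply, nem_coe (contDiffOn_spatialDeriv F.isOpen_dom hg).continuousOn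
    (periodic_spatialDeriv F.isOpen_dom hg fun _ _ _ => rfl) h]
  exact congrArg (fun L => L (Y t)) (((hasFDerivAt_spatial F.isOpen_dom hg (h t) t).comp _ (hasFDerivAt_prodMk_right ξ (X t))).unique (F.hasFDerivAt_gradient hξ.1 (hξ.2 t)))

end

/-- The action as a function of a continuous loop and its derivative. -/
def lagC (ξ : ℝ) (X Y : CLoop N) : ℝ := F.T ξ * (1 / 2 * pair (F.mC ξ Y) Y + mean (F.potC ξ X))

lemma action_eq (hξ : ξ ∈ F.J) {x : Loop N} (hx : F.Admissible x) :
    F.action ξ x = F.lagC ξ (circ x) (circ (dLoop x)) := by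
  have h1 : F.action ξ x = ∫ t in 0..F.T ξ, (1 / 2 * inner ℝ (F.massOp ξ ((dLoop x : ℝ → Conf N) (t
    / F.T ξ))) ((dLoop x : ℝ → Conf N) (t / F.T ξ)) + F.U ξ (x.1 (t / F.T ξ))) := by
    refine integral_congr fun t _ => ?_
    simp only [F.deriv_traj (loop_differentiable x), massOp, inner_diagOp]; congr 2
    refine sum_congr rfl fun i _ => ?_; simp only [PiLp.smul_apply, smul_eq_mul, coe_dLoop]
    have := F.T_ne hξ; field_simp
  rw [h1, F.integral_traj hξ fun s => 1 / 2 * inner ℝ (F.massOp ξ ((dLoop x : ℝ → Conf N) s)) ((dLoop x : ℝ → Conf N) s) + F.U ξ (x.1 s), lagC]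
  congr 1
  have hc1 : Continuous fun s : ℝ => 1 / 2 * inner ℝ (F.mC ξ (circ (dLoop x)) s) (circ (dLoop x) s)
    := continuous_const.mul (continuous_inner_circle _ _)
  rw [pair_apply, mean_apply, ← intervalIntegral.integral_const_mul, ← intervalIntegral.integral_add
    (hc1.intervalIntegrable 0 1) ((continuous_coe_circle _).intervalIntegrable 0 1)]
  refine integral_congr fun s _ => ?_
  simp only [F.potC_coe (F.mem_domC_circ hξ hx), circ_coe, mC, mulC_apply, constC_apply]

lemma hasDerivAt_lagC {X Y : ℝ → CLoop N} {X' Y' : CLoop N} {s : ℝ} (h : (ξ, X s) ∈ F.domC) (hX :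
    HasDerivAt X X' s) (hY : HasDerivAt Y Y' s) : HasDerivAt (fun s => F.lagC ξ (X s) (Y s)) (F.T ξ
    * (pair (F.mC ξ (Y s)) Y' + pair (F.gradC ξ (X s)) X')) s := by
  have h1 := (mean).hasFDerivAt.comp_hasDerivAt s ((F.hasFDerivAt_potC h).comp_hasDerivAt s hX)
  have h2 : HasDerivAt (fun s => pair (F.mC ξ (Y s)) (Y s)) (pair (F.mC ξ (Y s)) Y' + pair (F.mC ξ
    Y') (Y s)) s := (pair).hasDerivAt_of_bilinear (fun _ => (F.mC ξ).hasFDerivAt.comp_hasDerivAt s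
    hY) fun _ => hY
  refine (((h2.const_mul (1 / 2)).add h1).const_mul (F.T ξ)).congr_deriv ?_
  rw [F.pair_mC_comm ξ Y', pair_comm Y']
  have h3 : mean (mulC (nem (fun q => fderiv ℝ (F.U q.1.1) q.1.2) (ξ, X s)) X') = pair (F.gradC ξ (X
    s)) X' := by
    rw [mean_apply, pair_apply]; refine integral_congr fun t _ => ?_
    simp only [mulC_apply, F.gradC_coe h, F.inner_gradient]
    rw [nem_coe (F.contDiffOn_lift F.contDiffOn_fderiv_U).continuousOn (fun _ _ _ => rfl) h]
  rw [h3]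
  ring

/-- The Euler-Lagrange expression of a loop. -/
def elC (ξ : ℝ) (x : Loop N) : CLoop N := F.gradC ξ (circ x) - F.mC ξ (circ (dLoop (dLoop x)))

lemma pair_mC_dLoop (ξ : ℝ) (x h : Loop N) : pair (F.mC ξ (circ (dLoop x))) (circ (dLoop h)) = -pair
    (F.mC ξ (circ (dLoop (dLoop x)))) (circ h) := by
  rw [F.pair_mC_comm, F.pair_mC_comm]
  refine neg_eq_iff_eq_neg.1 (pair_by_parts (hasDerivAt_circ _) fun t => ?_).symm
  have := (F.massOp ξ).hasFDerivAt.comp_hasDerivAt t (hasDerivAt_circ h t)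
  exact this

lemma dLoop_add_smul (x h : Loop N) (s : ℝ) : dLoop (x + s • h) = dLoop x + s • dLoop h := by
  rw [map_add, map_smul]

section

variable (hξ : ξ ∈ F.J) {x : Loop N} (hx : F.Admissible x) (h : Loop N)
include ξ hξ x hx h

lemma admissible_eventually : ∀ᶠ s : ℝ in 𝓝 0, F.Admissible (x + s • h : Loop N) := by
  have h1 : ContinuousAt (fun s : ℝ => (ξ, circ x + s • circ h)) 0 := by fun_prop
  have h2 : F.domC ∈ 𝓝 (ξ, circ x + (0 : ℝ) • circ h) := by
    rw [zero_smul_cLoop, add_zero]; exact F.isOpen_domC.mem_nhds (F.mem_domC_circ hξ hx)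
  filter_upwards [h1.preimage_mem_nhds h2] with s hs t
  have := (F.mem_domC.1 hs).2 t
  simpa using this

lemma hasDerivAt_action : HasDerivAt (fun s : ℝ => F.action ξ (x + s • h : Loop N)) (F.T ξ * pair
    (F.elC ξ x) (circ h)) 0 := by
  have hlin : ∀ y z : CLoop N, HasDerivAt (fun s : ℝ => y + s • z) z 0 := fun y z => by
    have h1 := (hasDerivAt_id (0 : ℝ)).smul_const z; rw [one_smul] at h1; exact h1.const_add y
  have h1 := F.hasDerivAt_lagC (ξ := ξ) (s := 0) (X := fun s => circ x + s • circ h)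
    (Y := fun s => circ (dLoop x) + s • circ (dLoop h)) (by simpa [zero_smul_cLoop] using F.mem_domC_circ hξ hx) (hlin _ _) (hlin _ _)
  simp only [zero_smul_cLoop, add_zero] at h1
  rw [F.pair_mC_dLoop] at h1
  refine (h1.congr_of_eventuallyEq ?_).congr_deriv ?_
  · filter_upwards [F.admissible_eventually hξ hx h] with s hs
    rw [F.action_eq hξ hs, dLoop_add_smul]; simp only [map_add, map_smul]
  · rw [elC, map_sub, _root_.sub_apply]; ring

end

end LagrangianFamily

namespace LagrangianFamily

variable {N : ℕ} (F : LagrangianFamily N) {ξ : ℝ}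

section

variable (hξ : ξ ∈ F.J) {x : Loop N} (hx : F.Admissible x)
include ξ hξ x hx

lemma elC_coe (s : ℝ) : F.elC ξ x s = gradient (F.U ξ) (x.1 s) - F.massOp ξ ((dLoop (dLoop x) : ℝ →
    Conf N) s) := by
  rw [elC, ContinuousMap.sub_apply, F.gradC_coe (F.mem_domC_circ hξ hx), mC, mulC_apply,
    constC_apply, circ_coe, circ_coe]

lemma isSolution_iff : F.IsSolution ξ x ↔ F.elC ξ x = 0 := by
  have key : ∀ (s : ℝ) i, F.elC ξ x s i = gradient (F.U ξ) (x.1 s) i - F.mass ξ i * ((F.T ξ)⁻¹ *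
    (F.T ξ)⁻¹ * (dLoop (dLoop x) : ℝ → Conf N) s i) := fun s i => by
    rw [F.elC_coe hξ hx, PiLp.sub_apply, massOp, diagOp_apply]; field_simp
  constructor
  · rintro ⟨-, h⟩; refine circle_ext fun s => ?_; ext i; rw [key]; have h1 := h (F.T ξ * s) i
    rw [F.deriv_deriv_traj, traj, mul_div_cancel_left₀ _ (F.T_ne hξ)] at h1; rw [← h1]; simp
  · intro h; refine ⟨hx, fun t i => ?_⟩; have h1 := key (t / F.T ξ) i; rw [h] at h1
    rw [F.deriv_deriv_traj]; have h2 : (0 : CLoop N) ((t / F.T ξ : ℝ) : UnitAddCircle) i = 0 := rfl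
    rw [h2] at h1; exact (sub_eq_zero.1 h1.symm).symm

end

/-- The Hessian operator `-m d²/dt² + D²U(x)` on loops. -/
def hessLoop {ξ : ℝ} (hξ : ξ ∈ F.J) {x : Loop N} (hx : F.Admissible x) : Loop N →ₗ[ℝ] Loop N :=
  opLoop (fun s => fderiv ℝ (gradient (F.U ξ)) (x.1 s))
    (F.contDiffOn_hessian.comp_contDiff (f := fun s : ℝ => (ξ, x.1 s))
      (contDiff_const.prodMk (loop_contDiff x)) fun s => ⟨hξ, hx s⟩)
    (fun s => by simp only [loop_periodic x s])
  - (F.mLoop ξ).comp (dLoop.comp dLoop)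

section

variable (hξ : ξ ∈ F.J) {x : Loop N} (hx : F.Admissible x)
include ξ hξ x hx

lemma hessLoop_apply (h : Loop N) (s : ℝ) : (F.hessLoop hξ hx h : ℝ → Conf N) s = fderiv ℝ (gradient
    (F.U ξ)) (x.1 s) (h.1 s) - F.massOp ξ ((dLoop (dLoop h) : ℝ → Conf N) s) := rfl

lemma circ_hessLoop (h : Loop N) : circ (F.hessLoop hξ hx h) = mulC (F.hessC ξ (circ x)) (circ h) -
    F.mC ξ (circ (dLoop (dLoop h))) :=
  circle_ext fun s => by
    rw [circ_coe, F.hessLoop_apply hξ hx, ContinuousMap.sub_apply, mulC_apply, F.hessC_coe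
      (F.mem_domC_circ hξ hx), mC, mulC_apply, constC_apply, circ_coe, circ_coe, circ_coe]

lemma hessianEq_iff (h : Loop N) (μ : ℝ) : F.HessianEq ξ x h μ ↔ F.hessLoop hξ hx h = μ • h := by
  have key : ∀ s i, (F.hessLoop hξ hx h : ℝ → Conf N) s i = -(F.mass ξ i * ((F.T ξ)⁻¹ * (F.T ξ)⁻¹ *
    (dLoop (dLoop h) : ℝ → Conf N) s i)) + fderiv ℝ (gradient (F.U ξ)) (x.1 s) (h.1 s) i := fun s i
    => by
    rw [F.hessLoop_apply hξ hx, PiLp.sub_apply, massOp, diagOp_apply]; field_simp; ring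
  constructor
  · intro hh; refine Subtype.ext (funext fun s => ?_); ext i; rw [key]; have h1 := hh (F.T ξ * s) i
    rw [F.deriv_deriv_traj, traj, traj, mul_div_cancel_left₀ _ (F.T_ne hξ)] at h1; exact h1
  · intro hh t i; have h1 := key (t / F.T ξ) i; rw [F.deriv_deriv_traj]; rw [hh] at h1
    exact h1.symm

lemma l2_hessLoop (h k : Loop N) : l2 (F.hessLoop hξ hx h) k = l2 h (F.hessLoop hξ hx k) := by
  have h1 : pair (F.mC ξ (circ (dLoop (dLoop h)))) (circ k) = pair (circ h) (F.mC ξ (circ (dLoop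
    (dLoop k)))) := by
    have e2 := F.pair_mC_dLoop ξ k h; rw [F.pair_mC_comm, pair_comm, F.pair_mC_dLoop ξ h k] at e2
    rw [pair_comm (circ h)]; linarith
  rw [l2_apply, l2_apply, circ_hessLoop, circ_hessLoop, map_sub, map_sub, _root_.sub_apply, h1]
  congr 1
  simp only [pair_apply]
  refine integral_congr fun s _ => ?_
  simp only [mulC_apply, F.hessC_coe (F.mem_domC_circ hξ hx), circ_coe]
  exact F.inner_hessian_comm hξ (hx s) _ _

lemma hasDerivAt_elC (h : Loop N) : HasDerivAt (fun s : ℝ => F.elC ξ (x + s • h : Loop N)) (circ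
    (F.hessLoop hξ hx h)) 0 := by
  have hlin : ∀ y z : CLoop N, HasDerivAt (fun s : ℝ => y + s • z) z 0 := fun y z => by
    have h1 := (hasDerivAt_id (0 : ℝ)).smul_const z; rw [one_smul] at h1; exact h1.const_add y
  rw [F.circ_hessLoop]
  refine ((comp_hasDerivAt_of_eq 0 (F.hasFDerivAt_gradC (F.mem_domC_circ hξ hx)) (hlin (circ x) (circ h)) (by rw [zero_smul_cLoop, add_zero])).sub ((F.mC ξ).hasFDerivAt.comp_hasDerivAt 0 (hlin (circ (dLoop (dLoop x))) (circ (dLoop (dLoop h)))))).congr_of_eventuallyEq (of_forall fun s => ?_)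
  simp only [elC, map_add, map_smul]
  simp

lemma hessLoop_dLoop (hsol : F.elC ξ x = 0) : F.hessLoop hξ hx (dLoop x) = 0 := by
  refine Subtype.ext (funext fun s => ?_)
  rw [F.hessLoop_apply]
  have h1 : ∀ s, gradient (F.U ξ) (x.1 s) = F.massOp ξ ((dLoop (dLoop x) : ℝ → Conf N) s) := fun s
    => by
    have := F.elC_coe hξ hx s; rw [hsol] at this; exact sub_eq_zero.1 this.symm
  have h3 := (F.massOp ξ).hasFDerivAt.comp_hasDerivAt s
    (loop_differentiable (dLoop (dLoop x)) s).hasDerivAt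
  have h4 : (F.massOp ξ) ∘ (dLoop (dLoop x) : ℝ → Conf N) = gradient (F.U ξ) ∘ x.1 := funext fun s
    => (h1 s).symm
  rw [h4] at h3
  exact sub_eq_zero.2 (((F.hasFDerivAt_gradient hξ (hx s)).comp_hasDerivAt s (loop_differentiable x s).hasDerivAt).unique h3)

end

lemma massOp_skew {p : Conf N × (Conf N →L[ℝ] Conf N)} (hp : p ∈ F.infSymm) (hξ : ξ ∈ F.J) (u v :
    Conf N) : inner ℝ (F.massOp ξ u) (p.2 v) = -inner ℝ (F.massOp ξ v) (p.2 u) := by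
  have h1 : ∀ u : Conf N, inner ℝ (F.massOp ξ u) (p.2 u) = 0 := fun u => by
    rw [massOp, inner_diagOp]; have := ((hp ξ hξ).1) u
    have e : ∑ i, F.mass ξ i / F.T ξ ^ 2 * (u i * p.2 u i) = (∑ i, F.mass ξ i * (u i * p.2 u i)) /
      F.T ξ ^ 2 := by
      rw [Finset.sum_div]; exact sum_congr rfl fun i _ => by ring
    rw [e, this, zero_div]
  have h2 := h1 (u + v)
  simp only [map_add, inner_add_left, inner_add_right, h1] at h2
  linarith

section

variable (hξ : ξ ∈ F.J) {x : Loop N} (hx : F.Admissible x)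
include ξ hξ x hx

lemma hessLoop_affLoop (hsol : F.elC ξ x = 0) {p : Conf N × (Conf N →L[ℝ] Conf N)} (hp : p ∈
    F.infSymm) : F.hessLoop hξ hx (affLoop p x) = 0 := by
  refine Subtype.ext (funext fun s => ?_)
  rw [F.hessLoop_apply]
  have h1 : gradient (F.U ξ) (x.1 s) = F.massOp ξ ((dLoop (dLoop x) : ℝ → Conf N) s) := by
    have := F.elC_coe hξ hx s; rw [hsol] at this; exact sub_eq_zero.1 this.symm
  have h2 : ∀ y : Loop N, ∀ a : Conf N, dLoop (affLoop (a, p.2) y) = affLoop (0, p.2) (dLoop y) :=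
    fun y a => Subtype.ext (funext fun s => by
      have := (p.2.hasFDerivAt.comp_hasDerivAt s (loop_differentiable y s).hasDerivAt).const_add a
      refine this.deriv.trans ?_; simp [affLoop])
  have h3 : dLoop (dLoop (affLoop p x)) = affLoop (0, p.2) (dLoop (dLoop x)) := by
    rw [← h2 (dLoop x) 0, ← h2 x p.1]
  rw [h3]
  refine ext_inner_right ℝ fun v => ?_
  rw [inner_sub_left, F.fderiv_gradient_eq hξ (hx s)]
  have h4 := (((F.contDiffAt_U hξ (hx s)).fderiv_right (m := ∞) (by simp)).differentiableAt (by
    simp)).hasFDerivAt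
  have h6 : (fun y => fderiv ℝ (F.U ξ) y (p.1 + p.2 y)) =ᶠ[𝓝 (x.1 s)] fun _ => 0 := by
    filter_upwards [F.isOpen_Ω.mem_nhds (hx s)] with y hy; exact (hp ξ hξ).2 y hy
  have h8 := congrArg (fun L => L v) ((h4.clm_apply ((p.2.hasFDerivAt).const_add p.1)).unique ((hasFDerivAt_const 0 _).congr_of_eventuallyEq h6))
  have h9 := ((F.contDiffAt_U hξ (hx s)).isSymmSndFDerivAt (by
    rw [minSmoothness_of_isRCLikeNormedField]
    exact WithTop.coe_le_coe.2 le_top)).eq v (p.1 + p.2 (x.1 s))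
  have h10 := F.massOp_skew hp hξ ((dLoop (dLoop x) : ℝ → Conf N) s) v
  rw [← h1, F.inner_gradient] at h10
  simp only [_root_.add_apply, ContinuousLinearMap.comp_apply, ContinuousLinearMap.flip_apply,
    _root_.zero_apply, h9] at h8
  have h11 : inner ℝ (F.massOp ξ ((affLoop (0, p.2) (dLoop (dLoop x)) : ℝ → Conf N) s)) v = inner ℝ
    (F.massOp ξ v) (p.2 ((dLoop (dLoop x) : ℝ → Conf N) s)) := by
    rw [massOp, inner_diagOp_comm, real_inner_comm]; simp [affLoop]
  rw [h11]
  change fderiv ℝ (fderiv ℝ (F.U ξ)) _ (p.1 + p.2 _) v - _ = inner ℝ 0 v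
  rw [inner_zero_left]
  linarith

lemma pair_elC_dLoop : pair (F.elC ξ x) (circ (dLoop x)) = 0 := by
  have hd := F.mem_domC_circ hξ hx
  have h1 : pair (F.mC ξ (circ (dLoop (dLoop x)))) (circ (dLoop x)) = 0 := by
    have e1 := F.pair_mC_dLoop ξ x (dLoop x); rw [F.pair_mC_comm, pair_comm] at e1; linarith
  have h2 : pair (F.gradC ξ (circ x)) (circ (dLoop x)) = 0 := by
    have h3 : ∀ t : ℝ, HasDerivAt (fun t : ℝ => F.potC ξ (circ x) t) ((⟨fun t => inner ℝ (F.gradC ξ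
      (circ x) t) (circ (dLoop x) t), by fun_prop⟩ : Per(ℝ)) t) t := fun t => by
      simp only [F.potC_coe hd, ContinuousMap.coe_mk, F.gradC_coe hd, F.inner_gradient]
      exact (((F.contDiffAt_U hξ ((F.mem_domC.1 hd).2 t)).toFDeriv)).comp_hasDerivAt t (hasDerivAt_circ x t)
    exact hasDerivAt_mean_zero h3
  rw [elC, map_sub, _root_.sub_apply, h1, h2, sub_zero]

lemma pair_elC_affLoop {p : Conf N × (Conf N →L[ℝ] Conf N)} (hp : p ∈ F.infSymm) : pair (F.elC ξ x)
    (circ (affLoop p x)) = 0 := by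
  have h1 : pair (F.mC ξ (circ (dLoop (dLoop x)))) (circ (affLoop p x)) = 0 := by
    have e1 := F.pair_mC_dLoop ξ x (affLoop p x)
    have e2 : pair (F.mC ξ (circ (dLoop x))) (circ (dLoop (affLoop p x))) = 0 := by
      rw [pair_apply]; refine intervalIntegral.integral_zero_ae (of_forall fun s _ => ?_)
      have e3 : (dLoop (affLoop p x) : ℝ → Conf N) s = p.2 ((dLoop x : ℝ → Conf N) s) :=
        ((p.2.hasFDerivAt.comp_hasDerivAt s (loop_differentiable x s).hasDerivAt).const_add
        p.1).deriv
      simp only [mC, mulC_apply, constC_apply, circ_coe, e3]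
      have := F.massOp_skew hp hξ ((dLoop x : ℝ → Conf N) s) ((dLoop x : ℝ → Conf N) s); linarith
    linarith
  have h2 : pair (F.gradC ξ (circ x)) (circ (affLoop p x)) = 0 := by
    rw [pair_apply]; refine intervalIntegral.integral_zero_ae (of_forall fun s _ => ?_)
    rw [F.gradC_coe (F.mem_domC_circ hξ hx), F.inner_gradient, circ_coe, circ_coe]
    exact (hp ξ hξ).2 _ (hx s)
  rw [elC, map_sub, _root_.sub_apply, h1, h2, sub_zero]

end

/-- The Lie algebra element `(c, (a, A))` acts on loops by `c dx/dt + a + A x`. -/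
def symLoop (x : Loop N) : (Gen N) →ₗ[ℝ] Loop N where
  toFun v := v.1 • dLoop x + affLoop v.2 x
  map_add' u v := Subtype.ext (funext fun s => by
    simp [affLoop, add_smul]
    abel)
  map_smul' c v := Subtype.ext (funext fun s => by simp [affLoop, mul_smul])

def symSet : Set (Gen N) := {v | v = (1, 0) ∨ (v.1 = 0 ∧ v.2 ∈ F.infSymm)}

def zeroModes (x : Loop N) : Submodule ℝ (Loop N) := span ℝ (symLoop x '' F.symSet)

lemma symLoop_time (x : Loop N) : symLoop x (1, 0) = dLoop x := by
  refine Subtype.ext (funext fun s => ?_)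
  simp [symLoop, affLoop]

lemma symLoop_space (x : Loop N) {v : Gen N} (h : v.1 = 0) : symLoop x v = affLoop v.2 x := by
  simp [symLoop, h]

section

variable (hξ : ξ ∈ F.J)
include ξ hξ

lemma transverse_iff_symSet (x h : Loop N) : F.Transverse ξ x h ↔ ∀ v ∈ F.symSet, l2 h (symLoop x v)
    = 0 := by
  rw [F.transverse_iff hξ]
  constructor
  · rintro ⟨h1, h2⟩ v (rfl | ⟨hv1, hv2⟩)
    · rwa [symLoop_time]
    · rw [symLoop_space x hv1]; exact h2 _ hv2
  · intro hh; refine ⟨?_, fun p hp => ?_⟩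
    · rw [← symLoop_time]; exact hh _ (Or.inl rfl)
    · have := hh (0, p) (Or.inr ⟨rfl, hp⟩); rwa [symLoop_space x rfl] at this

lemma transverse_iff_zeroModes (x h : Loop N) : F.Transverse ξ x h ↔ ∀ z ∈ F.zeroModes x, l2 h z = 0
    := by
  rw [F.transverse_iff_symSet hξ]
  constructor
  · intro hh z hz; induction hz using Submodule.span_induction with
    | mem z hz =>
      obtain ⟨v, hv, rfl⟩ := hz; exact hh v hv
    | zero => simp
    | add y z _ _ hy hz => rw [map_add, hy, hz, add_zero]
    | smul c z _ hz => rw [map_smul, hz, smul_zero]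
  · exact fun hh v hv => hh _ (subset_span ⟨v, hv, rfl⟩)

lemma hessLoop_zeroModes {x : Loop N} (hx : F.Admissible x) (hsol : F.elC ξ x = 0) {z : Loop N} (hz
    : z ∈ F.zeroModes x) : F.hessLoop hξ hx z = 0 := by
  have h : F.zeroModes x ≤ LinearMap.ker (F.hessLoop hξ hx) := by
    refine Submodule.span_le.2 ?_; rintro _ ⟨v, rfl | ⟨hv1, hv2⟩, rfl⟩
    · rw [symLoop_time]; exact F.hessLoop_dLoop hξ hx hsol
    · rw [symLoop_space x hv1]; exact F.hessLoop_affLoop hξ hx hsol hv2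
  exact h hz

lemma pair_elC_symLoop {x : Loop N} (hx : F.Admissible x) {v : Gen N} (hv : v ∈ F.symSet) : pair
    (F.elC ξ x) (circ (symLoop x v)) = 0 := by
  rcases hv with rfl | ⟨hv1, hv2⟩
  · rw [symLoop_time]; exact F.pair_elC_dLoop hξ hx
  · rw [symLoop_space x hv1]; exact F.pair_elC_affLoop hξ hx hv2

end

lemma exists_basis_zeroModes (x : Loop N) : ∃ (n : ℕ) (v : Fin n → Gen N), (∀ k, v k ∈ F.symSet) ∧
    LinearIndependent ℝ (fun k => symLoop x (v k)) ∧ F.zeroModes x = span ℝ (Set.range fun k =>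
    symLoop x (v k)) := by
  obtain ⟨b, hb, hspan, hli⟩ := exists_linearIndependent ℝ (symLoop x '' F.symSet)
  have hfin : FiniteDimensional ℝ (LinearMap.range (symLoop x)) := inferInstance
  have hle : F.zeroModes x ≤ LinearMap.range (symLoop x) := by
    refine Submodule.span_le.2 ?_; rintro _ ⟨v, -, rfl⟩; exact ⟨v, rfl⟩
  have hfz := Submodule.finiteDimensional_of_le hle
  have hbf : Finite b := by
    have h2 : LinearIndependent ℝ (fun y : b => (⟨y, (fun y => subset_span (hb y.2)) y⟩ : F.zeroModes x)) := by
      refine LinearIndependent.of_comp (F.zeroModes x).subtype ?_; exact hli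
    exact h2.finite
  have := Fintype.ofFinite b
  let e := Fintype.equivFin b
  have h3 : ∀ y : b, ∃ v ∈ F.symSet, symLoop x v = y := fun y => hb y.2
  choose v hv1 hv2 using h3
  refine ⟨Fintype.card b, fun k => v (e.symm k), fun k => hv1 _, ?_, ?_⟩
  · simp only [hv2]; exact hli.comp _ e.symm.injective
  · rw [zeroModes, ← hspan]; congr 1; ext y; simp only [hv2, Set.mem_range]; constructor
    · exact fun hy => ⟨e ⟨y, hy⟩, by simp⟩
    · rintro ⟨k, rfl⟩; exact (e.symm k).2

end LagrangianFamily

lemma eq_zero_of_l2 {N : ℕ} {x : Loop N} (h : ∀ y, l2 x y = 0) : x = 0 := l2_self_eq_zero (h x)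

lemma norm_le_of_l2_le {N : ℕ} {x : Loop N} {a b l : ℝ} (hl : 0 < l) (ha : l2 x x ≤ a * l ^ 2) (hb :
    l2 (dLoop x) (dLoop x) ≤ b * l ^ 2) (s : ℝ) : ‖x.1 s‖ ≤ (1 + (a + b) / 2) * l := by
  have key : ∀ (X : CLoop N) (c : ℝ), pair X X ≤ c * l ^ 2 → ∫ s in 0..1, ‖X s‖ ≤ (1 + c) / 2 * l :=
    fun X c h => by
    have hc := continuous_coe_circle X; have h1 : ∫ s in 0..1, ‖X s‖ ≤ ∫ s in 0..1, (l / 2 + (1 / (2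
      * l)) * inner ℝ (X s) (X s)) := by
      refine integral_mono_on zero_le_one (intervalIntegrable (by fun_prop) _ _)
        (intervalIntegrable (by fun_prop) _ _) fun s _ => ?_
      rw [real_inner_self_eq_norm_sq, ← sub_nonneg]; have : l / 2 + 1 / (2 * l) * ‖X s‖ ^ 2 - ‖X s‖
        = (‖X s‖ - l) ^ 2 / (2 * l) := by
        field_simp; ring
      rw [this]; positivity
    refine h1.trans ?_; rw [intervalIntegral.integral_add (by simp) (intervalIntegrable (by
      fun_prop) _ _), intervalIntegral.integral_const_mul, ← pair_apply]
    simp only [intervalIntegral.integral_const, sub_zero, one_smul]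
    calc l / 2 + 1 / (2 * l) * pair X X ≤ l / 2 + 1 / (2 * l) * (c * l ^ 2) := by gcongr
      _ = (1 + c) / 2 * l := by field_simp
  have h2 : x.1 s = mean (circ x) + prim (circ (dLoop x)) s := by
    rw [prim_of_hasDerivAt (hasDerivAt_circ x), ContinuousMap.sub_apply, constC_apply, circ_coe]
    abel
  have h3 : ‖mean (circ x)‖ ≤ (1 + a) / 2 * l := by
    rw [mean_apply]
    exact (intervalIntegral.norm_integral_le_integral_norm zero_le_one).trans (key _ _ ha)
  have h4 : ‖prim (circ (dLoop x)) s‖ ≤ (1 + b) / 2 * l := by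
    rw [prim_apply]; have hc : Continuous fun u : ℝ => circ (dLoop x) (s + u) :=
      (circ (dLoop x)).continuous.comp (continuous_const.add (AddCircle.continuous_mk' 1))
    refine (intervalIntegral.norm_integral_le_integral_norm zero_le_one).trans ?_
    refine (integral_mono_on zero_le_one (g := fun u : ℝ => ‖circ (dLoop x) (s +
      u)‖) (intervalIntegrable (by fun_prop) _ _) (intervalIntegrable (by fun_prop) _ _) fun u hu =>
      ?_).trans ?_
    · rw [norm_smul]; refine mul_le_of_le_one_left (norm_nonneg _) ?_; rw [norm_eq_abs, abs_le]
      constructor <;> linarith [hu.1, hu.2]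
    · refine le_trans (le_of_eq ?_) (key (shift s (circ (dLoop x))) b (by rw [pair_shift]; exact hb))
      refine integral_congr fun u _ => ?_; simp only [shift_apply, add_comm]
  rw [h2]
  refine (norm_add_le _ _).trans ((add_le_add h3 h4).trans (le_of_eq ?_))
  ring

namespace LagrangianFamily

variable {N : ℕ} (F : LagrangianFamily N) {ξ : ℝ}

lemma l2_hessLoop_self (hξ : ξ ∈ F.J) {x : Loop N} (hx : F.Admissible x) (h : Loop N) : l2
    (F.hessLoop hξ hx h) h = pair (F.mC ξ (circ (dLoop h))) (circ (dLoop h)) + pair (mulC (F.hessC ξ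
    (circ x)) (circ h)) (circ h) := by
  rw [l2_apply, circ_hessLoop, map_sub, _root_.sub_apply, F.pair_mC_dLoop]
  ring

lemma exists_le_pair_mC (hξ : ξ ∈ F.J) :
    ∃ c > 0, ∀ X : CLoop N, c * pair X X ≤ pair (F.mC ξ X) X := by
  obtain ⟨c, hc0, hc⟩ : ∃ c > 0, ∀ i, c ≤ F.mass ξ i / F.T ξ ^ 2 := by
    rcases isEmpty_or_nonempty (Fin N) with he | he
    · exact ⟨1, one_pos, fun i => (he.false i).elim⟩
    · obtain ⟨i, hi⟩ := Finite.exists_min fun i => F.mass ξ i / F.T ξ ^ 2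
      exact ⟨_, (fun i => div_pos (F.mass_pos ξ hξ i) (pow_pos (F.T_pos ξ hξ) 2)) i, hi⟩
  refine ⟨c, hc0, fun X => ?_⟩
  rw [pair_apply, pair_apply, ← intervalIntegral.integral_const_mul]
  have hc1 := continuous_inner_circle X X
  refine integral_mono_on zero_le_one
    (intervalIntegrable (by fun_prop) _ _) ((continuous_inner_circle (F.mC ξ X) X).intervalIntegrable _ _) fun s _ => ?_
  rw [mC, mulC_apply, constC_apply, massOp, inner_diagOp, PiLp.inner_apply, mul_sum]
  refine Finset.sum_le_sum fun i _ => ?_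
  have := hc i
  simp only [RCLike.inner_apply, conj_trivial]
  exact mul_le_mul_of_nonneg_right this (mul_self_nonneg _)

end LagrangianFamily

namespace SymmetricFamily

variable {N : ℕ} (F : SymmetricFamily N)

lemma q_admissible {ξ : ℝ} (hξ : ξ ∈ F.J) : F.Admissible (F.q ξ) := (F.q_sol ξ hξ).1

lemma elC_q {ξ : ℝ} (hξ : ξ ∈ F.J) : F.elC ξ (F.q ξ) = 0 :=
  (F.isSolution_iff hξ (F.q_admissible hξ)).1 (F.q_sol ξ hξ)

def hessQ {ξ : ℝ} (hξ : ξ ∈ F.J) : Loop N →ₗ[ℝ] Loop N := F.hessLoop hξ (F.q_admissible hξ)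

lemma isMode_iff {ξ : ℝ} (hξ : ξ ∈ F.J) (h : Loop N) (μ : ℝ) : F.IsMode ξ h μ ↔ F.hessQ hξ h = μ • h
    ∧ F.Transverse ξ (F.q ξ) h := and_congr (F.hessianEq_iff hξ _ h μ) Iff.rfl

lemma l2_ρ {ξ : ℝ} (hξ : ξ ∈ F.J) (g : D6) (x y : Loop N) : l2 (F.ρ g x) (F.ρ g y) = l2 x y := by
  have h := F.ρ_ip ξ hξ g x y
  rw [F.ip_eq hξ, F.ip_eq hξ] at h
  exact mul_left_cancel₀ (F.T_ne hξ) h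

lemma ρ_inv_apply (g : D6) (x : Loop N) : F.ρ g (F.ρ g⁻¹ x) = x := by simp

section

variable {ξ : ℝ} (hξ : ξ ∈ F.J)
include ξ hξ

lemma l2_ρ_left (g : D6) (x y : Loop N) : l2 (F.ρ g x) y = l2 x (F.ρ g⁻¹ y) := by
  conv_lhs => rw [← F.ρ_inv_apply g y]
  exact F.l2_ρ hξ g _ _

lemma l2_hessQ_comm (h k : Loop N) : l2 (F.hessQ hξ h) k = l2 h (F.hessQ hξ k) := F.l2_hessLoop hξ _
    h k

lemma hasDerivAt_pair_elC (h : Loop N) : HasDerivAt (fun s : ℝ => F.T ξ * pair (F.elC ξ (F.q ξ + s •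
    h)) (circ h)) (F.T ξ * l2 (F.hessQ hξ h) h) 0 := by
  have h2 := (pair.flip (circ h)).hasFDerivAt.comp_hasDerivAt 0 (F.hasDerivAt_elC hξ (F.q_admissible hξ) h)
  exact h2.const_mul (F.T ξ)

lemma l2_hessQ_ρ_self (g : D6) (h : Loop N) : l2 (F.hessQ hξ (F.ρ g h)) (F.ρ g h) = l2 (F.hessQ hξ
    h) h := by
  have hq := F.q_admissible hξ
  have hd : ∀ h : Loop N, ∀ᶠ s : ℝ in 𝓝 0, HasDerivAt (fun s => F.action ξ (F.q ξ + s • h : Loop N))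
    (F.T ξ * pair (F.elC ξ (F.q ξ + s • h)) (circ h)) s := fun h => by
    filter_upwards [F.admissible_eventually hξ hq h] with s hs
    have h1 : HasDerivAt (fun u => u - s) 1 s := (hasDerivAt_id s).sub_const s
    have h2 := (F.hasDerivAt_action hξ hs h).comp_of_eq s h1 (sub_self s).symm; rw [mul_one] at h2
    refine h2.congr_of_eventuallyEq (of_forall fun u => ?_); simp only [comp_apply]
    congr 2; rw [add_assoc, ← add_smul, add_sub_cancel]
  have heq : (fun s => F.action ξ (F.q ξ + s • F.ρ g h : Loop N)) =ᶠ[𝓝 0] fun s : ℝ => F.action ξ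
    (F.q ξ + s • h : Loop N) := by
    filter_upwards [F.admissible_eventually hξ hq h] with s hs
    rw [← F.ρ_action ξ hξ g _ hs, map_add, map_smul, F.ρ_q ξ hξ g]
  have heq2 : (fun s => F.T ξ * pair (F.elC ξ (F.q ξ + s • F.ρ g h)) (circ (F.ρ g h))) =ᶠ[𝓝 0] fun s
    : ℝ => F.T ξ * pair (F.elC ξ (F.q ξ + s • h)) (circ h) := by
    filter_upwards [hd h, hd (F.ρ g h), heq.eventuallyEq_nhds] with s h1 h2 h3
    exact h2.unique (h1.congr_of_eventuallyEq h3)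
  exact mul_left_cancel₀ (F.T_ne hξ) ((F.hasDerivAt_pair_elC hξ (F.ρ g h)).unique ((F.hasDerivAt_pair_elC hξ h).congr_of_eventuallyEq heq2))

lemma hessQ_ρ (g : D6) (h : Loop N) : F.hessQ hξ (F.ρ g h) = F.ρ g (F.hessQ hξ h) := by
  have key : ∀ h k : Loop N, l2 (F.hessQ hξ (F.ρ g h)) (F.ρ g k) = l2 (F.hessQ hξ h) k := by
    intro h k; have h1 := F.l2_hessQ_ρ_self hξ g (h + k); have h2 := F.l2_hessQ_ρ_self hξ g h
    have h3 := F.l2_hessQ_ρ_self hξ g k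
    have h4 : ∀ u v : Loop N, l2 (F.hessQ hξ u) v = l2 (F.hessQ hξ v) u := fun u v => by
      rw [F.l2_hessQ_comm, l2_comm]
    simp at h1; have h5 := h4 h k
    have h6 := h4 (F.ρ g h) (F.ρ g k); linarith
  refine sub_eq_zero.1 (eq_zero_of_l2 fun y => ?_)
  rw [← F.ρ_inv_apply g y, map_sub, LinearMap.sub_apply, key, F.l2_ρ hξ, sub_self]

lemma hessQ_zeroModes {z : Loop N} (hz : z ∈ F.zeroModes (F.q ξ)) : F.hessQ hξ z = 0 :=
    F.hessLoop_zeroModes hξ _ (F.elC_q hξ) hz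

lemma transverse_iff_l2 (h : Loop N) : F.Transverse ξ (F.q ξ) h ↔ ∀ z ∈ F.zeroModes (F.q ξ), l2 h z
    = 0 := F.transverse_iff_zeroModes hξ _ h

lemma exists_transverse_sub (h : Loop N) : ∃ z ∈ F.zeroModes (F.q ξ), F.Transverse ξ (F.q ξ) (h - z)
    := by
  obtain ⟨n, v, -, -, hs⟩ := F.exists_basis_zeroModes (F.q ξ)
  obtain ⟨c, hc⟩ := exists_proj (fun k => LagrangianFamily.symLoop (F.q ξ) (v k)) h
  refine ⟨∑ k, c k • LagrangianFamily.symLoop (F.q ξ) (v k), ?_,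
    (F.transverse_iff_l2 hξ _).2 fun z hz => ?_⟩
  · rw [hs]; exact Submodule.sum_mem _ fun k _ => Submodule.smul_mem _ (c k) (subset_span ⟨k, rfl⟩)
  · rw [hs] at hz; induction hz using Submodule.span_induction with
    | mem z hz =>
      obtain ⟨k, rfl⟩ := hz; exact hc k
    | zero => simp
    | add y z _ _ hy hz => rw [map_add, hy, hz, add_zero]
    | smul c z _ hz => rw [map_smul, hz, smul_zero]

lemma exists_mode_sub {h : Loop N} (hh : F.hessQ hξ h = 0) : ∃ z ∈ F.zeroModes (F.q ξ), F.IsMode ξ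
    (h - z) 0 := by
  obtain ⟨z, hz, hz2⟩ := F.exists_transverse_sub hξ h
  refine ⟨z, hz, (F.isMode_iff hξ _ _).2 ⟨?_, hz2⟩⟩
  rw [map_sub, hh, F.hessQ_zeroModes hξ hz, sub_zero, zero_smul]

end

variable {F} {ξ0 : ℝ} {κ : ℝ → ℝ}

section

variable (hc : F.IsCritical ξ0 κ) {ξ : ℝ} (hξ : ξ ∈ F.J)
include hc ξ hξ

lemma IsCritical.eq_zero_of_mode (hκ : κ ξ ≠ 0) {h : Loop N} (hm : F.IsMode ξ h 0) : h = 0 := by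
  by_contra hne
  obtain ⟨δ, hδ, hg⟩ := hc.gap
  rcases hg ξ hξ h 0 hne hm with h1 | h1
  · exact hκ h1.symm
  · rw [abs_zero] at h1; exact absurd h1 (not_le.2 hδ)

lemma IsCritical.mode_ρ {h : Loop N} (hm : F.IsMode ξ h (κ ξ)) (g : D6) : F.IsMode ξ (F.ρ g h) (κ ξ)
    := by
  obtain ⟨E, hE, -⟩ := hc.irreducible ξ hξ
  exact (hE _).1 (E.apply_mem_toSubmodule g ((hE h).2 hm))

lemma IsCritical.zeroModes_ρ {z : Loop N} (hz : z ∈ F.zeroModes (F.q ξ)) (g : D6) : F.ρ g z ∈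
    F.zeroModes (F.q ξ) := by
  have h1 : F.hessQ hξ (F.ρ g z) = 0 := by rw [F.hessQ_ρ, F.hessQ_zeroModes hξ hz, map_zero]
  obtain ⟨y, hy, hm⟩ := F.exists_mode_sub hξ h1
  suffices h : F.ρ g z - y = 0 by rwa [sub_eq_zero.1 h]
  by_cases hκ : κ ξ = 0
  · rw [← hκ] at hm; refine l2_self_eq_zero ?_; have h3 := (F.transverse_iff_l2 hξ _).1
      ((F.isMode_iff hξ _ _).1 (hc.mode_ρ hξ hm g⁻¹)).2 z hz
    rw [l2_comm, ← F.l2_ρ_left hξ] at h3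
    rw [map_sub, (F.transverse_iff_l2 hξ _).1 ((F.isMode_iff hξ _ _).1 hm).2 y hy, l2_comm, h3, sub_zero]
  · exact hc.eq_zero_of_mode hξ hκ hm

lemma IsCritical.transverse_ρ {h : Loop N} (hh : F.Transverse ξ (F.q ξ) h) (g : D6) : F.Transverse ξ
    (F.q ξ) (F.ρ g h) := by
  rw [F.transverse_iff_l2 hξ] at hh ⊢
  intro z hz
  rw [F.l2_ρ_left hξ]
  exact hh _ (hc.zeroModes_ρ hξ hz _)

end

variable (F)

lemma exists_norm_ρ_le {ξ : ℝ} (hξ : ξ ∈ F.J) : ∃ C, ∀ (g : D6) (h : Loop N) (l : ℝ), 0 < l →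
    (∀ s, ‖h.1 s‖ ≤ l) → (∀ s, ‖(dLoop h : ℝ → Conf N) s‖ ≤ l) →
    ∀ s, ‖(F.ρ g h : ℝ → Conf N) s‖ ≤ C * l := by
  obtain ⟨c, hc0, hc⟩ := F.exists_le_pair_mC hξ
  have hpair : ∀ (A : Per(Conf N →L[ℝ] Conf N)) (X : CLoop N),
      |pair (mulC A X) X| ≤ ‖A‖ * pair X X := fun A X => by
    rw [pair_apply, pair_apply, ← intervalIntegral.integral_const_mul]
    have hc1 := continuous_inner_circle X X
    refine (intervalIntegral.abs_integral_le_integral_abs zero_le_one).trans ?_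
    refine integral_mono_on zero_le_one
      (intervalIntegrable ((continuous_inner_circle (mulC A X) X).abs) _ _)
      (intervalIntegrable (by fun_prop) _ _) fun s _ => ?_
    rw [real_inner_self_eq_norm_mul_norm, ← mul_assoc]; refine (abs_real_inner_le_norm _ _).trans ?_
    gcongr; rw [mulC_apply]; exact (ContinuousLinearMap.le_opNorm _ _).trans
      (mul_le_mul_of_nonneg_right (A.norm_coe_le_norm _) (norm_nonneg _))
  obtain ⟨v, hv, hV⟩ : ∃ v : ℝ, 0 ≤ v ∧ ∀ X : CLoop N,
      |pair (mulC (F.hessC ξ (circ (F.q ξ))) X) X| ≤ v * pair X X :=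
    ⟨‖F.hessC ξ (circ (F.q ξ))‖, norm_nonneg (F.hessC ξ (circ (F.q ξ))), hpair _⟩
  obtain ⟨m, hm, hM⟩ : ∃ m : ℝ, 0 ≤ m ∧ ∀ X : CLoop N, |pair (F.mC ξ X) X| ≤ m * pair X X :=
    ⟨‖(constC (F.massOp ξ) : Per(Conf N →L[ℝ] Conf N))‖, norm_nonneg (constC (F.massOp ξ) : Per(Conf
    N →L[ℝ] Conf N)), hpair _⟩
  refine ⟨1 + (1 + (m + 2 * v) / c) / 2, fun g h l hl h0 h1 => ?_⟩
  have hb : ∀ y : Loop N, (∀ s, ‖y.1 s‖ ≤ l) → l2 y y ≤ l ^ 2 := fun y hy => by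
    rw [l2_eq_integral]; have : ∫ s in 0..1, inner ℝ (y.1 s) (y.1 s) ≤ ∫ _ in 0..1, l ^ 2 := by
      have hcy := loop_continuous y; refine integral_mono_on zero_le_one
        (intervalIntegrable (by fun_prop) _ _) (by simp) fun s _ => ?_
      rw [real_inner_self_eq_norm_sq]; have := hy s; gcongr
    simpa using this
  have hh := hb h h0
  have hinv := F.l2_ρ hξ g h h
  refine norm_le_of_l2_le hl (by rw [hinv, one_mul]; exact hh) ?_
  have e1 := F.l2_hessQ_ρ_self hξ g h
  rw [hessQ, F.l2_hessLoop_self, F.l2_hessLoop_self] at e1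
  have e2 := hc (circ (dLoop (F.ρ g h)))
  have e3 := (abs_le.1 (hV (circ h))).2
  have e4 := (abs_le.1 (hV (circ (F.ρ g h)))).1
  have e5 := (abs_le.1 (hM (circ (dLoop h)))).2
  rw [← l2_apply] at e2 e3 e4 e5
  rw [hinv] at e4
  rw [div_mul_eq_mul_div, le_div_iff₀ hc0]
  have e6 := mul_le_mul_of_nonneg_left hh hv
  have e7 := mul_le_mul_of_nonneg_left (hb _ h1) hm
  linarith

end SymmetricFamily

lemma neg_one_smul_loop {N : ℕ} (x : Loop N) : (-1 : ℝ) • x = -x := Subtype.ext (by simp)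

lemma exists_eq_S_pow_mul_B_pow (g : D6) : ∃ i j : ℕ, g = S ^ i * B ^ j := by
  rcases g with k | k
  · refine ⟨0, k.val, ?_⟩; rw [B, DihedralGroup.r_one_pow, pow_zero, one_mul, ZMod.natCast_zmod_val]
  · refine ⟨1, k.val, ?_⟩
    rw [B, DihedralGroup.r_one_pow, pow_one, S, DihedralGroup.sr_mul_r, zero_add,
      ZMod.natCast_zmod_val]

lemma Irrep.dim_pos (t : Irrep) : 0 < t.dim := by cases t <;> simp

/-- The trace of `B` and `B⁻¹` on a representation, divided by the dimension. -/
def Irrep.char : Irrep → ℝ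
  | .I => 2
  | .II => 2
  | .III => -2
  | .IV => -2
  | .V => -1
  | .VI => 1

lemma cos_two_pi_div_three : cos (2 * π / 3) = -(1 / 2) := by
  rw [show 2 * π / 3 = π - π / 3 by ring, Real.cos_pi_sub, Real.cos_pi_div_three]

lemma sin_two_pi_div_three : sin (2 * π / 3) = Real.sqrt 3 / 2 := by
  rw [show 2 * π / 3 = π - π / 3 by ring, Real.sin_pi_sub, Real.sin_pi_div_three]

lemma Irrep.matB_mul_self (t : Irrep) : t.matB * t.matB + 1 = t.char • t.matB := by
  have h := Real.mul_self_sqrt (show 0 ≤ 3 by norm_num)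
  cases t
  case V =>
    ext i j; fin_cases i <;> fin_cases j <;>
    simp [Irrep.matB, Irrep.char, rotMatrix, cos_two_pi_div_three,
      sin_two_pi_div_three] <;> nlinarith [h]
  case VI =>
    ext i j; fin_cases i <;> fin_cases j <;>
    simp [Irrep.matB, Irrep.char, rotMatrix] <;> nlinarith [h]
  all_goals
    ext i j
    simp only [Irrep.matB, Irrep.char, mul_one, mul_neg, neg_mul, neg_neg, Matrix.add_apply,
      Matrix.smul_apply, Matrix.neg_apply, one_apply, smul_eq_mul]
    split_ifs <;> norm_num

namespace SymmetricFamily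

variable {N : ℕ} {F : SymmetricFamily N} {ξ0 : ℝ} {κ : ℝ → ℝ} {ξ : ℝ}

lemma ρ_mem_of_generators {W : Submodule ℝ (Loop N)} (hB : ∀ x ∈ W, F.ρ B x ∈ W)
    (hS : ∀ x ∈ W, F.ρ S x ∈ W) (g : D6) {x : Loop N} (hx : x ∈ W) : F.ρ g x ∈ W := by
  have hpow : ∀ (g : D6), (∀ x ∈ W, F.ρ g x ∈ W) → ∀ (n : ℕ), ∀ x ∈ W, F.ρ (g ^ n) x ∈ W := by
    intro g hg n; induction n with
    | zero => simp
    | succ n ih =>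
      intro x hx; rw [pow_succ, map_mul, mul_apply]; exact ih _ (hg x hx)
  obtain ⟨i, j, rfl⟩ := exists_eq_S_pow_mul_B_pow g
  rw [map_mul, mul_apply]
  exact hpow S hS i _ (hpow B hB j _ hx)

section

variable (hc : F.IsCritical ξ0 κ) (hξ : ξ ∈ F.J)
include hc ξ hξ

lemma IsCritical.exists_mode_ne_zero : ∃ h : Loop N, h ≠ 0 ∧ F.IsMode ξ h (κ ξ) := by
  obtain ⟨E, hE, hirr⟩ := hc.irreducible ξ hξ
  by_contra! hcon
  have h1 : (⊥ : Subrepresentation E.toRepresentation) ≠ ⊤ := bot_ne_top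
  refine h1 (Subrepresentation.toSubmodule_injective ?_)
  refine (eq_bot_iff.2 fun x _ => ?_).symm
  refine (Submodule.mem_bot ℝ).2 (Subtype.ext ?_)
  by_contra hx
  exact hcon x hx ((hE x).1 x.2)

lemma IsCritical.mem_of_mode {W : Submodule ℝ (Loop N)} (hW : ∀ x ∈ W, F.IsMode ξ x (κ ξ)) (hB : ∀ x
    ∈ W, F.ρ B x ∈ W) (hS : ∀ x ∈ W, F.ρ S x ∈ W) (hne : ∃ x ∈ W, x ≠ 0) {h : Loop N} (hm : F.IsMode
    ξ h (κ ξ)) : h ∈ W := by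
  obtain ⟨E, hE, hirr⟩ := hc.irreducible ξ hξ
  let V : Subrepresentation E.toRepresentation :=
    ⟨W.comap E.toSubmodule.subtype, fun g v hv => ρ_mem_of_generators hB hS g hv⟩
  rcases hirr.eq_bot_or_eq_top V with h1 | h1
  · obtain ⟨x, hx, hx0⟩ := hne
    have h2 : (⟨x, (hE x).2 (hW x hx)⟩ : E.toSubmodule) ∈ V.toSubmodule := hx; rw [h1] at h2
    exact absurd (congrArg Subtype.val ((Submodule.mem_bot ℝ).1 h2)) hx0
  · have h2 : (⟨h, (hE h).2 hm⟩ : E.toSubmodule) ∈ V.toSubmodule := by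
      rw [h1]; exact Submodule.mem_top
    exact h2

end

variable (F) in
def modeSpace {ξ : ℝ} (hξ : ξ ∈ F.J) (μ : ℝ) : Submodule ℝ (Loop N) where
  carrier := {h | F.IsMode ξ h μ}
  add_mem' {x y} hx hy := by
    simp only [Set.mem_ofPred_eq, F.isMode_iff hξ, F.transverse_iff_l2 hξ] at hx hy ⊢
    refine ⟨by rw [map_add, hx.1, hy.1, smul_add], fun z hz => ?_⟩
    rw [map_add, LinearMap.add_apply, hx.2 z hz, hy.2 z hz, add_zero]
  zero_mem' := by
    simp only [Set.mem_ofPred_eq, F.isMode_iff hξ, F.transverse_iff_l2 hξ]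
    exact ⟨by rw [map_zero, smul_zero], fun z _ => by simp⟩
  smul_mem' c x hx := by
    simp only [Set.mem_ofPred_eq, F.isMode_iff hξ, F.transverse_iff_l2 hξ] at hx ⊢
    refine ⟨by rw [map_smul, hx.1, smul_comm], fun z hz => ?_⟩
    rw [map_smul, LinearMap.smul_apply, hx.2 z hz, smul_zero]

variable (F) in
/-- An orthonormal set of modes with eigenvalue `μ` that belongs to the representation `t`. -/
structure IsFrame (ξ μ : ℝ) (t : Irrep) (φ : Fin t.dim → Loop N) : Prop where
  mode : ∀ i, F.IsMode ξ (φ i) μ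
  orthonormal : ∀ i j, F.ip ξ (φ i) (φ j) = if i = j then 1 else 0
  act_B : ∀ j, F.ρ B (φ j) = ∑ i, t.matB i j • φ i
  act_S : ∀ j, F.ρ S (φ j) = ∑ i, t.matS i j • φ i

lemma IsCriticalFrame.isFrame {t : Irrep} {J1 : Set ℝ} {φ : ℝ → Fin t.dim → Loop N}
    (hf : F.IsCriticalFrame ξ0 κ t J1 φ) (hξ : ξ ∈ J1) : F.IsFrame ξ (κ ξ) t (φ ξ) :=
  ⟨hf.mode ξ hξ, hf.orthonormal ξ hξ, hf.act_B ξ hξ, hf.act_S ξ hξ⟩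

lemma IsFrame.ne_zero {ξ μ : ℝ} {t : Irrep} {φ : Fin t.dim → Loop N} (hf : F.IsFrame ξ μ t φ)
    (hξ : ξ ∈ F.J) (i : Fin t.dim) : φ i ≠ 0 := fun h0 => by
  have h := hf.orthonormal i i
  rw [h0, F.ip_eq hξ] at h
  simp at h

section

variable {t : Irrep} {φ : Fin t.dim → Loop N} (hf : F.IsFrame ξ (κ ξ) t φ)
  (hc : F.IsCritical ξ0 κ) (hξ : ξ ∈ F.J) {h : Loop N} (hm : F.IsMode ξ h (κ ξ))
include ξ t φ hf hc hξ h hm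

lemma IsFrame.exists_sum : ∃ c : Fin t.dim → ℝ, h = ∑ i, c i • φ i := by
  have hstab : ∀ (g : D6) (A : Matrix (Fin t.dim) (Fin t.dim) ℝ), (∀ j, F.ρ g (φ j) = ∑ i, A i j • φ
    i) → ∀ x ∈ span ℝ (Set.range φ), F.ρ g x ∈ span ℝ (Set.range φ) := fun g A hA x hx => by
    induction hx using Submodule.span_induction with
    | mem x hx =>
      obtain ⟨j, rfl⟩ := hx; rw [hA]
      exact Submodule.sum_mem _ fun i _ => Submodule.smul_mem _ _ (subset_span ⟨i, rfl⟩)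
    | zero => simp
    | add x y _ _ hx hy => rw [map_add]; exact Submodule.add_mem _ hx hy
    | smul c x _ hx => rw [map_smul]; exact Submodule.smul_mem _ _ hx
  have h1 := hc.mem_of_mode hξ (fun x hx => by
      have : span ℝ (Set.range φ) ≤ F.modeSpace hξ (κ ξ) :=
        Submodule.span_le.2 (by rintro _ ⟨i, rfl⟩; exact hf.mode i)
      exact this hx) (hstab B _ hf.act_B) (hstab S _ hf.act_S)
    ⟨φ ⟨0, t.dim_pos⟩, subset_span ⟨_, rfl⟩, hf.ne_zero hξ _⟩ hm
  obtain ⟨c, hc⟩ := (Submodule.mem_span_range_iff_exists_fun ℝ).1 h1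
  exact ⟨c, hc.symm⟩

lemma IsFrame.ρ_B_sq : F.ρ B (F.ρ B h) + h = t.char • F.ρ B h := by
  have h1 : ∀ j, F.ρ B (F.ρ B (φ j)) + φ j = t.char • F.ρ B (φ j) := fun j => by
    have e1 : F.ρ B (F.ρ B (φ j)) = ∑ i, (t.matB * t.matB) i j • φ i := by
      rw [hf.act_B j, map_sum]; simp only [map_smul, hf.act_B, smul_sum, smul_smul]
      rw [Finset.sum_comm]; refine sum_congr rfl fun i _ => ?_
      rw [← Finset.sum_smul, Matrix.mul_apply]; simp only [mul_comm]
    have e2 : φ j = ∑ i, (1 : Matrix (Fin t.dim) (Fin t.dim) ℝ) i j • φ i := by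
      simp [one_apply]
    conv_lhs => rw [e1, e2]
    rw [← Finset.sum_add_distrib, hf.act_B, smul_sum]; refine sum_congr rfl fun i _ => ?_
    rw [← add_smul, ← Matrix.add_apply, Irrep.matB_mul_self, Matrix.smul_apply, smul_smul,
      smul_eq_mul]
  obtain ⟨c, rfl⟩ := hf.exists_sum hc hξ hm
  simp only [map_sum, map_smul, smul_sum, ← Finset.sum_add_distrib]
  refine sum_congr rfl fun i _ => ?_
  rw [← smul_add, h1, smul_comm]

end

section

variable {t t' : Irrep} {φ : Fin t.dim → Loop N} {φ' : Fin t'.dim → Loop N}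
  (hf : F.IsFrame ξ (κ ξ) t φ) (hf' : F.IsFrame ξ (κ ξ) t' φ') (hc : F.IsCritical ξ0 κ)
  (hξ : ξ ∈ F.J)
include ξ t t' φ φ' hf hf' hc hξ

lemma IsFrame.char_eq : t.char = t'.char := by
  have hm := hf.mode ⟨0, t.dim_pos⟩
  have h4 : F.ρ B (φ ⟨0, t.dim_pos⟩) ≠ 0 := fun h2 => by
    have h3 := F.ρ_inv_apply B⁻¹ (φ ⟨0, t.dim_pos⟩); rw [inv_inv, h2, map_zero] at h3
    exact hf.ne_zero hξ _ h3.symm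
  exact smul_left_injective ℝ h4 ((hf.ρ_B_sq hc hξ hm).symm.trans (hf'.ρ_B_sq hc hξ hm))

lemma IsFrame.eq : t = t' := by
  have hchar := hf.char_eq hf' hc hξ
  have key : ∀ {φ φ' : Fin 1 → Loop N} {a b : ℝ}, (∀ h, F.IsMode ξ h (κ ξ) → ∃ c : Fin 1 → ℝ, h = ∑
    i, c i • φ i) → F.ρ S (φ 0) = a • φ 0 → F.IsMode ξ (φ' 0) (κ ξ) → F.ρ S (φ' 0) = b • φ' 0 → φ' 0
    ≠ 0 → a = b := by
    intro φ φ' a b hs h1 hm h2 hne; obtain ⟨c, hcc⟩ := hs _ hm; rw [Fin.sum_univ_one] at hcc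
    have h3 : F.ρ S (φ' 0) = a • φ' 0 := by rw [hcc, map_smul, h1, smul_comm]
    exact smul_left_injective ℝ hne (h3.symm.trans h2)
  have h3 := hf.act_S
  have h4 := hf'.act_S
  cases t <;> cases t' <;> first
    | rfl
    | (exfalso; norm_num [Irrep.char] at hchar; done)
    | (exfalso
       have h3 := h3 0; have h4 := h4 0
       simp only [Irrep.matS, Finset.univ_unique, Fin.default_eq_zero, Finset.sum_singleton,
         one_apply, Matrix.neg_apply] at h3 h4
       have := key (fun h hm => hf.exists_sum hc hξ hm) h3 (hf'.mode 0) h4 ((hf'.ne_zero hξ) 0)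
       norm_num at this)

end

section

variable (x : Loop N)
include x

lemma ρ_S_S : F.ρ S (F.ρ S x) = x := by
  rw [← mul_apply, ← map_mul, show S * S = 1 by decide, map_one, Module.End.one_apply]

lemma ρ_S_B : F.ρ S (F.ρ B x) = F.ρ B⁻¹ (F.ρ S x) := by
  rw [← mul_apply, ← map_mul, show S * B = B⁻¹ * S by decide, map_mul, mul_apply]

lemma ρ_B_S : F.ρ B (F.ρ S x) = F.ρ S (F.ρ B⁻¹ x) := by
  rw [← mul_apply, ← map_mul, show B * S = S * B⁻¹ by decide, map_mul, mul_apply]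

lemma ρ_B_inv_B : F.ρ B⁻¹ (F.ρ B x) = x := by simp

lemma ρ_B_six : F.ρ B (F.ρ B (F.ρ B (F.ρ B (F.ρ B (F.ρ B x))))) = x := by
  simp only [← mul_apply, ← map_mul]
  rw [show B * (B * (B * (B * (B * B)))) = 1 by decide, map_one, Module.End.one_apply]

end

lemma exists_smul_ip (hξ : ξ ∈ F.J) {v : Loop N} (hv : v ≠ 0) :
    ∃ c : ℝ, c ≠ 0 ∧ F.ip ξ (c • v : Loop N) (c • v : Loop N) = 1 := by
  have h1 : 0 < F.ip ξ v v := by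
    rw [F.ip_eq hξ]; exact mul_pos (F.T_pos ξ hξ) (l2_self_pos hv)
  refine ⟨(Real.sqrt (F.ip ξ v v))⁻¹, inv_ne_zero (Real.sqrt_pos.2 h1).ne', ?_⟩
  have h2 := Real.mul_self_sqrt h1.le
  rw [F.ip_eq hξ, map_smul, map_smul, LinearMap.smul_apply, smul_eq_mul, smul_eq_mul]
  rw [F.ip_eq hξ] at h1 h2 ⊢
  have h3 := (Real.sqrt_pos.2 h1).ne'
  field_simp
  rw [sq, h2]

section

variable (hc : F.IsCritical ξ0 κ) (hξ : ξ ∈ F.J)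
include hc ξ hξ

lemma exists_S_eigenvector {v : Loop N} (hv : v ≠ 0) (hm : F.IsMode ξ v (κ ξ)) {c : ℝ} (hB : F.ρ B
    (F.ρ B v) + v = (2 * c) • F.ρ B v) : ∃ u : Loop N, u ≠ 0 ∧ F.IsMode ξ u (κ ξ) ∧ F.ρ B (F.ρ B u)
    + u = (2 * c) • F.ρ B u ∧ (F.ρ S u = u ∨ F.ρ S u = -u) := by
  let E := F.modeSpace hξ (κ ξ)
  have hBS : F.ρ B (F.ρ B (F.ρ S v)) + F.ρ S v = (2 * c) • F.ρ B (F.ρ S v) := by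
    have h1 : v + F.ρ B⁻¹ (F.ρ B⁻¹ v) = (2 * c) • F.ρ B⁻¹ v := by
      have := congrArg (fun x => F.ρ B⁻¹ (F.ρ B⁻¹ x)) hB
      simpa only [map_add, map_smul, ρ_B_inv_B] using this
    rw [ρ_B_S, ρ_B_S, ← map_add, add_comm, h1, map_smul]
  by_cases h0 : v + F.ρ S v = 0
  · exact ⟨v, hv, hm, hB, Or.inr (eq_neg_of_add_eq_zero_right h0)⟩
  · refine ⟨_, h0, E.add_mem hm (hc.mode_ρ hξ hm S), ?_, Or.inl ?_⟩
    · rw [map_add, map_add, smul_add, ← hB, ← hBS]; abel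
    · rw [map_add, ρ_S_S, add_comm]

lemma exists_rot_frame {v : Loop N} (hv : v ≠ 0) (hm : F.IsMode ξ v (κ ξ)) {α : ℝ} (hα : sin α
    ≠ 0) (hB : F.ρ B (F.ρ B v) + v = (2 * cos α) • F.ρ B v) : ∃ φ : Fin 2 → Loop N, (∀ i,
    F.IsMode ξ (φ i) (κ ξ)) ∧ (∀ i j, F.ip ξ (φ i) (φ j) = if i = j then 1 else 0) ∧ (∀ j, F.ρ B (φ
    j) = ∑ i, rotMatrix α i j • φ i) ∧ ∀ j, F.ρ S (φ j) = ∑ i, (!![1, 0; 0, -1] : Matrix (Fin 2)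
    (Fin 2) ℝ) i j • φ i := by
  set c := cos α
  set σ := sin α
  have hcs := sin_sq_add_cos_sq α
  let E := F.modeSpace hξ (κ ξ)
  have hinv : ∀ u : Loop N, F.ρ B (F.ρ B u) + u = (2 * c) • F.ρ B u → F.ρ B⁻¹ u = (2 * c) • u - F.ρ
    B u := fun u hu => by
    have := congrArg (F.ρ B⁻¹) hu; rw [map_add, map_smul, ρ_B_inv_B, ρ_B_inv_B] at this
    rw [← this, add_sub_cancel_left]
  obtain ⟨u, hu0, hum, huB, huS⟩ : ∃ u : Loop N, u ≠ 0 ∧ F.IsMode ξ u (κ ξ) ∧ F.ρ B (F.ρ B u) + u =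
    (2 * c) • F.ρ B u ∧ F.ρ S u = u := by
    obtain ⟨u, hu0, hum, huB, huS | huS⟩ := exists_S_eigenvector hc hξ hv hm hB
    · exact ⟨u, hu0, hum, huB, huS⟩
    · refine ⟨F.ρ B u - c • u, fun h0 => hu0 ?_,
        E.sub_mem (hc.mode_ρ hξ hum B) (E.smul_mem c hum), ?_, ?_⟩
      · have h1 := sub_eq_zero.1 h0; rw [h1, map_smul, h1] at huB
        have h2 : σ ^ 2 • u = (c • c • u + u) - (2 * c) • c • u := by
          rw [eq_sub_of_add_eq hcs]; module
        rw [huB, sub_self] at h2; exact (smul_eq_zero.1 h2).resolve_left (pow_ne_zero 2 hα)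
      · rw [map_sub, map_sub, map_smul, map_smul, smul_sub, smul_comm (2 * c) c, ← huB, ← map_smul (F.ρ B) (2 * c), ← huB,
          map_add, smul_add]
        abel
      · rw [map_sub, map_smul, ρ_S_B, huS, map_neg, hinv u huB]; module
  obtain ⟨l, hl, hl1⟩ := F.exists_smul_ip hξ hu0
  set p := l • u with hp
  have hpm : F.IsMode ξ p (κ ξ) := E.smul_mem l hum
  have hpS : F.ρ S p = p := by rw [hp, map_smul, huS]
  have hpB : F.ρ B (F.ρ B p) + p = (2 * c) • F.ρ B p := by
    rw [hp, map_smul, map_smul, ← smul_add, huB, smul_comm]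
  clear_value p
  set m := σ⁻¹ • (F.ρ B p - c • p) with hm'
  have hBp : F.ρ B p = c • p + σ • m := by
    rw [hm', smul_smul, mul_inv_cancel₀ hα, one_smul]; abel
  have hBm : F.ρ B m = (-σ) • p + c • m := by
    have h2 : σ • F.ρ B m = σ • ((-σ) • p + c • m) := by
      have h3 : σ • F.ρ B m = F.ρ B (F.ρ B p) - c • F.ρ B p := by
        rw [hm', map_smul, smul_smul, mul_inv_cancel₀ hα, one_smul, map_sub, map_smul]
      rw [h3, eq_sub_of_add_eq hpB, hBp]
      have h4 : (2 * c) • (c • p + σ • m) - p - c • (c • p + σ • m) = (c ^ 2 - 1) • p + (c * σ) • m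
        := by module
      rw [h4, show c ^ 2 - 1 = -σ ^ 2 by linarith]
      module
    exact smul_right_injective _ hα h2
  have hSm : F.ρ S m = -m := by
    rw [hm', map_smul, map_sub, map_smul, ρ_S_B, hpS, hinv p hpB]; module
  have hpp : l2 p p = (F.T ξ)⁻¹ := by
    rw [F.ip_eq hξ] at hl1; exact eq_inv_of_mul_eq_one_right hl1
  have hpm0 : l2 p m = 0 := by
    have := F.l2_ρ hξ S p m; rw [hpS, hSm, map_neg] at this; linarith
  have hmm1 : l2 m m = (F.T ξ)⁻¹ := by
    have := F.l2_ρ hξ B p p; rw [hBp] at this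
    simp only [map_add, map_smul, LinearMap.add_apply, LinearMap.smul_apply, smul_eq_mul, hpm0,
      l2_comm m p, hpp] at this
    have h5 : σ ^ 2 * l2 m m = σ ^ 2 * (F.T ξ)⁻¹ := by
      have h6 : (1 - c ^ 2) * (F.T ξ)⁻¹ = σ ^ 2 * (F.T ξ)⁻¹ := by rw [eq_sub_of_add_eq hcs]
      linarith
    exact mul_left_cancel₀ (pow_ne_zero 2 hα) h5
  refine ⟨![p, m], ?_, ?_, ?_, ?_⟩
  · intro i; fin_cases i
    exacts [hpm, E.smul_mem _ (E.sub_mem (hc.mode_ρ hξ hpm B) (E.smul_mem c hpm))]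
  · intro i j; rw [F.ip_eq hξ]
    fin_cases i <;> fin_cases j <;> simp [hpp, hpm0, hmm1, l2_comm m p, F.T_ne hξ]
  · intro j; fin_cases j
    · simpa [rotMatrix] using hBp
    · simpa [rotMatrix] using hBm
  · intro j; fin_cases j
    · simpa using hpS
    · simpa [neg_one_smul_loop] using hSm

lemma IsCritical.exists_isFrame : ∃ (t : Irrep) (φ : Fin t.dim → Loop N), F.IsFrame ξ (κ ξ) t φ :=
    by
  let E := F.modeSpace hξ (κ ξ)
  have hEB : ∀ {x : Loop N}, x ∈ E → F.ρ B x ∈ E := fun hx => hc.mode_ρ hξ hx B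
  have hone : ∀ {v : Loop N}, v ≠ 0 → v ∈ E → ∀ {e : ℝ}, e = 1 ∨ e = -1 → F.ρ B v = e • v → ∃ (t :
    Irrep) (φ : Fin t.dim → Loop N), F.IsFrame ξ (κ ξ) t φ := by
    intro v hv hvE e he hB; have hee : e * e = 1 := by rcases he with rfl | rfl <;> norm_num
    obtain ⟨u, hu0, huE, huB, huS⟩ : ∃ u : Loop N, u ≠ 0 ∧ u ∈ E ∧ F.ρ B u = e • u ∧ (F.ρ S u = u ∨
      F.ρ S u = -u) := by
      by_cases h0 : v + F.ρ S v = 0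
      · exact ⟨v, hv, hvE, hB, Or.inr (eq_neg_of_add_eq_zero_right h0)⟩
      · refine ⟨_, h0, E.add_mem hvE (hc.mode_ρ hξ hvE S), ?_, Or.inl ?_⟩
        · have h1 : F.ρ B⁻¹ v = e • v := by
            have := congrArg (fun x => e • F.ρ B⁻¹ x) hB
            simp only [map_smul, ρ_B_inv_B, smul_smul, hee, one_smul] at this; exact this.symm
          rw [map_add, hB, ρ_B_S, h1, map_smul, smul_add]
        · rw [map_add, ρ_S_S, add_comm]
    obtain ⟨l, -, hl⟩ := F.exists_smul_ip hξ hu0; have hmode := E.smul_mem l huE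
    have hort : ∀ i j : Fin 1, F.ip ξ (l • u : Loop N) (l • u : Loop N) = if i = j then 1 else 0 :=
      fun i j => by rw [hl, if_pos (elim i j)]
    rcases he with rfl | rfl <;> rcases huS with huS | huS
    · exact ⟨.I, fun _ => l • u, fun _ => hmode, hort,
        fun j => by simp [Irrep.matB, huB, one_apply, elim 0 j],
        fun j => by simp [Irrep.matS, huS, one_apply, elim 0 j]⟩
    · exact ⟨.II, fun _ => l • u, fun _ => hmode, hort,
        fun j => by simp [Irrep.matB, huB, one_apply, elim 0 j],
        fun j => by simp [Irrep.matS, huS, one_apply, elim 0 j, neg_one_smul_loop]⟩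
    · exact ⟨.III, fun _ => l • u, fun _ => hmode, hort,
        fun j => by simp [Irrep.matB, huB, one_apply, elim 0 j, neg_one_smul_loop],
        fun j => by simp [Irrep.matS, huS, one_apply, elim 0 j]⟩
    · exact ⟨.IV, fun _ => l • u, fun _ => hmode, hort,
        fun j => by simp [Irrep.matB, huB, one_apply, elim 0 j, neg_one_smul_loop],
        fun j => by simp [Irrep.matS, huS, one_apply, elim 0 j, neg_one_smul_loop]⟩
  obtain ⟨v, hv0, hv⟩ := hc.exists_mode_ne_zero hξ
  change v ∈ E at hv
  by_cases h1 : F.ρ B v - v = 0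
  · exact hone hv0 hv (Or.inl rfl) (by rw [one_smul, sub_eq_zero.1 h1])
  set x := F.ρ B v - v with hx
  have hxE := E.sub_mem (hEB hv) hv
  by_cases h2 : F.ρ B x + x = 0
  · exact hone h1 hxE (Or.inr rfl) (by rw [neg_one_smul_loop, eq_neg_of_add_eq_zero_left h2])
  set y := F.ρ B x + x with hy
  have hyE := E.add_mem (hEB hxE) hxE
  by_cases h3 : F.ρ B (F.ρ B y) + F.ρ B y + y = 0
  · obtain ⟨φ, h4, h5, h6, h7⟩ := exists_rot_frame hc hξ h2 hyE (α := 2 * π / 3)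
      (by rw [sin_two_pi_div_three]; positivity) (by
        rw [cos_two_pi_div_three, show (2 : ℝ) * -(1 / 2) = -1 by norm_num, neg_one_smul_loop]
        rw [← sub_eq_zero, ← h3]; abel)
    exact ⟨.V, φ, h4, h5, h6, h7⟩
  · set z := F.ρ B (F.ρ B y) + F.ρ B y + y with hz
    obtain ⟨φ, h4, h5, h6, h7⟩ := exists_rot_frame hc hξ h3 (E.add_mem (E.add_mem (hEB (hEB hyE)) (hEB hyE)) hyE) (α := π / 3)
      (by simp) (by
        rw [Real.cos_pi_div_three, show (2 : ℝ) * (1 / 2) = 1 by norm_num, one_smul,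
          ← sub_eq_zero, hz, hy, hx]
        simp; rw [ρ_B_six]; abel)
    exact ⟨.VI, φ, h4, h5, h6, h7⟩

end

end SymmetricFamily

end D6Bifurcation

namespace PeriodicODE

section Parameters

variable {P F : Type} [NormedAddCommGroup P] [NormedSpace ℝ P]
  [NormedAddCommGroup F] [NormedSpace ℝ F]

def SmoothPeriodic (O : Set P) (b : P → ℝ → F) : Prop :=
  SmoothOn (fun q : P × ℝ => b q.1 q.2) (O ×ˢ univ) ∧
    ∀ p ∈ O, Periodic (b p) 1

lemma SmoothPeriodic.contDiff {O : Set P} {b : P → ℝ → F} (h : SmoothPeriodic O b) {p : P}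
    (hp : p ∈ O) : Smooth (b p) :=
  h.1.comp_contDiff (contDiff_const.prodMk contDiff_id) fun _ => ⟨hp, mem_univ _⟩

lemma SmoothPeriodic.mono {O O' : Set P} {b : P → ℝ → F} (h : SmoothPeriodic O b) (hO : O' ⊆ O) :
    SmoothPeriodic O' b := ⟨h.1.mono (Set.prod_mono hO subset_rfl), fun p hp => h.2 p (hO hp)⟩

section

variable {O : Set P} {b : P → ℝ → F} (h : SmoothPeriodic O b)
include O b h

lemma SmoothPeriodic.toCircle_coe {p : P} (hp : p ∈ O) (t : ℝ) : toCircle (b p) t = b p t :=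
  PeriodicODE.toCircle_coe (h.contDiff hp).continuous (h.2 p hp) t

lemma SmoothPeriodic.contDiffOn_toCircle (hO : IsOpen O) : SmoothOn (fun p => toCircle (b p)) O :=
    PeriodicODE.contDiffOn_toCircle hO h.1 h.2

lemma SmoothPeriodic.shift : SmoothPeriodic (O ×ˢ (univ : Set ℝ)) (fun (p : P × ℝ) t => b p.1 (t
    + p.2)) := by
  refine ⟨h.1.comp (f := fun q : (P × ℝ) × ℝ => (q.1.1, q.2 + q.1.2))
    (by fun_prop) fun q hq => ⟨hq.1.1, mem_univ _⟩, fun p hp t => ?_⟩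
  have := h.2 p.1 hp.1 (t + p.2)
  simp only [← this]
  congr 1
  ring

end

variable [CompleteSpace F]

section

variable {O : Set P} {b : P → ℝ → F} (h : SmoothPeriodic O b)
include O b h

lemma SmoothPeriodic.shift_toCircle {p : P} (hp : p ∈ O) (σ : ℝ) : PeriodicODE.shift σ (toCircle (b
    p)) = toCircle (fun t => b p (t + σ)) :=
  circle_ext fun t => by
    rw [shift_apply, ← AddCircle.coe_add, h.toCircle_coe hp]
    exact (h.shift.toCircle_coe (p := (p, σ)) ⟨hp, mem_univ _⟩ t).symm

lemma SmoothPeriodic.contDiffOn_shift (hO : IsOpen O) : SmoothOn (fun p : P × ℝ =>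
    PeriodicODE.shift p.2 (toCircle (b p.1))) (O ×ˢ univ) :=
  (h.shift.contDiffOn_toCircle (hO.prod isOpen_univ)).congr fun p hp => h.shift_toCircle hp.1 p.2

end

variable {E : Type} [NormedAddCommGroup E] [InnerProductSpace ℝ E] [FiniteDimensional ℝ E]
  [CompleteSpace E] {ι : Type} [Fintype ι] [DecidableEq ι]

lemma contDiffOn_solve {O : Set P} (hO : IsOpen O) {V : P → ℝ → E →L[ℝ] E} {b b' : P → ι → ℝ → E}
    (hV : SmoothPeriodic O V) (hb : ∀ j, SmoothPeriodic O fun p => b p j) (hb' : ∀ j, SmoothPeriodic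
    O fun p => b' p j) {D : P → BorderedData E ι} (hD : ∀ p, D p = (toCircle (V p), fun j =>
    toCircle (b p j), fun j => toCircle (b' p j))) (hinj : ∀ p ∈ O, Injective (bordered (D p))) (a :
    ι → ℝ) : SmoothOn (fun q : P × ℝ => (solve (D q.1) (0, a)).1 (q.2 : UnitAddCircle)) (O ×ˢ univ)
    ∧ SmoothOn (fun p => (solve (D p) (0, a)).2) O := by
  have hDs : SmoothOn (fun q : P × ℝ => shiftData q.2 (D q.1)) (O ×ˢ univ) := by
    simp only [hD, shiftData]; refine (hV.contDiffOn_shift hO).prodMk (ContDiffOn.prodMk ?_ ?_)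
    · exact contDiffOn_pi.2 fun j => (hb j).contDiffOn_shift hO
    · exact contDiffOn_pi.2 fun j => (hb' j).contDiffOn_shift hO
  have hs : SmoothOn (fun q : P × ℝ => solve (shiftData q.2 (D q.1)) (0, a)) (O ×ˢ univ) := fun q hq
    =>
    ContDiffAt.comp_contDiffWithinAt (g := fun D : BorderedData E ι => solve D (0, a)) q
      (contDiffAt_solve (bordered_shift_injective q.2 (hinj q.1 hq.1)) (0, a)) (hDs q hq)
  constructor
  · have hev : Smooth fun X : Per(E) × (ι → ℝ) => X.1 0 := ((evalCLM ℝ 0).comp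
      (fst ℝ Per(E) (ι → ℝ))).contDiff
    refine (hev.comp_contDiffOn hs).congr fun q hq => ?_; simp
    rw [solve_shift q.2 (hinj q.1 hq.1), shift_apply, zero_add]
  · refine (contDiff_snd.comp_contDiffOn (hs.comp (f := fun p : P => (p, (0 : ℝ))) (by fun_prop) fun p hp => ⟨hp, mem_univ _⟩)).congr fun p hp => ?_
    simp; rw [solve_shift 0 (hinj p hp)]

end Parameters

end PeriodicODE

namespace D6Bifurcation

open PeriodicODE

namespace SymmetricFamily

variable {N : ℕ} (F : SymmetricFamily N) {ι : Type} [Fintype ι] [DecidableEq ι] {ξ : ℝ}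

/-- The potential of the linearized equation `h'' = m⁻¹ (D²U(q) - μ) h`. -/
def potential (ξ μ : ℝ) (s : ℝ) : Conf N →L[ℝ] Conf N :=
  (F.massInv ξ).comp (fderiv ℝ (gradient (F.U ξ)) ((F.q ξ).1 s)
    - μ • ContinuousLinearMap.id ℝ (Conf N))

/-- The data of the eigenvalue problem for the Hessian, bordered by the functions `b`. -/
def data (ξ μ : ℝ) (b : ι → Loop N) : BorderedData (Conf N) ι :=
  (toCircle (F.potential ξ μ), fun j => circ (b j),
    fun j => toCircle fun s => F.massInv ξ ((b j : ℝ → Conf N) s))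

lemma smoothPeriodic_q : SmoothPeriodic F.J fun ξ => (F.q ξ).1 :=
  ⟨F.q_smooth, fun ξ _ => loop_periodic (F.q ξ)⟩

lemma smoothPeriodic_potential :
    SmoothPeriodic (F.J ×ˢ (univ : Set ℝ)) fun p : ℝ × ℝ => F.potential p.1 p.2 := by
  refine ⟨?_, fun p _ s => by simp only [potential, loop_periodic (F.q p.1) s]⟩
  have h1 : SmoothOn (fun q : (ℝ × ℝ) × ℝ => (q.1.1, (F.q q.1.1 : ℝ → Conf N) q.2)) ((F.J ×ˢ univ)
    ×ˢ univ) := ContDiffOn.prodMk (by fun_prop) (F.q_smooth.comp (f := fun q : (ℝ × ℝ) × ℝ =>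
    (q.1.1, q.2)) (by fun_prop) fun q hq => ⟨hq.1.1, mem_univ _⟩)
  have h3 : SmoothOn (fun q : (ℝ × ℝ) × ℝ => F.massInv q.1.1) ((F.J ×ˢ univ) ×ˢ univ) :=
    F.contDiffOn_massInv.comp (f := fun q : (ℝ × ℝ) × ℝ => q.1.1) (by fun_prop) fun q hq => hq.1.1
  refine h3.clm_comp ((F.contDiffOn_hessian.comp h1 fun q hq => ⟨hq.1.1, F.q_admissible hq.1.1 q.2⟩).sub ?_)
  have h4 : Smooth fun q : (ℝ × ℝ) × ℝ => q.1.2 • ContinuousLinearMap.id ℝ (Conf N) := by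
    fun_prop
  exact h4.contDiffOn

lemma potential_coe (hξ : ξ ∈ F.J) (μ s : ℝ) : toCircle (F.potential ξ μ) s = F.potential ξ μ s :=
    F.smoothPeriodic_potential.toCircle_coe (p := (ξ, μ)) ⟨hξ, mem_univ _⟩ s

lemma massInv_coe (ξ s : ℝ) (x : Loop N) : toCircle (fun s => F.massInv ξ (x.1 s)) s = F.massInv ξ
    (x.1 s) := toCircle_coe ((F.massInv ξ).continuous.comp (loop_continuous x)) (fun s => congrArg
    (F.massInv ξ) (loop_periodic x s)) s

section

variable (hξ : ξ ∈ F.J) (μ : ℝ) (b : ι → Loop N)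
include ξ hξ μ b

lemma mulC_data_coe (X : CLoop N) (c : ι → ℝ) (s : ℝ) : (mulC (F.data ξ μ b).1 X + ∑ j, c j •
    (F.data ξ μ b).2.2 j) s = F.massInv ξ (fderiv ℝ (gradient (F.U ξ)) ((F.q ξ).1 s) (X s) - μ • X s
    + ∑ j, c j • (b j : ℝ → Conf N) s) := by
  rw [ContinuousMap.add_apply, mulC_apply, ContinuousMap.sum_apply]
  simp only [data, ContinuousMap.smul_apply, F.potential_coe hξ, F.massInv_coe, potential]
  simp

lemma contDiff_linear_rhs (c : ι → ℝ) {x : ℝ → Conf N} {n : ℕ} (hx : ContDiff ℝ n x) : ContDiff ℝ n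
    fun s : ℝ => F.massInv ξ (fderiv ℝ (gradient (F.U ξ)) ((F.q ξ).1 s) (x s) - μ • x s + ∑ j, c j •
    (b j : ℝ → Conf N) s) := by
  exact (F.massInv ξ).contDiff.comp ((((contDiff_infty.1 (F.contDiffOn_hessian.comp_contDiff (f := fun s : ℝ => (ξ, (F.q ξ).1 s)) (contDiff_const.prodMk (loop_contDiff _)) fun s => ⟨hξ, F.q_admissible hξ s⟩) n).clm_apply hx).sub (contDiff_const (c := μ).smul hx)).add (ContDiff.sum fun j _ => ((fun j => contDiff_infty.1 (loop_contDiff (b j)) n) j).const_smul (c j)))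

lemma bordered_data_iff (X : CLoop N) (c a : ι → ℝ) : bordered (F.data ξ μ b) (X, c) = (0, a) ↔ ∃ x
    : Loop N, circ x = X ∧ F.hessQ hξ x - μ • x + ∑ j, c j • b j = 0 ∧ ∀ j, l2 (b j) x = a j := by
  have hYs := F.mulC_data_coe hξ μ b X c
  obtain ⟨Y, hY⟩ : ∃ Y, Y = mulC (F.data ξ μ b).1 X + ∑ j, c j • (F.data ξ μ b).2.2 j := ⟨_, rfl⟩
  rw [← hY] at hYs
  have key : bordered (F.data ξ μ b) (X, c) = (0, a) ↔ X = constC (mean X) + resolv Y ∧ ∀ j, pair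
    (circ (b j)) X = a j := by
    rw [Prod.ext_iff, funext_iff, bordered_fst, sub_sub, sub_eq_zero, hY]
    refine and_congr Iff.rfl (forall_congr' fun j => ?_); rw [bordered_snd]; rfl
  rw [key]
  clear hY key
  constructor
  · rintro ⟨h1, h2⟩; have hsm := contDiff_of_resolv h1 fun n hn => by
      rw [funext hYs]; exact F.contDiff_linear_rhs hξ μ b c hn
    obtain ⟨x, rfl⟩ := exists_loop_of_contDiff hsm; refine ⟨x, rfl, ?_, h2⟩
    have h4 := circ_dLoop_of_hasDerivAt fun t => by
      rw [circ_dLoop_of_hasDerivAt (hasDerivAt_of_resolv h1)]; exact hasDerivAt_prim_of_resolv h1 t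
    refine Subtype.ext (funext fun s => ?_); have h5 := hYs s; rw [← h4, circ_coe, circ_coe] at h5
    have h6 := F.hessLoop_apply hξ (F.q_admissible hξ) x s; rw [h5, F.massOp_massInv hξ] at h6
    have h7 : ((F.hessQ hξ x - μ • x + ∑ j, c j • b j : Loop N) : ℝ → Conf N) s = (F.hessQ hξ x : ℝ
      → Conf N) s - μ • x.1 s + ∑ j, c j • (b j : ℝ → Conf N) s := by
      simp [Finset.sum_apply]
    rw [h7, hessQ, h6]; change _ = 0; abel
  · rintro ⟨x, rfl, h1, h2⟩; refine ⟨resolv_of_hasDerivAt (hasDerivAt_circ x) fun t => ?_, h2⟩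
    have h3 : Y t = circ (dLoop (dLoop x)) t := by
      rw [hYs, circ_coe, circ_coe, ← F.massInv_massOp hξ ((dLoop (dLoop x) : ℝ → Conf N) t)]
      congr 1; have h4 : ((F.hessQ hξ x - μ • x + ∑ j, c j • b j : Loop N) : ℝ → Conf N) t = 0 := by
        rw [h1]; rfl
      have h7 : ((F.hessQ hξ x - μ • x + ∑ j, c j • b j : Loop N) : ℝ → Conf N) t = (F.hessQ hξ x :
        ℝ → Conf N) t - μ • x.1 t + ∑ j, c j • (b j : ℝ → Conf N) t := by
        simp [Finset.sum_apply]
      rw [h7, hessQ, F.hessLoop_apply hξ (F.q_admissible hξ) x t] at h4; rw [← sub_eq_zero]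
      refine Eq.trans ?_ h4; abel
    rw [h3]; exact hasDerivAt_circ (dLoop x) t

end

lemma bordered_data_injective (hξ : ξ ∈ F.J) {b : ι → Loop N} (hli : LinearIndependent ℝ b) (hb : ∀
    j, F.hessQ hξ (b j) = 0) (hker : ∀ h, F.hessQ hξ h = 0 → (∀ j, l2 (b j) h = 0) → h = 0) :
    Injective (bordered (F.data ξ 0 b)) := by
  rw [injective_iff_map_eq_zero]
  rintro ⟨X, c⟩ hX
  obtain ⟨x, rfl, h1, h2⟩ := (F.bordered_data_iff hξ 0 b X c 0).1 hX
  rw [zero_smul, sub_zero] at h1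
  have h3 : ∑ j, c j • b j = 0 := by
    refine l2_self_eq_zero ?_; have h4 : ∀ j, l2 (∑ j, c j • b j) (b j) = 0 := fun j => by
      rw [eq_neg_of_add_eq_zero_right h1, map_neg, LinearMap.neg_apply, F.l2_hessQ_comm, hb,
        map_zero, neg_zero]
    conv_lhs => rw [map_sum]
    exact sum_eq_zero fun j _ => by rw [map_smul, h4, smul_zero]
  rw [h3, add_zero] at h1
  rw [hker x h1 h2, map_zero, funext fun j => Fintype.linearIndependent_iff.1 hli c h3 j]
  rfl

/-- Functions spanning the critical modes and the zero modes. -/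
def border {d n : ℕ} (φ : Fin d → Loop N)
    (v : Fin n → Gen N) (ξ : ℝ) : Fin d ⊕ Fin n → Loop N :=
  Sum.elim φ fun k => LagrangianFamily.symLoop (F.q ξ) (v k)

/-- A choice of generators whose zero modes at `q ξ` form a basis. -/
structure IsZeroBasis (ξ : ℝ) {n : ℕ} (v : Fin n → Gen N) :
    Prop where
  mem : ∀ k, v k ∈ F.symSet
  linearIndependent : LinearIndependent ℝ fun k => LagrangianFamily.symLoop (F.q ξ) (v k)
  span : F.zeroModes (F.q ξ)
    = span ℝ (Set.range fun k => LagrangianFamily.symLoop (F.q ξ) (v k))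

lemma exists_isZeroBasis (ξ : ℝ) : ∃ (n : ℕ) (v : Fin n → Gen N), F.IsZeroBasis ξ v := by
  obtain ⟨n, v, h1, h2, h3⟩ := F.exists_basis_zeroModes (F.q ξ)
  exact ⟨n, v, h1, h2, h3⟩

variable {F} {ξ0 : ℝ} {κ : ℝ → ℝ}

lemma IsFrame.l2_eq {ξ μ : ℝ} {t : Irrep} {φ : Fin t.dim → Loop N} (hf : F.IsFrame ξ μ t φ)
    (hξ : ξ ∈ F.J) (i j : Fin t.dim) : l2 (φ i) (φ j) = if i = j then (F.T ξ)⁻¹ else 0 := by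
  have h := hf.orthonormal i j
  rw [F.ip_eq hξ] at h
  split_ifs at h ⊢ with hij
  · exact eq_inv_of_mul_eq_one_right h
  · exact (mul_eq_zero.1 h).resolve_left (F.T_ne hξ)

lemma mem_zeroModes {x : Loop N} {v : Gen N} (hv : v ∈ F.symSet) : LagrangianFamily.symLoop x v ∈
    F.zeroModes x := subset_span ⟨v, hv, rfl⟩

lemma bordered_border_injective (hc : F.IsCritical ξ0 κ) {t : Irrep} {φ : Fin t.dim → Loop N}
    (hf : F.IsFrame ξ0 0 t φ) {n : ℕ} {v : Fin n → Gen N}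
    (hv : F.IsZeroBasis ξ0 v) : Injective (bordered (F.data ξ0 0 (F.border φ v ξ0))) := by
  have hξ := hc.mem
  refine F.bordered_data_injective hξ ?_ ?_ ?_
  · rw [Fintype.linearIndependent_iff]; intro c hcc
    simp only [border, Fintype.sum_sum_type, Sum.elim_inl, Sum.elim_inr] at hcc
    have h1 : ∀ i, c (inl i) = 0 := fun i => by
      have := congrArg (l2 (φ i)) hcc; rw [map_add, map_sum, map_sum, map_zero] at this
      simp only [map_smul, fun i k => (F.transverse_iff_l2 hξ _).1 (hf.mode i).2 _ (mem_zeroModes (hv.mem k)), hf.l2_eq hξ, smul_eq_mul, mul_ite, mul_zero,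
        Finset.sum_const_zero, add_zero, Finset.sum_ite_eq, Finset.mem_univ, if_true] at this
      exact (mul_eq_zero.1 this).resolve_right (inv_ne_zero (F.T_ne hξ))
    simp only [h1, zero_smul, Finset.sum_const_zero, zero_add] at hcc; rintro (i | k)
    exacts [h1 i, (Fintype.linearIndependent_iff.1 hv.linearIndependent _ hcc) k]
  · rintro (i | k)
    · have := ((F.isMode_iff hξ _ _).1 (hf.mode i)).1; rwa [zero_smul] at this
    · exact F.hessQ_zeroModes hξ (mem_zeroModes (hv.mem k))
  · intro h h1 h2; obtain ⟨z, hz, hm⟩ := F.exists_mode_sub hξ h1; rw [← hc.zero] at hm hf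
    obtain ⟨c, hcc⟩ := hf.exists_sum hc hξ hm
    have h3 : ∀ z ∈ F.zeroModes (F.q ξ0), l2 z h = 0 := fun z hz => by
      rw [hv.span] at hz; induction hz using Submodule.span_induction with
      | mem z hz =>
        obtain ⟨k, rfl⟩ := hz; exact h2 (inr k)
      | zero => simp
      | add y z _ _ hy hz => rw [map_add, LinearMap.add_apply, hy, hz, add_zero]
      | smul c z _ hz => rw [map_smul, LinearMap.smul_apply, hz, smul_zero]
    have h4 : h = (h - z) + z := by abel
    refine l2_self_eq_zero ?_
    have h5 : l2 h h = l2 (h - z) h + l2 z h := by rw [← LinearMap.add_apply, ← map_add, ← h4]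
    rw [h5, h3 z hz, hcc, map_sum, LinearMap.sum_apply, add_zero]; refine sum_eq_zero fun i _ => ?_
    have := h2 (inl i); rw [border, Sum.elim_inl] at this
    rw [map_smul, LinearMap.smul_apply, this, smul_zero]

end SymmetricFamily

end D6Bifurcation

namespace PeriodicODE

lemma isInvertible_real {L : ℝ →L[ℝ] ℝ} (h : L 1 ≠ 0) : L.IsInvertible :=
  ⟨ContinuousLinearEquiv.unitsEquivAut ℝ (Units.mk0 (L 1) h), by ext; simp⟩

section

variable {γ : ℝ × ℝ → ℝ} {k : ℝ → ℝ} {x : ℝ}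
include γ k x

lemma contDiffAt_of_implicit (hγ : SmoothAt γ (x, k x)) (hd : fderiv ℝ γ (x, k x) (0, 1) ≠ 0)
    (hk : ContinuousAt k x) (h0 : ∀ᶠ y in 𝓝 x, γ (y, k y) = γ (x, k x)) : SmoothAt k x := by
  have hinv : (fderiv ℝ γ (x, k x) ∘L .inr ℝ ℝ ℝ).IsInvertible := isInvertible_real (by simpa using hd)
  refine (hγ.contDiffAt_implicitFunction (by simp) hinv).congr_of_eventuallyEq ?_
  filter_upwards [(continuousAt_id.prodMk hk).eventually (hγ.eventually_apply_eq_iff_implicitFunction (by simp) hinv), h0] with y hy hy0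
  exact (hy.1 hy0).symm

lemma exists_contDiffOn_of_implicit {O : Set (ℝ × ℝ)} (hO : IsOpen O) (hx : (x, k x) ∈ O) (hγ :
    SmoothOn γ O) (hd : fderiv ℝ γ (x, k x) (0, 1) ≠ 0) (hk : ContinuousAt k x) (h0 : ∀ᶠ y in 𝓝 x, γ
    (y, k y) = 0) : ∃ J : Set ℝ, IsOpen J ∧ x ∈ J ∧ SmoothOn k J ∧ ∀ y ∈ J, (y, k y) ∈ O := by
  have hat : ∀ p ∈ O, SmoothAt γ p := fun p hp => hγ.contDiffAt (hO.mem_nhds hp)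
  have h2 := (((contDiffAt_of_implicit (hat _ hx) hd hk (by filter_upwards [h0] with y hy; rw [hy, h0.self_of_nhds])).of_le (m := 1) (by norm_cast)).eventually (by simp)).mono
      fun y hy => hy.continuousAt
  have h3 : Tendsto (fun y => (y, k y)) (𝓝 x) (𝓝 (x, k x)) := continuousAt_id.prodMk hk
  obtain ⟨J, hJ, hJo, hxJ⟩ := eventually_nhds_iff.1
    (h2.and ((h3.eventually (hO.mem_nhds hx)).and ((h3.eventually (((((hat _ hx).fderiv_right (m := 0) (by simp)).continuousAt).clm_apply continuousAt_const).eventually_ne hd)).and h0)))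
  refine ⟨J, hJo, hxJ, fun y hy => ?_, fun y hy => (hJ y hy).2.1⟩
  obtain ⟨e1, e2, e3, e4⟩ := hJ y hy
  refine (contDiffAt_of_implicit (hat _ e2) e3 e1 ?_).contDiffWithinAt
  filter_upwards [hJo.mem_nhds hy] with z hz
  rw [e4, (hJ z hz).2.2.2]

end

section Parameters

variable {P F : Type} [NormedAddCommGroup P] [NormedSpace ℝ P]
  [NormedAddCommGroup F] [NormedSpace ℝ F]

lemma SmoothPeriodic.deriv {O : Set P} {b : P → ℝ → F} (h : SmoothPeriodic O b) (hO : IsOpen O) :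
    SmoothPeriodic O fun p => deriv (b p) := by
  have hop : IsOpen (O ×ˢ (univ : Set ℝ)) := hO.prod isOpen_univ
  refine ⟨?_, fun p hp s => ?_⟩
  · have h1 := (h.1.fderiv_of_isOpen hop (m := ∞) (by simp)).clm_apply
      (contDiffOn_const (c := ((0 : P), (1 : ℝ))))
    refine h1.congr fun q hq => ?_; have h3 : HasDerivAt (fun s => (q.1, s)) (0, 1) q.2 :=
      (hasDerivAt_const _ _).prodMk (hasDerivAt_id _)
    exact ((((h.1.contDiffAt (hop.mem_nhds hq)).toFDeriv)).comp_hasDerivAt q.2 h3).deriv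
  · change _root_.deriv (b p) (s + 1) = _root_.deriv (b p) s
    conv_rhs => rw [funext fun s => (h.2 p hp s).symm]
    rw [deriv_comp_add_const]

lemma SmoothPeriodic.comp {P' : Type} [NormedAddCommGroup P'] [NormedSpace ℝ P'] {O : Set P}
    {O' : Set P'} {b : P → ℝ → F} (h : SmoothPeriodic O b) {f : P' → P} (hf : SmoothOn f O')
    (hm : Set.MapsTo f O' O) : SmoothPeriodic O' fun p => b (f p) :=
  ⟨h.1.comp ((hf.comp contDiffOn_fst fun _ hq => hq.1).prodMk contDiffOn_snd)
    fun _ hq => ⟨hm hq.1, mem_univ _⟩, fun _ hp => h.2 _ (hm hp)⟩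

lemma SmoothPeriodic.clm {G : Type} [NormedAddCommGroup G] [NormedSpace ℝ G] {O : Set P} {b : P → ℝ
    → F} (h : SmoothPeriodic O b) {L : P → F →L[ℝ] G} (hL : SmoothOn L O) : SmoothPeriodic O fun p s
    => L p (b p s) := ⟨(hL.comp contDiffOn_fst fun _ hq => hq.1).clm_apply h.1, fun p hp s =>
    congrArg (L p) (h.2 p hp s)⟩

end Parameters

end PeriodicODE

namespace D6Bifurcation

open PeriodicODE

namespace SymmetricFamily

variable {N : ℕ} (F : SymmetricFamily N) {ι : Type} [Fintype ι] [DecidableEq ι] {ξ : ℝ}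

lemma smoothPeriodic_const (O : Set ℝ) (x : Loop N) : SmoothPeriodic O fun _ => x.1 :=
    ⟨((loop_contDiff x).comp contDiff_snd).contDiffOn, fun _ _ => loop_periodic x⟩

lemma smoothPeriodic_symLoop (v : Gen N) :
    SmoothPeriodic F.J fun ξ => (LagrangianFamily.symLoop (F.q ξ) v : ℝ → Conf N) := by
  refine ⟨?_, fun ξ _ => loop_periodic _⟩
  exact (((F.smoothPeriodic_q.deriv F.isOpen_J).1).const_smul v.1).add (contDiffOn_const.add (v.2.2.contDiff.comp_contDiffOn F.q_smooth))

lemma smoothPeriodic_border {d n : ℕ} {O : Set ℝ} (hO : O ⊆ F.J) {φ : ℝ → Fin d → Loop N} (hφ : ∀ i,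
    SmoothPeriodic O fun ξ => (φ ξ i : ℝ → Conf N)) (v : Fin n → Gen N) (j : Fin d ⊕ Fin n) :
    SmoothPeriodic O fun ξ => (F.border (φ ξ) v ξ j : ℝ → Conf N) := by
  rcases j with i | k
  · exact hφ i
  · exact (F.smoothPeriodic_symLoop (v k)).mono hO

lemma contDiffOn_solve_data {O : Set (ℝ × ℝ)} (hO : IsOpen O) {J : Set ℝ} (hJ : J ⊆ F.J) (hOJ : ∀ p
    ∈ O, p.1 ∈ J) {b : ℝ → ι → Loop N} (hb : ∀ j, SmoothPeriodic J fun ξ => (b ξ j : ℝ → Conf N))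
    (hinj : ∀ p ∈ O, Injective (bordered (F.data p.1 p.2 (b p.1)))) (a : ι → ℝ) : SmoothOn (fun q :
    (ℝ × ℝ) × ℝ => (solve (F.data q.1.1 q.1.2 (b q.1.1)) (0, a)).1 (q.2 : UnitAddCircle)) (O ×ˢ
    univ) ∧ SmoothOn (fun p : ℝ × ℝ => (solve (F.data p.1 p.2 (b p.1)) (0, a)).2) O :=
    contDiffOn_solve hO (F.smoothPeriodic_potential.mono fun p hp => ⟨hJ (hOJ p hp), mem_univ _⟩)
    (fun j => (hb j).comp contDiffOn_fst hOJ) (fun j => ((hb j).comp contDiffOn_fst hOJ).clm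
    (F.contDiffOn_massInv.comp contDiffOn_fst fun p hp => hJ (hOJ p hp))) (fun _ => rfl) hinj a

lemma continuousAt_data {J : Set ℝ} (hJo : IsOpen J) (hJ : J ⊆ F.J) {b : ℝ → ι → Loop N}
    (hb : ∀ j, SmoothPeriodic J fun ξ => (b ξ j : ℝ → Conf N)) (hξ : ξ ∈ J) (μ : ℝ) :
    ContinuousAt (fun p : ℝ × ℝ => F.data p.1 p.2 (b p.1)) (ξ, μ) := by
  have hop : IsOpen (J ×ˢ (univ : Set ℝ)) := hJo.prod isOpen_univ
  have hmem : J ×ˢ (univ : Set ℝ) ∈ 𝓝 (ξ, μ) := hop.mem_nhds ⟨hξ, mem_univ _⟩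
  exact (((F.smoothPeriodic_potential.mono (Set.prod_mono hJ subset_rfl)).contDiffOn_toCircle hop).continuousOn.continuousAt hmem).prodMk ((continuousAt_pi.2 (fun j => (((hb j).comp contDiffOn_fst (fun p (hp : p ∈ J ×ˢ (univ : Set ℝ)) => hp.1)).contDiffOn_toCircle hop).continuousOn.continuousAt hmem)).prodMk (continuousAt_pi.2 (fun j => ((((hb j).comp contDiffOn_fst (fun p (hp : p ∈ J ×ˢ (univ : Set ℝ)) => hp.1)).clm (F.contDiffOn_massInv.comp contDiffOn_fst fun p hp => hJ hp.1)).contDiffOn_toCircle hop).continuousOn.continuousAt hmem)))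

variable {F} {ξ0 : ℝ} {κ : ℝ → ℝ}

lemma l2_eq_of_act (hξ : ξ ∈ F.J) {t : Irrep} {h : Fin t.dim → Loop N} (hB : ∀ j, F.ρ B (h j) = ∑ i,
    t.matB i j • h i) (hS : ∀ j, F.ρ S (h j) = ∑ i, t.matS i j • h i) (i j : Fin t.dim) : l2 (h i)
    (h j) = if i = j then l2 (h ⟨0, t.dim_pos⟩) (h ⟨0, t.dim_pos⟩) else 0 := by
  have two : ∀ {h : Fin 2 → Loop N} {α : ℝ}, sin α ≠ 0 → (∀ j, F.ρ B (h j) = ∑ i, rotMatrix α i j •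
    h i) → (∀ j, F.ρ S (h j) = ∑ i, (!![1, 0; 0, -1] : Matrix (Fin 2) (Fin 2) ℝ) i j • h i) → ∀ i j
    : Fin 2, l2 (h i) (h j) = if i = j then l2 (h 0) (h 0) else 0 := by
    intro h α hα hB hS; have hS0 : F.ρ S (h 0) = h 0 := by
      have := hS 0; rw [Fin.sum_univ_two] at this; simpa using this
    have hS1 : F.ρ S (h 1) = -h 1 := by
      have := hS 1; rw [Fin.sum_univ_two] at this; simpa [neg_one_smul_loop] using this
    have h01 : l2 (h 0) (h 1) = 0 := by
      have := F.l2_ρ hξ S (h 0) (h 1); rw [hS0, hS1, map_neg] at this; linarith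
    have h11 : l2 (h 1) (h 1) = l2 (h 0) (h 0) := by
      have hB0 := hB 0; rw [Fin.sum_univ_two] at hB0
      have h2 : F.ρ B (h 0) = cos α • h 0 + sin α • h 1 := by simpa [rotMatrix] using hB0
      have h3 := F.l2_ρ hξ B (h 0) (h 0); rw [h2] at h3
      simp only [map_add, map_smul, LinearMap.add_apply, LinearMap.smul_apply, smul_eq_mul, h01,
        l2_comm (h 1) (h 0)] at h3
      have h5 : sin α ^ 2 * l2 (h 1) (h 1) = sin α ^ 2 * l2 (h 0) (h 0) := by
        have h6 : (1 - cos α ^ 2) * l2 (h 0) (h 0) = sin α ^ 2 * l2 (h 0) (h 0) := by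
          rw [eq_sub_of_add_eq (sin_sq_add_cos_sq α)]
        linarith
      exact mul_left_cancel₀ (pow_ne_zero 2 hα) h5
    intro i j; fin_cases i <;> fin_cases j <;> simp [h01, h11, l2_comm (h 1) (h 0)]
  cases t
  case V => exact two (by rw [sin_two_pi_div_three]; positivity) hB hS i j
  case VI => exact two (by simp) hB hS i j
  all_goals
    rw [if_pos (elim (α := Fin 1) i j)]
    rw [elim (α := Fin 1) i ⟨0, one_pos⟩, elim (α := Fin 1) j ⟨0, one_pos⟩]

def proj (φ : ι → Loop N) : Loop N →ₗ[ℝ] Loop N := ∑ i, (l2 (φ i)).smulRight (φ i)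

lemma proj_apply (φ : ι → Loop N) (x : Loop N) : proj φ x = ∑ i, l2 (φ i) x • φ i := by simp [proj]

lemma exists_modes_of_proj (hc : F.IsCritical ξ0 κ) {t : Irrep} {φ : Fin t.dim → Loop N} (hf :
    F.IsFrame ξ0 (κ ξ0) t φ) (hξ : ξ ∈ F.J) (hinj : ∀ h, F.IsMode ξ h (κ ξ) → (∀ i, l2 (φ i) h = 0)
    → h = 0) : ∃ h : Fin t.dim → Loop N, (∀ i, F.IsMode ξ (h i) (κ ξ)) ∧ (∀ i j, l2 (φ j) (h i) = if
    i = j then 1 else 0) ∧ (∀ j, F.ρ B (h j) = ∑ i, t.matB i j • h i) ∧ ∀ j, F.ρ S (h j) = ∑ i,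
    t.matS i j • h i := by
  have hξ0 := hc.mem
  have hT := F.T_ne hξ0
  let E := F.modeSpace hξ (κ ξ)
  let E0 := F.modeSpace hξ0 (κ ξ0)
  have hprojE : ∀ x, proj φ x ∈ E0 := fun x => by
    rw [proj_apply]; exact E0.sum_mem fun i _ => E0.smul_mem _ (hf.mode i)
  have hproj : ∀ x k, l2 (φ k) (proj φ x) = (F.T ξ0)⁻¹ * l2 (φ k) x := fun x k => by
    rw [proj_apply, map_sum]; simp [hf.l2_eq hξ0, mul_comm]
  have hprojm : ∀ e ∈ E0, ∀ x, l2 e (proj φ x) = (F.T ξ0)⁻¹ * l2 e x := fun e he x => by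
    obtain ⟨c, rfl⟩ := hf.exists_sum hc hξ0 he
    simp only [map_sum, LinearMap.sum_apply, map_smul, LinearMap.smul_apply, hproj, smul_eq_mul,
      mul_sum]
    exact sum_congr rfl fun i _ => by ring
  have hequiv : ∀ g x, proj φ (F.ρ g x) = F.ρ g (proj φ x) := fun g x => by
    have h1 : ∀ e ∈ E0, l2 e (proj φ (F.ρ g x)) = l2 e (F.ρ g (proj φ x)) := fun e he => by
      rw [hprojm e he, l2_comm e, F.l2_ρ_left hξ0, l2_comm e (F.ρ g (proj φ x)),
        F.l2_ρ_left hξ0, l2_comm x, l2_comm (proj φ x), hprojm _ (hc.mode_ρ hξ0 he _)]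
    refine sub_eq_zero.1 (l2_self_eq_zero ?_)
    rw [map_sub, h1 _ (E0.sub_mem (hprojE _) (hc.mode_ρ hξ0 (hprojE x) g)), sub_self]
  have hφ_eq : ∀ i x, proj φ x = φ i → ∀ j, l2 (φ j) x = if i = j then 1 else 0 := fun i x hx j => by
    have h1 := hproj x j; rw [hx, hf.l2_eq hξ0] at h1
    refine mul_left_cancel₀ (inv_ne_zero hT) (h1.symm.trans ?_); by_cases hij : j = i
    · rw [if_pos hij, if_pos hij.symm, mul_one]
    · rw [if_neg hij, if_neg (Ne.symm hij), mul_zero]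
  have hsurj : ∀ i, ∃ h ∈ E, proj φ h = φ i := fun i => by
    have h1 := hc.mem_of_mode hξ0 (W := E.map (proj φ)) ?_ ?_ ?_ ?_ (hf.mode i)
    · exact h1
    · rintro _ ⟨x, -, rfl⟩; exact hprojE x
    · rintro _ ⟨x, hx, rfl⟩; exact ⟨F.ρ B x, hc.mode_ρ hξ hx B, hequiv B x⟩
    · rintro _ ⟨x, hx, rfl⟩; exact ⟨F.ρ S x, hc.mode_ρ hξ hx S, hequiv S x⟩
    · obtain ⟨x, hx0, hx⟩ := hc.exists_mode_ne_zero hξ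
      refine ⟨_, ⟨x, hx, rfl⟩, fun h0 => hx0 (hinj x hx fun i => ?_)⟩; have h1 := hproj x i
      rw [h0, map_zero] at h1; exact (mul_eq_zero.1 h1.symm).resolve_left (inv_ne_zero hT)
  choose h hE hh using hsurj
  have hact : ∀ (g : D6) (A : Matrix (Fin t.dim) (Fin t.dim) ℝ), (∀ j, F.ρ g (φ j) = ∑ i, A i j • φ
    i) → ∀ j, F.ρ g (h j) = ∑ i, A i j • h i := by
    intro g A hA j; refine sub_eq_zero.1 (hinj _ (E.sub_mem (hc.mode_ρ hξ (hE j) g)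
      (E.sum_mem fun i _ => E.smul_mem _ (hE i))) fun k => ?_)
    have h1 : proj φ (F.ρ g (h j) - ∑ i, A i j • h i) = 0 := by
      rw [map_sub, hequiv, hh, hA, map_sum]; simp only [map_smul, hh, sub_self]
    have h2 := hproj (F.ρ g (h j) - ∑ i, A i j • h i) k; rw [h1, map_zero] at h2
    exact (mul_eq_zero.1 h2.symm).resolve_left (inv_ne_zero hT)
  exact ⟨h, hE, fun i => hφ_eq i _ (hh i), hact B _ hf.act_B, hact S _ hf.act_S⟩

lemma IsCritical.exists_isCriticalFrame (hc : F.IsCritical ξ0 κ) :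
    ∃ (t : Irrep) (J1 : Set ℝ) (φ : ℝ → Fin t.dim → Loop N), F.IsCriticalFrame ξ0 κ t J1 φ := by
  obtain ⟨t, φ0, hf⟩ := hc.exists_isFrame hc.mem
  obtain ⟨n, v, hv⟩ := F.exists_isZeroBasis ξ0
  refine ⟨t, ?_⟩
  have hξ0 := hc.mem
  set b : ℝ → Fin t.dim ⊕ Fin n → Loop N := fun ξ => F.border φ0 v ξ with hb
  have hbs := F.smoothPeriodic_border subset_rfl (fun i => smoothPeriodic_const F.J (φ0 i)) v
  obtain ⟨O, hO, hOo, hmem⟩ := eventually_nhds_iff.1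
    (((F.continuousAt_data F.isOpen_J subset_rfl hbs hξ0 0).eventually
      (eventually_bordered_injective (bordered_border_injective hc (by rw [← hc.zero]; exact hf) hv))).and
      ((F.isOpen_J.prod isOpen_univ).mem_nhds ⟨hξ0, mem_univ 0⟩))
  have hOJ : ∀ p ∈ O, p.1 ∈ F.J := fun p hp => (hO p hp).2.1
  let a : Fin t.dim → Fin t.dim ⊕ Fin n → ℝ := fun i => Pi.single (inl i) 1
  have hs := fun i => F.contDiffOn_solve_data hOo subset_rfl hOJ hbs (fun p hp => (hO p hp).1) (a i)
  have hinjm : ∀ ξ, (ξ, κ ξ) ∈ O → ∀ h, F.IsMode ξ h (κ ξ) → (∀ i, l2 (φ0 i) h = 0) → h = 0 := by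
    intro ξ hξ h hm hh; have hξJ := hOJ _ hξ; have h1 := (F.isMode_iff hξJ _ _).1 hm
    have h2 : bordered (F.data ξ (κ ξ) (b ξ)) (circ h, 0) = (0, 0) := by
      refine (F.bordered_data_iff hξJ (κ ξ) (b ξ) (circ h) 0 0).2 ⟨h, rfl, ?_, ?_⟩
      · simp [h1.1]
      · rintro (i | k)
        · exact hh i
        · rw [l2_comm]; exact (F.transverse_iff_l2 hξJ _).1 h1.2 _ (mem_zeroModes (hv.mem k))
    exact circ_injective ((congrArg Prod.fst ((hO _ hξ).1 (h2.trans (map_zero (bordered (F.data ξ (κ ξ) (b ξ)))).symm))).trans (map_zero _).symm)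
  have hsolve : ∀ ξ, (ξ, κ ξ) ∈ O → ∀ i h, F.IsMode ξ h (κ ξ) → (∀ j, l2 (φ0 j) h = if i = j then 1
    else 0) → solve (F.data ξ (κ ξ) (b ξ)) (0, a i) = (circ h, 0) := by
    intro ξ hξ i h hm hh; have hξJ := hOJ _ hξ; have h1 := (F.isMode_iff hξJ _ _).1 hm
    refine (eq_solve (hO _ hξ).1 ?_).symm
    refine (F.bordered_data_iff hξJ (κ ξ) (b ξ) (circ h) 0 _).2 ⟨h, rfl, ?_, ?_⟩
    · simp [h1.1]
    · rintro (j | k)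
      · change l2 (φ0 j) h = _; rw [hh]; simp [a, Pi.single_apply, eq_comm]
      · rw [l2_comm]
        refine ((F.transverse_iff_l2 hξJ _).1 h1.2 _ (mem_zeroModes (hv.mem k))).trans ?_; simp [a]
  have hmode : ∀ ξ, (ξ, κ ξ) ∈ O → _ := fun ξ hξ =>
    exists_modes_of_proj hc hf (hOJ _ hξ) (hinjm ξ hξ)
  have hmem' : (ξ0, κ ξ0) ∈ O := by rwa [hc.zero]
  have hκc : ContinuousAt κ ξ0 := by
    have := hc.tendsto; rwa [← hc.zero] at this
  let i0 : Fin t.dim := ⟨0, t.dim_pos⟩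
  let γ : ℝ × ℝ → ℝ := fun p => (solve (F.data p.1 p.2 (b p.1)) (0, a i0)).2 (inl i0)
  have hγ := contDiffOn_pi.1 (hs i0).2 (inl i0)
  have hγ0 : ∀ᶠ ξ in 𝓝 ξ0, γ (ξ, κ ξ) = 0 := by
    filter_upwards [(continuousAt_id.prodMk hκc).eventually (hOo.mem_nhds hmem')] with ξ hξ
    obtain ⟨h, h1, h2, -⟩ := hmode ξ hξ; simp only [γ]; rw [hsolve ξ hξ i0 (h i0) (h1 i0) (h2 i0)]
    rfl
  have hγμ : ∀ᶠ μ in 𝓝 0, γ (ξ0, μ) = F.T ξ0 * μ := by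
    filter_upwards [((continuous_const.prodMk continuous_id).tendsto _).eventually (hOo.mem_nhds hmem)] with μ hμ
    have h1 : solve (F.data ξ0 μ (b ξ0)) (0, a i0) = (circ (F.T ξ0 • φ0 i0), Pi.single (inl i0) (F.T
      ξ0 * μ)) := by
      refine (eq_solve (hO _ hμ).1 ?_).symm
      refine (F.bordered_data_iff hξ0 μ (b ξ0) _ _ _).2 ⟨_, rfl, ?_, ?_⟩
      · have h3 : ∑ j, (Pi.single (inl i0) (F.T ξ0 * μ) : Fin t.dim ⊕ Fin n → ℝ) j • b ξ0 j = (F.T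
          ξ0 * μ) • φ0 i0 := by
          rw [Finset.sum_eq_single (inl i0)]
          · rw [Pi.single_eq_same]; rfl
          · intro j _ hj; rw [Pi.single_eq_of_ne hj]; exact zero_smul ℝ (b ξ0 j)
          · exact fun h => absurd (Finset.mem_univ _) h
        rw [h3, map_smul, ((F.isMode_iff hξ0 _ _).1 (hf.mode i0)).1, hc.zero]; module
      · rintro (j | k)
        · change l2 (φ0 j) (F.T ξ0 • φ0 i0) = _; rw [map_smul, hf.l2_eq hξ0]; by_cases hj : j = i0
          · simp [a, hj, F.T_ne hξ0]
          · simp [a, hj]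
        · rw [l2_comm]; rw [map_smul, LinearMap.smul_apply]
          change F.T ξ0 • l2 (φ0 i0) (LagrangianFamily.symLoop (F.q ξ0) (v k)) = _
          rw [(F.transverse_iff_l2 hξ0 _).1 (hf.mode i0).2 _ (mem_zeroModes (hv.mem k))]; simp [a]
    simp only [γ]; rw [h1]
    exact Pi.single_eq_same (M := fun _ => ℝ) (inl i0 : Fin t.dim ⊕ Fin n) (F.T ξ0 * μ)
  have hγd : fderiv ℝ γ (ξ0, κ ξ0) (0, 1) ≠ 0 := by
    rw [hc.zero]; have h4 : HasDerivAt (fun μ => F.T ξ0 * μ) (F.T ξ0) 0 := by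
      simpa using (hasDerivAt_id 0).const_mul (F.T ξ0)
    rw [((((hγ.contDiffAt (hOo.mem_nhds hmem)).toFDeriv)).comp_hasDerivAt 0 ((hasDerivAt_const _ _).prodMk (hasDerivAt_id _))).unique (h4.congr_of_eventuallyEq hγμ)]
    exact F.T_ne hξ0
  obtain ⟨J1, hJo, hJξ, hκs, hJO⟩ := exists_contDiffOn_of_implicit hOo hmem' hγ hγd hκc hγ0
  have hJJ : J1 ⊆ F.J := fun ξ hξ => hOJ _ (hJO ξ hξ)
  have hex : ∀ ξ, ∃ h : Fin t.dim → Loop N, ξ ∈ J1 → (∀ i, F.IsMode ξ (h i) (κ ξ)) ∧ (∀ i j, l2 (φ0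
    j) (h i) = if i = j then 1 else 0) ∧ (∀ j, F.ρ B (h j) = ∑ i, t.matB i j • h i) ∧ ∀ j, F.ρ S (h
    j) = ∑ i, t.matS i j • h i := fun ξ => by
    by_cases hξ : ξ ∈ J1
    · obtain ⟨h, hh⟩ := hmode ξ (hJO ξ hξ); exact ⟨h, fun _ => hh⟩
    · exact ⟨0, fun h => absurd h hξ⟩
  choose h hh using hex
  have hsm : ∀ i, SmoothPeriodic J1 fun ξ => (h ξ i : ℝ → Conf N) := fun i => by
    refine ⟨?_, fun ξ _ => loop_periodic _⟩
    refine ((hs i).1.comp ((contDiffOn_fst.prodMk (hκs.comp contDiffOn_fst fun p hp => hp.1)).prodMk contDiffOn_snd) fun p hp => ⟨hJO _ hp.1, mem_univ _⟩).congr fun p hp => ?_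
    obtain ⟨e1, e2, -⟩ := hh p.1 hp.1; simp
    rw [hsolve p.1 (hJO _ hp.1) i (h p.1 i) (e1 i) (e2 i), circ_coe]
  have hpos : ∀ ξ ∈ J1, 0 < F.T ξ * l2 (h ξ i0) (h ξ i0) := fun ξ hξ => by
    refine mul_pos (F.T_pos ξ (hJJ hξ)) (l2_self_pos fun h0 => ?_); have := (hh ξ hξ).2.1 i0 i0
    rw [h0, map_zero, if_pos rfl] at this; exact zero_ne_one this
  set c : ℝ → ℝ := fun ξ => (Real.sqrt (F.T ξ * l2 (h ξ i0) (h ξ i0)))⁻¹ with hcdef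
  have hcs : SmoothOn c J1 := by
    have h2 : SmoothOn (fun ξ => l2 (h ξ i0) (h ξ i0)) J1 := by
      have h3 : Smooth fun X : CLoop N => pair X X := by fun_prop
      exact h3.comp_contDiffOn ((hsm i0).contDiffOn_toCircle hJo)
    refine (((F.T_smooth.mono hJJ).mul h2).sqrt fun ξ hξ => (hpos ξ hξ).ne').inv fun ξ hξ => ?_
    exact (Real.sqrt_pos.2 (hpos ξ hξ)).ne'
  have hact : ∀ (g : D6) (A : Matrix (Fin t.dim) (Fin t.dim) ℝ) (ξ : ℝ), (∀ j, F.ρ g (h ξ j) = ∑ i,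
    A i j • h ξ i) → ∀ j, F.ρ g (c ξ • h ξ j) = ∑ i, A i j • c ξ • h ξ i := fun g A ξ hA j => by
    rw [map_smul, hA, smul_sum]; exact sum_congr rfl fun i _ => smul_comm _ _ _
  refine ⟨J1, fun ξ i => c ξ • h ξ i, hJo, hJJ, hJξ, fun i => ?_, fun ξ hξ i => ?_, fun ξ hξ i j =>
    ?_, fun ξ hξ => hact B _ ξ (hh ξ hξ).2.2.1, fun ξ hξ => hact S _ ξ (hh ξ hξ).2.2.2⟩
  · exact (hcs.comp contDiffOn_fst fun p hp => hp.1).smul (hsm i).1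
  · exact (F.modeSpace (hJJ hξ) (κ ξ)).smul_mem _ ((hh ξ hξ).1 i)
  · obtain ⟨-, -, hB, hS⟩ := hh ξ hξ
    rw [F.ip_eq (hJJ hξ), map_smul, map_smul, LinearMap.smul_apply, l2_eq_of_act (hJJ hξ) hB hS i j]
    split_ifs
    · have h2 := (Real.sqrt_pos.2 (hpos ξ hξ)).ne'; simp only [hcdef, smul_eq_mul]
      change F.T ξ * (_ * (_ * l2 (h ξ i0) (h ξ i0))) = 1; field_simp
      rw [sq, Real.mul_self_sqrt (hpos ξ hξ).le]
    · simp

end SymmetricFamily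

namespace SymmetricFamily

variable {N : ℕ} (F : SymmetricFamily N) {ξ0 : ℝ} {κ : ℝ → ℝ} {t : Irrep} {J1 : Set ℝ}
  {φ : ℝ → Fin t.dim → Loop N} {n : ℕ} {v : Fin n → Gen N} {ξ : ℝ}

structure Setting (ξ0 : ℝ) (κ : ℝ → ℝ) (t : Irrep) (J1 : Set ℝ) (φ : ℝ → Fin t.dim → Loop N)
    {n : ℕ} (v : Fin n → Gen N) : Prop where
  critical : F.IsCritical ξ0 κ
  frame : F.IsCriticalFrame ξ0 κ t J1 φ
  basis : F.IsZeroBasis ξ0 v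

abbrev Coord (t : Irrep) : Type := Conf t.dim

abbrev Unknown (N : ℕ) (t : Irrep) (n : ℕ) : Type := CLoop N × (Fin t.dim ⊕ Fin n → ℝ)

def bC (φ : ℝ → Fin t.dim → Loop N) (v : Fin n → Gen N) (ξ : ℝ)
    (j : Fin t.dim ⊕ Fin n) : CLoop N := circ (F.border (φ ξ) v ξ j)

/-- The function `q + ∑ uᵢ φᵢ`. -/
def baseC (φ : ℝ → Fin t.dim → Loop N) (p : ℝ × Coord t) : CLoop N :=
  circ (F.q p.1) + ∑ i, p.2 i • circ (φ p.1 i)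

def miC (ξ : ℝ) : CLoop N →L[ℝ] CLoop N := mulC (constC (F.massInv ξ))

/-- The acceleration that belongs to the force `∇U(X) + ∑ cⱼ bⱼ`. -/
def accC (φ : ℝ → Fin t.dim → Loop N) (v : Fin n → Gen N) (ξ : ℝ)
    (X : CLoop N) (c : Fin t.dim ⊕ Fin n → ℝ) : CLoop N :=
  F.miC ξ (F.gradC ξ X + ∑ j, c j • F.bC φ v ξ j)

def lsMap (φ : ℝ → Fin t.dim → Loop N) (v : Fin n → Gen N)
    (z : (ℝ × Coord t) × Unknown N t n) : Unknown N t n :=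
  (F.baseC φ z.1 + z.2.1 - constC (mean (F.baseC φ z.1 + z.2.1))
    - resolv (F.accC φ v z.1.1 (F.baseC φ z.1 + z.2.1) z.2.2),
    fun j => pair (F.bC φ v z.1.1 j) z.2.1)

def lsDom (J1 : Set ℝ) (φ : ℝ → Fin t.dim → Loop N) (n : ℕ) :
    Set ((ℝ × Coord t) × Unknown N t n) :=
  {z | z.1.1 ∈ J1 ∧ (z.1.1, F.baseC φ z.1 + z.2.1) ∈ F.domC}

lemma circ_base (φ : ℝ → Fin t.dim → Loop N) (p : ℝ × Coord t) :
    circ (F.q p.1 + crit φ p.1 p.2) = F.baseC φ p := by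
  simp [baseC, crit, map_sum]

lemma baseC_zero (φ : ℝ → Fin t.dim → Loop N) (ξ : ℝ) : F.baseC φ (ξ, 0) = circ (F.q ξ) := by
  rw [← circ_base]
  simp [crit]

lemma contDiffOn_miC : SmoothOn F.miC F.J := by
  have h : Smooth fun L =>
      (mulC (constC L) : CLoop N →L[ℝ] CLoop N) := by fun_prop
  exact h.comp_contDiffOn F.contDiffOn_massInv

variable {F}

variable (H : F.Setting ξ0 κ t J1 φ v)

include H in
lemma Setting.smoothPeriodic_frame (i : Fin t.dim) : SmoothPeriodic J1
    fun ξ => (φ ξ i : ℝ → Conf N) := ⟨H.frame.smooth i, fun _ _ => loop_periodic _⟩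

include H in
lemma Setting.smoothPeriodic_border (j : Fin t.dim ⊕ Fin n) :
    SmoothPeriodic J1 fun ξ => (F.border (φ ξ) v ξ j : ℝ → Conf N) :=
  F.smoothPeriodic_border H.frame.subset H.smoothPeriodic_frame v j

include H in
lemma Setting.contDiffOn_bC (j : Fin t.dim ⊕ Fin n) : SmoothOn (fun ξ
    => F.bC φ v ξ j) J1 := (H.smoothPeriodic_border j).contDiffOn_toCircle H.frame.isOpen

include H in
lemma Setting.contDiffOn_baseC :
    SmoothOn (F.baseC φ) (J1 ×ˢ univ) := by
  have hm : Set.MapsTo Prod.fst (J1 ×ˢ (univ : Set (Coord t))) J1 := fun p hp => hp.1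
  refine (((F.smoothPeriodic_q.mono H.frame.subset).contDiffOn_toCircle H.frame.isOpen).comp contDiffOn_fst hm).add (ContDiffOn.sum fun i _ => ?_)
  have h3 : SmoothOn (fun p : ℝ × Coord t => p.2 i) (J1 ×ˢ univ) := by fun_prop
  exact h3.smul (((fun i => (H.smoothPeriodic_frame i).contDiffOn_toCircle H.frame.isOpen) i).comp contDiffOn_fst hm)

include H in
lemma Setting.isOpen_lsDom : IsOpen (F.lsDom J1 φ n) := by
  have h2 : ContinuousOn (fun z : (ℝ × Coord t) × Unknown N t n =>
      (z.1.1, F.baseC φ z.1 + z.2.1)) {z | z.1.1 ∈ J1} := by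
    refine ContinuousOn.prodMk (by fun_prop) (ContinuousOn.add ?_ (by fun_prop))
    exact H.contDiffOn_baseC.continuousOn.comp (by fun_prop) fun z hz => ⟨hz, mem_univ _⟩
  exact h2.isOpen_inter_preimage (H.frame.isOpen.preimage (by fun_prop)) F.isOpen_domC

include H in
lemma Setting.contDiffOn_accC : SmoothOn (fun z : (ℝ × Coord t) ×
    Unknown N t n => F.accC φ v z.1.1 (F.baseC φ z.1 + z.2.1) z.2.2) (F.lsDom J1 φ n) := by
  have hm : Set.MapsTo (fun z => z.1.1) (F.lsDom J1 φ n) J1 := fun z hz => hz.1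
  have h0 : SmoothOn (fun z => z.1.1) (F.lsDom J1 φ n) := by
    fun_prop
  have h3 : ∀ j, SmoothOn (fun z =>
      z.2.2 j • F.bC φ v z.1.1 j) (F.lsDom J1 φ n) := fun j => by
    have h4 : SmoothOn (fun z => z.2.2 j) (F.lsDom J1 φ n) := by fun_prop
    exact h4.smul ((H.contDiffOn_bC j).comp h0 hm)
  exact ((F.contDiffOn_miC.mono H.frame.subset).comp h0 hm).clm_apply
    ((F.contDiffOn_gradC.comp (h0.prodMk ((H.contDiffOn_baseC.comp contDiffOn_fst fun z hz => ⟨hz.1, mem_univ _⟩).add (by fun_prop))) fun z hz => hz.2).add (ContDiffOn.sum fun j _ => h3 j))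

/-- The integrated equation of motion, in terms of the position and the acceleration. -/
def resid : CLoop N × CLoop N →L[ℝ] CLoop N :=
  .fst ℝ _ _ - (constC.comp mean).comp (.fst ℝ _ _) - resolv.comp (.snd ℝ _ _)

include H in
lemma Setting.contDiffOn_position : SmoothOn (fun z : (ℝ × Coord t) ×
    Unknown N t n => F.baseC φ z.1 + z.2.1) (F.lsDom J1 φ n) := by
  have h1 : SmoothOn (fun z => z.2.1) (F.lsDom J1 φ n) := by
    fun_prop
  exact (H.contDiffOn_baseC.comp contDiffOn_fst fun z hz => ⟨hz.1, mem_univ _⟩).add h1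

include H in
lemma Setting.contDiffOn_lsMap_fst :
    SmoothOn (fun z => (F.lsMap φ v z).1) (F.lsDom J1 φ n) := by
  exact (((resid).contDiff).comp_contDiffOn (H.contDiffOn_position.prodMk H.contDiffOn_accC)).congr fun z _ => rfl

include H in
lemma Setting.contDiffOn_lsMap_snd (j : Fin t.dim ⊕ Fin n) :
    SmoothOn (fun z => (F.lsMap φ v z).2 j) (F.lsDom J1 φ n) := by
  have h0 : SmoothOn (fun z : (ℝ × Coord t) × Unknown N t n => z.1.1) (F.lsDom J1 φ n) := by
    fun_prop
  have h1 : SmoothOn (fun z => z.2.1) (F.lsDom J1 φ n) := by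
    fun_prop
  have h4 : Smooth fun X : CLoop N × CLoop N => pair X.1 X.2 := by fun_prop
  have h5 := h4.comp_contDiffOn (((H.contDiffOn_bC j).comp h0 fun z hz => hz.1).prodMk h1)
  exact h5.congr fun z _ => rfl

include H in
lemma Setting.contDiffOn_lsMap : SmoothOn (F.lsMap φ v) (F.lsDom J1 φ
    n) := H.contDiffOn_lsMap_fst.prodMk (contDiffOn_pi.2 H.contDiffOn_lsMap_snd)

lemma hasDerivAt_smul_cLoop {f : ℝ → ℝ} {f' s : ℝ} (hf : HasDerivAt f f' s) (z : CLoop N) :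
    HasDerivAt (fun s => f s • z) (f' • z) s := hf.smul_const z

lemma miC_coe {ξ s : ℝ} (X : CLoop N) : F.miC ξ X s = F.massInv ξ (X s) := rfl

lemma accC_coe {X : CLoop N} (hX : (ξ, X) ∈ F.domC) (c : Fin t.dim ⊕ Fin n → ℝ) (s : ℝ) : F.accC φ v
    ξ X c s = F.massInv ξ (gradient (F.U ξ) (X s) + ∑ j, c j • (F.border (φ ξ) v ξ j : ℝ → Conf N)
    s) := by
  rw [accC, miC_coe, ContinuousMap.add_apply, F.gradC_coe hX, ContinuousMap.sum_apply]
  simp only [ContinuousMap.smul_apply, bC, circ_coe]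

lemma contDiff_force (hξ : ξ ∈ F.J) (c : Fin t.dim ⊕ Fin n → ℝ) {x : ℝ → Conf N} {m : ℕ} (hx :
    ContDiff ℝ m x) (hΩ : ∀ s, x s ∈ F.Ω) : ContDiff ℝ m fun s : ℝ => F.massInv ξ (gradient (F.U ξ)
    (x s) + ∑ j, c j • (F.border (φ ξ) v ξ j : ℝ → Conf N) s) := by
  have e1 := (F.contDiffOn_gradient.of_le (by exact_mod_cast le_top)).comp_contDiff (contDiff_const.prodMk hx) fun s => ⟨hξ, hΩ s⟩
  exact (F.massInv ξ).contDiff.comp (e1.add (ContDiff.sum fun j _ => ((fun j => contDiff_infty.1 (loop_contDiff _) m) j).const_smul (c j)))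

lemma eq_resolv_accC_iff (hξ : ξ ∈ F.J) {X : CLoop N} (hX : (ξ, X) ∈ F.domC) (c : Fin t.dim ⊕ Fin n
    → ℝ) : X = constC (mean X) + resolv (F.accC φ v ξ X c) ↔ ∃ x : Loop N, circ x = X ∧ F.elC ξ x =
    -∑ j, c j • F.bC φ v ξ j := by
  have hYs := fun s => accC_coe (φ := φ) (v := v) hX c s
  obtain ⟨Y, hY⟩ : ∃ Y, Y = F.accC φ v ξ X c := ⟨_, rfl⟩
  rw [← hY] at hYs ⊢
  clear hY
  have hΩ := (F.mem_domC.1 hX).2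
  have hel : ∀ x : Loop N, circ x = X → ∀ s : ℝ, F.elC ξ x s + ∑ j, c j • F.bC φ v ξ j s = F.massOp
    ξ (Y s - (dLoop (dLoop x) : ℝ → Conf N) s) := by
    rintro x rfl s; have hx : F.Admissible x := fun s => by
      have := hΩ s; rwa [circ_coe] at this
    rw [F.elC_coe hξ hx, map_sub, hYs, F.massOp_massInv hξ, circ_coe]; simp only [bC, circ_coe]
    abel
  constructor
  · intro h1; have hsm := contDiff_of_resolv h1 fun m hm => by
      rw [funext hYs]; exact contDiff_force hξ c hm hΩ
    obtain ⟨x, hx⟩ := exists_loop_of_contDiff hsm; refine ⟨x, hx, circle_ext fun s => ?_⟩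
    have h3 := circ_dLoop_of_hasDerivAt (by
      rw [hx]; exact hasDerivAt_of_resolv h1)
    have h4 := circ_dLoop_of_hasDerivAt fun t => by
      rw [h3]; exact hasDerivAt_prim_of_resolv h1 t
    have h5 := hel x hx s; rw [← h4, circ_coe, sub_self, map_zero] at h5
    rw [eq_neg_of_add_eq_zero_left h5, ContinuousMap.neg_apply, ContinuousMap.sum_apply]
    simp
  · rintro ⟨x, hx, h1⟩; have h2 : ∀ s : ℝ, circ (dLoop (dLoop x)) s = Y s := fun s => by
        have h3 := hel x hx s; rw [h1, ContinuousMap.neg_apply, ContinuousMap.sum_apply] at h3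
        simp only [ContinuousMap.smul_apply, neg_add_cancel] at h3
        have h4 := congrArg (F.massInv ξ) h3; rw [map_zero, F.massInv_massOp hξ] at h4
        rw [circ_coe]; exact (sub_eq_zero.1 h4.symm).symm
    rw [← hx]; refine resolv_of_hasDerivAt (hasDerivAt_circ x) fun s => ?_; rw [← h2]
    exact hasDerivAt_circ (dLoop x) s

lemma lsMap_eq_zero_iff {p : ℝ × Coord t} (hξ : p.1 ∈ F.J) {h : CLoop N} (hX : (p.1, F.baseC φ p +
    h) ∈ F.domC) (c : Fin t.dim ⊕ Fin n → ℝ) : F.lsMap φ v (p, h, c) = 0 ↔ ∃ w : Loop N, circ w = h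
    ∧ F.elC p.1 (F.q p.1 + crit φ p.1 p.2 + w) = -∑ j, c j • F.bC φ v p.1 j ∧ ∀ j, l2 (F.border (φ
    p.1) v p.1 j) w = 0 := by
  have h1 : F.lsMap φ v (p, h, c) = 0 ↔ F.baseC φ p + h = constC (mean (F.baseC φ p + h)) + resolv
    (F.accC φ v p.1 (F.baseC φ p + h) c) ∧ ∀ j, pair (F.bC φ v p.1 j) h = 0 := by
    rw [Prod.ext_iff, funext_iff, lsMap, sub_sub]; exact and_congr sub_eq_zero Iff.rfl
  rw [h1, eq_resolv_accC_iff hξ hX]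
  constructor
  · rintro ⟨⟨x, hx, h2⟩, h3⟩; have h4 : circ (x - (F.q p.1 + crit φ p.1 p.2)) = h := by
      rw [map_sub, circ_base, hx, add_sub_cancel_left]
    refine ⟨_, h4, by rwa [add_sub_cancel], fun j => ?_⟩
    rw [l2_apply, h4]; exact h3 j
  · rintro ⟨w, rfl, h2, h3⟩; exact ⟨⟨_, by rw [map_add, circ_base], h2⟩, h3⟩

include H in
lemma Setting.mem_lsDom (hξ : ξ ∈ J1)
    (c : Fin t.dim ⊕ Fin n → ℝ) : ((ξ, (0 : Coord t)), (0, c)) ∈ F.lsDom J1 φ n :=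
  ⟨hξ, by
    simp only [baseC_zero, add_zero]
    exact F.mem_domC_circ (H.frame.subset hξ) (F.q_admissible (H.frame.subset hξ))⟩

abbrev lin (F : SymmetricFamily N) (φ : ℝ → Fin t.dim → Loop N)
    (v : Fin n → Gen N) (ξ : ℝ) :
    BorderedData (Conf N) (Fin t.dim ⊕ Fin n) := F.data ξ 0 (F.border (φ ξ) v ξ)

include H in
lemma Setting.lin_injective :
    Injective (bordered (F.lin φ v ξ0)) := by
  have h := H.frame.isFrame H.frame.mem
  rw [H.critical.zero] at h
  exact bordered_border_injective H.critical h H.basis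

include H in
lemma Setting.continuousAt_lin (hξ : ξ ∈ J1) :
    ContinuousAt (F.lin φ v) ξ :=
  ContinuousAt.comp (f := fun ξ : ℝ => (ξ, (0 : ℝ))) (F.continuousAt_data H.frame.isOpen
    H.frame.subset H.smoothPeriodic_border hξ 0) (by fun_prop)

include H in
lemma Setting.eventually_lin_injective :
    ∀ᶠ ξ in 𝓝 ξ0, Injective (bordered (F.lin φ v ξ)) :=
  (H.continuousAt_lin H.frame.mem).eventually (eventually_bordered_injective H.lin_injective)

lemma mulC_lin (hξ : ξ ∈ F.J) (X : CLoop N) :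
    mulC (F.lin φ v ξ).1 X = F.miC ξ (mulC (F.hessC ξ (circ (F.q ξ))) X) :=
  circle_ext fun s => by
    rw [miC_coe, mulC_apply, mulC_apply, F.hessC_coe (F.mem_domC_circ hξ (F.q_admissible hξ)),
      circ_coe]
    change toCircle (F.potential ξ 0) s _ = _; rw [F.potential_coe hξ]; simp [potential]

lemma lin_border (ξ : ℝ) (j : Fin t.dim ⊕ Fin n) : (F.lin φ v ξ).2.2 j = F.miC ξ (F.bC φ v ξ j) :=
  circle_ext fun s => by
    rw [miC_coe, bC, circ_coe]; exact F.massInv_coe ξ s _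

include H in
lemma Setting.hasDerivAt_lsMap (hξ : ξ ∈ J1) (e : Coord t) {z : ℝ →
    Unknown N t n} {z' : Unknown N t n} (hz : HasDerivAt z z' 0) (hz0 : z 0 = 0) : HasDerivAt (fun s
    : ℝ => F.lsMap φ v ((ξ, s • e), z s)) (bordered (F.lin φ v ξ) (circ (crit φ ξ e) + z'.1, z'.2) -
    (0, fun j => pair (F.bC φ v ξ j) (circ (crit φ ξ e)))) 0 := by
  have hJ := H.frame.subset hξ
  have hb : ∀ s : ℝ, F.baseC φ (ξ, s • e) = circ (F.q ξ) + s • circ (crit φ ξ e) := fun s => by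
    simp [baseC, crit, map_sum, smul_sum, smul_smul]
  have h1 : HasDerivAt (fun s => (z s).1) z'.1 0 := (fst ℝ (CLoop N) (Fin t.dim
    ⊕ Fin n → ℝ)).hasFDerivAt.comp_hasDerivAt (0 : ℝ) hz
  have hX : HasDerivAt (fun s : ℝ => F.baseC φ (ξ, s • e) + (z s).1) (circ (crit φ ξ e) + z'.1) 0 :=
    by
    simp only [hb]
    have h3 : HasDerivAt (fun s : ℝ => s • circ (crit φ ξ e)) ((1 : ℝ) • circ (crit φ ξ e)) 0 :=
      hasDerivAt_smul_cLoop (hasDerivAt_id (0 : ℝ)) _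
    rw [one_smul ℝ _] at h3; exact (h3.const_add _).add h1
  have hX0 : F.baseC φ (ξ, (0 : ℝ) • e) + (z 0).1 = circ (F.q ξ) := by
    rw [hb, hz0, zero_smul_cLoop, add_zero]; exact add_zero _
  have ha : HasDerivAt (fun s => F.accC φ v ξ (F.baseC φ (ξ, s • e) + (z s).1) (z s).2) (mulC (F.lin
    φ v ξ).1 (circ (crit φ ξ e) + z'.1) + ∑ j, z'.2 j • (F.lin φ v ξ).2.2 j) 0 := by
    have h4 : F.miC ξ (mulC (F.hessC ξ (circ (F.q ξ))) (circ (crit φ ξ e) + z'.1) + ∑ j, z'.2 j •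
      F.bC φ v ξ j) = mulC (F.lin φ v ξ).1 (circ (crit φ ξ e) + z'.1) + ∑ j, z'.2 j • (F.lin φ v
      ξ).2.2 j := by
      rw [map_add, map_sum, mulC_lin hJ]; simp only [map_smul, lin_border]
    rw [← h4]
    exact (F.miC ξ).hasFDerivAt.comp_hasDerivAt 0 ((comp_hasDerivAt_of_eq (0 : ℝ) (F.hasFDerivAt_gradC (F.mem_domC_circ hJ (F.q_admissible hJ))) hX hX0.symm).add (HasDerivAt.fun_sum fun j _ => hasDerivAt_smul_cLoop (hasDerivAt_pi.1 ((snd ℝ (CLoop N) (Fin t.dim ⊕ Fin n → ℝ)).hasFDerivAt.comp_hasDerivAt 0 hz) j) _))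
  refine (((hX.sub ((constC.comp mean).hasFDerivAt.comp_hasDerivAt 0 hX)).sub (resolv.hasFDerivAt.comp_hasDerivAt 0 ha)).prodMk (hasDerivAt_pi.2 fun j => (pair (F.bC φ v ξ j)).hasFDerivAt.comp_hasDerivAt 0 h1)).congr_deriv (Prod.ext ?_ (funext fun j => ?_))
  · rw [Prod.fst_sub, bordered_fst, sub_zero]; rfl
  · rw [Prod.snd_sub, Pi.sub_apply, bordered_snd]; change pair (F.bC φ v ξ j) z'.1
      = pair (F.bC φ v ξ j) (circ (crit φ ξ e) + z'.1) - pair (F.bC φ v ξ j) (circ (crit φ ξ e))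
    rw [map_add, add_sub_cancel_left]

include H in
lemma Setting.lsMap_zero (hξ : ξ ∈ J1) :
    F.lsMap φ v ((ξ, 0), 0) = 0 := by
  have hJ := H.frame.subset hξ
  refine (lsMap_eq_zero_iff hJ (H.mem_lsDom hξ 0).2 0).2 ⟨0, map_zero _, ?_, fun j => ?_⟩
  · simp [crit, F.elC_q hJ, zero_smul_cLoop]
  · rw [map_zero]

end SymmetricFamily

end D6Bifurcation

namespace PeriodicODE

lemma exists_contDiffOn_implicit {P K : Type} [NormedAddCommGroup P] [NormedSpace ℝ P]
    [CompleteSpace P] [NormedAddCommGroup K] [NormedSpace ℝ K] [CompleteSpace K] {f : P × K → K} {O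
    : Set (P × K)} (hO : IsOpen O) (hf : SmoothOn f O) {z : P × K} (hz : z ∈ O) (h0 : f z = 0) (hinv
    : (fderiv ℝ f z ∘L .inr ℝ P K).IsInvertible) : ∃ (Q : Set P) (ψ : P → K), IsOpen Q ∧ z.1 ∈ Q ∧
    SmoothOn ψ Q ∧ ψ z.1 = z.2 ∧ (∀ p ∈ Q, (p, ψ p) ∈ O ∧ f (p, ψ p) = 0) ∧ ∀ᶠ y in 𝓝 z, f y = 0 →
    y.2 = ψ y.1 := by
  have hat : ∀ y ∈ O, SmoothAt f y := fun y hy => hf.contDiffAt (hO.mem_nhds hy)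
  have hn : (∞ : WithTop ℕ∞) ≠ 0 := by simp
  obtain ⟨ψ, hψ⟩ : ∃ ψ, ψ = (hat z hz).implicitFunction hn hinv := ⟨_, rfl⟩
  have hψ0 : ψ z.1 = z.2 := by
    rw [hψ]; exact (hat z hz).implicitFunction_apply_self hn hinv
  have hψs : SmoothAt ψ z.1 := by
    rw [hψ]; exact (hat z hz).contDiffAt_implicitFunction hn hinv
  have heq : ∀ᶠ p in 𝓝 z.1, f (p, ψ p) = 0 := by
    have := (hat z hz).eventually_apply_implicitFunction hn hinv; rwa [h0, ← hψ] at this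
  have huniq : ∀ᶠ y in 𝓝 z, f y = 0 → y.2 = ψ y.1 := by
    have := (hat z hz).eventually_apply_eq_iff_implicitFunction hn hinv; rw [h0, ← hψ] at this
    exact this.mono fun y hy h => (hy.1 h).symm
  have hpt : Tendsto (fun p => (p, ψ p)) (𝓝 z.1) (𝓝 z) := by
    have := continuousAt_id.prodMk hψs.continuousAt; rwa [ContinuousAt, id, hψ0] at this
  have hinv' : ∀ᶠ y in 𝓝 z, (fderiv ℝ f y ∘L .inr ℝ P K).IsInvertible := by
    obtain ⟨e, he⟩ := hinv; have h2 := e.nhds; rw [he] at h2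
    exact (((((hat z hz).fderiv_right (m := 0) (by simp)).continuousAt).clm_comp continuousAt_const).eventually h2).mono fun y ⟨e', he'⟩ => ⟨e', he'⟩
  obtain ⟨Q, hQ, hQo, hzQ⟩ := eventually_nhds_iff.1
    ((((hψs.of_le (m := 1) (by norm_cast)).eventually (by simp)).mono fun p hp => hp.continuousAt).and (heq.and (hpt.eventually (hinv'.and (hO.mem_nhds hz)))))
  refine ⟨Q, ψ, hQo, hzQ, fun p hp => ?_, hψ0, fun p hp => ?_, huniq⟩
  · obtain ⟨e1, e2, e3, e4⟩ := hQ p hp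
    refine (((hat _ e4).contDiffAt_implicitFunction hn e3).congr_of_eventuallyEq
      ?_).contDiffWithinAt
    filter_upwards [(continuousAt_id.prodMk e1).eventually ((hat _ e4).eventually_apply_eq_iff_implicitFunction hn e3), hQo.mem_nhds hp] with y hy hyQ
    grind
  · exact ⟨(hQ p hp).2.2.2, (hQ p hp).2.1⟩

lemma continuousAt_solve {E ι Z : Type} [NormedAddCommGroup E] [InnerProductSpace ℝ E]
    [FiniteDimensional ℝ E] [Fintype ι] [DecidableEq ι] [TopologicalSpace Z] {D : Z → BorderedData E
    ι} {r : Z → Per(E) × (ι → ℝ)} {z : Z} (hD : ContinuousAt D z) (hr : ContinuousAt r z) (hinj :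
    Injective (bordered (D z))) : ContinuousAt (fun z => solve (D z) (r z)) z := by
  obtain ⟨e, he⟩ := bordered_isInvertible _ hinj
  have h1 := (contDiffAt_map_inverse (n := 0) e).continuousAt
  rw [he] at h1
  exact (ContinuousAt.comp (f := fun z => bordered (D z)) h1 (ContinuousAt.comp (g := bordered) (contDiff_bordered (E := E) (ι := ι)).continuous.continuousAt hD)).clm_apply hr

end PeriodicODE

namespace D6Bifurcation

open PeriodicODE LagrangianFamily

namespace SymmetricFamily

variable {N : ℕ} {F : SymmetricFamily N} {ξ0 : ℝ} {κ : ℝ → ℝ} {t : Irrep} {J1 : Set ℝ}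
  {φ : ℝ → Fin t.dim → Loop N} {n : ℕ} {v : Fin n → Gen N}
  {Q : Set (ℝ × Coord t)} {ψ : ℝ × Coord t → Unknown N t n}
  {w : ℝ → Coord t → Loop N} {ξ : ℝ}

/-- `ψ` is the local solution of the Lyapunov–Schmidt equation. -/
structure IsReduction (F : SymmetricFamily N) (ξ0 : ℝ) (J1 : Set ℝ) (φ : ℝ → Fin t.dim → Loop N)
    (v : Fin n → Gen N) (Q : Set (ℝ × Coord t))
    (ψ : ℝ × Coord t → Unknown N t n) : Prop where
  isOpen : IsOpen Q
  mem : (ξ0, 0) ∈ Q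
  smooth : SmoothOn ψ Q
  zero : ψ (ξ0, 0) = 0
  dom : ∀ p ∈ Q, (p, ψ p) ∈ F.lsDom J1 φ n
  eq : ∀ p ∈ Q, F.lsMap φ v (p, ψ p) = 0
  unique : ∀ᶠ z in 𝓝 (((ξ0, 0), 0) : (ℝ × Coord t) × CLoop N),
    ∀ c, F.lsMap φ v (z.1, z.2, c) = 0 → (z.2, c) = ψ z.1

lemma neg_smul_cLoop (c : ℝ) (X : CLoop N) : (-c) • X = -(c • X) := by module

lemma crit_zero (φ : ℝ → Fin t.dim → Loop N) (ξ : ℝ) : crit φ ξ 0 = 0 := by simp [crit]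

lemma Setting.fderiv_lsMap_inr (H : F.Setting ξ0 κ t J1 φ v) : fderiv ℝ (F.lsMap φ v) ((ξ0, 0), 0)
    ∘L .inr ℝ (ℝ × Coord t) (Unknown N t n) = bordered (F.lin φ v ξ0) := by
  refine ContinuousLinearMap.ext fun k => ?_
  have hline : HasDerivAt (fun s : ℝ => s • k) k 0 := by
    have := (hasDerivAt_id (0 : ℝ)).smul_const k; rwa [one_smul] at this
  have h2 : HasDerivAt (fun s : ℝ => (((ξ0, s • (0 : Coord t)), s • k) : (ℝ × Coord t) × Unknown N t
    n)) (0, k) 0 := by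
    simp; exact (hasDerivAt_const _ _).prodMk hline
  have h4 := (comp_hasDerivAt_of_eq (0 : ℝ) ((H.contDiffOn_lsMap.contDiffAt (H.isOpen_lsDom.mem_nhds (H.mem_lsDom H.frame.mem 0))).toFDeriv) h2 (Prod.ext (Prod.ext rfl (smul_zero _).symm) (zero_smul ℝ k).symm)).unique (H.hasDerivAt_lsMap H.frame.mem 0 hline (zero_smul ℝ k))
  rw [crit_zero, map_zero] at h4
  simp at h4
  have h5 : ((0, fun _ => 0) : Unknown N t n) = 0 := rfl
  rw [h5, sub_zero] at h4
  exact h4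

lemma lsMap_eq_sub (p : ℝ × Coord t) (h : CLoop N) (c : Fin t.dim ⊕ Fin n → ℝ) : bordered (F.lin φ v
    p.1) (h, c) = bordered (F.lin φ v p.1) (h, 0) + F.lsMap φ v (p, h, c) - F.lsMap φ v (p, h, 0) :=
    by
  have e : (∑ j, c j • (F.lin φ v p.1).2.2 j) = F.miC p.1 (∑ j, c j • F.bC φ v p.1 j) := by
    rw [map_sum]; exact sum_congr rfl fun j _ => by rw [map_smul, lin_border]
  have e0 : ∑ j, (0 : Fin t.dim ⊕ Fin n → ℝ) j • (F.lin φ v p.1).2.2 j = 0 :=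
    sum_eq_zero fun j _ => zero_smul_cLoop _
  have e1 : ∑ j, (0 : Fin t.dim ⊕ Fin n → ℝ) j • F.bC φ v p.1 j = 0 :=
    sum_eq_zero fun j _ => zero_smul_cLoop _
  refine Prod.ext ?_ (funext fun j => ?_)
  · rw [Prod.fst_sub, Prod.fst_add, bordered_fst, bordered_fst, e, e0]
    simp only [lsMap, accC, map_add, e1, map_zero]; abel
  · rw [Prod.snd_sub, Prod.snd_add, Pi.sub_apply, Pi.add_apply, bordered_snd, bordered_snd]
    simp only [lsMap]; ring

section

variable (H : F.Setting ξ0 κ t J1 φ v)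
include H

lemma Setting.exists_isReduction : ∃ (Q : Set (ℝ × Coord t)) (ψ : ℝ × Coord t → Unknown N t n),
    F.IsReduction ξ0 J1 φ v Q ψ := by
  have h0 : ((ξ0, (0 : Coord t)), (0 : Unknown N t n)) ∈ F.lsDom J1 φ n := H.mem_lsDom H.frame.mem 0
  obtain ⟨Q, ψ, hQ, hm, hs, hz, hd, hu⟩ := exists_contDiffOn_implicit H.isOpen_lsDom
    H.contDiffOn_lsMap h0 (H.lsMap_zero H.frame.mem)
    (by rw [H.fderiv_lsMap_inr]; exact bordered_isInvertible _ H.lin_injective)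
  refine ⟨Q, ψ, hQ, hm, hs, hz, fun p hp => (hd p hp).1, fun p hp => (hd p hp).2, ?_⟩
  let r : (ℝ × Coord t) × CLoop N → Unknown N t n := fun z =>
    bordered (F.lin φ v z.1.1) (z.2, 0) - F.lsMap φ v (z.1, z.2, 0)
  let Θ : (ℝ × Coord t) × CLoop N → Unknown N t n := fun z => solve (F.lin φ v z.1.1) (r z)
  have hlin : ContinuousAt (fun z : (ℝ × Coord t) × CLoop N => F.lin φ v z.1.1) ((ξ0, 0), 0) :=
    ContinuousAt.comp (f := fun z : (ℝ × Coord t) × CLoop N => z.1.1) (H.continuousAt_lin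
    H.frame.mem) (by fun_prop)
  have hbc : Continuous (bordered : BorderedData (Conf N) (Fin t.dim ⊕ Fin n) → _) :=
    contDiff_bordered.continuous
  have hb : ContinuousAt (fun z : (ℝ × Coord t) × CLoop N => bordered (F.lin φ v z.1.1)) ((ξ0, 0),
    0) := ContinuousAt.comp (g := bordered) hbc.continuousAt hlin
  have hz2 : ContinuousAt (fun z : (ℝ × Coord t) × CLoop N =>
      (z.2, (0 : Fin t.dim ⊕ Fin n → ℝ))) ((ξ0, 0), 0) := by fun_prop
  have hΘ : ContinuousAt Θ ((ξ0, 0), 0) := continuousAt_solve hlin ((hb.clm_apply hz2).sub (ContinuousAt.comp (g := F.lsMap φ v) (f := fun z : (ℝ × Coord t) × CLoop N => (z.1, z.2, (0 : Fin t.dim ⊕ Fin n → ℝ))) (H.contDiffOn_lsMap.contDiffAt (H.isOpen_lsDom.mem_nhds h0)).continuousAt (by fun_prop))) H.lin_injective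
  have hΘ0 : Θ ((ξ0, 0), 0) = 0 := by
    have h2 : r ((ξ0, 0), 0) = 0 := by
      have h3 : bordered (F.lin φ v ξ0) (0, 0) = 0 := map_zero _
      change bordered (F.lin φ v ξ0) (0, 0) - F.lsMap φ v ((ξ0, 0), 0) = 0
      rw [h3, H.lsMap_zero H.frame.mem, sub_zero]
    change solve _ (r _) = 0; rw [h2]; exact map_zero _
  have htend : Tendsto (fun z => (z.1, Θ z)) (𝓝 (((ξ0, 0), 0) : (ℝ × Coord t) × CLoop N)) (𝓝 ((ξ0,
    0), 0)) := by
    have := (continuousAt_fst (p := (((ξ0, 0), 0) : (ℝ × Coord t) × CLoop N))).prodMk hΘ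
    rwa [ContinuousAt, hΘ0] at this
  filter_upwards [htend.eventually hu, (continuousAt_fst.comp continuousAt_fst : ContinuousAt (fun z : (ℝ × Coord t) × CLoop N => z.1.1) ((ξ0, 0), 0)).eventually H.eventually_lin_injective] with z hz1 hz2 c hc
  have h1 : (z.2, c) = Θ z := eq_solve hz2 (by
    change bordered (F.lin φ v z.1.1) (z.2, c) = r z; rw [lsMap_eq_sub z.1 z.2 c, hc, add_zero])
  rw [h1]
  refine hz1 ?_
  rw [← h1]
  exact hc

lemma Setting.eventually_isNoncritical_iff : ∀ᶠ ξ in 𝓝 ξ0, ∀ h : Loop N, F.IsNoncritical φ ξ h ↔ ∀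
    j, l2 (F.border (φ ξ) v ξ j) h = 0 := by
  filter_upwards [H.eventually_lin_injective, H.frame.isOpen.mem_nhds H.frame.mem] with ξ hi hξ h
  have hJ := H.frame.subset hξ
  constructor
  · rintro ⟨h1, h2⟩ (i | k)
    · rw [l2_comm]; exact (F.ip_eq_zero hJ _ _).1 (h2 i)
    · rw [l2_comm]; exact (F.transverse_iff_l2 hJ h).1 h1 _ (mem_zeroModes (H.basis.mem k))
  · intro h1
    refine ⟨(F.transverse_iff_l2 hJ h).2 fun z hz => ?_, fun i => (F.ip_eq_zero hJ _ _).2 ?_⟩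
    · obtain ⟨c, hc⟩ := exists_proj (fun k => symLoop (F.q ξ) (v k)) z
      obtain ⟨y, hy⟩ : ∃ y, y = z - ∑ k, c k • symLoop (F.q ξ) (v k) := ⟨_, rfl⟩; rw [← hy] at hc
      have hyZ : y ∈ F.zeroModes (F.q ξ) := by
        rw [hy]; exact Submodule.sub_mem _ hz (Submodule.sum_mem _ fun k _ =>
          Submodule.smul_mem _ _ (mem_zeroModes (H.basis.mem k)))
      have hb : bordered (F.lin φ v ξ) (circ y, 0) = (0, 0) := by
        refine (F.bordered_data_iff hJ 0 _ _ 0 0).2 ⟨y, rfl, ?_, ?_⟩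
        · rw [F.hessQ_zeroModes hJ hyZ]
          have h3 : ∑ j, (0 : Fin t.dim ⊕ Fin n → ℝ) j • F.border (φ ξ) v ξ j = 0 :=
            sum_eq_zero fun j _ => zero_smul ℝ _
          rw [h3, zero_smul ℝ y, sub_zero, add_zero]
        · rintro (i | k)
          · exact (F.transverse_iff_l2 hJ _).1 ((H.frame.isFrame hξ).mode i).2 y hyZ
          · rw [l2_comm]; exact hc k
      rw [sub_eq_zero.1 (hy.symm.trans (circ_injective ((Prod.ext_iff.1 (hi (hb.trans (map_zero _).symm))).1.trans (map_zero _).symm))), map_sum]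
      refine sum_eq_zero fun k _ => ?_; rw [map_smul, l2_comm]; have := h1 (inr k)
      simp only [border, Sum.elim_inr] at this; rw [this, smul_zero]
    · rw [l2_comm]; exact h1 (inl i)

end

lemma exists_loop_elC (hξ : ξ ∈ F.J) {x : Loop N} (hx : F.Admissible x) :
    ∃ y : Loop N, circ y = F.elC ξ x := by
  refine exists_loop_of_contDiff ?_
  simp only [F.elC_coe hξ hx]
  exact (F.contDiffOn_gradient.comp_contDiff (contDiff_const.prodMk (loop_contDiff x)) fun s => ⟨hξ, hx s⟩).sub ((F.massOp ξ).contDiff.comp (loop_contDiff _))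

lemma elC_stationary_iff (hξ : ξ ∈ F.J) (hn : ∀ h : Loop N, F.IsNoncritical φ ξ h ↔ ∀ j, l2
    (F.border (φ ξ) v ξ j) h = 0) {x : Loop N} (hx : F.Admissible x) : (∀ h : Loop N,
    F.IsNoncritical φ ξ h → HasDerivAt (fun s : ℝ => F.action ξ (x + s • h : Loop N)) 0 0) ↔ ∃ c :
    Fin t.dim ⊕ Fin n → ℝ, F.elC ξ x = -∑ j, c j • F.bC φ v ξ j := by
  constructor
  · intro h1; obtain ⟨y, hy⟩ := exists_loop_elC hξ hx
    obtain ⟨c, hc⟩ := exists_proj (F.border (φ ξ) v ξ) y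
    obtain ⟨z, hz⟩ : ∃ z, z = y - ∑ j, c j • F.border (φ ξ) v ξ j := ⟨_, rfl⟩; rw [← hz] at hc
    have h3 := (F.hasDerivAt_action hξ hx z).unique (h1 z ((hn z).2 fun j => by rw [l2_comm]; exact hc j))
    rw [mul_eq_zero, or_iff_right (F.T_ne hξ), ← hy, ← l2_apply] at h3
    have h4 : y = z + ∑ j, c j • F.border (φ ξ) v ξ j := by rw [hz, sub_add_cancel]
    have h5 : l2 (∑ j, c j • F.border (φ ξ) v ξ j) z = 0 := by
      rw [l2_comm, map_sum]; refine sum_eq_zero fun j _ => ?_; rw [map_smul, hc, smul_zero]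
    rw [h4, map_add, LinearMap.add_apply, h5, add_zero] at h3
    rw [l2_self_eq_zero h3, zero_add] at h4; refine ⟨-c, ?_⟩
    rw [← hy, h4, map_sum, ← Finset.sum_neg_distrib]; refine sum_congr rfl fun j _ => ?_
    rw [map_smul, Pi.neg_apply]; rw [neg_smul_cLoop, neg_neg, bC]
  · rintro ⟨c, hc⟩ h hh; have h1 := F.hasDerivAt_action hξ hx h
    have h2 : pair (F.elC ξ x) (circ h) = 0 := by
      rw [pair_comm, hc, map_neg, map_sum, sum_eq_zero, neg_zero]; intro j _; have := (hn h).1 hh j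
      rw [l2_comm] at this; rw [map_smul, bC]; rw [l2_apply] at this; rw [this, smul_zero]
    rwa [h2, mul_zero] at h1

/-- `w` belongs to the local solution `ψ` of the Lyapunov–Schmidt equation at `p`. -/
structure IsSolutionAt (F : SymmetricFamily N) (φ : ℝ → Fin t.dim → Loop N)
    (v : Fin n → Gen N)
    (ψ : ℝ × Coord t → Unknown N t n) (w : ℝ → Coord t → Loop N) (p : ℝ × Coord t) : Prop where
  circ_eq : circ (w p.1 p.2) = (ψ p).1
  elC_eq : F.elC p.1 (F.point φ w p.1 p.2) = -∑ j, (ψ p).2 j • F.bC φ v p.1 j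

lemma circ_point (w : ℝ → Coord t → Loop N) (p : ℝ × Coord t) :
    circ (F.point φ w p.1 p.2) = F.baseC φ p + circ (w p.1 p.2) := by
  rw [point, map_add, circ_base]

section

variable (R : F.IsReduction ξ0 J1 φ v Q ψ) {p : ℝ × Coord t} (hp : p ∈ Q)
include R p hp

lemma IsReduction.l2_eq_zero (j : Fin t.dim ⊕ Fin n) : pair (F.bC φ v p.1 j) (ψ p).1 = 0 :=
  congrFun (Prod.ext_iff.1 (R.eq p hp)).2 j

lemma IsReduction.admissible (hw : F.IsSolutionAt φ v ψ w p) : F.Admissible (F.point φ w p.1 p.2) :=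
    fun s => by
  have h := (F.mem_domC.1 (R.dom p hp).2).2 s
  simp only at h
  rwa [← hw.circ_eq, ← circ_point, circ_coe] at h

end

lemma norm_circ_le {x : Loop N} {ε : ℝ} (hε : 0 ≤ ε) (h : ∀ s, ‖x.1 s‖ ≤ ε) : ‖circ x‖ ≤ ε := by
  refine (ContinuousMap.norm_le _ hε).2 fun s => ?_
  induction s using QuotientAddGroup.induction_on with
  | H s => exact (congrArg norm (circ_coe x s)).le.trans (h s)

lemma norm_apply_le (x : Loop N) (s : ℝ) : ‖x.1 s‖ ≤ ‖circ x‖ := by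
  rw [← circ_coe x s]
  exact ContinuousMap.norm_coe_le_norm _ _

section

variable {α : Type} {l : Filter α} {x : α → Loop N}
include α l x

lemma tendsto_circ (h : ∀ ε > 0, ∀ᶠ a in l, ∀ s, ‖(x a : ℝ → Conf N) s‖ < ε) : Tendsto (fun a =>
    circ (x a)) l (𝓝 0) := by
  refine NormedAddGroup.tendsto_nhds_zero.2 fun ε hε => ?_
  filter_upwards [h (ε / 2) (half_pos hε)] with a ha
  exact (norm_circ_le (half_pos hε).le fun s => (ha s).le).trans_lt (half_lt_self hε)

lemma eventually_norm_lt (h : Tendsto (fun a => circ (x a)) l (𝓝 0)) {ε : ℝ} (hε : 0 < ε) : ∀ᶠ a in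
    l, ∀ s, ‖(x a : ℝ → Conf N) s‖ < ε :=
  (NormedAddGroup.tendsto_nhds_zero.1 h ε hε).mono fun _ ha s => (norm_apply_le _ s).trans_lt ha

end

lemma tendsto_fst_nhds {ξ0 : ℝ} : Tendsto (fun p : ℝ × Coord t => p.1) (𝓝 (ξ0, 0)) (𝓝 ξ0) :=
  continuousAt_fst

section

variable (R : F.IsReduction ξ0 J1 φ v Q ψ) (H : F.Setting ξ0 κ t J1 φ v)
include R H

lemma IsReduction.exists_isLyapunovSchmidt : ∃ w, F.IsLyapunovSchmidt φ w ξ0 := by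
  have hex : ∀ (ξ : ℝ) (u : Coord t), ∃ w : Loop N, (ξ, u) ∈ Q → circ w = (ψ (ξ, u)).1 ∧ F.elC ξ
    (F.q ξ + crit φ ξ u + w) = -∑ j, (ψ (ξ, u)).2 j • F.bC φ v ξ j ∧ ∀ j, l2 (F.border (φ ξ) v ξ j)
    w = 0 := fun ξ u => by
    by_cases hp : (ξ, u) ∈ Q
    · obtain ⟨w, hw⟩ := (lsMap_eq_zero_iff (p := (ξ, u)) (H.frame.subset (R.dom _ hp).1)
        (R.dom _ hp).2 _).1 (R.eq _ hp)
      exact ⟨w, fun _ => hw⟩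
    · exact ⟨0, fun h => absurd h hp⟩
  choose w hw using hex
  have hQ := R.isOpen.mem_nhds R.mem
  have hs : Tendsto (fun p : ℝ × Coord t => circ (w p.1 p.2)) (𝓝 (ξ0, 0)) (𝓝 0) := by
    have h1 : Tendsto (fun p => (ψ p).1) (𝓝 (ξ0, 0)) (𝓝 0) := by
      have := (R.smooth.contDiffAt hQ).continuousAt.fst; rwa [ContinuousAt, R.zero] at this
    refine h1.congr' ?_; filter_upwards [hQ] with p hp; exact (hw p.1 p.2 hp).1.symm
  have hn := tendsto_fst_nhds (t := t).eventually H.eventually_isNoncritical_iff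
  refine ⟨w, fun ε hε => eventually_norm_lt hs hε, ?_, ?_⟩
  · filter_upwards [hQ, hn] with p hp hnp; exact (hnp _).2 (hw p.1 p.2 hp).2.2
  · filter_upwards [hQ, hn] with p hp hnp
    have hx := R.admissible hp ⟨(hw p.1 p.2 hp).1, (hw p.1 p.2 hp).2.1⟩
    exact (elC_stationary_iff (H.frame.subset (R.dom _ hp).1) hnp hx).2 ⟨_, (hw p.1 p.2 hp).2.1⟩

lemma IsReduction.isSolutionAt (hw : F.IsLyapunovSchmidt φ w ξ0) : ∀ᶠ p in 𝓝 (ξ0, (0 : Coord t)),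
    F.IsSolutionAt φ v ψ w p := by
  have hs := tendsto_circ hw.small
  have ht : Tendsto (fun p => (p, circ (w p.1 p.2))) (𝓝 (ξ0, 0)) (𝓝 ((ξ0, 0), 0)) :=
    tendsto_id.prodMk_nhds hs
  have hdom : ∀ᶠ p : ℝ × Coord t in 𝓝 (ξ0, 0), (p, circ (w p.1 p.2), 0) ∈ F.lsDom J1 φ n := by
    exact (tendsto_id.prodMk_nhds (hs.prodMk_nhds tendsto_const_nhds)).eventually (H.isOpen_lsDom.mem_nhds (H.mem_lsDom H.frame.mem 0))
  filter_upwards [tendsto_fst_nhds.eventually H.eventually_isNoncritical_iff, hw.noncritical, hw.stationary, hdom, ht.eventually R.unique]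
    with p h1 h2 h3 h4 h5
  have hJ := H.frame.subset h4.1
  have hx : F.Admissible (F.point φ w p.1 p.2) := fun s => by
    have h := (F.mem_domC.1 h4.2).2 s; simp only at h; rwa [← circ_point, circ_coe] at h
  obtain ⟨c, hc⟩ := (elC_stationary_iff hJ h1 hx).1 h3
  have h6 := h5 c ((lsMap_eq_zero_iff hJ h4.2 c).2 ⟨_, rfl, hc, (h1 _).1 h2⟩)
  exact ⟨congrArg Prod.fst h6, by rw [hc, ← h6]⟩

end

end SymmetricFamily

section Curves

variable {V G : Type} [NormedAddCommGroup V] [NormedSpace ℝ V] [NormedAddCommGroup G]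
  [NormedSpace ℝ G]

lemma hasDerivAt_line (a v : V) (r : ℝ) : HasDerivAt (fun r : ℝ => a + r • v) v r := by
  have := ((hasDerivAt_id r).smul_const v).const_add a
  rwa [one_smul] at this

lemma iteratedDeriv_line {f : V → G} {O : Set V} (hO : IsOpen O) (hf : SmoothOn f O) (a v : V) (m :
    ℕ) : ∀ r : ℝ, a + r • v ∈ O → iteratedDeriv m (fun r : ℝ => f (a + r • v)) r = iteratedFDeriv ℝ
    m f (a + r • v) fun _ => v := by
  induction m with
  | zero => simp
  | succ m ih =>
    intro r hr; have hline := hasDerivAt_line a v r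
    have h1 : (iteratedDeriv m fun r => f (a + r • v)) =ᶠ[𝓝 r] fun r => iteratedFDeriv ℝ m f (a + r
      • v) fun _ => v := by
      filter_upwards [hline.continuousAt.preimage_mem_nhds (hO.mem_nhds hr)] with r' hr'
      exact ih r' hr'
    have h2 := (hf.contDiffAt (hO.mem_nhds hr)).differentiableAt_iteratedFDeriv (by
        exact_mod_cast WithTop.coe_lt_coe.2 (WithTop.coe_lt_top m))
    rw [iteratedDeriv_succ, h1.deriv_eq, iteratedFDeriv_succ_apply_left]
    exact ((ContinuousMultilinearMap.apply ℝ (fun _ => V) G (fun _ => v)).hasFDerivAt.comp_hasDerivAt r (h2.hasFDerivAt.comp_hasDerivAt r hline)).deriv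

lemma iteratedDeriv_two_eq {f f' : ℝ → G} {f'' : G} {x : ℝ} (h : ∀ᶠ y in 𝓝 x, HasDerivAt f (f' y) y)
    (h' : HasDerivAt f' f'' x) : iteratedDeriv 2 f x = f'' := by
  have h1 : deriv f =ᶠ[𝓝 x] f' := h.mono fun y hy => hy.deriv
  rw [iteratedDeriv_succ, iteratedDeriv_one, h1.deriv_eq, h'.deriv]

lemma iteratedDeriv_two_comp {h : V → G} {γ : ℝ → V} {x : ℝ} (hh : SmoothAt h (γ x)) (hγ : SmoothAt
    γ x) : iteratedDeriv 2 (fun r => h (γ r)) x = fderiv ℝ (fderiv ℝ h) (γ x) (deriv γ x) (deriv γ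
    x) + fderiv ℝ h (γ x) (iteratedDeriv 2 γ x) := by
  have h1 : ∀ᶠ r in 𝓝 x, HasDerivAt (fun r => h (γ r)) (fderiv ℝ h (γ r) (deriv γ r)) r := by
    filter_upwards [hγ.continuousAt.eventually ((hh.of_le (m := 1) (by norm_cast)).eventually
      (by simp)), (hγ.of_le (m := 1) (by norm_cast)).eventually (by simp)] with r h2 h3
    exact (h2.toFDeriv).comp_hasDerivAt r
      (h3.differentiableAt (by simp)).hasDerivAt
  refine iteratedDeriv_two_eq h1 ?_
  have h4 : HasDerivAt (deriv γ) (iteratedDeriv 2 γ x) x := by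
    rw [iteratedDeriv_succ, iteratedDeriv_one]; have h5 : ContDiffAt ℝ 1 (deriv γ) x := by
      have := (hγ.fderiv_right (m := 1) (by norm_cast)).clm_apply (contDiffAt_const (c := (1 : ℝ)))
      exact this
    exact (h5.differentiableAt (by simp)).hasDerivAt
  exact ((((hh.fderiv_right (m := 1) (by norm_cast)).toFDeriv)).comp_hasDerivAt x ((hγ.differentiableAt (by simp)).hasDerivAt)).clm_apply h4

lemma exists_norm_le_sq {f : ℝ × V → G} {ξ0 : ℝ} (hf : SmoothAt f (ξ0, 0)) (h0 : ∀ᶠ ξ in 𝓝 ξ0, f (ξ,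
    0) = 0) (h1 : ∀ᶠ ξ in 𝓝 ξ0, ∀ e, HasDerivAt (fun s : ℝ => f (ξ, s • e)) 0 0) : ∃ c : ℝ, ∀ᶠ p in
    𝓝 (ξ0, (0 : V)), ‖f p‖ ≤ c * ‖p.2‖ ^ 2 := by
  obtain ⟨K, O, hO, hK⟩ := (hf.fderiv_right (m := 1) (by norm_cast)).exists_lipschitzOnWith
  have hd := ((hf.of_le (m := 1) (by norm_cast)).eventually (by simp)).mono fun p hp =>
    hp.differentiableAt (by simp)
  obtain ⟨ε, hε, hball⟩ := eventually_nhds_iff_ball.1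
    ((hd.and hO).and (continuousAt_fst.eventually (h0.and h1)))
  refine ⟨K, ?_⟩
  filter_upwards [ball_mem_nhds _ hε] with p hp
  have hmem : ∀ s ∈ Set.Icc (0 : ℝ) 1, (p.1, s • p.2) ∈ ball (ξ0, (0 : V)) ε := fun s hs => by
    rw [mem_ball, Prod.dist_eq, max_lt_iff, dist_zero_right] at hp ⊢; refine ⟨hp.1, ?_⟩
    rw [norm_smul, Real.norm_of_nonneg hs.1]
    exact (mul_le_of_le_one_left (norm_nonneg _) hs.2).trans_lt hp.2
  have hder : ∀ s ∈ Set.Icc (0 : ℝ) 1, HasDerivAt (fun s : ℝ => f (p.1, s • p.2)) (fderiv ℝ f (p.1,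
    s • p.2) (0, p.2)) s := fun s hs => by
    have h2 : HasDerivAt (fun s => (p.1, s • p.2)) ((0 : ℝ), p.2) s := by
      have := hasDerivAt_line (0 : V) p.2 s; simp at this
      exact (hasDerivAt_const s p.1).prodMk this
    exact (hball _ (hmem s hs)).1.1.hasFDerivAt.comp_hasDerivAt s h2
  have hz : 0 ∈ Set.Icc (0 : ℝ) 1 := ⟨le_rfl, zero_le_one⟩
  have hp' := hball _ (hmem 0 hz)
  have hb : ∀ s ∈ Set.Ico (0 : ℝ) 1, ‖fderiv ℝ f (p.1, s • p.2) (0, p.2)‖ ≤ K * ‖p.2‖ ^ 2 := by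
    intro s hs; have h5 : ‖((p.1, s • p.2) : ℝ × V) - (p.1, (0 : ℝ) • p.2)‖ ≤ ‖p.2‖ := by
      rw [Prod.mk_sub_mk, sub_self, zero_smul, sub_zero, Prod.norm_mk, norm_zero,
        max_eq_right (norm_nonneg _), norm_smul, Real.norm_of_nonneg hs.1]
      exact mul_le_of_le_one_left (norm_nonneg _) hs.2.le
    have h6 : fderiv ℝ f (p.1, s • p.2) (0, p.2) = (fderiv ℝ f (p.1, s • p.2) - fderiv ℝ f (p.1, (0
      : ℝ) • p.2)) (0, p.2) := by
      rw [_root_.sub_apply, (hder 0 hz).unique (hp'.2.2 p.2), sub_zero]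
    rw [h6]; refine (ContinuousLinearMap.le_opNorm _ _).trans ?_
    rw [Prod.norm_mk, norm_zero, max_eq_right (norm_nonneg _), pow_two, ← mul_assoc]
    exact mul_le_mul_of_nonneg_right ((hK.norm_sub_le (hball _ (hmem s (⟨hs.1, hs.2.le⟩))).1.2 hp'.1.2).trans (mul_le_mul_of_nonneg_left h5 K.2)) (norm_nonneg _)
  have h7 := norm_image_sub_le_of_norm_deriv_le_segment_01'
    (fun s hs => (hder s hs).hasDerivWithinAt) hb
  have h8 : f (p.1, (0 : ℝ) • p.2) = 0 := by rw [zero_smul]; exact hp'.2.1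
  rwa [h8, sub_zero, one_smul] at h7

end Curves

open PeriodicODE LagrangianFamily

namespace SymmetricFamily

variable {N : ℕ} {F : SymmetricFamily N} {ξ0 : ℝ} {κ : ℝ → ℝ} {t : Irrep} {J1 : Set ℝ}
  {φ : ℝ → Fin t.dim → Loop N} {n : ℕ} {v : Fin n → Gen N}
  {Q : Set (ℝ × Coord t)} {ψ : ℝ × Coord t → Unknown N t n}
  {w : ℝ → Coord t → Loop N}

def velC (F : SymmetricFamily N) (φ : ℝ → Fin t.dim → Loop N)
    (v : Fin n → Gen N) (ψ : ℝ × Coord t → Unknown N t n)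
    (p : ℝ × Coord t) : CLoop N :=
  prim (F.accC φ v p.1 (F.baseC φ p + (ψ p).1) (ψ p).2)

lemma IsSolutionAt.circ_point_eq {p : ℝ × Coord t} (hw : F.IsSolutionAt φ v ψ w p) :
    circ (F.point φ w p.1 p.2) = F.baseC φ p + (ψ p).1 := by
  rw [circ_point, hw.circ_eq]

section

variable (R : F.IsReduction ξ0 J1 φ v Q ψ)
include R

lemma IsReduction.circ_dLoop_point {p : ℝ × Coord t} (hp : p ∈ Q) (hw : F.IsSolutionAt φ v ψ w p) :
    circ (dLoop (F.point φ w p.1 p.2)) = F.velC φ v ψ p := by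
  refine circ_dLoop_of_hasDerivAt ?_
  rw [hw.circ_point_eq]
  refine hasDerivAt_of_resolv ?_
  have h := (Prod.ext_iff.1 (R.eq p hp)).1
  simp only [lsMap, Prod.fst_zero] at h
  rw [sub_sub] at h
  exact sub_eq_zero.1 h

lemma IsReduction.contDiffOn_graph : SmoothOn (fun p => (p, ψ p)) Q := contDiffOn_id.prodMk R.smooth

lemma IsReduction.contDiffOn_pos (H : F.Setting ξ0 κ t J1 φ v) : SmoothOn (fun p => F.baseC φ
    p + (ψ p).1) Q := by
  exact (H.contDiffOn_position.comp R.contDiffOn_graph R.dom).congr fun _ _ => rfl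

lemma IsReduction.contDiffOn_velC (H : F.Setting ξ0 κ t J1 φ v) : SmoothOn (F.velC φ v ψ) Q := by
  exact (((prim).contDiff).comp_contDiffOn (H.contDiffOn_accC.comp R.contDiffOn_graph R.dom)).congr fun _ _ => rfl

end

lemma contDiffOn_lagC {O : Set (ℝ × Coord t)} {X Y : ℝ × Coord t → CLoop N}
    (hX : SmoothOn X O) (hY : SmoothOn Y O) (hO : ∀ p ∈ O, (p.1, X p) ∈ F.domC) :
    SmoothOn (fun p => F.lagC p.1 (X p) (Y p)) O := by
  have h0 : SmoothOn (fun p : ℝ × Coord t => p.1) O := contDiffOn_fst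
  have hm : Set.MapsTo (fun p => p.1) O F.J := fun p hp => (F.mem_domC.1 (hO p hp)).1
  have h1 := (F.contDiffOn_mC.comp h0 hm).clm_apply hY
  have h2 : Smooth fun Z : CLoop N × CLoop N => pair Z.1 Z.2 := by fun_prop
  have h3 := h2.comp_contDiffOn (h1.prodMk hY)
  exact (((F.T_smooth.comp h0 hm).congr fun _ _ => rfl).mul ((contDiffOn_const).mul h3 |>.add (((mean).contDiff).comp_contDiffOn ((F.contDiffOn_potC.comp (h0.prodMk hX) hO).congr fun _ _ => rfl)))).congr fun _ _ => rfl

/-- A neighbourhood on which the Lyapunov–Schmidt reduction has all the properties that hold near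
the critical point. -/
structure IsLocal (F : SymmetricFamily N) (ξ0 : ℝ) (J1 : Set ℝ) (φ : ℝ → Fin t.dim → Loop N)
    (v : Fin n → Gen N) (Q : Set (ℝ × Coord t))
    (ψ : ℝ × Coord t → Unknown N t n) (w : ℝ → Coord t → Loop N) : Prop
    extends F.IsReduction ξ0 J1 φ v Q ψ where
  solution : ∀ p ∈ Q, F.IsSolutionAt φ v ψ w p
  zero_eq : ∀ p ∈ Q, ψ (p.1, 0) = 0
  injective : ∀ p ∈ Q, Injective (bordered (F.lin φ v p.1))
  noncritical : ∀ p ∈ Q, ∀ h : Loop N, F.IsNoncritical φ p.1 h ↔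
    ∀ j, l2 (F.border (φ p.1) v p.1 j) h = 0
  independent : ∀ p ∈ Q, ∀ c : Fin n → ℝ, (∀ l, ∑ k, c k *
    pair (circ (symLoop (F.q p.1) (v k))) (circ (symLoop (F.point φ w p.1 p.2) (v l))) = 0) → c = 0

lemma IsReduction.mono (R : F.IsReduction ξ0 J1 φ v Q ψ) {Q' : Set (ℝ × Coord t)} (ho : IsOpen Q')
    (hm : (ξ0, 0) ∈ Q') (hs : Q' ⊆ Q) : F.IsReduction ξ0 J1 φ v Q' ψ := ⟨ho, hm, R.smooth.mono hs,
    R.zero, fun p hp => R.dom p (hs hp), fun p hp => R.eq p (hs hp), R.unique⟩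

lemma circ_symLoop (x : Loop N) (v : Gen N) :
    circ (symLoop x v) = v.1 • circ (dLoop x) + (constC v.2.1 + mulC (constC v.2.2) (circ x)) := by
  refine circle_ext fun s => ?_
  rw [circ_coe, ContinuousMap.add_apply, ContinuousMap.add_apply, mulC_apply,
    ContinuousMap.smul_apply, circ_coe, circ_coe]
  rfl

lemma continuousAt_pair {Z : Type} [TopologicalSpace Z] {X Y : Z → CLoop N} {z : Z} (hX :
    ContinuousAt X z) (hY : ContinuousAt Y z) : ContinuousAt (fun z => pair (X z) (Y z)) z := by
  fun_prop

lemma continuousAt_symmetry {Z : Type} [TopologicalSpace Z] {X V : Z → CLoop N} {z : Z}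
    (v : Gen N) (hX : ContinuousAt X z) (hV : ContinuousAt V z) :
    ContinuousAt (fun z => v.1 • V z + (constC v.2.1 + mulC (constC v.2.2) (X z))) z := by
  fun_prop

lemma Setting.exists_isLocal (H : F.Setting ξ0 κ t J1 φ v) (hw : F.IsLyapunovSchmidt φ w ξ0) : ∃ (Q
    : Set (ℝ × Coord t)) (ψ : ℝ × Coord t → Unknown N t n), F.IsLocal ξ0 J1 φ v Q ψ w := by
  obtain ⟨Q, ψ, R⟩ := H.exists_isReduction
  have hQ := R.isOpen.mem_nhds R.mem
  have hsol := R.isSolutionAt H hw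
  have hzero : ∀ᶠ p : ℝ × Coord t in 𝓝 (ξ0, 0), ψ (p.1, 0) = 0 := by
    filter_upwards [((tendsto_fst_nhds.prodMk_nhds tendsto_const_nhds).prodMk_nhds tendsto_const_nhds).eventually R.unique, hQ] with p hp hpQ
    exact (hp 0 (H.lsMap_zero (R.dom p hpQ).1)).symm
  let A : ℝ × Coord t → Matrix (Fin n) (Fin n) ℝ := fun p k l =>
    pair (circ (symLoop (F.q p.1) (v k))) ((v l).1 • F.velC φ v ψ p
      + (constC (v l).2.1 + mulC (constC (v l).2.2) (F.baseC φ p + (ψ p).1)))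
  have hAeq : ∀ p ∈ Q, F.IsSolutionAt φ v ψ w p → ∀ k l, A p k l = pair (circ (symLoop (F.q p.1) (v
    k))) (circ (symLoop (F.point φ w p.1 p.2) (v l))) := fun p hp hs k l => by
      rw [circ_symLoop (F.point φ w p.1 p.2), R.circ_dLoop_point hp hs, hs.circ_point_eq]
  have hAc : ContinuousAt A (ξ0, 0) := by
    refine continuousAt_pi.2 fun k => continuousAt_pi.2 fun l => ?_
    exact continuousAt_pair (ContinuousAt.comp (g := fun ξ => F.bC φ v ξ (inr k)) (x := (ξ0, 0)) ((H.contDiffOn_bC (inr k)).contDiffAt (H.frame.isOpen.mem_nhds H.frame.mem)).continuousAt continuousAt_fst) (continuousAt_symmetry (v l) (((R.contDiffOn_pos H).contDiffAt hQ).continuousAt) (((R.contDiffOn_velC H).contDiffAt hQ).continuousAt))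
  have hA0 : (A (ξ0, 0)).det ≠ 0 := by
    intro hdet; obtain ⟨c, hc0, hc⟩ := Matrix.exists_vecMul_eq_zero_iff.2 hdet
    refine hc0 (funext (Fintype.linearIndependent_iff.1 H.basis.linearIndependent c ?_))
    have hpt : F.point φ w ξ0 0 = F.q ξ0 := circ_injective (by
      have h1 := hsol.self_of_nhds.circ_point_eq; rw [baseC_zero, R.zero] at h1
      exact h1.trans (add_zero _))
    refine l2_self_eq_zero ?_; rw [map_sum]; refine sum_eq_zero fun l _ => ?_
    rw [map_smul, map_sum, LinearMap.sum_apply]; have h2 := congrFun hc l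
    simp only [Matrix.vecMul, dotProduct, Pi.zero_apply] at h2
    have h3 : ∑ k, (l2 (c k • symLoop (F.q ξ0) (v k))) (symLoop (F.q ξ0) (v l)) = 0 := by
      rw [← h2]; refine sum_congr rfl fun k _ => ?_
      rw [hAeq (ξ0, 0) R.mem hsol.self_of_nhds, hpt, map_smul, LinearMap.smul_apply, smul_eq_mul,
        l2_apply]
    rw [h3, smul_zero]
  obtain ⟨Q', hQ', ho, hm⟩ := eventually_nhds_iff.1 (hsol.and (hzero.and (((ContinuousAt.comp (g := Matrix.det) (continuous_id.matrix_det).continuousAt hAc).eventually_ne hA0).and (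
    (tendsto_fst_nhds.eventually (H.eventually_lin_injective.and
      H.eventually_isNoncritical_iff)).and hQ))))
  refine ⟨Q', ψ, R.mono ho hm fun p hp => (hQ' p hp).2.2.2.2, fun p hp => (hQ' p hp).1,
    fun p hp => (hQ' p hp).2.1, fun p hp => (hQ' p hp).2.2.2.1.1,
    fun p hp => (hQ' p hp).2.2.2.1.2, fun p hp c hc => ?_⟩
  by_contra hne
  refine (hQ' p hp).2.2.1 (Matrix.exists_vecMul_eq_zero_iff.1 ⟨c, hne, funext fun l => ?_⟩)
  simp only [Matrix.vecMul, dotProduct, Pi.zero_apply]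
  rw [← hc l]
  exact sum_congr rfl fun k _ => by rw [hAeq p (hQ' p hp).2.2.2.2 (hQ' p hp).1]

lemma IsLocal.contDiffOn_SLS (L : F.IsLocal ξ0 J1 φ v Q ψ w) (H : F.Setting ξ0 κ t J1 φ v) :
    SmoothOn (fun p : ℝ × Coord t => F.SLS φ w p.1 p.2) Q := by
  have hR := L.toIsReduction
  have h0 : SmoothOn (fun p => p.1) Q := contDiffOn_fst
  have hJ : ∀ p ∈ Q, p.1 ∈ F.J := fun p hp => H.frame.subset (L.dom p hp).1
  have h1 : SmoothOn (fun p => circ (F.q p.1)) Q :=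
    (F.smoothPeriodic_q.contDiffOn_toCircle F.isOpen_J).comp h0 hJ
  have h2 : SmoothOn (fun p => circ (dLoop (F.q p.1))) Q :=
    ((F.smoothPeriodic_q.deriv F.isOpen_J).contDiffOn_toCircle F.isOpen_J).comp h0 hJ
  refine ((contDiffOn_lagC (hR.contDiffOn_pos H) (hR.contDiffOn_velC H)
    fun p hp => (L.dom p hp).2).sub (contDiffOn_lagC h1 h2 fun p hp =>
      F.mem_domC_circ (hJ p hp) (F.q_admissible (hJ p hp)))).congr fun p hp => ?_
  rw [SLS, F.action_eq (hJ p hp) (hR.admissible hp (L.solution p hp)),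
    F.action_eq (hJ p hp) (F.q_admissible (hJ p hp)), (L.solution p hp).circ_point_eq,
    hR.circ_dLoop_point hp (L.solution p hp)]

end SymmetricFamily

open LagrangianFamily

lemma iteratedDeriv_two_clm {V G : Type} [NormedAddCommGroup V] [NormedSpace ℝ V]
    [NormedAddCommGroup G] [NormedSpace ℝ G] (L : V →L[ℝ] G) {γ : ℝ → V} {x : ℝ} (hγ : SmoothAt γ x)
    : iteratedDeriv 2 (fun r => L (γ r)) x = L (iteratedDeriv 2 γ x) := by
  have h1 : fderiv ℝ (L : V → G) = fun _ => L := funext fun _ => L.fderiv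
  rw [iteratedDeriv_two_comp L.contDiff.contDiffAt hγ, h1]
  simp

namespace SymmetricFamily

variable {N : ℕ} {F : SymmetricFamily N} {ξ0 : ℝ} {κ : ℝ → ℝ} {t : Irrep} {J1 : Set ℝ}
  {φ : ℝ → Fin t.dim → Loop N} {n : ℕ} {v : Fin n → Gen N}
  {Q : Set (ℝ × Coord t)} {ψ : ℝ × Coord t → Unknown N t n}
  {w : ℝ → Coord t → Loop N} {ξ : ℝ}
local notation "Λ" => F.SLS φ w
local notation "Ψ" => F.point φ w

lemma baseC_add_smul (φ : ℝ → Fin t.dim → Loop N) (ξ : ℝ) (u e : Coord t) (s : ℝ) :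
    F.baseC φ (ξ, u + s • e) = F.baseC φ (ξ, u) + s • circ (crit φ ξ e) := by
  simp only [baseC, crit, map_sum, map_smul, PiLp.add_apply, PiLp.smul_apply, smul_sum,
    smul_smul, smul_eq_mul, add_assoc]
  rw [← Finset.sum_add_distrib]
  refine congrArg _ (sum_congr rfl fun i _ => ?_)
  module

section

variable (H : F.Setting ξ0 κ t J1 φ v) (hξ : ξ ∈ J1) (e : Coord t)
include H ξ hξ e

lemma Setting.pair_bC_crit_inl (i : Fin t.dim) : F.T ξ * pair (F.bC φ v ξ (inl i)) (circ (crit φ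
    ξ e)) = e i := by
  have hJ := H.frame.subset hξ
  rw [crit, map_sum, map_sum, Finset.sum_eq_single i]
  · rw [map_smul, map_smul, bC]; change F.T ξ * (e i • l2 (φ ξ i) (φ ξ i)) = _
    rw [(H.frame.isFrame hξ).l2_eq hJ, if_pos rfl, smul_eq_mul]; field_simp [F.T_ne hJ]
  · intro k _ hk; rw [map_smul, map_smul, bC]; change e k • l2 (φ ξ i) (φ ξ k) = 0
    rw [(H.frame.isFrame hξ).l2_eq hJ, if_neg (Ne.symm hk), smul_zero]
  simp

lemma Setting.pair_bC_crit_inr (k : Fin n) : pair (F.bC φ v ξ (inr k)) (circ (crit φ ξ e)) = 0 := by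
  rw [crit, map_sum, map_sum]
  refine sum_eq_zero fun i _ => ?_
  rw [map_smul, map_smul, pair_comm]
  change e i • l2 (φ ξ i) (symLoop (F.q ξ) (v k)) = 0
  rw [(F.transverse_iff_l2 (H.frame.subset hξ) _).1 (H.frame.mode ξ hξ i).2 _ (mem_zeroModes (H.basis.mem k)),
    smul_zero]

end

lemma IsLocal.pair_elC (L : F.IsLocal ξ0 J1 φ v Q ψ w) (H : F.Setting ξ0 κ t J1 φ v)
    {p : ℝ × Coord t} (hp : p ∈ Q) {e : Coord t} {X : CLoop N}
    (hX : ∀ j, pair (F.bC φ v p.1 j) X = pair (F.bC φ v p.1 j) (circ (crit φ p.1 e))) :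
    F.T p.1 * pair (F.elC p.1 (Ψ p.1 p.2)) X = -∑ i, (ψ p).2 (inl i) * e i := by
  rw [(L.solution p hp).elC_eq, pair_comm, map_neg, map_sum, mul_neg, Fintype.sum_sum_type,
    mul_add, mul_sum, mul_sum]
  have h1 : ∀ k, F.T p.1 * (pair X) ((ψ p).2 (inr k) • F.bC φ v p.1 (inr k)) = 0 :=
    fun k => by rw [map_smul, pair_comm, hX, H.pair_bC_crit_inr (L.dom p hp).1, smul_zero, mul_zero]
  rw [sum_eq_zero fun k _ => h1 k, add_zero]
  refine congrArg _ (sum_congr rfl fun i _ => ?_)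
  rw [map_smul, pair_comm, hX, smul_eq_mul, mul_left_comm, H.pair_bC_crit_inl (L.dom p hp).1]

lemma eventually_line_mem (hQ : IsOpen Q) {u : Coord t} (hp : (ξ, u) ∈ Q) (e : Coord t) :
    ∀ᶠ s : ℝ in 𝓝 0, (ξ, u + s • e) ∈ Q := by
  have h : ContinuousAt (fun s : ℝ => (ξ, u + s • e)) 0 := by fun_prop
  exact h.preimage_mem_nhds (hQ.mem_nhds (by simpa using hp))

section

variable (L : F.IsLocal ξ0 J1 φ v Q ψ w)
include L

lemma IsLocal.hasDerivAt_SLS (H : F.Setting ξ0 κ t J1 φ v) {u : Coord t} (hp : (ξ, u) ∈ Q) (e :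
    Coord t) : HasDerivAt (fun s : ℝ => Λ ξ (u + s • e)) (-∑ i, (ψ (ξ, u)).2 (inl i) * e i) 0 := by
  have hJ := H.frame.subset (L.dom _ hp).1
  have hQ := L.isOpen.mem_nhds hp
  have hline : HasDerivAt (fun s : ℝ => (ξ, u + s • e)) ((0 : ℝ), e) 0 :=
    (hasDerivAt_const _ _).prodMk (hasDerivAt_line u e 0)
  have hz : (ξ, u) = (ξ, u + (0 : ℝ) • e) := by rw [zero_smul, add_zero]
  obtain ⟨X, hX⟩ : ∃ X : ℝ → CLoop N, X = fun s => F.baseC φ (ξ, u + s • e)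
    + (ψ (ξ, u + s • e)).1 := ⟨_, rfl⟩
  obtain ⟨V, hV⟩ : ∃ V : ℝ → CLoop N, V = fun s => F.velC φ v ψ (ξ, u + s • e) := ⟨_, rfl⟩
  obtain ⟨X', hX'⟩ : ∃ X', HasDerivAt X X' 0 := ⟨_, by
    rw [hX]; exact comp_hasDerivAt_of_eq (0 : ℝ) ((((L.toIsReduction.contDiffOn_pos
      H).contDiffAt hQ).toFDeriv)) hline hz⟩
  obtain ⟨V', hV'⟩ : ∃ V', HasDerivAt V V' 0 := ⟨_, by
    rw [hV]
    exact comp_hasDerivAt_of_eq (l := F.velC φ v ψ) (0 : ℝ) (((L.toIsReduction.contDiffOn_velC H).contDiffAt hQ).toFDeriv) hline hz⟩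
  have hmem := eventually_line_mem L.isOpen hp e
  have hXx : ∀ᶠ s in 𝓝 0, X s = circ (Ψ ξ (u + s • e)) := by
    filter_upwards [hmem] with s hs; rw [hX]; exact (L.solution _ hs).circ_point_eq.symm
  have hVx : ∀ᶠ s in 𝓝 0, V s = circ (dLoop (Ψ ξ (u + s • e))) := by
    filter_upwards [hmem] with s hs; rw [hV]
    exact (L.toIsReduction.circ_dLoop_point hs (L.solution _ hs)).symm
  have hX0 : X 0 = circ (Ψ ξ u) := by simpa using hXx.self_of_nhds
  have hV0 : V 0 = circ (dLoop (Ψ ξ u)) := by simpa using hVx.self_of_nhds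
  have h1 := F.hasDerivAt_lagC (ξ := ξ) (by rw [hX0]; exact F.mem_domC_circ hJ (L.toIsReduction.admissible hp (L.solution _ hp))) hX' hV'
  have h2 : pair (F.mC ξ (V 0)) V' = -pair (F.mC ξ (circ (dLoop (dLoop (Ψ ξ u))))) X' := by
    refine ((pair (F.mC ξ (V 0))).hasFDerivAt.comp_hasDerivAt 0 hV').unique ((((pair (F.mC ξ (circ (dLoop (dLoop (Ψ ξ u)))))).hasFDerivAt.comp_hasDerivAt 0 hX').neg).congr_of_eventuallyEq ?_)
    filter_upwards [hXx, hVx] with s hs1 hs2; simp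
    rw [hV0, hs1, hs2, F.pair_mC_dLoop]
  have h5 : F.T ξ * (pair (F.mC ξ (V 0)) V' + pair (F.gradC ξ (X 0)) X') = -∑ i, (ψ (ξ, u)).2 (inl
    i) * e i := by
    rw [← L.pair_elC H hp (X := X') fun j => ?_]
    · rw [h2, elC, hX0, map_sub, _root_.sub_apply, neg_add_eq_sub]
    · have h7 : HasDerivAt (fun s : ℝ => pair (F.bC φ v ξ j) (F.baseC φ (ξ, u)) + s • pair (F.bC φ v
        ξ j) (circ (crit φ ξ e))) (pair (F.bC φ v ξ j) (circ (crit φ ξ e))) 0 := hasDerivAt_line _ _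
        0
      refine ((pair (F.bC φ v ξ j)).hasFDerivAt.comp_hasDerivAt 0 hX').unique (h7.congr_of_eventuallyEq ?_)
      filter_upwards [hmem] with s hs; simp only [comp_apply, hX]
      rw [map_add, L.toIsReduction.l2_eq_zero hs, add_zero, baseC_add_smul, map_add, map_smul]
  rw [h5] at h1
  refine (h1.sub_const (F.action ξ (F.q ξ))).congr_of_eventuallyEq ?_
  filter_upwards [hmem, hXx, hVx] with s hs hs1 hs2
  rw [SLS, F.action_eq hJ (L.toIsReduction.admissible hs (L.solution _ hs)), hs1, hs2]

lemma IsLocal.hasDerivAt_SLS_ray (H : F.Setting ξ0 κ t J1 φ v) {ξ r : ℝ} {e : Coord t} (hp : (ξ, r •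
    e) ∈ Q) : HasDerivAt (fun r : ℝ => Λ ξ (r • e)) (-∑ i, (ψ (ξ, r • e)).2 (inl i) * e i) r := by
  have h := L.hasDerivAt_SLS H hp e
  rw [← sub_self r] at h
  refine (HasDerivAt.comp_sub_const r r h).congr_of_eventuallyEq (of_forall fun s => ?_)
  have : r • e + (s - r) • e = s • e := by rw [← add_smul, add_sub_cancel]
  simp only [this]

lemma IsLocal.zero_mem : ∀ᶠ ξ in 𝓝 ξ0, (ξ, (0 : Coord t)) ∈ Q := by
  exact (tendsto_id.prodMk_nhds tendsto_const_nhds).eventually (L.isOpen.mem_nhds L.mem)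

end

lemma Setting.isMode_crit (H : F.Setting ξ0 κ t J1 φ v) (hξ : ξ ∈ J1) (e : Coord t) :
    F.IsMode ξ (crit φ ξ e) (κ ξ) :=
  Submodule.sum_mem (F.modeSpace (H.frame.subset hξ) (κ ξ)) fun i _ =>
    Submodule.smul_mem _ _ (H.frame.mode ξ hξ i)

lemma IsLocal.hasDerivAt_ψ (L : F.IsLocal ξ0 J1 φ v Q ψ w) (H : F.Setting ξ0 κ t J1 φ v) (hp : (ξ,
    0) ∈ Q) (e : Coord t) : HasDerivAt (fun s : ℝ => ψ (ξ, s • e)) (0, Sum.elim (fun i => -(κ ξ * e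
    i)) 0) 0 := by
  have hξ := (L.dom _ hp).1
  have hJ := H.frame.subset hξ
  obtain ⟨z', hz'⟩ : ∃ z', HasDerivAt (fun s : ℝ => ψ (ξ, s • e)) z' 0 := ⟨_, by
    have h := comp_hasDerivAt_of_eq 0
      (((L.smooth.contDiffAt (L.isOpen.mem_nhds hp)).toFDeriv))
      ((hasDerivAt_const (0 : ℝ) ξ).prodMk (hasDerivAt_line 0 e 0)) (by rw [zero_smul, add_zero])
    exact h.congr_of_eventuallyEq (of_forall fun s => by simp)⟩
  have h0 : ψ (ξ, (0 : ℝ) • e) = 0 := by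
    rw [zero_smul]; exact L.zero_eq _ hp
  have h2 : HasDerivAt (fun s : ℝ => F.lsMap φ v ((ξ, s • e), ψ (ξ, s • e))) 0 0 := by
    refine (hasDerivAt_const 0 (0 : Unknown N t n)).congr_of_eventuallyEq ?_
    filter_upwards [eventually_line_mem L.isOpen hp e] with s hs; rw [zero_add] at hs
    exact L.eq _ hs
  have h4 : bordered (F.lin φ v ξ) (circ (crit φ ξ e), Sum.elim (fun i => -(κ ξ * e i)) 0) = (0, fun
    j => pair (F.bC φ v ξ j) (circ (crit φ ξ e))) := by
    refine (F.bordered_data_iff hJ 0 _ _ _ _).2 ⟨_, rfl, ?_, fun j => rfl⟩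
    rw [((F.isMode_iff hJ _ _).1 (H.isMode_crit hξ e)).1, Fintype.sum_sum_type]
    simp only [Sum.elim_inl, Sum.elim_inr, Pi.zero_apply, fun y => zero_smul ℝ y, Finset.sum_const_zero, border,
      sub_zero, add_zero]
    rw [crit, smul_sum, ← Finset.sum_add_distrib]; refine sum_eq_zero fun i _ => ?_; module
  have h5 := L.injective _ hp ((sub_eq_zero.1 ((H.hasDerivAt_lsMap hξ e hz' h0).unique h2)).trans h4.symm)
  have h6 : z' = (0, Sum.elim (fun i => -(κ ξ * e i)) 0) :=
    Prod.ext (by simpa using (Prod.ext_iff.1 h5).1) (Prod.ext_iff.1 h5).2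
  rwa [h6] at hz'

lemma pair_mulC_hessC_comm {X : CLoop N} (hX : (ξ, X) ∈ F.domC) (Y Z : CLoop N) :
    pair (mulC (F.hessC ξ X) Y) Z = pair Y (mulC (F.hessC ξ X) Z) := by
  rw [pair_apply, pair_apply]
  refine integral_congr fun s _ => ?_
  simp only [mulC_apply, F.hessC_coe hX]
  exact F.inner_hessian_comm (F.mem_domC.1 hX).1 ((F.mem_domC.1 hX).2 s) _ _

lemma iteratedDeriv_pair_gradC (hξ : ξ ∈ F.J) {x : Loop N} (hx : F.Admissible x) (f : Loop N) : F.T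
    ξ * iteratedDeriv 2 (fun r : ℝ => pair (F.gradC ξ (circ x + r • circ f)) (circ f)) 0 = ∫ t in (0
    : ℝ)..F.T ξ, iteratedFDeriv ℝ 3 (F.U ξ) (F.traj ξ x t) (fun _ => F.traj ξ f t) := by
  have hd := F.mem_domC_circ hξ hx
  have hline : SmoothAt (fun r : ℝ => (ξ, circ x + r • circ f)) 0 := by fun_prop
  have hl0 : (ξ, circ x + (0 : ℝ) • circ f) = (ξ, circ x) := by rw [zero_smul_cLoop, add_zero]
  obtain ⟨G, hG⟩ : ∃ G : ℝ → CLoop N, G = fun r => F.gradC ξ (circ x + r • circ f) := ⟨_, rfl⟩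
  have hGs : SmoothAt G 0 := by
    rw [hG]; exact ContDiffAt.comp (0 : ℝ)
      (f := fun r : ℝ => (ξ, circ x + r • circ f)) (by rw [hl0]; exact F.contDiffOn_gradC.contDiffAt (F.isOpen_domC.mem_nhds hd)) hline
  have hev : ∀ᶠ r : ℝ in 𝓝 0, (ξ, circ x + r • circ f) ∈ F.domC :=
    hline.continuousAt.preimage_mem_nhds (F.isOpen_domC.mem_nhds (by rw [hl0]; exact hd))
  have h1 : iteratedDeriv 2 (fun r : ℝ => pair (F.gradC ξ (circ x + r • circ f)) (circ f)) 0 = pair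
    (iteratedDeriv 2 G 0) (circ f) := by
    rw [pair_comm, ← (iteratedDeriv_two_clm (pair (circ f)) hGs), hG]; simp only [pair_comm]
  rw [h1, pair_apply, ← F.integral_traj hξ]
  refine integral_congr fun τ _ => ?_
  obtain ⟨s, hs⟩ : ∃ s, s = τ / F.T ξ := ⟨_, rfl⟩
  simp only [traj, ← hs]
  rw [circ_coe]
  have h3 : ∀ r : ℝ, (ξ, circ x + r • circ f) ∈ F.domC → (x : ℝ → Conf N) s + r • (f : ℝ → Conf N) s
    ∈ F.Ω := fun r hr => by
    have := (F.mem_domC.1 hr).2 s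
    rwa [ContinuousMap.add_apply, ContinuousMap.smul_apply, circ_coe, circ_coe] at this
  have h5 : inner ℝ ((iteratedDeriv 2 G 0) (s : UnitAddCircle)) ((f : ℝ → Conf N) s) = iteratedDeriv
    2 (fun r => inner ℝ ((f : ℝ → Conf N) s) (G r (s : UnitAddCircle))) 0 := by
    rw [real_inner_comm]
    exact (iteratedDeriv_two_clm ((innerSL ℝ ((f : ℝ → Conf N) s)).comp (evalCLM ℝ (s : UnitAddCircle))) hGs).symm
  rw [h5]
  have h6 : (fun r => inner ℝ ((f : ℝ → Conf N) s) (G r (s : UnitAddCircle))) =ᶠ[𝓝 0] deriv fun r =>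
    F.U ξ ((x : ℝ → Conf N) s + r • (f : ℝ → Conf N) s) := by
    filter_upwards [hev] with r hr
    have h7 := ((F.contDiffAt_U hξ (h3 r hr)).toFDeriv).comp_hasDerivAt
      r (hasDerivAt_line ((x : ℝ → Conf N) s) ((f : ℝ → Conf N) s) r)
    have h8 : deriv (fun r => F.U ξ ((x : ℝ → Conf N) s + r • (f : ℝ → Conf N) s)) r = _ := h7.deriv
    rw [h8, hG, F.gradC_coe hr, ContinuousMap.add_apply, ContinuousMap.smul_apply, circ_coe,
      circ_coe, real_inner_comm, F.inner_gradient]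
  rw [h6.iteratedDeriv_eq, ← iteratedDeriv_succ', iteratedDeriv_line F.isOpen_Ω (fun y hy => (F.contDiffAt_U hξ hy).contDiffWithinAt) _ _ 3 0
    (h3 0 hev.self_of_nhds), zero_smul, add_zero]

lemma sum_sq_of_norm {e : Coord t} (he : ‖e‖ = 1) : ∑ i, e i * e i = 1 := by
  have h := EuclideanSpace.real_norm_sq_eq e
  grind

lemma IsLocal.SLS_zero (L : F.IsLocal ξ0 J1 φ v Q ψ w) (hp : (ξ, 0) ∈ Q) :
    Ψ ξ 0 = F.q ξ ∧ Λ ξ 0 = 0 := by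
  have h : Ψ ξ 0 = F.q ξ := circ_injective (by
    have h1 := (L.solution _ hp).circ_point_eq; rw [baseC_zero, L.zero_eq _ hp] at h1
    exact h1.trans (add_zero _))
  exact ⟨h, by rw [SLS, h, sub_self]⟩

lemma eventually_ray_mem (hQ : IsOpen Q) (hp : (ξ, 0) ∈ Q) (e : Coord t) :
    ∀ᶠ r : ℝ in 𝓝 0, (ξ, r • e) ∈ Q := by
  have := eventually_line_mem hQ hp e
  simpa only [zero_add] using this

section

variable (L : F.IsLocal ξ0 J1 φ v Q ψ w) (H : F.Setting ξ0 κ t J1 φ v)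
include L H

lemma IsLocal.deriv_SLS_ray (hp : (ξ, 0) ∈ Q) (e : Coord t) : deriv (fun r : ℝ => Λ
    ξ (r • e)) =ᶠ[𝓝 0] fun r => -∑ i, (ψ (ξ, r • e)).2 (inl i) * e i := by
  filter_upwards [eventually_ray_mem L.isOpen hp e] with r hr
  exact (L.hasDerivAt_SLS_ray H hr).deriv

lemma IsLocal.coeff_two (hp : (ξ, 0) ∈ Q) {e : Coord t} (he : ‖e‖ = 1) : F.coeff φ w 2 ξ e =
    κ ξ := by
  have h3 : HasDerivAt (fun r : ℝ => -∑ i, (ψ (ξ, r • e)).2 (inl i) * e i)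
      (-∑ i, -(κ ξ * e i) * e i) 0 :=
    (HasDerivAt.fun_sum fun i _ => ((hasDerivAt_pi.1 ((snd ℝ (CLoop N) (Fin t.dim ⊕ Fin n → ℝ)).hasFDerivAt.comp_hasDerivAt (0 : ℝ) (L.hasDerivAt_ψ H hp e))) (inl i)).mul_const (e i)).neg
  rw [coeff, iteratedDeriv_succ, iteratedDeriv_one, (L.deriv_SLS_ray H hp e).deriv_eq, h3.deriv]
  have h4 : ∀ i, -(κ ξ * e i) * e i = -κ ξ * (e i * e i) := fun i => by ring
  simp only [h4]
  rw [← mul_sum, sum_sq_of_norm he]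
  ring

lemma IsLocal.coeff_three (hp : (ξ, 0) ∈ Q) (e : Coord t) : F.coeff φ w 3 ξ e = ∫ t in (0 : ℝ)..F.T
    ξ, iteratedFDeriv ℝ 3 (F.U ξ) (F.traj ξ (F.q ξ) t) (fun _ => F.traj ξ (crit φ ξ e) t) := by
  have hξ := (L.dom _ hp).1
  have hJ := H.frame.subset hξ
  have hqa := F.q_admissible hJ
  have hd := F.mem_domC_circ hJ hqa
  obtain ⟨f, hf⟩ : ∃ f, f = crit φ ξ e := ⟨_, rfl⟩
  obtain ⟨χ, hχ⟩ : ∃ χ, χ = F.mC ξ (circ (dLoop (dLoop f))) := ⟨_, rfl⟩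
  obtain ⟨X, hX⟩ : ∃ X : ℝ → CLoop N, X = fun r => F.baseC φ (ξ, r • e) + (ψ (ξ, r • e)).1 :=
    ⟨_, rfl⟩
  have hmem := eventually_ray_mem L.isOpen hp e
  have hbase : ∀ r : ℝ, F.baseC φ (ξ, r • e) = circ (F.q ξ) + r • circ f := fun r => by
    have := baseC_add_smul (F := F) φ ξ 0 e r; rwa [zero_add, baseC_zero, ← hf] at this
  have hz : ψ (ξ, (0 : ℝ) • e) = 0 := by
    rw [zero_smul]; exact L.zero_eq _ hp
  have hX0 : X 0 = circ (F.q ξ) := by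
    rw [hX]; simp only; rw [hbase, hz, zero_smul_cLoop, add_zero]; exact add_zero _
  have hXs : SmoothAt X 0 := by
    rw [hX]; exact ContDiffAt.comp 0 (f := fun r : ℝ => (ξ, r • e))
      (((L.toIsReduction.contDiffOn_pos H)).contDiffAt (L.isOpen.mem_nhds (by
        rw [zero_smul]; exact hp))) (by fun_prop)
  have hXd : deriv X 0 = circ f := by
    have h3 : HasDerivAt X (circ f + 0) 0 := by
      rw [hX]; simp only [hbase]
      exact (hasDerivAt_line (circ (F.q ξ)) (circ f) 0).add ((fst ℝ (CLoop N) (Fin t.dim ⊕ Fin n → ℝ)).hasFDerivAt.comp_hasDerivAt (0 : ℝ) (L.hasDerivAt_ψ H hp e))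
    rw [h3.deriv, add_zero]
  have horth : pair (circ f) (iteratedDeriv 2 X 0) = 0 := by
    have h1 : ∀ i, pair (F.bC φ v ξ (inl i)) (iteratedDeriv 2 X 0) = 0 := fun i => by
      rw [← iteratedDeriv_two_clm _ hXs]
      refine iteratedDeriv_two_eq (f' := fun _ => pair (F.bC φ v ξ (inl i)) (circ f)) ?_
        (hasDerivAt_const _ _)
      filter_upwards [hmem.eventually_nhds] with r hr
      refine (hasDerivAt_line (pair (F.bC φ v ξ (inl i)) (circ (F.q ξ)))
        (pair (F.bC φ v ξ (inl i)) (circ f)) r).congr_of_eventuallyEq ?_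
      filter_upwards [hr] with r' hr'; rw [hX]; simp only
      rw [hbase, map_add, map_add, map_smul, L.toIsReduction.l2_eq_zero hr', add_zero]
    rw [hf, crit, map_sum, map_sum, _root_.sum_apply]; refine sum_eq_zero fun i _ => ?_
    rw [map_smul, map_smul]; change e i • pair (F.bC φ v ξ (inl i)) (iteratedDeriv 2 X 0) = 0
    rw [h1, smul_zero]
  have hder : deriv (fun r => Λ ξ (r • e)) =ᶠ[𝓝 0] fun r => F.T ξ * (pair (F.gradC ξ (X r)) (circ f)
    - pair χ (X r)) := by
    filter_upwards [L.deriv_SLS_ray H hp e, hmem] with r h1 h2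
    have h3 := L.pair_elC H h2 (X := circ f) fun j => by rw [hf]
    simp only at h3; rw [h1, ← h3]; have h4 : X r = circ (Ψ ξ (r • e)) := by
      rw [hX]; exact (L.solution _ h2).circ_point_eq.symm
    rw [elC, map_sub, _root_.sub_apply, h4, hχ]; have h6 := F.pair_mC_dLoop ξ f (Ψ ξ (r • e))
    rw [F.pair_mC_comm, pair_comm] at h6
    rw [neg_injective ((F.pair_mC_dLoop ξ (Ψ ξ (r • e)) f).symm.trans h6)]
  have hh : SmoothAt (fun Y => pair (F.gradC ξ Y) (circ f)) (X 0) := by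
    rw [hX0]; have h2 : Smooth fun Z => pair Z (circ f) := by fun_prop
    exact (h2.contDiffAt.comp _ (ContDiffAt.comp (circ (F.q ξ)) (F.contDiffOn_gradC.contDiffAt (F.isOpen_domC.mem_nhds hd)) (by fun_prop))).congr_of_eventuallyEq (of_forall fun _ => rfl)
  have hline0 : circ (F.q ξ) + (0 : ℝ) • circ f = circ (F.q ξ) := by rw [zero_smul_cLoop, add_zero]
  have e1 := iteratedDeriv_two_comp hh hXs
  have e2 := iteratedDeriv_two_comp (γ := fun r => circ (F.q ξ) + r • circ f) (x := 0) (h := fun Y :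
    CLoop N => pair (F.gradC ξ Y) (circ f)) (by rw [hline0, ← hX0]; exact hh) (by fun_prop)
  have e0 : deriv (fun r : ℝ => circ (F.q ξ) + r • circ f) 0 = circ f :=
    (hasDerivAt_line _ _ (0 : ℝ)).deriv
  rw [iteratedDeriv_two_eq (of_forall fun r => hasDerivAt_line _ _ r) (hasDerivAt_const _ _), map_zero, add_zero, hline0, e0] at e2
  rw [hXd, hX0, ← e2] at e1
  have e4 : fderiv ℝ (fun Y => pair (F.gradC ξ Y) (circ f)) (circ (F.q ξ)) (iteratedDeriv 2 X 0) =
    pair χ (iteratedDeriv 2 X 0) := by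
    have h1 := (pair (circ f)).hasFDerivAt.comp _ (F.hasFDerivAt_gradC hd)
    have h2 : (fun Y => pair (F.gradC ξ Y) (circ f)) = pair (circ f) ∘ F.gradC ξ :=
      funext fun Y => pair_comm _ _
    rw [h2, h1.fderiv, ContinuousLinearMap.comp_apply, pair_comm, pair_mulC_hessC_comm hd,
      pair_comm]
    have h3 : mulC (F.hessC ξ (circ (F.q ξ))) (circ f) = κ ξ • circ f + χ := by
      have h4 := F.circ_hessLoop hJ hqa f; have h5 : F.hessLoop hJ hqa f = κ ξ • f := by
        rw [hf]; exact ((F.isMode_iff hJ _ _).1 (H.isMode_crit hξ e)).1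
      rw [h5, map_smul, ← hχ] at h4; exact (sub_eq_iff_eq_add.1 h4.symm)
    rw [h3, map_add, _root_.add_apply, map_smul, _root_.smul_apply, horth, smul_zero, zero_add]
  rw [e4] at e1
  have hh' : SmoothAt (fun r => pair (F.gradC ξ (X r)) (circ f)) 0 := hh.comp 0 hXs
  have hp' : SmoothAt (fun r => pair χ (X r)) 0 := (pair χ).contDiff.contDiffAt.comp 0 hXs
  rw [← hf, ← iteratedDeriv_pair_gradC hJ hqa f, coeff, iteratedDeriv_succ', hder.iteratedDeriv_eq,
    iteratedDeriv_const_mul_field, iteratedDeriv_fun_sub (hh'.of_le (by norm_cast)) (hp'.of_le (by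
    norm_cast)), e1, iteratedDeriv_two_clm (pair χ) hXs, add_sub_cancel_right]

lemma IsLocal.reducedExpansion : F.ReducedExpansion φ w ξ0 κ := by
  have hQ := L.isOpen.mem_nhds L.mem
  refine ⟨(L.contDiffOn_SLS H).contDiffAt hQ, ?_, ?_⟩
  · obtain ⟨c, hc⟩ := exists_norm_le_sq ((L.smooth.contDiffAt hQ).fst)
      (by filter_upwards [L.zero_mem] with ξ hξ; rw [L.zero_eq _ hξ]; rfl)
      (by
        filter_upwards [L.zero_mem] with ξ hξ e; exact (fst ℝ (CLoop N)
          (Fin t.dim ⊕ Fin n → ℝ)).hasFDerivAt.comp_hasDerivAt 0 (L.hasDerivAt_ψ H hξ e))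
    refine ⟨c, ?_⟩; filter_upwards [hc, hQ] with p hp hpQ s; refine (norm_apply_le _ s).trans ?_
    rwa [(L.solution p hpQ).circ_eq]
  · filter_upwards [L.zero_mem] with ξ hξ e he
    refine ⟨?_, ?_, L.coeff_two H hξ he, L.coeff_three H hξ e⟩
    · rw [coeff, iteratedDeriv_zero, zero_smul, (L.SLS_zero hξ).2]
    · rw [coeff, iteratedDeriv_one, (L.deriv_SLS_ray H hξ e).self_of_nhds]; simp only
      rw [zero_smul, L.zero_eq _ hξ]; simp

lemma IsLocal.hasFDerivAt_zero_iff {u : Coord t} (hp : (ξ, u) ∈ Q) : HasFDerivAt (Λ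
    ξ) (0 : Coord t →L[ℝ] ℝ) u ↔ F.IsSolution ξ (Ψ ξ u) := by
  have hJ := H.frame.subset (L.dom _ hp).1
  have hx := L.toIsReduction.admissible hp (L.solution _ hp)
  rw [F.isSolution_iff hJ hx]
  have hline : ∀ e : Coord t, u = u + (0 : ℝ) • e := fun e => by rw [zero_smul, add_zero]
  constructor
  · intro h; have h1 : ∀ i, (ψ (ξ, u)).2 (inl i) = 0 := fun i => by
      have h3 := (h.comp_hasDerivAt_of_eq (0 : ℝ) (hasDerivAt_line u (EuclideanSpace.single i 1) 0) (hline _)).unique (L.hasDerivAt_SLS H hp (EuclideanSpace.single i 1))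
      rw [_root_.zero_apply, Finset.sum_eq_single i] at h3
      · simpa using h3.symm
      · intro j _ hj; simp [hj]
      simp
    have h2 := (L.solution _ hp).elC_eq
    simp only [Fintype.sum_sum_type, h1, zero_smul_cLoop, Finset.sum_const_zero, zero_add] at h2
    have h3 := L.independent _ hp (fun k => (ψ (ξ, u)).2 (inr k)) fun l => by
      have h4 := F.pair_elC_symLoop hJ hx (H.basis.mem l)
      rw [h2, pair_comm, map_neg, map_sum, neg_eq_zero] at h4; rw [← h4]
      refine sum_congr rfl fun k _ => ?_; rw [map_smul, pair_comm, smul_eq_mul]; rfl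
    rw [h2]
    simp only [fun k => congrFun h3 k, Pi.zero_apply, zero_smul_cLoop, Finset.sum_const_zero,
      neg_zero]
  · intro h; have hdiff : DifferentiableAt ℝ (Λ ξ) u := by
      exact DifferentiableAt.comp (g := fun p : ℝ × Coord t => Λ p.1 p.2)
        (f := fun u : Coord t => (ξ, u)) u (((L.contDiffOn_SLS H).contDiffAt (L.isOpen.mem_nhds hp)).differentiableAt (by simp)) (by fun_prop)
    have h1 : fderiv ℝ (Λ ξ) u = 0 := ContinuousLinearMap.ext fun e => by
      have h3 := L.pair_elC H hp (e := e) fun j => rfl; simp only at h3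
      rw [(hdiff.hasFDerivAt.comp_hasDerivAt_of_eq 0 (hasDerivAt_line u e 0) (hline e)).unique (L.hasDerivAt_SLS H hp e), ← h3, h, map_zero]
      simp
    rw [← h1]; exact hdiff.hasFDerivAt

end

def coordC (F : SymmetricFamily N) (φ : ℝ → Fin t.dim → Loop N) (ξ : ℝ) (X : CLoop N) : Coord t :=
  WithLp.toLp 2 fun i => F.T ξ * pair (circ (φ ξ i)) X

lemma coordC_apply (ξ : ℝ) (X : CLoop N) (i : Fin t.dim) :
    F.coordC φ ξ X i = F.T ξ * pair (circ (φ ξ i)) X := rfl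

section

variable (L : F.IsLocal ξ0 J1 φ v Q ψ w) (H : F.Setting ξ0 κ t J1 φ v)
include L H

lemma IsLocal.coordC_point {p : ℝ × Coord t} (hp : p ∈ Q) : F.coordC φ p.1 (circ (Ψ p.1
    p.2) - circ (F.q p.1)) = p.2 := by
  refine PiLp.ext fun i => ?_
  have h1 : circ (Ψ p.1 p.2) - circ (F.q p.1) = circ (crit φ p.1 p.2) + (ψ p).1 := by
    rw [(L.solution p hp).circ_point_eq, ← circ_base, map_add]; abel
  have h2 : pair (circ (φ p.1 i)) (ψ p).1 = 0 := L.toIsReduction.l2_eq_zero hp (inl i)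
  rw [coordC_apply, h1, map_add, h2, add_zero]
  exact H.pair_bC_crit_inl (L.dom p hp).1 _ _

lemma IsLocal.point_injective {u u' : Coord t} (hu : (ξ, u) ∈ Q) (hu' : (ξ, u') ∈ Q) (h :
    Ψ ξ u = Ψ ξ u') : u = u' := by
  have h1 := L.coordC_point H hu
  have h2 := L.coordC_point H hu'
  simp only at h1 h2
  rw [← h1, ← h2, h]

end

section

variable (H : F.Setting ξ0 κ t J1 φ v)
include H

lemma Setting.continuousAt_circ_frame (i : Fin t.dim) : ContinuousAt (fun ξ => circ (φ ξ i)) ξ0 :=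
  ((H.contDiffOn_bC (inl i)).contDiffAt (H.frame.isOpen.mem_nhds H.frame.mem)).continuousAt

lemma Setting.continuousAt_coordC : ContinuousAt (fun z : ℝ × CLoop N => F.coordC φ z.1 z.2) (ξ0, 0)
    := by
  exact (PiLp.continuous_toLp 2 _).continuousAt.comp (continuousAt_pi.2 fun i => (ContinuousAt.comp (F.T_smooth.contDiffAt (F.isOpen_J.mem_nhds H.critical.mem)).continuousAt continuousAt_fst).mul (continuousAt_pair (ContinuousAt.comp (g := fun ξ => circ (φ ξ i)) (x := (ξ0, 0)) (H.continuousAt_circ_frame i) continuousAt_fst) continuousAt_snd))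

lemma Setting.continuousAt_crit {Z : Type} [TopologicalSpace Z] {z : Z} {f : Z → ℝ} {u : Z → Coord
    t} (hf : ContinuousAt f z) (hz : f z = ξ0) (hu : ContinuousAt u z) : ContinuousAt (fun z => circ
    (crit φ (f z) (u z))) z := by
  have h2 : ContinuousAt (fun z => ∑ i, u z i • circ (φ (f z) i)) z :=
    tendsto_finsetSum _ fun i _ => by
      have h3 : ContinuousAt (fun z => u z i) z := by fun_prop
      exact h3.smul ((fun i => ContinuousAt.comp_of_eq (H.continuousAt_circ_frame i) hf hz) i)
  refine h2.congr (of_forall fun z => ?_)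
  simp [crit, map_sum]

end

lemma crit_zero_param (ξ : ℝ) : circ (crit φ ξ (0 : Coord t)) = 0 := by rw [crit_zero, map_zero]

section

variable (L : F.IsLocal ξ0 J1 φ v Q ψ w)
include L

lemma IsLocal.exists_near (H : F.Setting ξ0 κ t J1 φ v) {η : ℝ} (hη : 0 < η) : ∃ ε > 0, ∀ᶠ ξ in 𝓝
    ξ0, ∀ x ∈ F.nearSolutions ξ ε, ∃ u : Coord t, ‖u‖ < η ∧ x = Ψ ξ u := by
  have hc := H.continuousAt_coordC
  have hc0 : F.coordC φ ξ0 (0 : CLoop N) = 0 := PiLp.ext fun i => by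
    rw [coordC_apply, map_zero, mul_zero]; rfl
  have h1 : ContinuousAt (fun z : ℝ × CLoop N => (((z.1, F.coordC φ z.1 z.2), z.2 - circ (crit φ z.1
    (F.coordC φ z.1 z.2))) : (ℝ × Coord t) × CLoop N)) (ξ0, 0) := (continuousAt_fst.prodMk
    hc).prodMk (continuousAt_snd.sub (H.continuousAt_crit continuousAt_fst rfl hc))
  have hev : ∀ᶠ y in 𝓝 (((ξ0, 0), 0) : (ℝ × Coord t) × CLoop N), y.1 ∈ Q ∧ ‖y.1.2‖ < η ∧ ∀ c,
    F.lsMap φ v (y.1, y.2, c) = 0 → (y.2, c) = ψ y.1 := by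
    have e2 : ∀ᶠ y in 𝓝 (((ξ0, 0), 0) : (ℝ × Coord t) × CLoop N), ‖y.1.2‖ < η := by
      have : ContinuousAt (fun y : (ℝ × Coord t) × CLoop N => ‖y.1.2‖) ((ξ0, 0), 0) := by fun_prop
      exact this.eventually (gt_mem_nhds (by simpa using hη))
    filter_upwards [continuousAt_fst.eventually (L.isOpen.mem_nhds L.mem), e2, L.unique] with y a b c using ⟨a, b, c⟩
  have h2 : ∀ᶠ z : ℝ × CLoop N in 𝓝 (ξ0, 0), (z.1, F.coordC φ z.1 z.2) ∈ Q ∧ ‖F.coordC φ z.1 z.2‖ <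
    η ∧ ∀ c, F.lsMap φ v ((z.1, F.coordC φ z.1 z.2), z.2 - circ (crit φ z.1 (F.coordC φ z.1 z.2)),
    c) = 0 → (z.2 - circ (crit φ z.1 (F.coordC φ z.1 z.2)), c) = ψ (z.1, F.coordC φ z.1 z.2) := by
    have h3 : (((ξ0, F.coordC φ ξ0 (0 : CLoop N)), 0 - circ (crit φ ξ0 (F.coordC φ ξ0 (0 : CLoop
      N)))) : (ℝ × Coord t) × CLoop N) = ((ξ0, 0), 0) := by
      rw [hc0, crit_zero_param, sub_zero]
    rw [ContinuousAt] at h1; simp only [h3] at h1; exact h1.eventually hev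
  obtain ⟨ε, hε, hball⟩ := eventually_nhds_iff_ball.1 h2
  refine ⟨ε / 2, half_pos hε, ?_⟩
  filter_upwards [ball_mem_nhds ξ0 hε, L.zero_mem] with ξ hξ hξQ x hx
  obtain ⟨hsol, hnear, htr⟩ := hx
  obtain ⟨h, hh⟩ : ∃ h, h = x - F.q ξ := ⟨_, rfl⟩
  rw [← hh] at htr
  have hnorm : ‖circ h‖ < ε := by
    refine (norm_circ_le (half_pos hε).le fun s => ?_).trans_lt (half_lt_self hε); rw [hh]
    exact (hnear s).le
  obtain ⟨hQ, hu, huniq⟩ := hball (ξ, circ h) (by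
    rw [mem_ball, Prod.dist_eq, max_lt_iff, dist_zero_right]; exact ⟨hξ, hnorm⟩)
  simp only at hQ hu huniq
  obtain ⟨u, hu'⟩ : ∃ u, u = F.coordC φ ξ (circ h) := ⟨_, rfl⟩
  rw [← hu'] at hQ hu huniq
  have hξJ := (L.dom _ hQ).1
  have hJ := H.frame.subset hξJ
  rw [(map_sub _ _ _).symm] at huniq
  have hpt : F.q ξ + crit φ ξ u + (h - crit φ ξ u) = x := by
    rw [hh]; abel
  have hbase : F.baseC φ (ξ, u) + circ (h - crit φ ξ u) = circ x := by
    rw [← circ_base, ← map_add, hpt]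
  have hls := huniq 0 ((lsMap_eq_zero_iff (p := (ξ, u)) hJ (by
    rw [hbase]; exact F.mem_domC_circ hJ hsol.1) 0).2 ⟨_, rfl, ?_, ?_⟩)
  · refine ⟨u, hu, ?_⟩; have h3 : circ (w ξ u) = circ (h - crit φ ξ u) := by
      have h4 := (L.solution _ hQ).circ_eq; rw [← hls] at h4; exact h4
    rw [point, circ_injective h3, hpt]
  · simp only; rw [hpt, (F.isSolution_iff hJ hsol.1).1 hsol]; simp [zero_smul_cLoop]
  · rintro (i | k)
    · have h3 : F.T ξ * pair (circ (φ ξ i)) (circ (h - crit φ ξ u)) = 0 := by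
        have h4 := coordC_apply (F := F) (φ := φ) ξ (circ h) i; rw [← hu'] at h4
        rw [map_sub, map_sub, mul_sub, ← h4]; exact sub_eq_zero.2 (H.pair_bC_crit_inl hξJ u i).symm
      exact (mul_eq_zero.1 h3).resolve_left (F.T_ne hJ)
    · change l2 (symLoop (F.q ξ) (v k)) (h - crit φ ξ u) = 0
      rw [l2_comm, map_sub, LinearMap.sub_apply, (F.transverse_iff_l2 hJ _).1 htr _ (mem_zeroModes
        (H.basis.mem k)), (F.transverse_iff_l2 hJ _).1 (H.isMode_crit hξJ u).2 _ (mem_zeroModes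
        (H.basis.mem k)), sub_zero]

lemma IsLocal.isNoncritical_w {p : ℝ × Coord t} (hp : p ∈ Q) : F.IsNoncritical φ p.1 (w p.1 p.2) :=
    by
  refine (L.noncritical p hp _).2 fun j => ?_
  rw [l2_apply, (L.solution p hp).circ_eq]
  exact L.toIsReduction.l2_eq_zero hp j

lemma IsLocal.mem_nearSolutions (H : F.Setting ξ0 κ t J1 φ v) {ε : ℝ} (hε : 0 < ε) : ∀ᶠ p in 𝓝 (ξ0,
    (0 : Coord t)), F.IsSolution p.1 (Ψ p.1 p.2) → Ψ p.1 p.2 ∈ F.nearSolutions p.1 ε := by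
  have hQ := L.isOpen.mem_nhds L.mem
  have hs : Tendsto (fun p => circ (Ψ p.1 p.2 - F.q p.1)) (𝓝 (ξ0, 0)) (𝓝 0) := by
    have h3 : Tendsto (fun p => circ (crit φ p.1 p.2) + (ψ p).1) (𝓝 (ξ0, 0))
        (𝓝 (circ (crit φ ξ0 0) + (ψ (ξ0, 0)).1)) := Tendsto.add (H.continuousAt_crit continuousAt_fst rfl continuousAt_snd) ((L.smooth.contDiffAt hQ).continuousAt.fst)
    rw [crit_zero_param, L.zero] at h3
    have h4 : Tendsto (fun p => circ (crit φ p.1 p.2) + (ψ p).1) (𝓝 (ξ0, 0)) (𝓝 0) := by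
      simpa using h3
    refine h4.congr' ?_; filter_upwards [hQ] with p hp
    rw [map_sub, (L.solution p hp).circ_point_eq, ← circ_base, map_add]; abel
  filter_upwards [eventually_norm_lt hs hε, hQ] with p h1 hp h2
  refine ⟨h2, h1, ?_⟩
  have hJ := H.frame.subset (L.dom p hp).1
  have h3 : Ψ p.1 p.2 - F.q p.1 = crit φ p.1 p.2 + w p.1 p.2 := by
    rw [point]; abel
  rw [h3, F.transverse_iff_l2 hJ]
  intro z hz
  rw [map_add, LinearMap.add_apply, (F.transverse_iff_l2 hJ _).1 (H.isMode_crit (L.dom p hp).1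
    p.2).2 z hz, (F.transverse_iff_l2 hJ _).1 (L.isNoncritical_w hp).1 z hz, add_zero]

end

lemma Setting.isNoncritical_ρ (H : F.Setting ξ0 κ t J1 φ v) (hξ : ξ ∈ J1) {h : Loop N}
    (hh : F.IsNoncritical φ ξ h) (g : D6) : F.IsNoncritical φ ξ (F.ρ g h) := by
  have hJ := H.frame.subset hξ
  refine ⟨H.critical.transverse_ρ hJ hh.1 g, fun i => (F.ip_eq_zero hJ _ _).2 ?_⟩
  obtain ⟨c, hc⟩ := (H.frame.isFrame hξ).exists_sum H.critical hJ
    (H.critical.mode_ρ hJ (H.frame.mode ξ hξ i) g⁻¹)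
  rw [F.l2_ρ_left hJ, hc, map_sum]
  refine sum_eq_zero fun j _ => ?_
  rw [map_smul, (F.ip_eq_zero hJ _ _).1 (hh.2 j), smul_zero]

lemma Setting.stationary_ρ (H : F.Setting ξ0 κ t J1 φ v) (hξ : ξ ∈ J1) {x : Loop N} (hx :
    F.Admissible x) (hs : ∀ h : Loop N, F.IsNoncritical φ ξ h → HasDerivAt (fun s : ℝ => F.action ξ
    (x + s • h : Loop N)) 0 0) (g : D6) (h : Loop N) (hh : F.IsNoncritical φ ξ h) : HasDerivAt (fun
    s : ℝ => F.action ξ (F.ρ g x + s • h : Loop N)) 0 0 := by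
  have hJ := H.frame.subset hξ
  refine (hs _ (H.isNoncritical_ρ hξ hh g⁻¹)).congr_of_eventuallyEq ?_
  filter_upwards [F.admissible_eventually hJ hx (F.ρ g⁻¹ h)] with s hs
  rw [← F.ρ_action ξ hJ g _ hs, map_add, map_smul, F.ρ_inv_apply]

section

variable (L : F.IsLocal ξ0 J1 φ v Q ψ w) (H : F.Setting ξ0 κ t J1 φ v)
include L H

lemma IsLocal.continuousAt_circ_dLoop_w : Tendsto (fun p : ℝ × Coord t => circ (dLoop (w p.1 p.2)))
    (𝓝 (ξ0, 0)) (𝓝 0) := by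
  have hQ := L.isOpen.mem_nhds L.mem
  have h3 : ContinuousAt (fun p : ℝ × Coord t => ∑ i, p.2 i • circ (dLoop (φ p.1 i))) (ξ0, 0) :=
    tendsto_finsetSum _ fun i _ => by
      have h4 : ContinuousAt (fun p : ℝ × Coord t => p.2 i) (ξ0, 0) := by fun_prop
      exact h4.smul (ContinuousAt.comp_of_eq (g := fun ξ => circ (dLoop (φ ξ i))) ((fun i => ((((H.smoothPeriodic_frame i).deriv H.frame.isOpen).contDiffOn_toCircle H.frame.isOpen).contDiffAt (H.frame.isOpen.mem_nhds H.frame.mem)).continuousAt) i) continuousAt_fst rfl)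
  have heq : ∀ p ∈ Q, F.velC φ v ψ p - (circ (dLoop (F.q p.1)) + ∑ i, p.2 i • circ (dLoop (φ p.1
    i))) = circ (dLoop (w p.1 p.2)) := fun p hp => by
    rw [← L.toIsReduction.circ_dLoop_point hp (L.solution p hp), point, crit]
    simp only [map_add, map_sum, map_smul]; abel
  have h7 : w ξ0 0 = 0 := circ_injective (by
    rw [map_zero]; have := (L.solution _ L.mem).circ_eq; rw [L.zero] at this; exact this)
  have h8 := heq _ L.mem
  simp only at h8
  rw [h7, map_zero, map_zero] at h8
  have h9 : Tendsto (fun p => F.velC φ v ψ p - (circ (dLoop (F.q p.1))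
      + ∑ i, p.2 i • circ (dLoop (φ p.1 i)))) (𝓝 (ξ0, 0))
      (𝓝 (F.velC φ v ψ (ξ0, 0) - (circ (dLoop (F.q ξ0))
      + ∑ i, (0 : Coord t) i • circ (dLoop (φ ξ0 i))))) := Tendsto.sub (((L.toIsReduction.contDiffOn_velC H).contDiffAt hQ).continuousAt) (Tendsto.add (ContinuousAt.comp_of_eq (g := fun ξ => circ (dLoop (F.q ξ))) ((((F.smoothPeriodic_q.deriv F.isOpen_J).contDiffOn_toCircle F.isOpen_J).contDiffAt (F.isOpen_J.mem_nhds H.critical.mem)).continuousAt) continuousAt_fst rfl) h3)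
  rw [h8] at h9
  refine h9.congr' ?_
  filter_upwards [hQ] with p hp using heq p hp

lemma IsLocal.ρ_point (g : D6) {A : Coord t → Coord t} (hA : Continuous A) (hA0 : A 0 = 0) (hg : ∀ ξ
    ∈ J1, ∀ u, F.ρ g (crit φ ξ u) = crit φ ξ (A u)) : ∀ᶠ p in 𝓝 (ξ0, (0 : Coord t)), F.ρ g (F.point
    φ w p.1 p.2) = Ψ p.1 (A p.2) := by
  have hQ := L.isOpen.mem_nhds L.mem
  have hA' : Tendsto (fun p : ℝ × Coord t => (p.1, A p.2)) (𝓝 (ξ0, 0)) (𝓝 (ξ0, 0)) := by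
    have h : ContinuousAt (fun p : ℝ × Coord t => (p.1, A p.2)) (ξ0, 0) := by fun_prop
    rwa [ContinuousAt, hA0] at h
  have hw0 : Tendsto (fun p : ℝ × Coord t => circ (w p.1 p.2)) (𝓝 (ξ0, 0)) (𝓝 0) := by
    have h1 := (L.smooth.contDiffAt hQ).continuousAt.fst; rw [ContinuousAt, L.zero] at h1
    refine h1.congr' ?_; filter_upwards [hQ] with p hp using (L.solution p hp).circ_eq.symm
  obtain ⟨C, hC⟩ := F.exists_norm_ρ_le H.critical.mem
  have hρ0 : Tendsto (fun p : ℝ × Coord t => circ (F.ρ g (w p.1 p.2))) (𝓝 (ξ0, 0)) (𝓝 0) := by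
    refine tendsto_circ fun ε hε => ?_; obtain ⟨l, hl, hlε⟩ : ∃ l > 0, C * l < ε := by
      refine ⟨ε / (2 * (|C| + 1)), by positivity, ?_⟩
      rw [mul_div_assoc', div_lt_iff₀ (by positivity)]
      nlinarith [le_abs_self C, abs_nonneg C]
    filter_upwards [eventually_norm_lt hw0 hl, eventually_norm_lt (L.continuousAt_circ_dLoop_w H) hl]
      with p h1 h2 s
    exact (hC g _ l hl (fun s => (h1 s).le) (fun s => (h2 s).le) s).trans_lt hlε
  filter_upwards [hQ, hA'.eventually hQ, (hA'.prodMk_nhds hρ0).eventually L.unique] with p hp hAp huniq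
  have hξ := (L.dom p hp).1
  have hJ := H.frame.subset hξ
  have hx := L.toIsReduction.admissible hp (L.solution p hp)
  have hx' := F.ρ_admissible g _ hx
  have hpt : F.ρ g (Ψ p.1 p.2) = F.q p.1 + crit φ p.1 (A p.2) + F.ρ g (w p.1 p.2) := by
    rw [point, map_add, map_add, F.ρ_q p.1 hJ, hg p.1 hξ]
  obtain ⟨c, hc⟩ := (elC_stationary_iff hJ (L.noncritical p hp) hx').1 (H.stationary_ρ hξ hx
    ((elC_stationary_iff hJ (L.noncritical p hp) hx).2 ⟨_, (L.solution p hp).elC_eq⟩) g)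
  have hls := huniq c ((lsMap_eq_zero_iff (p := (p.1, A p.2)) hJ (by
    rw [← circ_base, ← map_add, ← hpt]; exact F.mem_domC_circ hJ hx') c).2 ⟨_, rfl, by
      simp only; rw [← hpt]
      exact hc, (L.noncritical p hp _).1 (H.isNoncritical_ρ hξ (L.isNoncritical_w hp) g)⟩)
  have h3 : circ (w p.1 (A p.2)) = circ (F.ρ g (w p.1 p.2)) := by
    have h4 := (L.solution _ hAp).circ_eq; rw [← hls] at h4; exact h4
  rw [hpt, ← circ_injective h3, point]

end

end SymmetricFamily

def Irrep.linB (t : Irrep) :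
    Conf t.dim →ₗ[ℝ] Conf t.dim :=
  toEuclideanLin t.matB

def Irrep.linS (t : Irrep) :
    Conf t.dim →ₗ[ℝ] Conf t.dim :=
  toEuclideanLin t.matS

lemma toEuclideanLin_coord {d : ℕ} (A : Matrix (Fin d) (Fin d) ℝ) (u : Conf d)
    (i : Fin d) : toEuclideanLin A u i = ∑ j, A i j * u j := by
  simp [Matrix.mulVec, dotProduct]

lemma norm_toEuclideanLin_rotMatrix (α : ℝ) (u : Conf 2) :
    ‖toEuclideanLin (rotMatrix α) u‖ = ‖u‖ := by
  rw [norm_eq, norm_eq]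
  congr 1
  simp only [Fin.sum_univ_two, toEuclideanLin_coord, norm_eq_abs, sq_abs, rotMatrix]
  simp
  linear_combination (u 0 ^ 2 + u 1 ^ 2) * sin_sq_add_cos_sq α

lemma norm_toEuclideanLin_reflection (u : Conf 2) :
    ‖toEuclideanLin !![(1 : ℝ), 0; 0, -1] u‖ = ‖u‖ := by
  rw [norm_eq, norm_eq]
  congr 1
  simp only [Fin.sum_univ_two, toEuclideanLin_coord, norm_eq_abs, sq_abs]
  simp

lemma toEuclideanLin_one_apply (u : Conf 1) : toEuclideanLin (1 : Matrix (Fin 1) (Fin 1) ℝ) u = u :=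
  PiLp.ext fun i => by simp

lemma toEuclideanLin_neg_one_apply (u : Conf 1) :
    toEuclideanLin (-1 : Matrix (Fin 1) (Fin 1) ℝ) u = -u :=
  PiLp.ext fun i => by rw [toEuclideanLin_coord, Fin.sum_univ_one, elim i 0]; simp

lemma Irrep.norm_linB (t : Irrep) (u : Conf t.dim) : ‖t.linB u‖ = ‖u‖ := by
  cases t
  · exact congrArg norm (toEuclideanLin_one_apply u)
  · exact congrArg norm (toEuclideanLin_one_apply u)
  · exact (congrArg norm (toEuclideanLin_neg_one_apply u)).trans (norm_neg u)
  · exact (congrArg norm (toEuclideanLin_neg_one_apply u)).trans (norm_neg u)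
  · exact norm_toEuclideanLin_rotMatrix _ u
  · exact norm_toEuclideanLin_rotMatrix _ u

lemma Irrep.norm_linS (t : Irrep) (u : Conf t.dim) : ‖t.linS u‖ = ‖u‖ := by
  cases t
  · exact congrArg norm (toEuclideanLin_one_apply u)
  · exact (congrArg norm (toEuclideanLin_neg_one_apply u)).trans (norm_neg u)
  · exact congrArg norm (toEuclideanLin_one_apply u)
  · exact (congrArg norm (toEuclideanLin_neg_one_apply u)).trans (norm_neg u)
  · exact norm_toEuclideanLin_reflection u
  · exact norm_toEuclideanLin_reflection u

namespace SymmetricFamily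

variable {N : ℕ} {F : SymmetricFamily N} {ξ0 : ℝ} {κ : ℝ → ℝ} {t : Irrep} {J1 : Set ℝ}
  {φ : ℝ → Fin t.dim → Loop N} {n : ℕ} {v : Fin n → Gen N}
  {Q : Set (ℝ × Coord t)} {ψ : ℝ × Coord t → Unknown N t n}
  {w : ℝ → Coord t → Loop N}
local notation "Λ" => F.SLS φ w
local notation "Γ" => F.coeff φ w
local notation "Ψ" => F.point φ w

lemma ρ_crit {M : Matrix (Fin t.dim) (Fin t.dim) ℝ} {g : D6} {ξ : ℝ} (hg : ∀ j, F.ρ g (φ ξ j) = ∑ i,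
    M i j • φ ξ i) (u : Coord t) : F.ρ g (crit φ ξ u) = crit φ ξ (toEuclideanLin M u) := by
  simp only [crit, map_sum, map_smul, hg, toEuclideanLin_coord, smul_sum, Finset.sum_smul]
  rw [Finset.sum_comm]
  refine sum_congr rfl fun i _ => sum_congr rfl fun j _ => ?_
  module

/-- What the Lyapunov–Schmidt reduction says in a neighbourhood of the symmetric solution:
bifurcated solutions correspond to the critical points of an invariant function. -/
structure IsReduced {d : ℕ} (F : SymmetricFamily N) (ξ0 : ℝ) (κ : ℝ → ℝ)
    (φ : ℝ → Fin d → Loop N) (w : ℝ → EuclideanSpace ℝ (Fin d) → Loop N)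
    (AB AS : EuclideanSpace ℝ (Fin d) →ₗ[ℝ] EuclideanSpace ℝ (Fin d)) (δ : ℝ) : Prop where
  pos : 0 < δ
  mem : ξ0 ∈ F.J
  norm_B : ∀ u, ‖AB u‖ = ‖u‖
  norm_S : ∀ u, ‖AS u‖ = ‖u‖
  kappa_zero : κ ξ0 = 0
  kappa_tendsto : Tendsto κ (𝓝 ξ0) (𝓝 0)
  smooth : SmoothOn (fun p : ℝ × EuclideanSpace ℝ (Fin d) => F.SLS φ w p.1 p.2) (ball (ξ0, 0) δ)
  critical : ∀ ξ u, (ξ, u) ∈ ball (ξ0, 0) δ →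
    (HasFDerivAt (F.SLS φ w ξ) (0 : EuclideanSpace ℝ (Fin d) →L[ℝ] ℝ) u ↔ F.IsSolution ξ (F.point φ w ξ u))
  injective : ∀ ξ u u', (ξ, u) ∈ ball (ξ0, 0) δ → (ξ, u') ∈ ball (ξ0, 0) δ →
    F.point φ w ξ u = F.point φ w ξ u' → u = u'
  point_zero : ∀ ξ ∈ ball ξ0 δ, F.point φ w ξ 0 = F.q ξ
  ρ_B : ∀ ξ u, (ξ, u) ∈ ball (ξ0, 0) δ →
    F.ρ B (F.point φ w ξ u) = F.point φ w ξ (AB u)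
  ρ_S : ∀ ξ u, (ξ, u) ∈ ball (ξ0, 0) δ →
    F.ρ S (F.point φ w ξ u) = F.point φ w ξ (AS u)
  SLS_B : ∀ ξ u, (ξ, u) ∈ ball (ξ0, 0) δ → F.SLS φ w ξ (AB u) = F.SLS φ w ξ u
  SLS_S : ∀ ξ u, (ξ, u) ∈ ball (ξ0, 0) δ → F.SLS φ w ξ (AS u) = F.SLS φ w ξ u
  coeff : ∀ ξ ∈ ball ξ0 δ, ∀ e : EuclideanSpace ℝ (Fin d), ‖e‖ = 1 → F.coeff φ w 0 ξ e = 0 ∧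
    F.coeff φ w 1 ξ e = 0 ∧ F.coeff φ w 2 ξ e = κ ξ
  near : ∀ η > 0, ∃ ε > 0, ∀ᶠ ξ in 𝓝 ξ0, ∀ x ∈ F.nearSolutions ξ ε,
    ∃ u : EuclideanSpace ℝ (Fin d), ‖u‖ < η ∧ x = F.point φ w ξ u
  mem_near : ∀ ε > 0, ∀ᶠ p in 𝓝 (ξ0, (0 : EuclideanSpace ℝ (Fin d))),
    F.IsSolution p.1 (F.point φ w p.1 p.2) → F.point φ w p.1 p.2 ∈ F.nearSolutions p.1 ε

lemma IsLocal.exists_isReduced (L : F.IsLocal ξ0 J1 φ v Q ψ w) (H : F.Setting ξ0 κ t J1 φ v) :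
    ∃ δ, F.IsReduced ξ0 κ φ w t.linB t.linS δ := by
  have hc : ∀ᶠ p : ℝ × Coord t in 𝓝 (ξ0, 0), ∀ e : Coord t, ‖e‖ = 1 → Γ 0 p.1 e = 0 ∧ Γ 1 p.1 e = 0
    ∧ Γ 2 p.1 e = κ p.1 := by
    refine continuousAt_fst.eventually (p := fun ξ => ∀ e : Coord t, ‖e‖ = 1 →
      Γ 0 ξ e = 0 ∧ Γ 1 ξ e = 0 ∧ Γ 2 ξ e = κ ξ) ?_
    filter_upwards [(L.reducedExpansion H).coeffs] with ξ h e he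
    exact ⟨(h e he).1, (h e he).2.1, (h e he).2.2.1⟩
  obtain ⟨δ, hδ, hball⟩ := eventually_nhds_iff_ball.1
    (((L.ρ_point H B (LinearMap.continuous_of_finiteDimensional t.linB) (map_zero _) fun ξ hξ u => ρ_crit (H.frame.act_B ξ hξ) u).and (L.ρ_point H S (LinearMap.continuous_of_finiteDimensional t.linS) (map_zero _) fun ξ hξ u => ρ_crit (H.frame.act_S ξ hξ) u)).and (hc.and (L.isOpen.mem_nhds L.mem)))
  have hQ : ball (ξ0, 0) δ ⊆ Q := fun p hp => (hball p hp).2.2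
  have h0 : ∀ ξ ∈ ball ξ0 δ, (ξ, 0) ∈ ball (ξ0, (0 : Coord t)) δ := fun ξ hξ => by
      rw [mem_ball, Prod.dist_eq, dist_self]
      exact max_lt hξ hδ
  have hinv : ∀ (g : D6) (ξ : ℝ) (u u' : Coord t), (ξ, u) ∈ ball (ξ0, 0) δ → F.ρ g (Ψ ξ u) = Ψ ξ u'
    → Λ ξ u' = Λ ξ u := by
    intro g ξ u u' hp h
    have hx := L.toIsReduction.admissible (hQ hp) (L.solution _ (hQ hp))
    rw [SLS, ← h, F.ρ_action ξ (H.frame.subset (L.dom _ (hQ hp)).1) g _ hx, SLS]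
  exact ⟨δ, {
    pos := hδ
    mem := H.critical.mem
    norm_B := t.norm_linB
    norm_S := t.norm_linS
    kappa_zero := H.critical.zero
    kappa_tendsto := H.critical.tendsto
    smooth := (L.contDiffOn_SLS H).mono hQ
    critical := fun ξ u hp => L.hasFDerivAt_zero_iff H (hQ hp)
    injective := fun ξ u u' hu hu' h => L.point_injective H (hQ hu) (hQ hu') h
    point_zero := fun ξ hξ => (L.SLS_zero (hQ (h0 ξ hξ))).1
    ρ_B := fun ξ u hp => (hball _ hp).1.1
    ρ_S := fun ξ u hp => (hball _ hp).1.2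
    SLS_B := fun ξ u hp => hinv B ξ u _ hp (hball _ hp).1.1
    SLS_S := fun ξ u hp => hinv S ξ u _ hp (hball _ hp).1.2
    coeff := fun ξ hξ => (hball _ (h0 ξ hξ)).2.1
    near := fun η hη => L.exists_near H hη
    mem_near := fun ε hε => L.mem_nearSolutions H hε }⟩

end SymmetricFamily

section Taylor

variable {P : Type*} [NormedAddCommGroup P] [NormedSpace ℝ P]
variable {E : Type*} [NormedAddCommGroup E] [NormedSpace ℝ E]

def dirDeriv (v : E) (g : E → ℝ) : E → ℝ := fun x => fderiv ℝ g x v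

lemma contDiffOn_dirDeriv {O : Set E} (hO : IsOpen O) {g : E → ℝ} (hg : SmoothOn g O)
    (v : E) : SmoothOn (dirDeriv v g) O :=
  (hg.fderiv_of_isOpen hO (by simp)).clm_apply contDiffOn_const

lemma dirDeriv_congr {O : Set E} (hO : IsOpen O) {f g : E → ℝ} (h : Set.EqOn f g O) (v : E) :
    Set.EqOn (dirDeriv v f) (dirDeriv v g) O := fun x hx => by
  rw [dirDeriv, dirDeriv, (h.eventuallyEq_of_mem (hO.mem_nhds hx)).fderiv_eq]

section

variable {O : Set E} (hO : IsOpen O) {g : E → ℝ} (hg : SmoothOn g O)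
include O hO g hg

lemma dirDeriv_comm (v v' : E) : Set.EqOn (dirDeriv v (dirDeriv v' g)) (dirDeriv v' (dirDeriv v g))
    O := by
  intro x hx
  have h2 := ((hg.fderiv_of_isOpen hO (m := ∞) (by simp)).contDiffAt (hO.mem_nhds
    hx)).differentiableAt (by simp)
  have key : ∀ a b : E, dirDeriv a (dirDeriv b g) x = fderiv ℝ (fderiv ℝ g) x a b := fun a b => by
    have h3 : HasFDerivAt (fun y => fderiv ℝ g y b) ((fderiv ℝ (fderiv ℝ g) x).flip b) x := by
      refine (h2.hasFDerivAt.clm_apply (hasFDerivAt_const b x)).congr_fderiv ?_; ext z; simp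
    rw [dirDeriv, show dirDeriv b g = fun y => fderiv ℝ g y b from rfl, h3.fderiv]; rfl
  rw [key, key]
  exact ((hg.contDiffAt (hO.mem_nhds hx)).isSymmSndFDerivAt (by simp; norm_cast)).eq v v'

lemma contDiffOn_iterate_dirDeriv (v : E) (j : ℕ) : SmoothOn ((dirDeriv v)^[j] g) O := by
  induction j with
  | zero => exact hg
  | succ j ih =>
    rw [Function.iterate_succ_apply']; exact contDiffOn_dirDeriv hO ih v

lemma iterate_dirDeriv_comm (v v' : E) (j : ℕ) : Set.EqOn ((dirDeriv v)^[j] (dirDeriv v' g))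
    (dirDeriv v' ((dirDeriv v)^[j] g)) O := by
  induction j with
  | zero => exact fun _ _ => rfl
  | succ j ih =>
    rw [Function.iterate_succ_apply', Function.iterate_succ_apply']
    exact (dirDeriv_congr hO ih v).trans
      (dirDeriv_comm hO (contDiffOn_iterate_dirDeriv hO hg v j) v v')

lemma hasDerivAt_dirDeriv {c : ℝ → E} {v : E} {r : ℝ} (hc : HasDerivAt c v r) (hr : c r ∈ O) :
    HasDerivAt (fun r => g (c r)) (dirDeriv v g (c r)) r :=
  comp_hasDerivAt_of_eq r
    (((hg.contDiffAt (hO.mem_nhds hr)).toFDeriv)) hc rfl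

end

lemma hasDerivAt_prodMk_right (p : P) (r : ℝ) : HasDerivAt (fun r : ℝ => (p, r)) ((0 : P), (1 : ℝ))
    r := (hasDerivAt_const r p).prodMk (hasDerivAt_id r)

lemma iteratedDeriv_eq_iterate_dirDeriv {O : Set (P × ℝ)} (hO : IsOpen O) {g : P × ℝ → ℝ}
    (hg : SmoothOn g O) (j : ℕ) {p : P} {r : ℝ} (h : (p, r) ∈ O) :
    iteratedDeriv j (fun r => g (p, r)) r = (dirDeriv ((0 : P), (1 : ℝ)))^[j] g (p, r) := by
  induction j generalizing r with
  | zero => simp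
  | succ j ih =>
    rw [iteratedDeriv_succ, Function.iterate_succ_apply']
    have hcont : ContinuousAt (fun r => (p, r)) r := by fun_prop
    have hev : iteratedDeriv j (fun r => g (p, r)) =ᶠ[𝓝 r] fun r => (dirDeriv (0, 1))^[j] g (p, r)
      := by
      filter_upwards [hcont.eventually (hO.mem_nhds h)] with s hs using ih hs
    rw [hev.deriv_eq]; exact (hasDerivAt_dirDeriv hO (contDiffOn_iterate_dirDeriv hO hg _ j)
      (hasDerivAt_prodMk_right p r) h).deriv

/-- The remainder in the Taylor expansion of order `m` in the last variable. -/
def remainder (g : P × ℝ → ℝ) (m : ℕ) (z : P × ℝ) : ℝ :=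
  g z - ∑ j ∈ Finset.range m,
    (dirDeriv ((0 : P), (1 : ℝ)))^[j] g (z.1, 0) * z.2 ^ j / (j.factorial : ℝ)

lemma hasDerivAt_remainder {O : Set (P × ℝ)} (hO : IsOpen O) {g : P × ℝ → ℝ} (hg : SmoothOn g O) (m
    : ℕ) {p : P} {r : ℝ} (h : (p, r) ∈ O) : HasDerivAt (fun r => remainder g (m + 1) (p, r))
    (remainder (dirDeriv ((0 : P), (1 : ℝ)) g) m (p, r)) r := by
  have h2 : ∀ j : ℕ, HasDerivAt (fun r => (dirDeriv (0, 1))^[j + 1] g (p, 0) * r ^ (j + 1) / ((j +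
    1).factorial : ℝ)) ((dirDeriv (0, 1))^[j] (dirDeriv (0, 1) g) (p, 0) * r ^ j / (j.factorial :
    ℝ)) r := fun j => by
    refine (((hasDerivAt_pow (j + 1) r).const_mul ((dirDeriv (0, 1))^[j + 1] g (p, 0))).div_const ((j + 1).factorial : ℝ)).congr_deriv ?_
    rw [Nat.factorial_succ, iterate_succ_apply]; push_cast
    have : (j.factorial : ℝ) ≠ 0 := by positivity
    field_simp
  refine (((hasDerivAt_dirDeriv hO hg (hasDerivAt_prodMk_right p r) h).sub ((HasDerivAt.fun_sum fun j (_ : j ∈ Finset.range m) => h2 j).const_add (g (p, 0)))).congr_of_eventuallyEq (of_forall fun s => ?_))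
  simp only [remainder, Finset.sum_range_succ' _ m, Pi.sub_apply]
  simp
  ring

lemma remainder_succ_zero (g : P × ℝ → ℝ) (m : ℕ) (p : P) : remainder g (m + 1) (p, 0) = 0 := by
  simp [remainder, Finset.sum_range_succ' _ m]

lemma exists_remainder_le {O : Set (P × ℝ)} (hO : IsOpen O) {g : P × ℝ → ℝ}
    (hg : SmoothOn g O) (m : ℕ) {p0 : P} (h : (p0, 0) ∈ O) :
    ∃ K, 0 ≤ K ∧ ∀ᶠ z in 𝓝 (p0, (0 : ℝ)), |remainder g m z| ≤ K * |z.2| ^ m := by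
  induction m generalizing g with
  | zero =>
    refine ⟨|g (p0, 0)| + 1, by positivity, ?_⟩
    filter_upwards [(((hg.contDiffAt (hO.mem_nhds h)).continuousAt).abs).eventually (gt_mem_nhds (lt_add_one _))] with z hz
    simpa [remainder] using hz.le
  | succ m ih =>
    obtain ⟨K, hK0, hK⟩ := ih (contDiffOn_dirDeriv hO hg (0, (1 : ℝ))); refine ⟨K, hK0, ?_⟩
    obtain ⟨ε, hε, hball⟩ := eventually_nhds_iff_ball.1 (hK.and (hO.mem_nhds h))
    filter_upwards [ball_mem_nhds (p0, (0 : ℝ)) hε] with ⟨p, r⟩ hz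
    rw [mem_ball, Prod.dist_eq, max_lt_iff, dist_eq, sub_zero] at hz
    have hmem : ∀ s ∈ Set.uIcc 0 r, (p, s) ∈ ball (p0, (0 : ℝ)) ε := fun s hs => by
      rw [mem_ball, Prod.dist_eq, max_lt_iff, dist_eq, sub_zero]
      refine ⟨hz.1, lt_of_le_of_lt ?_ hz.2⟩; simpa using Set.abs_sub_left_of_mem_uIcc hs
    have hle : ∀ s ∈ Set.uIcc 0 r, |s| ≤ |r| := fun s hs => by
      simpa using Set.abs_sub_left_of_mem_uIcc hs
    have h1 := Convex.norm_image_sub_le_of_norm_hasDerivWithin_le (C := K * |r| ^ m) (x := 0) (y := r)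
      (fun s hs => (hasDerivAt_remainder hO hg m (hball _ (hmem s hs)).2).hasDerivWithinAt)
      (fun s hs => by
        rw [norm_eq_abs]; refine ((hball _ (hmem s hs)).1).trans ?_
        exact mul_le_mul_of_nonneg_left (pow_le_pow_left₀ (abs_nonneg _) (hle s hs) m) hK0)
      (convex_uIcc 0 r) Set.left_mem_uIcc Set.right_mem_uIcc
    rw [remainder_succ_zero, sub_zero, sub_zero, norm_eq_abs, norm_eq_abs] at h1
    rw [pow_succ, ← mul_assoc]; exact h1

end Taylor

lemma exists_eventually_choice {α β : Type*} [Nonempty β] {l : Filter α} {P : α → β → Prop}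
    (h : ∀ᶠ x in l, ∃ y, P x y) : ∃ f : α → β, ∀ᶠ x in l, P x (f x) :=
  ⟨fun x => Classical.epsilon (P x), h.mono fun _ hx => Classical.epsilon_spec hx⟩

/-- A family of functions of one variable with `∂s = κ r + a rⁿ⁺¹ / (n+1)! + O(r²ⁿ⁺¹)`. -/
structure IsRadial (s : ℝ → ℝ → ℝ) (κ a : ℝ → ℝ) (n : ℕ) (ξ0 : ℝ) : Prop where
  order_pos : 0 < n
  kappa_tendsto : Tendsto κ (𝓝 ξ0) (𝓝 0)
  tendsto : Tendsto a (𝓝 ξ0) (𝓝 (a ξ0))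
  ne_zero : a ξ0 ≠ 0
  hasDerivAt : ∀ᶠ z : ℝ × ℝ in 𝓝 (ξ0, 0),
    HasDerivAt (deriv (s z.1)) (iteratedDeriv 2 (s z.1) z.2) z.2
  expansion : ∃ K, 0 ≤ K ∧ ∀ᶠ z : ℝ × ℝ in 𝓝 (ξ0, 0),
    |deriv (s z.1) z.2 - κ z.1 * z.2 - a z.1 * z.2 ^ (n + 1) / (n + 1).factorial|
      ≤ K * |z.2| ^ (2 * n + 1) ∧
    |iteratedDeriv 2 (s z.1) z.2 - κ z.1 - a z.1 * z.2 ^ n / n.factorial| ≤ K * |z.2| ^ (2 * n)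

namespace IsRadial

open SymmetricFamily

variable {s : ℝ → ℝ → ℝ} {κ a : ℝ → ℝ} {n : ℕ} {ξ0 : ℝ}

section

variable (R : IsRadial s κ a n ξ0)
include R

lemma exists_estimates : ∃ ε > 0, ∃ c > 0, ∃ C > 0, ∀ ξ, |ξ - ξ0| < ε → ∀ r, 0 ≤ r → r < ε →
    HasDerivAt (deriv (s ξ)) (iteratedDeriv 2 (s ξ) r) r ∧ a ξ0 * κ ξ * r + c * r ^ (n + 1) ≤ a ξ0 *
    deriv (s ξ) r ∧ a ξ0 * deriv (s ξ) r ≤ a ξ0 * κ ξ * r + C * r ^ 2 ∧ c * r ^ (n + 1) ≤ a ξ0 *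
    (iteratedDeriv 2 (s ξ) r * r - deriv (s ξ) r) := by
  obtain ⟨K, hK, hexp⟩ := R.expansion
  obtain ⟨b, hb⟩ : ∃ b, b = a ξ0 := ⟨_, rfl⟩
  have hb0 : b ≠ 0 := hb ▸ R.ne_zero
  have hbpos : 0 < b ^ 2 := by positivity
  have hta : Tendsto (fun ξ => b * a ξ) (𝓝 ξ0) (𝓝 (b ^ 2)) := by
    have := R.tendsto.const_mul b; rwa [← hb, ← sq] at this
  obtain ⟨f, hf⟩ : ∃ f : ℝ, f = (n + 1).factorial := ⟨_, rfl⟩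
  have hfpos : 0 < f := by rw [hf]; positivity
  have hf1 : 1 ≤ f := by rw [hf]; exact_mod_cast Nat.succ_le_of_lt (Nat.factorial_pos _)
  have hfn : f = (n + 1) * n.factorial := by rw [hf, Nat.factorial_succ]; push_cast; ring
  have hn1 : (1 : ℝ) ≤ n := by exact_mod_cast R.order_pos
  obtain ⟨ε, hε, hball⟩ := eventually_nhds_iff_ball.1 (R.hasDerivAt.and (hexp.and (continuousAt_fst.eventually (p := fun ξ => b ^ 2 / 2 < b * a ξ ∧ b * a ξ < 2 * b ^ 2) ((hta.eventually (lt_mem_nhds (by linarith))).and (hta.eventually (gt_mem_nhds (by linarith)))))))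
  obtain ⟨D, hD⟩ : ∃ D, D = |b| * K := ⟨_, rfl⟩
  have hD0 : 0 ≤ D := by rw [hD]; positivity
  obtain ⟨c, hc⟩ : ∃ c, c = b ^ 2 / (4 * f) := ⟨_, rfl⟩
  have hcpos : 0 < c := by rw [hc]; positivity
  refine ⟨min ε (min 1 (c / (4 * (D + 1)))), by positivity, c, hcpos, 2 * b ^ 2 + D + 1,
    by positivity, ?_⟩
  intro ξ hξ r hr hrε
  rw [lt_min_iff] at hξ
  rw [lt_min_iff, lt_min_iff] at hrε
  obtain ⟨hd, ⟨e1, e2⟩, e3, e4⟩ := hball (ξ, r) (by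
    rw [mem_ball, Prod.dist_eq, max_lt_iff, dist_eq, dist_eq, sub_zero, abs_of_nonneg hr]
    exact ⟨hξ.1, hrε.1⟩)
  simp only at hd e1 e2 e3 e4
  rw [abs_of_nonneg hr, ← hf] at e1
  rw [abs_of_nonneg hr] at e2
  rw [← hb]
  have hDr : D * r ≤ c / 4 := by
    have h2 := hrε.2.2; rw [lt_div_iff₀ (by positivity)] at h2
    nlinarith
  have hrn : r ^ n ≤ r := by
    calc r ^ n ≤ r ^ 1 := pow_le_pow_of_le_one hr hrε.2.1.le R.order_pos
      _ = r := pow_one r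
  have hp : 0 ≤ r ^ (n + 1) := by positivity
  have hrn' : r ^ (2 * n + 1) ≤ r ^ (n + 1) * r := by
    rw [show 2 * n + 1 = (n + 1) + n by ring, pow_add]
    exact mul_le_mul_of_nonneg_left hrn hp
  have hr2 : r ^ (n + 1) ≤ r ^ 2 := pow_le_pow_of_le_one hr hrε.2.1.le (by
    have := R.order_pos; omega)
  have hsmall : D * r ^ (2 * n + 1) ≤ c / 4 * r ^ (n + 1) := by
    calc D * r ^ (2 * n + 1) ≤ D * (r ^ (n + 1) * r) := mul_le_mul_of_nonneg_left hrn' hD0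
      _ = D * r * r ^ (n + 1) := by ring
      _ ≤ _ := mul_le_mul_of_nonneg_right hDr hp
  obtain ⟨x, hx⟩ : ∃ x, x = b * a ξ / f := ⟨_, rfl⟩
  have hx1 : 2 * c ≤ x := by
    rw [hx, hc, le_div_iff₀ hfpos]
    have : 2 * (b ^ 2 / (4 * f)) * f = b ^ 2 / 2 := by field_simp; norm_num
    linarith
  have hx2 : x ≤ 2 * b ^ 2 := by
    rw [hx, div_le_iff₀ hfpos]; nlinarith
  have e1' : |b * deriv (s ξ) r - b * κ ξ * r - x * r ^ (n + 1)| ≤ D * r ^ (2 * n + 1) := by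
    have h2 : b * deriv (s ξ) r - b * κ ξ * r - x * r ^ (n + 1) = b * (deriv (s ξ) r - κ ξ * r - a ξ
      * r ^ (n + 1) / f) := by
      rw [hx]; ring
    rw [h2, abs_mul, hD, mul_assoc]; exact mul_le_mul_of_nonneg_left e1 (abs_nonneg b)
  have e2' : |b * (iteratedDeriv 2 (s ξ) r * r) - b * κ ξ * r - x * (n + 1) * r ^ (n + 1)| ≤ D * r ^
    (2 * n + 1) := by
    have hnf : (0 : ℝ) < n.factorial := by positivity
    have h2 : b * (iteratedDeriv 2 (s ξ) r * r) - b * κ ξ * r - x * (n + 1) * r ^ (n + 1) = b * r *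
      (iteratedDeriv 2 (s ξ) r - κ ξ - a ξ * r ^ n / n.factorial) := by
      rw [hx, hfn]; field_simp; ring
    rw [h2, abs_mul, abs_mul, abs_of_nonneg hr, hD, pow_succ]
    calc |b| * r * _ ≤ |b| * r * (K * r ^ (2 * n)) := mul_le_mul_of_nonneg_left e2 (by positivity)
      _ = _ := by ring
  rw [abs_le] at e1' e2'
  have hxp : c * 2 * r ^ (n + 1) ≤ x * r ^ (n + 1) := mul_le_mul_of_nonneg_right (by linarith) hp
  have hxp2 : x * r ^ (n + 1) ≤ 2 * b ^ 2 * r ^ 2 := mul_le_mul hx2 hr2 hp (by positivity)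
  have hxn : x * r ^ (n + 1) ≤ n * (x * r ^ (n + 1)) := le_mul_of_one_le_left (by nlinarith) hn1
  have hcp : 0 ≤ c * r ^ (n + 1) := by positivity
  have hDr2 : D * r ^ (2 * n + 1) ≤ D * r ^ 2 :=
    mul_le_mul_of_nonneg_left (pow_le_pow_of_le_one hr hrε.2.1.le (by
      have := R.order_pos; omega)) hD0
  refine ⟨hd, by linarith, ?_, ?_⟩
  · linarith
  linarith

lemma exists_dichotomy : ∃ η0 > 0, ∀ η > 0, η ≤ η0 → ∀ᶠ ξ in 𝓝 ξ0, (κ ξ * a ξ0 < 0 → ∃ r ∈ Set.Ioo 0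
    η, deriv (s ξ) r = 0) ∧ (∀ r ∈ Set.Ioo 0 η, ∀ r' ∈ Set.Ioo 0 η, deriv (s ξ) r = 0 → deriv (s ξ)
    r' = 0 → r = r') ∧ (0 ≤ κ ξ * a ξ0 → ∀ r ∈ Set.Ioo 0 η, deriv (s ξ) r ≠ 0) := by
  obtain ⟨ε, hε, c, hc, C, hC, h⟩ := R.exists_estimates
  refine ⟨ε, hε, fun η hη hηε => ?_⟩
  have hev : ∀ᶠ ξ in 𝓝 ξ0, 0 < a ξ0 * κ ξ * (η / 2) + c * (η / 2) ^ (n + 1) := by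
    refine (((R.kappa_tendsto.const_mul _).mul_const _).add_const _).eventually (lt_mem_nhds ?_)
    rw [mul_zero, zero_mul, zero_add]; positivity
  filter_upwards [ball_mem_nhds ξ0 hε, hev] with ξ hξ hpos
  have hξ' := hξ
  refine ⟨fun hκ => ?_, ?_, fun hκ r hr h0 => ?_⟩
  · obtain ⟨k, hk⟩ : ∃ k, k = -(a ξ0 * κ ξ) := ⟨_, rfl⟩
    have hk0 : 0 < k := by rw [hk]; linarith [mul_comm (κ ξ) (a ξ0)]
    obtain ⟨r₁, hr₁⟩ : ∃ r₁, r₁ = min (η / 4) (k / (2 * C)) := ⟨_, rfl⟩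
    have hr₁0 : 0 < r₁ := by rw [hr₁]; positivity
    have hr₁η : r₁ ≤ η / 4 := by rw [hr₁]; exact min_le_left _ _
    have hr₁k : C * r₁ ≤ k / 2 := by
      have : r₁ ≤ k / (2 * C) := by rw [hr₁]; exact min_le_right _ _
      rw [le_div_iff₀ (by positivity)] at this
      linarith
    have hlt : a ξ0 * deriv (s ξ) r₁ < 0 := by
      refine (h ξ hξ' r₁ hr₁0.le (by linarith)).2.2.1.trans_lt ?_
      have : a ξ0 * κ ξ = -k := by rw [hk, neg_neg]
      rw [this]; nlinarith [mul_pos hk0 hr₁0]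
    have hcont : ContinuousOn (fun r => a ξ0 * deriv (s ξ) r) (Set.Icc r₁ (η / 2)) := fun r hr =>
      ((h ξ hξ' r (hr₁0.le.trans hr.1) (by linarith [hr.2])).1.continuousAt.const_mul (a
      ξ0)).continuousWithinAt
    obtain ⟨r, hr, hr0⟩ := intermediate_value_Icc (by linarith) hcont ⟨hlt.le, (hpos.trans_le (h ξ hξ' (η / 2) (by linarith) (by linarith)).2.1).le⟩
    grind
  · have key : ∀ r r', 0 < r → r < r' → r' < η → deriv (s ξ) r = 0 → deriv (s ξ) r' = 0 → False := by
      intro r r' h0 hlt hη' hr hr'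
      have hder : ∀ x ∈ Set.Icc r r', HasDerivAt (fun y => deriv (s ξ) y / y) ((iteratedDeriv 2 (s
        ξ) x * x - deriv (s ξ) x * 1) / x ^ 2) x := fun x hx =>
        (h ξ hξ' x (h0.le.trans hx.1) (by linarith [hx.2])).1.div (hasDerivAt_id x)
          (h0.trans_le hx.1).ne'
      obtain ⟨x, hx, hx0⟩ := exists_hasDerivAt_eq_zero hlt
        (fun x hx => (hder x hx).continuousAt.continuousWithinAt) (by rw [hr, hr', zero_div, zero_div])
        (fun x hx => hder x ⟨hx.1.le, hx.2.le⟩)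
      have hxpos := h0.trans hx.1; have h2 := (h ξ hξ' x hxpos.le (by linarith [hx.2])).2.2.2
      rw [mul_one, div_eq_zero_iff, or_iff_left (by positivity)] at hx0
      rw [hx0, mul_zero] at h2; have : 0 < c * x ^ (n + 1) := by positivity
      linarith
    grind
  · have h2 := (h ξ hξ' r hr.1.le (by linarith [hr.2])).2.1
    rw [h0, mul_zero] at h2; have h3 : 0 < c * r ^ (n + 1) := by have := hr.1; positivity
    have h4 : 0 ≤ a ξ0 * κ ξ * r := mul_nonneg (by grind) hr.1.le
    linarith

lemma exists_branch {δ : ℝ} (hδ : 0 < δ) : ∃ η > 0, η ≤ δ ∧ ∃ r : ℝ → ℝ, Tendsto r (along ξ0 fun ξ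
    => κ ξ * a ξ0 < 0) (𝓝 0) ∧ (∀ᶠ ξ in along ξ0 fun ξ => κ ξ * a ξ0 < 0, r ξ ∈ Set.Ioo 0 η ∧ deriv
    (s ξ) (r ξ) = 0 ∧ ∀ x ∈ Set.Ioo 0 η, deriv (s ξ) x = 0 → x = r ξ) ∧ ∀ᶠ ξ in along ξ0 fun ξ => 0
    ≤ κ ξ * a ξ0, ∀ x ∈ Set.Ioo 0 η, deriv (s ξ) x ≠ 0 := by
  obtain ⟨η0, hη0, h⟩ := R.exists_dichotomy
  have hη := lt_min hη0 hδ
  have h1 := h _ hη (min_le_left _ _)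
  have h2 : ∀ᶠ ξ in along ξ0 fun ξ => κ ξ * a ξ0 < 0, ∃ r ∈ Set.Ioo 0 (min η0 δ), deriv (s ξ) r = 0
    := by
    filter_upwards [nhdsWithin_le_nhds h1, self_mem_nhdsWithin] with ξ h3 h4 using h3.1 h4
  obtain ⟨r, hr⟩ := exists_eventually_choice h2
  refine ⟨_, hη, min_le_right _ _, r, ?_, ?_, ?_⟩
  · refine Metric.tendsto_nhds.2 fun ε hε => ?_
    filter_upwards [hr, nhdsWithin_le_nhds h1, nhdsWithin_le_nhds (h (min ε (min η0 δ)) (lt_min hε hη) ((min_le_right _ _).trans (min_le_left _ _))), self_mem_nhdsWithin]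
      with ξ h4 h5 h6 h7
    obtain ⟨x, hx, hx0⟩ := h6.1 h7
    rw [← (h5.2.1 x ⟨hx.1, hx.2.trans_le (min_le_right _ _)⟩ _ h4.1 hx0 h4.2), dist_eq, sub_zero, abs_of_pos hx.1]
    grind
  · filter_upwards [hr, nhdsWithin_le_nhds h1] with ξ h4 h5; grind
  · filter_upwards [nhdsWithin_le_nhds h1, self_mem_nhdsWithin] with ξ h3 h4 using h3.2.2 h4

end

lemma neg (R : IsRadial s κ a 1 ξ0) : IsRadial (fun ξ r => s ξ (-r)) κ (fun ξ => -a ξ) 1 ξ0 := by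
  have h1 : ∀ ξ r, deriv (fun r => s ξ (-r)) r = -deriv (s ξ) (-r) := fun ξ r =>
    deriv_comp_neg (s ξ) r
  have h2 : ∀ ξ r, iteratedDeriv 2 (fun r => s ξ (-r)) r = iteratedDeriv 2 (s ξ) (-r) := by
    intro ξ r; rw [iteratedDeriv_comp_neg 2 (s ξ) r]; simp
  have ht : Tendsto (fun z : ℝ × ℝ => (z.1, -z.2)) (𝓝 (ξ0, 0)) (𝓝 (ξ0, 0)) := by
    have h : ContinuousAt (fun z : ℝ × ℝ => (z.1, -z.2)) (ξ0, 0) := by fun_prop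
    simpa [ContinuousAt] using h
  obtain ⟨K, hK, hexp⟩ := R.expansion
  refine ⟨one_pos, R.kappa_tendsto, R.tendsto.neg, neg_ne_zero.2 R.ne_zero, ?_, K, hK, ?_⟩
  · filter_upwards [ht.eventually R.hasDerivAt] with z hz
    have h3 : deriv (fun r => s z.1 (-r)) = fun r => -deriv (s z.1) (-r) := funext fun r => h1 _ _
    simp only [h2, h3]; have h4 := (HasDerivAt.comp_of_eq z.2 hz (hasDerivAt_neg z.2) rfl).neg
    simp at h4; exact h4
  · filter_upwards [ht.eventually hexp] with z hz; grind

lemma exists_branch_both (R : IsRadial s κ a 1 ξ0) {δ : ℝ} (hδ : 0 < δ) : ∃ η > 0, η ≤ δ ∧ ∃ r : ℝ →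
    ℝ, Tendsto r (along ξ0 fun ξ => κ ξ ≠ 0) (𝓝 0) ∧ (∀ᶠ ξ in along ξ0 fun ξ => κ ξ ≠ 0, r ξ ≠ 0 ∧
    |r ξ| < η ∧ deriv (s ξ) (r ξ) = 0 ∧ ∀ x, |x| < η → deriv (s ξ) x = 0 → x = 0 ∨ x = r ξ) ∧ ∀ᶠ ξ
    in along ξ0 fun ξ => κ ξ = 0, ∀ x, |x| < η → deriv (s ξ) x = 0 → x = 0 := by
  obtain ⟨η₁, hη₁, h⟩ := R.exists_dichotomy
  obtain ⟨η₂, hη₂, h'⟩ := R.neg.exists_dichotomy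
  simp only [fun ξ r => deriv_comp_neg (s ξ) r, neg_eq_zero, ne_eq] at h'
  have key : ∀ η > 0, η ≤ min η₁ η₂ → ∀ᶠ ξ in 𝓝 ξ0, (κ ξ ≠ 0 → ∃ r, (r ≠ 0 ∧ |r| < η) ∧ deriv (s ξ)
    r = 0) ∧ (∀ x y, (x ≠ 0 ∧ |x| < η) → (y ≠ 0 ∧ |y| < η) → deriv (s ξ) x = 0 → deriv (s ξ) y = 0 →
    x = y) ∧ (κ ξ = 0 → ∀ x, (x ≠ 0 ∧ |x| < η) → deriv (s ξ) x ≠ 0) := by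
    intro η hη hle
    filter_upwards [h η hη (hle.trans (min_le_left _ _)), h' η hη (hle.trans (min_le_right _ _))]
      with ξ h2 h3
    have hpos : ∀ x, 0 < x → |x| < η → deriv (s ξ) x = 0 → x ∈ Set.Ioo 0 η ∧ κ ξ * a ξ0 < 0 :=
      fun x hx hxη h0 => by
        have hm : x ∈ Set.Ioo 0 η := ⟨hx, (le_abs_self x).trans_lt hxη⟩; grind
    have hneg : ∀ x, x < 0 → |x| < η → deriv (s ξ) x = 0 → -x ∈ Set.Ioo 0 η ∧ 0 < κ ξ * a ξ0 :=
      fun x hx hxη h0 => by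
        have hm : -x ∈ Set.Ioo 0 η := ⟨neg_pos.2 hx, (neg_le_abs x).trans_lt hxη⟩
        refine ⟨hm, not_le.1 fun hc => h3.2.2 (by linarith) (-x) hm ?_⟩
        rw [neg_neg]; exact h0
    refine ⟨fun hκ => ?_, fun x y hx hy hx0 hy0 => ?_, fun hκ x hx h0 => ?_⟩
    · rcases lt_or_gt_of_ne (mul_ne_zero hκ R.ne_zero) with hlt | hgt
      · obtain ⟨r, hr, hr0⟩ := h2.1 hlt
        exact ⟨r, ⟨hr.1.ne', by rw [abs_of_pos hr.1]; exact hr.2⟩, hr0⟩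
      · obtain ⟨r, hr, hr0⟩ := h3.1 (by linarith)
        exact ⟨-r, ⟨neg_ne_zero.2 hr.1.ne', by rw [abs_neg, abs_of_pos hr.1]; exact hr.2⟩, hr0⟩
    · rcases lt_or_gt_of_ne hx.1 with hx1 | hx1 <;> rcases lt_or_gt_of_ne hy.1 with hy1 | hy1
      · have := h3.2.1 (-x) (hneg x hx1 hx.2 hx0).1 (-y) (hneg y hy1 hy.2 hy0).1
          (by rw [neg_neg]; exact hx0) (by rw [neg_neg]; exact hy0)
        linarith
      · grind
      · grind
      grind
    · grind
  have hη := lt_min (lt_min hη₁ hη₂) hδ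
  have h2 := key _ hη (min_le_left _ _)
  have h3 : ∀ᶠ ξ in along ξ0 fun ξ => κ ξ ≠ 0, ∃ r, (r ≠ 0 ∧ |r| < min (min η₁ η₂) δ) ∧ deriv (s ξ)
    r = 0 := by
    filter_upwards [nhdsWithin_le_nhds h2, self_mem_nhdsWithin] with ξ h4 h5 using h4.1 h5
  obtain ⟨r, hr⟩ := exists_eventually_choice h3
  refine ⟨_, hη, min_le_right _ _, r, ?_, ?_, ?_⟩
  · refine Metric.tendsto_nhds.2 fun ε hε => ?_
    filter_upwards [hr, nhdsWithin_le_nhds h2, nhdsWithin_le_nhds (key (min ε (min (min η₁ η₂) δ)) (lt_min hε hη) ((min_le_right _ _).trans (min_le_left _ _))), self_mem_nhdsWithin]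
      with ξ h5 h6 h7 h8
    obtain ⟨x, hx, hx0⟩ := h7.1 h8
    rw [← h6.2.1 x _ ⟨hx.1, hx.2.trans_le (min_le_right _ _)⟩ h5.1 hx0 h5.2, dist_eq, sub_zero]
    grind
  · filter_upwards [hr, nhdsWithin_le_nhds h2] with ξ h4 h5; grind
  · filter_upwards [nhdsWithin_le_nhds h2, self_mem_nhdsWithin] with ξ h4 h5 x hx hx0; grind

variable {l : Filter ℝ} {r : ℝ → ℝ}

lemma tendsto_graph (hl : l ≤ 𝓝 ξ0) (hr : Tendsto r l (𝓝 0)) : Tendsto (fun ξ => (ξ, r ξ)) l (𝓝 (ξ0,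
    0)) := Tendsto.prodMk_nhds (tendsto_id.mono_left hl) hr

section

variable (R : IsRadial s κ a n ξ0) (hl : l ≤ 𝓝 ξ0) (hr : Tendsto r l (𝓝 0))
  (h0 : ∀ᶠ ξ in l, r ξ ≠ 0 ∧ deriv (s ξ) (r ξ) = 0)
include R hl hr h0

lemma isBigO_order : (fun ξ => κ ξ + a ξ * r ξ ^ n / (n + 1).factorial) =O[l] fun ξ => r ξ ^ (2 * n)
    := by
  obtain ⟨K, hK, hexp⟩ := R.expansion
  refine of_bound K ?_
  filter_upwards [h0, (tendsto_graph hl hr).eventually hexp] with ξ h1 h2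
  have h3 := h2.1
  rw [h1.2] at h3
  refine le_of_mul_le_mul_right ?_ (abs_pos.2 h1.1)
  rw [norm_eq_abs, norm_eq_abs, ← abs_mul, abs_pow, mul_assoc, ← pow_succ]
  grind

lemma isBigO_pow : (fun ξ => r ξ ^ n) =O[l] κ := by
  have h2 : (fun ξ => r ξ ^ (2 * n)) =o[l] fun ξ => r ξ ^ n := by
    have h3 : (fun ξ => r ξ ^ n) =o[l] fun _ => (1 : ℝ) := by
      rw [isLittleO_one_iff]; have := hr.pow n; rwa [zero_pow R.order_pos.ne'] at this
    have h4 := h3.mul_isBigO (isBigO_refl (fun ξ => r ξ ^ n) l)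
    simp only [one_mul, ← pow_add, ← two_mul] at h4; exact h4
  have h3 : (fun ξ => r ξ ^ n) =O[l] fun ξ => a ξ * r ξ ^ n / (n + 1).factorial := by
    refine of_bound (2 * (n + 1).factorial / |a ξ0|) ?_; have h5 := abs_pos.2 R.ne_zero
    filter_upwards [((R.tendsto.mono_left hl).abs).eventually (lt_mem_nhds (half_lt_self h5))] with ξ h6
    rw [norm_eq_abs, norm_eq_abs, abs_div, abs_mul, Nat.abs_cast]
    have h7 : (0 : ℝ) < (n + 1).factorial := by positivity
    rw [div_mul_div_comm, le_div_iff₀ (by positivity)]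
    have h8 := mul_le_mul_of_nonneg_left h6.le (mul_nonneg h7.le (abs_nonneg (r ξ ^ n))); linarith
  refine h3.trans ((((R.isBigO_order hl hr h0).trans_isLittleO h2).neg_left.trans_isBigO h3).right_isBigO_add.trans (of_bound 1 (of_forall fun ξ => ?_)))
  simp

lemma isBigO_hess : (fun ξ => iteratedDeriv 2 (s ξ) (r ξ) + n * κ ξ) =O[l] fun ξ => κ ξ ^ 2 := by
  have h2 := (R.isBigO_pow hl hr h0).pow 2
  have h3 : (fun ξ => iteratedDeriv 2 (s ξ) (r ξ) - κ ξ - a ξ * r ξ ^ n / n.factorial) =O[l] fun ξ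
    => r ξ ^ (2 * n) := by
    obtain ⟨K, -, hexp⟩ := R.expansion; refine of_bound K ?_
    filter_upwards [(tendsto_graph hl hr).eventually hexp] with ξ h; simpa using h.2
  simp only [← pow_mul, mul_comm n 2] at h2
  refine ((h3.add ((R.isBigO_order hl hr h0).const_mul_left (n + 1 : ℝ))).trans h2).congr_left fun ξ => ?_
  rw [Nat.factorial_succ]
  have : (n.factorial : ℝ) ≠ 0 := by positivity
  push_cast
  field_simp
  ring

end

end IsRadial

lemma iteratedDeriv_add_right (f : ℝ → ℝ) (a : ℝ) (m : ℕ) (x : ℝ) : iteratedDeriv m (fun y => f (a +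
    y)) x = iteratedDeriv m f (a + x) := congrFun (iteratedDeriv_comp_const_add m f a) x

lemma isRadial_of_contDiffOn {s : ℝ → ℝ → ℝ} {κ : ℝ → ℝ} {ξ0 : ℝ} {O : Set (ℝ × ℝ)} (hO : IsOpen O)
    (hs : SmoothOn (fun z : ℝ × ℝ => s z.1 z.2) O) (h0 : (ξ0, 0) ∈ O) (hκ : Tendsto κ (𝓝 ξ0) (𝓝 0))
    {n : ℕ} (hn : n = 1 ∨ n = 2) (hlow : ∀ᶠ ξ in 𝓝 ξ0, iteratedDeriv 1 (s ξ) 0 = 0 ∧ iteratedDeriv 2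
    (s ξ) 0 = κ ξ) (hmid : n = 2 → ∀ᶠ ξ in 𝓝 ξ0, iteratedDeriv 3 (s ξ) 0 = 0 ∧ iteratedDeriv 5 (s ξ)
    0 = 0) (hne : iteratedDeriv (n + 2) (s ξ0) 0 ≠ 0) : IsRadial s κ (fun ξ => iteratedDeriv (n + 2)
    (s ξ) 0) n ξ0 := by
  obtain ⟨g, hg⟩ : ∃ g : ℝ × ℝ → ℝ, g = fun z => s z.1 z.2 := ⟨_, rfl⟩
  rw [← hg] at hs
  obtain ⟨D, hD⟩ : ∃ D : (ℝ × ℝ → ℝ) → ℝ × ℝ → ℝ, D = dirDeriv (0, 1) := ⟨_, rfl⟩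
  have hsg : ∀ ξ, s ξ = fun r => g (ξ, r) := fun ξ => by rw [hg]
  have hit : ∀ j, ∀ z ∈ O, iteratedDeriv j (s z.1) z.2 = D^[j] g z := fun j z hz => by
    rw [hsg, hD]; exact iteratedDeriv_eq_iterate_dirDeriv hO hs j hz
  have hsm : ∀ j, SmoothOn (D^[j] g) O := fun j => by
    rw [hD]; exact contDiffOn_iterate_dirDeriv hO hs _ j
  have hOev := hO.mem_nhds h0
  have hO0 : ∀ᶠ ξ in 𝓝 ξ0, (ξ, 0) ∈ O := by
    have h : ContinuousAt (fun ξ => (ξ, (0 : ℝ))) ξ0 := by fun_prop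
    exact h.eventually hOev
  have hder : ∀ z ∈ O, HasDerivAt (fun r => D g (z.1, r)) (D^[2] g z) z.2 := fun z hz => by
    have h := hasDerivAt_dirDeriv hO (hsm 1) (hasDerivAt_prodMk_right z.1 z.2) hz; rw [← hD] at h
    exact h
  have hev : ∀ z ∈ O, deriv (s z.1) =ᶠ[𝓝 z.2] fun r => D g (z.1, r) := fun z hz => by
    have h : ContinuousAt (fun r => (z.1, r)) z.2 := by fun_prop
    filter_upwards [h.eventually (hO.mem_nhds hz)] with r hr; rw [← iteratedDeriv_one]
    exact hit 1 _ hr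
  refine ⟨by omega, hκ, ?_, hne, ?_, ?_⟩
  · have h2 := hit (n + 2) _ h0; simp only at h2; simp only [h2]
    refine (ContinuousAt.comp (f := fun ξ => (ξ, 0)) ((hsm (n + 2)).contDiffAt (hO.mem_nhds h0)).continuousAt (by fun_prop)).tendsto.congr' ?_
    filter_upwards [hO0] with ξ hξ using (hit (n + 2) _ hξ).symm
  · filter_upwards [hOev] with z hz; rw [hit 2 z hz]
    exact (hder z hz).congr_of_eventuallyEq (hev z hz)
  · obtain ⟨K₁, hK₁, h1⟩ := exists_remainder_le hO (hsm 1) (2 * n + 1) h0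
    obtain ⟨K₂, hK₂, h2⟩ := exists_remainder_le hO (hsm 2) (2 * n) h0
    refine ⟨max K₁ K₂, hK₁.trans (le_max_left _ _), ?_⟩
    have hc : ∀ᶠ z : ℝ × ℝ in 𝓝 (ξ0, 0), (z.1, 0) ∈ O ∧ (iteratedDeriv 1 (s z.1) 0 = 0 ∧
      iteratedDeriv 2 (s z.1) 0 = κ z.1) ∧ (n = 2 → iteratedDeriv 3 (s z.1) 0 = 0 ∧ iteratedDeriv 5
      (s z.1) 0 = 0) := by
      refine continuousAt_fst.eventually (p := fun ξ => (ξ, 0) ∈ O ∧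
        (iteratedDeriv 1 (s ξ) 0 = 0 ∧ iteratedDeriv 2 (s ξ) 0 = κ ξ) ∧
        (n = 2 → iteratedDeriv 3 (s ξ) 0 = 0 ∧ iteratedDeriv 5 (s ξ) 0 = 0)) ?_
      refine hO0.and (hlow.and ?_); by_cases hn2 : n = 2
      · grind
      · exact of_forall fun _ h => (hn2 h).elim
    filter_upwards [hOev, h1, h2, hc] with z hz h3 h4 h5; obtain ⟨hz0, ⟨c1, c2⟩, c35⟩ := h5
    have e1 : deriv (s z.1) z.2 = D^[1] g z := by rw [← hit 1 z hz, iteratedDeriv_one]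
    rw [hit 2 z hz, e1]; rw [remainder, ← hD] at h3 h4
    simp only [fun i j => (Function.iterate_add_apply D i j g).symm, fun j => (hit j _ hz0).symm] at h3 h4
    refine ⟨le_trans (le_of_eq ?_) (h3.trans (mul_le_mul_of_nonneg_right (le_max_left _ _)
      (by positivity))), le_trans (le_of_eq ?_) (h4.trans (mul_le_mul_of_nonneg_right
      (le_max_right _ _) (by positivity)))⟩
    · congr 1; rcases hn with rfl | rfl
      · simp [sum_range_succ, c1, c2]; ring
      · simp [sum_range_succ, c1, c2, c35 rfl]; ring
    · congr 1; rcases hn with rfl | rfl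
      · simp [sum_range_succ, c2]; ring
      · simp [sum_range_succ, c2, c35 rfl]; ring

namespace SymmetricFamily

variable {N d : ℕ} {F : SymmetricFamily N} {ξ0 : ℝ} {κ : ℝ → ℝ} {φ : ℝ → Fin d → Loop N}
  {w : ℝ → Conf d → Loop N}
  {AB AS : Conf d →ₗ[ℝ] Conf d} {δ : ℝ} {ξ : ℝ}
local notation "Λ" => F.SLS φ w
local notation "Γ" => F.coeff φ w
local notation "Ψ" => F.point φ w

lemma mem_ball_iff {u : Conf d} : (ξ, u) ∈ ball (ξ0, (0 : Conf d)) δ ↔ |ξ - ξ0| < δ ∧ ‖u‖ < δ := by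
  rw [mem_ball, Prod.dist_eq, max_lt_iff, dist_zero_right, dist_eq]

lemma smul_mem_ball_iff {ξ r : ℝ} {e : Conf d} (he : ‖e‖ = 1) :
    (ξ, r • e) ∈ ball (ξ0, (0 : Conf d)) δ ↔ |ξ - ξ0| < δ ∧ |r| < δ := by
  rw [mem_ball_iff, norm_smul, he, mul_one, norm_eq_abs]

lemma eventually_smul_mem_ball (hδ : 0 < δ) {e : Conf d} (he : ‖e‖ = 1)
    {l : Filter ℝ} (hl : l ≤ 𝓝 ξ0) {r : ℝ → ℝ} (hr : Tendsto r l (𝓝 0)) :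
    ∀ᶠ ξ in l, (ξ, r ξ • e) ∈ ball (ξ0, (0 : Conf d)) δ := by
  filter_upwards [hl (ball_mem_nhds ξ0 hδ), hr (ball_mem_nhds 0 hδ)] with ξ h1 h2
  rw [smul_mem_ball_iff he]
  simp at h1 h2
  exact ⟨h1, h2⟩

namespace IsReduced

section

variable (R : F.IsReduced ξ0 κ φ w AB AS δ)
include R

lemma contDiffOn_ray {e : Conf d} (he : ‖e‖ = 1) : SmoothOn (fun z : ℝ × ℝ => Λ z.1
    (z.2 • e)) (ball (ξ0, 0) δ) := by
  have h1 : SmoothOn (fun z : ℝ × ℝ => (z.1, z.2 • e)) (ball (ξ0, 0) δ) := by fun_prop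
  refine R.smooth.comp h1 fun z hz => ?_
  rw [mem_ball, Prod.dist_eq, max_lt_iff, dist_eq, dist_eq, sub_zero] at hz
  exact (smul_mem_ball_iff he).2 hz

lemma hasFDerivAt {u : Conf d} (hp : (ξ, u) ∈ ball (ξ0, 0) δ) : HasFDerivAt (F.SLS φ
    w ξ) (fderiv ℝ (Λ ξ) u) u := by
  exact ((ContDiffAt.comp u (R.smooth.contDiffAt (Metric.isOpen_ball.mem_nhds hp)) (by fun_prop)).toFDeriv)

lemma contDiffAt {u : Conf d} (hp : (ξ, u) ∈ ball (ξ0, 0) δ) : SmoothAt (F.SLS φ w ξ) u :=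
  ContDiffAt.comp u (R.smooth.contDiffAt (Metric.isOpen_ball.mem_nhds hp)) (by fun_prop)

lemma hasDerivAt_ray {ξ r : ℝ} {e : Conf d} (hp : (ξ, r • e) ∈ ball (ξ0, 0) δ) : HasDerivAt
    (fun r : ℝ => Λ ξ (r • e)) (fderiv ℝ (Λ ξ) (r • e) e) r := by
  exact comp_hasDerivAt_of_eq r (R.hasFDerivAt hp) (by simpa using (hasDerivAt_id r).smul_const e) rfl

lemma isRadial {e : Conf d} (he : ‖e‖ = 1) {n : ℕ} (hn : n = 1 ∨ n = 2) (hmid : n = 2 → ∀ᶠ ξ in 𝓝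
    ξ0, Γ 3 ξ e = 0 ∧ Γ 5 ξ e = 0) (hne : Γ (n + 2) ξ0 e ≠ 0) :
    IsRadial (fun ξ r => Λ ξ (r • e)) κ (fun ξ => Γ (n + 2) ξ e) n ξ0 := by
  refine isRadial_of_contDiffOn Metric.isOpen_ball (R.contDiffOn_ray he)
    (Metric.mem_ball_self R.pos) R.kappa_tendsto hn ?_ hmid hne
  filter_upwards [ball_mem_nhds ξ0 R.pos] with ξ hξ
  exact (R.coeff ξ hξ e he).2

lemma isBranch {e : EuclideanSpace ℝ (Fin d)} (he : ‖e‖ = 1) {n : ℕ} (hn : n = 1 ∨ n = 2) (hmid : n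
    = 2 → ∀ᶠ ξ in 𝓝 ξ0, Γ 3 ξ e = 0 ∧ Γ 5 ξ e = 0) (hne : Γ (n + 2) ξ0 e ≠ 0) {l : Filter ℝ} (hl : l
    ≤ 𝓝 ξ0) {r : ℝ → ℝ} (hr : Tendsto r l (𝓝 0)) {G : Set D6} (h0 : ∀ᶠ ξ in l, r ξ ≠ 0 ∧ HasFDerivAt
    (Λ ξ) (0 : EuclideanSpace ℝ (Fin d) →L[ℝ] ℝ) (r ξ • e)) (hsym : ∀ᶠ ξ in l, ∀ g : D6, F.ρ g (Ψ ξ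
    (r ξ • e)) = Ψ ξ (r ξ • e) ↔ g ∈ G) : F.IsBranch φ w ξ0 κ l n e G r := by
  have hrad := R.isRadial he hn hmid hne
  have hball := eventually_smul_mem_ball R.pos he hl hr
  have h1 : ∀ᶠ ξ in l, r ξ ≠ 0 ∧ deriv (fun r => Λ ξ (r • e)) (r ξ) = 0 := by
    filter_upwards [h0, hball] with ξ h2 h3
    exact ⟨h2.1, by rw [(R.hasDerivAt_ray h3).deriv, h2.2.fderiv]; rfl⟩
  refine ⟨hr, ?_, hsym, ?_, hne, ?_, ?_⟩
  · filter_upwards [h0, hball] with ξ h2 h3 using ⟨h2.1, (R.critical _ _ h3).1 h2.2⟩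
  · intro m hm hmn; obtain ⟨rfl, rfl⟩ : n = 2 ∧ m = 3 := by omega
    exact (hmid rfl).mono fun _ h => h.1
  · refine (hrad.isBigO_order hl hr h1).trans (of_bound 1 ?_)
    filter_upwards [hr (ball_mem_nhds 0 one_pos)] with ξ h
    rw [Set.mem_preimage, mem_ball, dist_eq, sub_zero] at h; rw [norm_pow, norm_pow, one_mul]
    exact pow_le_pow_of_le_one (norm_nonneg _) h.le (by omega)
  · refine (hrad.isBigO_hess hl hr h1).congr_left fun ξ => ?_
    have h2 : (fun s => Λ ξ (r ξ • e + s • e)) = fun s => (fun r => Λ ξ (r • e)) (r ξ + s) :=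
      funext fun s => by simp only [add_smul]
    rw [hess, h2, iteratedDeriv_add_right (fun r => Λ ξ (r • e)), add_zero]

lemma eventually_q_mem_near {ε : ℝ} (hε : 0 < ε) : ∀ᶠ ξ in 𝓝 ξ0, F.q ξ ∈ F.nearSolutions ξ ε := by
  have h1 : ContinuousAt (fun ξ => (ξ, (0 : Conf d))) ξ0 := by fun_prop
  filter_upwards [h1.eventually (R.mem_near ε hε), ball_mem_nhds ξ0 R.pos,
    F.isOpen_J.mem_nhds R.mem] with ξ h2 h3 h4
  simp only [R.point_zero ξ h3] at h2
  exact h2 (F.q_sol ξ h4)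

lemma eventually_mem_near {ε : ℝ} (hε : 0 < ε) {e : Conf d} {l : Filter ℝ} (hl : l ≤ 𝓝 ξ0) {r : ℝ →
    ℝ} (hr : Tendsto r l (𝓝 0)) : ∀ᶠ ξ in l, F.IsSolution ξ (Ψ ξ (r ξ • e)) → Ψ
    ξ (r ξ • e) ∈ F.nearSolutions ξ ε := by
  have h1 : Tendsto (fun ξ => (ξ, r ξ • e)) l (𝓝 (ξ0, 0)) := by
    have h2 := hr.smul_const e; rw [zero_smul] at h2
    exact Tendsto.prodMk_nhds (tendsto_id.mono_left hl) h2
  exact h1.eventually (R.mem_near ε hε)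

end

lemma norm_iterate {A : Conf d →ₗ[ℝ] Conf d}
    (hA : ∀ u, ‖A u‖ = ‖u‖) (j : ℕ) (u : Conf d) : ‖A^[j] u‖ = ‖u‖ := by
  induction j with
  | zero => rfl
  | succ j ih => rw [Function.iterate_succ_apply', hA, ih]

section

variable (R : F.IsReduced ξ0 κ φ w AB AS δ) {u : Conf d}
  (hp : (ξ, u) ∈ ball (ξ0, 0) δ)
include R ξ u hp

lemma ρ_B_pow (j : ℕ) : F.ρ (B ^ j) (Ψ ξ u) = Ψ ξ (AB^[j] u) := by
  induction j with
  | zero => simp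
  | succ j ih =>
    rw [pow_succ', map_mul, mul_apply, ih, Function.iterate_succ_apply', R.ρ_B]
    rw [mem_ball_iff, norm_iterate R.norm_B]; exact mem_ball_iff.1 hp

lemma ρ_S_pow (j : ℕ) : F.ρ (S ^ j) (Ψ ξ u) = Ψ ξ (AS^[j] u) := by
  induction j with
  | zero => simp
  | succ j ih =>
    rw [pow_succ', map_mul, mul_apply, ih, Function.iterate_succ_apply', R.ρ_S]
    rw [mem_ball_iff, norm_iterate R.norm_S]; exact mem_ball_iff.1 hp

lemma ρ_apply (i j : ℕ) : F.ρ (S ^ i * B ^ j) (Ψ ξ u) = Ψ ξ (AS^[i] (AB^[j] u)) := by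
  rw [map_mul, mul_apply, R.ρ_B_pow hp, R.ρ_S_pow]
  rw [mem_ball_iff, norm_iterate R.norm_B]
  exact mem_ball_iff.1 hp

lemma ρ_apply_eq_iff (i j : ℕ) : F.ρ (S ^ i * B ^ j) (Ψ ξ u) = Ψ ξ u ↔ AS^[i] (AB^[j] u) = u := by
  rw [R.ρ_apply hp]
  refine ⟨fun h => R.injective _ _ _ ?_ hp h, fun h => by rw [h]⟩
  rw [mem_ball_iff, norm_iterate R.norm_S, norm_iterate R.norm_B]
  exact mem_ball_iff.1 hp

end

end IsReduced

end SymmetricFamily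

section

variable (i j : ℕ)
include i j

lemma S_pow_mul_B_pow_mod : S ^ i * B ^ j = S ^ (i % 2) * B ^ (j % 6) := by
  conv_lhs =>
    rw [← Nat.div_add_mod i 2, ← Nat.div_add_mod j 6, pow_add, pow_add, pow_mul, pow_mul,
      show S ^ 2 = 1 by decide, show B ^ 6 = 1 by decide, one_pow, one_pow, one_mul, one_mul]

lemma mem_D3_iff : S ^ i * B ^ j ∈ D3 ↔ Even j := by
  have hj : Even j ↔ Even (j % 6) := by rw [Nat.even_iff, Nat.even_iff]; omega
  rw [S_pow_mul_B_pow_mod, hj]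
  have h1 : i % 2 < 2 := Nat.mod_lt _ (by norm_num)
  have h2 : j % 6 < 6 := Nat.mod_lt _ (by norm_num)
  generalize i % 2 = a at h1
  generalize j % 6 = b at h2
  simp only [D3, Set.mem_insert_iff, mem_singleton_iff]
  interval_cases a <;> interval_cases b <;> decide

lemma mem_D3'_iff : S ^ i * B ^ j ∈ D3' ↔ Even (i + j) := by
  have hj : Even (i + j) ↔ Even ((i % 2) + (j % 6)) := by rw [Nat.even_iff, Nat.even_iff]; omega
  rw [S_pow_mul_B_pow_mod, hj]
  have h1 : i % 2 < 2 := Nat.mod_lt _ (by norm_num)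
  have h2 : j % 6 < 6 := Nat.mod_lt _ (by norm_num)
  generalize i % 2 = a at h1
  generalize j % 6 = b at h2
  simp only [D3', Set.mem_insert_iff, mem_singleton_iff]
  interval_cases a <;> interval_cases b <;> decide

lemma mem_D2_iff : S ^ i * B ^ j ∈ D2 ↔ 3 ∣ j := by
  have hj : 3 ∣ j ↔ 3 ∣ (j % 6) := by omega
  rw [S_pow_mul_B_pow_mod, hj]
  have h1 : i % 2 < 2 := Nat.mod_lt _ (by norm_num)
  have h2 : j % 6 < 6 := Nat.mod_lt _ (by norm_num)
  generalize i % 2 = a at h1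
  generalize j % 6 = b at h2
  simp only [D2, Set.mem_insert_iff, mem_singleton_iff]
  interval_cases a <;> interval_cases b <;> decide

lemma mem_D1_iff : S ^ i * B ^ j ∈ D1 ↔ 6 ∣ j := by
  have hj : 6 ∣ j ↔ 6 ∣ (j % 6) := by omega
  rw [S_pow_mul_B_pow_mod, hj]
  have h1 : i % 2 < 2 := Nat.mod_lt _ (by norm_num)
  have h2 : j % 6 < 6 := Nat.mod_lt _ (by norm_num)
  generalize i % 2 = a at h1
  generalize j % 6 = b at h2
  simp only [D1, Set.mem_insert_iff, mem_singleton_iff]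
  interval_cases a <;> interval_cases b <;> decide

lemma mem_D1'_iff : S ^ i * B ^ j ∈ D1' ↔ (i % 2 = 0 ∧ 6 ∣ j ∨ i % 2 = 1 ∧ 6 ∣ j + 3) := by
  have hj : (i % 2 = 0 ∧ 6 ∣ j ∨ i % 2 = 1 ∧ 6 ∣ j + 3) ↔ ((i % 2) % 2 = 0 ∧ 6 ∣ (j % 6) ∨ (i % 2) % 2 = 1 ∧ 6 ∣ (j % 6) + 3) := by
    omega
  rw [S_pow_mul_B_pow_mod, hj]
  have h1 : i % 2 < 2 := Nat.mod_lt _ (by norm_num)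
  have h2 : j % 6 < 6 := Nat.mod_lt _ (by norm_num)
  generalize i % 2 = a at h1
  generalize j % 6 = b at h2
  simp only [D1', Set.mem_insert_iff, mem_singleton_iff]
  interval_cases a <;> interval_cases b <;> decide

lemma mem_C6_iff : S ^ i * B ^ j ∈ C6 ↔ Even i := by
  constructor
  · rintro ⟨k, hk⟩; by_contra h; rw [Nat.not_even_iff_odd] at h; obtain ⟨m, rfl⟩ := h
    rw [pow_succ, pow_mul, show S ^ 2 = 1 by decide, one_pow, one_mul, B, DihedralGroup.r_one_pow,
      DihedralGroup.r_one_pow, S, DihedralGroup.sr_mul_r] at hk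
    simp at hk
  · rintro ⟨m, rfl⟩; refine ⟨j, ?_⟩
    rw [← two_mul, pow_mul, show S ^ 2 = 1 by decide, one_pow, one_mul]

end

namespace SymmetricFamily

variable {N : ℕ} {F : SymmetricFamily N} {ξ0 : ℝ} {κ : ℝ → ℝ} {φ : ℝ → Fin 1 → Loop N}
  {w : ℝ → Conf 1 → Loop N}
  {AB AS : Conf 1 →ₗ[ℝ] Conf 1} {δ : ℝ}
local notation "Λ" => F.SLS φ w
local notation "Ψ" => F.point φ w

lemma norm_e₁ : ‖e₁‖ = 1 := by simp [e₁]

lemma eq_smul_e₁ (u : Conf 1) : u = u 0 • e₁ :=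
  PiLp.ext fun i => by rw [elim i 0]; simp [e₁]

lemma e₁_ne_zero : e₁ ≠ 0 := norm_ne_zero_iff.1 (by rw [norm_e₁]; exact one_ne_zero)

lemma abs_apply_zero (u : Conf 1) : |u 0| = ‖u‖ := by
  conv_rhs => rw [eq_smul_e₁ u, norm_smul, norm_e₁, mul_one, norm_eq_abs]

namespace IsReduced

section

variable (R : F.IsReduced ξ0 κ φ w AB AS δ)
include R

lemma hasFDerivAt_zero_iff {ξ x : ℝ} (hξ : |ξ - ξ0| < δ) (hx : |x| < δ) : HasFDerivAt (Λ ξ) (0 :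
    EuclideanSpace ℝ (Fin 1) →L[ℝ] ℝ) (x • e₁) ↔ deriv (fun r : ℝ => Λ ξ (r • e₁)) x = 0 := by
  have hp := (smul_mem_ball_iff (ξ0 := ξ0) norm_e₁).2 ⟨hξ, hx⟩
  rw [(R.hasDerivAt_ray hp).deriv]
  refine ⟨fun h => by rw [h.fderiv]; rfl, fun h => ?_⟩
  have h1 : fderiv ℝ (Λ ξ) (x • e₁) = 0 := by
    ext u; rw [eq_smul_e₁ u, map_smul, h, smul_zero]; rfl
  rw [← h1]
  exact R.hasFDerivAt hp

lemma nearSolutions_eq {η : ℝ} (hη : 0 < η) (hηδ : η ≤ δ) : ∃ ε > 0, ∀ᶠ ξ in 𝓝 ξ0, F.q ξ ∈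
    F.nearSolutions ξ ε ∧ ∀ x ∈ F.nearSolutions ξ ε, ∃ r, |r| < η ∧ deriv (fun r : ℝ => Λ ξ
    (r • e₁)) r = 0 ∧ x = Ψ ξ (r • e₁) := by
  obtain ⟨ε, hε, h⟩ := R.near η hη
  refine ⟨ε, hε, ?_⟩
  filter_upwards [h, R.eventually_q_mem_near hε, ball_mem_nhds ξ0 R.pos] with ξ h1 h2 h3
  refine ⟨h2, fun x hx => ?_⟩
  obtain ⟨u, hu, rfl⟩ := h1 x hx
  have hu' : |u 0| < η := by rwa [abs_apply_zero]
  refine ⟨u 0, hu', ?_, by rw [← eq_smul_e₁]⟩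
  have h4 := (R.critical ξ u (mem_ball_iff.2 ⟨h3, hu.trans_le hηδ⟩)).2 hx.1
  rw [eq_smul_e₁ u] at h4
  exact (R.hasFDerivAt_zero_iff h3 (hu'.trans_le hηδ)).1 h4

lemma patternI (hB : ∀ u, AB u = u) (hS : ∀ u, AS u = u) : F.PatternI ξ0 κ φ w := by
  intro hne
  obtain ⟨η, hη, hηδ, r, hr, h1, h2⟩ := (R.isRadial norm_e₁ (Or.inl rfl) (by simp)
    hne).exists_branch_both R.pos
  have hl : (along ξ0 fun ξ => κ ξ ≠ 0) ≤ 𝓝 ξ0 := nhdsWithin_le_nhds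
  have hball := eventually_smul_mem_ball R.pos norm_e₁ hl hr
  have hcrit : ∀ᶠ ξ in along ξ0 fun ξ => κ ξ ≠ 0, r ξ ≠ 0 ∧ HasFDerivAt (Λ ξ) (0 : EuclideanSpace ℝ
    (Fin 1) →L[ℝ] ℝ) (r ξ • e₁) := by
    filter_upwards [h1, hball] with ξ h3 h4; have h5 := (smul_mem_ball_iff norm_e₁).1 h4
    exact ⟨h3.1, (R.hasFDerivAt_zero_iff h5.1 h5.2).2 h3.2.2.1⟩
  refine ⟨r, R.isBranch norm_e₁ (Or.inl rfl) (by simp) hne hl hr hcrit ?_, ?_⟩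
  · filter_upwards [hball] with ξ h3 g; obtain ⟨i, j, rfl⟩ := exists_eq_S_pow_mul_B_pow g
    rw [R.ρ_apply_eq_iff h3, show ⇑AB = id from funext hB, show ⇑AS = id from funext hS]; simp
  · obtain ⟨ε, hε, h3⟩ := R.nearSolutions_eq hη hηδ; refine ⟨ε, hε, ?_, ?_⟩
    · filter_upwards [hl h3, h1, hcrit, hball, R.eventually_mem_near hε hl hr,
        hl (ball_mem_nhds ξ0 R.pos)] with ξ h4 h5 h6 h7 h8 h9
      ext x; rw [Set.mem_insert_iff, mem_singleton_iff]; refine ⟨fun hx => ?_, ?_⟩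
      · obtain ⟨y, hy, hy0, rfl⟩ := h4.2 x hx; rcases h5.2.2.2 y hy hy0 with rfl | rfl
        · left; rw [zero_smul, R.point_zero ξ h9]
        · exact Or.inr rfl
      · rintro (rfl | rfl)
        · exact h4.1
        · exact h8 ((R.critical _ _ h7).1 h6.2)
    · filter_upwards [nhdsWithin_le_nhds h3, h2, nhdsWithin_le_nhds (ball_mem_nhds ξ0 R.pos)]
        with ξ h4 h5 h9
      ext x; rw [mem_singleton_iff]; refine ⟨fun hx => ?_, ?_⟩
      · obtain ⟨y, hy, hy0, rfl⟩ := h4.2 x hx; rw [h5 y hy hy0, zero_smul, R.point_zero ξ h9]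
      · rintro rfl; exact h4.1

lemma SLS_neg (h : (∀ u, AB u = -u) ∨ ∀ u, AS u = -u) {ξ : ℝ} {u : Conf 1} (hp : (ξ, u) ∈
    ball (ξ0, 0) δ) : Λ ξ (-u) = Λ ξ u := by
  rcases h with h | h
  · rw [← h, R.SLS_B ξ u hp]
  · rw [← h, R.SLS_S ξ u hp]

end

end IsReduced

lemma iteratedDeriv_eq_zero_of_even {s : ℝ → ℝ} (h : ∀ᶠ r in 𝓝 0, s (-r) = s r) {m : ℕ}
    (hm : Odd m) : iteratedDeriv m s 0 = 0 := by
  have h1 := EventuallyEq.iteratedDeriv_eq m h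
  rw [iteratedDeriv_comp_neg, hm.neg_one_pow, neg_zero] at h1
  simp at h1
  linarith

lemma iterate_smul_apply {d : ℕ} {A : Conf d →ₗ[ℝ] Conf d} {c : ℝ} (h : ∀ u, A u = c • u) (j : ℕ) (u
    : Conf d) : A^[j] u = c ^ j • u := by
  induction j with
  | zero => simp
  | succ j ih => rw [Function.iterate_succ_apply', ih, h, smul_smul, pow_succ']

namespace IsReduced

section

variable (R : F.IsReduced ξ0 κ φ w AB AS δ)
include R

lemma patternOneSide {β γ : ℝ} (hB : ∀ u, AB u = β • u) (hS : ∀ u, AS u = γ • u) (hβγ : β = -1 ∨ γ =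
    -1) {G : Set D6} {b : D6} (hG : ∀ i j : ℕ, γ ^ i * β ^ j = 1 ↔ S ^ i * B ^ j ∈ G) (hb : ∃ i j :
    ℕ, b = S ^ i * B ^ j ∧ γ ^ i * β ^ j = -1) : F.PatternOneSide G b ξ0 κ φ w := by
  intro hne
  have hneg : (∀ u, AB u = -u) ∨ ∀ u, AS u = -u := by
    refine hβγ.imp (fun h u => ?_) fun h u => ?_
    · rw [hB, h, neg_one_smul]
    · rw [hS, h, neg_one_smul]
  have heven : ∀ {ξ r : ℝ}, |ξ - ξ0| < δ → |r| < δ → Λ ξ (-r • e₁) = Λ ξ (r • e₁) := fun {ξ r} hξ hr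
    => by
    rw [neg_smul]; exact R.SLS_neg hneg ((smul_mem_ball_iff norm_e₁).2 ⟨hξ, hr⟩)
  have hev0 : ∀ r : ℝ, |r| < δ → ∀ᶠ x in 𝓝 r, |x| < δ := fun r hr =>
    continuous_abs.continuousAt.eventually (gt_mem_nhds hr)
  have hodd : ∀ m, Odd m → ∀ᶠ ξ in 𝓝 ξ0, F.coeff φ w m ξ e₁ = 0 := fun m hm => by
    filter_upwards [ball_mem_nhds ξ0 R.pos] with ξ hξ; refine iteratedDeriv_eq_zero_of_even ?_ hm
    filter_upwards [hev0 0 (by rw [abs_zero]; exact R.pos)] with r hr using heven hξ hr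
  have hmid : 2 = 2 → ∀ᶠ ξ in 𝓝 ξ0, F.coeff φ w 3 ξ e₁ = 0 ∧ F.coeff φ w 5 ξ e₁ = 0 := fun _ =>
    (hodd 3 (by decide)).and (hodd 5 (by decide))
  obtain ⟨η, hη, hηδ, r, hr, h1, h2⟩ := (R.isRadial norm_e₁ (Or.inr rfl) hmid
    hne).exists_branch R.pos
  have hl : (along ξ0 fun ξ => κ ξ * F.coeff φ w 4 ξ0 e₁ < 0) ≤ 𝓝 ξ0 := nhdsWithin_le_nhds
  have hball := eventually_smul_mem_ball R.pos norm_e₁ hl hr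
  have hcrit : ∀ᶠ ξ in along ξ0 fun ξ => κ ξ * F.coeff φ w 4 ξ0 e₁ < 0, r ξ ≠ 0 ∧ HasFDerivAt (Λ ξ)
    (0 : EuclideanSpace ℝ (Fin 1) →L[ℝ] ℝ) (r ξ • e₁) := by
    filter_upwards [h1, hball] with ξ h3 h4; have h5 := (smul_mem_ball_iff norm_e₁).1 h4
    exact ⟨h3.1.1.ne', (R.hasFDerivAt_zero_iff h5.1 h5.2).2 h3.2.1⟩
  have hderiv : ∀ {ξ x : ℝ}, |ξ - ξ0| < δ → |x| < δ → deriv (fun r => Λ ξ (r • e₁)) x = 0 → deriv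
    (fun r => Λ ξ (r • e₁)) (-x) = 0 := fun {ξ x} hξ hx h3 => by
    have h4 : (fun r => Λ ξ (-r • e₁)) =ᶠ[𝓝 x] fun r => Λ ξ (r • e₁) := by
      filter_upwards [hev0 x hx] with r hr using heven hξ hr
    have h5 := h4.deriv_eq; rw [deriv_comp_neg (fun r => Λ ξ (r • e₁)), h3] at h5; linarith
  have hact : ∀ {ξ : ℝ} {u}, (ξ, u) ∈ ball (ξ0, 0) δ → ∀ i j : ℕ, F.ρ (S ^ i * B ^ j) (Ψ ξ u) = Ψ ξ
    ((γ ^ i * β ^ j) • u) := by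
    intro ξ u hp i j; rw [R.ρ_apply hp, iterate_smul_apply hB, iterate_smul_apply hS, smul_smul]
  have hbact : ∀ {ξ : ℝ} {u}, (ξ, u) ∈ ball (ξ0, 0) δ → F.ρ b (Ψ ξ u) = Ψ ξ (-u) := by
    intro ξ u hp; obtain ⟨i, j, rfl, h3⟩ := hb; rw [hact hp, h3, neg_one_smul]
  have hnegball : ∀ {ξ : ℝ} {u : EuclideanSpace ℝ (Fin 1)}, (ξ, u) ∈ ball (ξ0, 0) δ → (ξ, -u) ∈ ball
    (ξ0, 0) δ := fun {ξ u} hp => by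
    rw [mem_ball_iff, norm_neg]; exact mem_ball_iff.1 hp
  refine ⟨r, R.isBranch norm_e₁ (Or.inr rfl) hmid hne hl hr hcrit ?_, ?_⟩
  · filter_upwards [hball, hcrit] with ξ h3 h4 g; obtain ⟨i, j, rfl⟩ := exists_eq_S_pow_mul_B_pow g
    rw [R.ρ_apply_eq_iff h3, iterate_smul_apply hB, iterate_smul_apply hS, smul_smul, ← hG]
    constructor
    · intro h6
      exact smul_left_injective ℝ (smul_ne_zero h4.1 e₁_ne_zero) (h6.trans (one_smul ℝ _).symm)
    · intro h6; rw [h6, one_smul]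
  · obtain ⟨ε, hε, h3⟩ := R.nearSolutions_eq hη hηδ
    have hlist : ∀ᶠ ξ in 𝓝 ξ0, ∀ x ∈ F.nearSolutions ξ ε, x = F.q ξ ∨ ∃ r ∈ Set.Ioo 0 η, deriv (fun
      r => Λ ξ (r • e₁)) r = 0 ∧ (x = Ψ ξ (r • e₁) ∨ x = Ψ ξ (-(r • e₁))) := by
      filter_upwards [h3, ball_mem_nhds ξ0 R.pos] with ξ h4 h5 x hx
      obtain ⟨y, hy, hy0, rfl⟩ := h4.2 x hx; rcases lt_trichotomy y 0 with hy1 | rfl | hy1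
      · refine Or.inr ⟨-y, ⟨neg_pos.2 hy1, by rwa [abs_of_neg hy1] at hy⟩,
          hderiv h5 (hy.trans_le hηδ) hy0, Or.inr ?_⟩
        rw [neg_smul, neg_neg]
      · left; rw [zero_smul, R.point_zero ξ h5]
      · exact Or.inr ⟨y, ⟨hy1, by rwa [abs_of_pos hy1] at hy⟩, hy0, Or.inl rfl⟩
    refine ⟨ε, hε, ?_, ?_⟩
    · filter_upwards [hl h3, hl hlist, h1, hcrit, hball, R.eventually_mem_near hε hl hr,
        R.eventually_mem_near hε hl (by simpa using hr.neg)] with ξ h4 h5 h6 h7 h8 h9 h10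
      rw [hbact h8]; rw [neg_smul] at h10; have h11 := (smul_mem_ball_iff norm_e₁).1 h8
      refine ⟨fun h => ?_, ?_⟩
      · have h13 : (2 : ℝ) • (r ξ • e₁) = 0 := by
          rw [two_smul]
          nth_rewrite 1 [← (R.injective _ _ _ (hnegball h8) h8 h)]
          exact neg_add_cancel _
        exact smul_ne_zero two_ne_zero (smul_ne_zero h7.1 e₁_ne_zero) h13
      · ext x; simp; refine ⟨fun hx => ?_, ?_⟩
        · rcases h5 x hx with h12 | ⟨y, hy, hy0, h12⟩
          · exact Or.inl h12
          · rw [h6.2.2 y hy hy0] at h12; exact Or.inr h12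
        · rintro (rfl | rfl | rfl)
          · exact h4.1
          · exact h9 ((R.critical _ _ h8).1 h7.2)
          · refine h10 ((R.critical _ _ (hnegball h8)).1 ?_); rw [← neg_smul]
            exact (R.hasFDerivAt_zero_iff h11.1 (by rw [abs_neg]; exact h11.2)).2
              (hderiv h11.1 h11.2 h6.2.1)
    · filter_upwards [nhdsWithin_le_nhds h3, nhdsWithin_le_nhds hlist, h2] with ξ h4 h5 h6; ext x
      rw [mem_singleton_iff]; refine ⟨fun hx => ?_, ?_⟩
      · rcases h5 x hx with h12 | ⟨y, hy, hy0, -⟩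
        · exact h12
        · exact (h6 y hy hy0).elim
      · rintro rfl; exact h4.1

lemma patternII (hB : ∀ u, AB u = u) (hS : ∀ u, AS u = -u) : F.PatternOneSide C6 S ξ0 κ φ w := by
  refine R.patternOneSide (β := 1) (γ := -1) (fun u => by rw [hB, one_smul])
    (fun u => by rw [hS, neg_one_smul]) (Or.inr rfl) (fun i j => ?_) ⟨1, 0, by simp, by simp⟩
  rw [mem_C6_iff, one_pow, mul_one, neg_one_pow_eq_one_iff_even (by norm_num)]

lemma patternIII (hB : ∀ u, AB u = -u) (hS : ∀ u, AS u = u) : F.PatternOneSide D3 M ξ0 κ φ w := by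
  refine R.patternOneSide (β := -1) (γ := 1) (fun u => by rw [hB, neg_one_smul]) (fun u => by rw
    [hS, one_smul]) (Or.inl rfl) (fun i j => ?_) ⟨0, 3, by simp [M], by norm_num⟩
  rw [mem_D3_iff, one_pow, one_mul, neg_one_pow_eq_one_iff_even (by norm_num)]

lemma patternIV (hB : ∀ u, AB u = -u) (hS : ∀ u, AS u = -u) : F.PatternOneSide D3' M ξ0 κ φ w := by
  refine R.patternOneSide (β := -1) (γ := -1) (fun u => by rw [hB, neg_one_smul]) (fun u => by rw
    [hS, neg_one_smul]) (Or.inl rfl) (fun i j => ?_) ⟨0, 3, by simp [M], by norm_num⟩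
  rw [mem_D3'_iff, ← pow_add, neg_one_pow_eq_one_iff_even (by norm_num)]

end

end IsReduced

end SymmetricFamily

section Polar

variable {ξ0 δ : ℝ}

/-- The domain of a family of functions in polar coordinates `((ξ, θ), r)`. -/
def polarDomain (ξ0 δ : ℝ) : Set ((ℝ × ℝ) × ℝ) := {z | |z.1.1 - ξ0| < δ ∧ |z.2| < δ}

lemma isOpen_polarDomain : IsOpen (polarDomain ξ0 δ) := by
  have h1 : IsOpen {z : (ℝ × ℝ) × ℝ | |z.1.1 - ξ0| < δ} := isOpen_lt (by fun_prop) continuous_const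
  have h2 : IsOpen {z : (ℝ × ℝ) × ℝ | |z.2| < δ} := isOpen_lt (by fun_prop) continuous_const
  exact h1.inter h2

abbrev radialDeriv (g : (ℝ × ℝ) × ℝ → ℝ) : (ℝ × ℝ) × ℝ → ℝ := dirDeriv ((0 : ℝ × ℝ), (1 : ℝ)) g

abbrev angularDeriv (g : (ℝ × ℝ) × ℝ → ℝ) : (ℝ × ℝ) × ℝ → ℝ :=
  dirDeriv (((0 : ℝ), (1 : ℝ)), (0 : ℝ)) g

section

variable {g : (ℝ × ℝ) × ℝ → ℝ} (hg : SmoothOn g (polarDomain ξ0 δ))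
include g hg

lemma hasDerivAt_angular {ξ θ r : ℝ} (hξ : |ξ - ξ0| < δ) (hr : |r| < δ) : HasDerivAt (fun θ => g
    ((ξ, θ), r)) (angularDeriv g ((ξ, θ), r)) θ := hasDerivAt_dirDeriv isOpen_polarDomain hg
    ((hasDerivAt_prodMk_right ξ θ).prodMk (hasDerivAt_const θ r)) ⟨hξ, hr⟩

lemma iterate_radialDeriv_angularDeriv {ξ : ℝ} (hξ : |ξ - ξ0| < δ) (hδ : 0 < δ) (j : ℕ) {c c' : ℝ →
    ℝ} (hc : ∀ θ, radialDeriv^[j] g ((ξ, θ), 0) = c θ) (hc' : ∀ θ, HasDerivAt c (c' θ) θ) (θ : ℝ) :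
    radialDeriv^[j] (angularDeriv g) ((ξ, θ), 0) = c' θ := by
  have h0 : |0| < δ := by rwa [abs_zero]
  rw [iterate_dirDeriv_comm isOpen_polarDomain hg _ _ j ⟨hξ, h0⟩]
  have h1 := hasDerivAt_angular (contDiffOn_iterate_dirDeriv isOpen_polarDomain hg
    (0, 1) j) hξ h0 (θ := θ)
  rw [funext hc] at h1
  exact h1.unique (hc' θ)

end

lemma exists_leading {h : (ℝ × ℝ) × ℝ → ℝ} (hh : SmoothOn h (polarDomain ξ0 δ)) (hδ : 0 < δ) {m : ℕ}
    {c : ℝ → ℝ → ℝ} (hc : ∀ᶠ ξ in 𝓝 ξ0, ∀ θ, (∀ j < m, radialDeriv^[j] h ((ξ, θ), 0) = 0) ∧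
    radialDeriv^[m] h ((ξ, θ), 0) = c ξ θ) (θ0 : ℝ) : ∃ K, 0 ≤ K ∧ ∀ᶠ z : (ℝ × ℝ) × ℝ in 𝓝 ((ξ0,
    θ0), 0), |h z - c z.1.1 z.1.2 * z.2 ^ m / m.factorial| ≤ K * |z.2| ^ (m + 1) := by
  obtain ⟨K, hK, h1⟩ := exists_remainder_le isOpen_polarDomain hh (m + 1) (p0 := (ξ0, θ0))
    (by simpa [polarDomain] using hδ)
  refine ⟨K, hK, ?_⟩
  have h2 : ContinuousAt (fun z : (ℝ × ℝ) × ℝ => z.1.1) ((ξ0, θ0), 0) := by fun_prop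
  filter_upwards [h1, h2.eventually hc] with z h3 h4
  refine le_of_eq_of_le ?_ h3
  rw [remainder, sum_range_succ, sum_eq_zero fun j hj => ?_, zero_add]
  · congr 3; rw [← (h4 z.1.2).2]
  · have h5 := (h4 z.1.2).1 j (Finset.mem_range.1 hj); simp at h5; rw [h5]; simp

lemma eventually_sign {h : (ℝ × ℝ) × ℝ → ℝ} {m : ℕ} {c : ℝ → ℝ → ℝ} {θ0 : ℝ} (hexp : ∃ K, 0 ≤ K ∧ ∀ᶠ
    z : (ℝ × ℝ) × ℝ in 𝓝 ((ξ0, θ0), 0), |h z - c z.1.1 z.1.2 * z.2 ^ m / m.factorial| ≤ K * |z.2| ^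
    (m + 1)) (hc : ContinuousAt (fun p : ℝ × ℝ => c p.1 p.2) (ξ0, θ0)) (h0 : c ξ0 θ0 ≠ 0) : ∀ᶠ z :
    (ℝ × ℝ) × ℝ in 𝓝 ((ξ0, θ0), 0), 0 < z.2 → 0 < c ξ0 θ0 * h z := by
  obtain ⟨K, hK, hexp⟩ := hexp
  obtain ⟨a, ha⟩ : ∃ a, a = c ξ0 θ0 := ⟨_, rfl⟩
  rw [← ha] at h0 ⊢
  have ha2 : 0 < a ^ 2 := by positivity
  have h1 : ContinuousAt (fun z : (ℝ × ℝ) × ℝ => a * c z.1.1 z.1.2 / m.factorial) ((ξ0, θ0), 0) := by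
    exact ((ContinuousAt.comp (f := fun z => z.1) (g := fun p : ℝ × ℝ => c p.1 p.2) (x := ((ξ0, θ0), (0 : ℝ))) hc continuousAt_fst).const_mul a).div_const _
  have h3 : ContinuousAt (fun z : (ℝ × ℝ) × ℝ => |a| * K * z.2) ((ξ0, θ0), 0) := by fun_prop
  have h4 : ∀ᶠ z : (ℝ × ℝ) × ℝ in 𝓝 ((ξ0, θ0), 0),
      |a| * K * z.2 < a * c z.1.1 z.1.2 / m.factorial := by
    refine h3.eventually_lt h1 ?_; simp only [mul_zero, ← ha, ← sq]; positivity
  filter_upwards [hexp, h4] with z h5 h6 hz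
  rw [abs_of_pos hz] at h5
  have hp : 0 < z.2 ^ m := by positivity
  have h7 : |a * h z - a * c z.1.1 z.1.2 / m.factorial * z.2 ^ m| ≤ |a| * K * z.2 * z.2 ^ m := by
    have h8 : a * h z - a * c z.1.1 z.1.2 / m.factorial * z.2 ^ m
      = a * (h z - c z.1.1 z.1.2 * z.2 ^ m / m.factorial) := by ring
    rw [h8, abs_mul]
    calc _ ≤ |a| * (K * z.2 ^ (m + 1)) := mul_le_mul_of_nonneg_left h5 (abs_nonneg a)
      _ = _ := by ring
  have h9 := mul_lt_mul_of_pos_right h6 hp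
  linarith [(abs_le.1 h7).1]

variable {g : (ℝ × ℝ) × ℝ → ℝ} {m : ℕ} {A b : ℝ → ℝ}

section

variable (hg : SmoothOn g (polarDomain ξ0 δ)) (hδ : 0 < δ)
include hg hδ

lemma exists_angular_leading (hc : ∀ᶠ ξ in 𝓝 ξ0, ∀ θ, (∀ j < m, radialDeriv^[j] g ((ξ, θ), 0) =
    radialDeriv^[j] g ((ξ, 0), 0)) ∧ radialDeriv^[m] g ((ξ, θ), 0) = A ξ + b ξ * cos (m * θ))
    (θ0 : ℝ) : (∃ K, 0 ≤ K ∧ ∀ᶠ z : (ℝ × ℝ) × ℝ in 𝓝 ((ξ0, θ0), 0), |angularDeriv g z - -(b z.1.1 *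
    (m * sin (m * z.1.2))) * z.2 ^ m / m.factorial| ≤ K * |z.2| ^ (m + 1)) ∧ ∃ K, 0 ≤ K ∧ ∀ᶠ z
    : (ℝ × ℝ) × ℝ in 𝓝 ((ξ0, θ0), 0), |angularDeriv (angularDeriv g) z - -(b z.1.1 * (m * (m *
    cos (m * z.1.2)))) * z.2 ^ m / m.factorial| ≤ K * |z.2| ^ (m + 1) := by
  have hlin : ∀ θ : ℝ, HasDerivAt (fun θ : ℝ => (m : ℝ) * θ) m θ := fun θ => by
    simpa using (hasDerivAt_id θ).const_mul (m : ℝ)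
  have hg1 := contDiffOn_dirDeriv isOpen_polarDomain hg (((0 : ℝ), (1 : ℝ)), (0 : ℝ))
  have h1 : ∀ᶠ ξ in 𝓝 ξ0, ∀ θ, (∀ j < m, radialDeriv^[j] (angularDeriv g) ((ξ, θ), 0) = 0) ∧
    radialDeriv^[m] (angularDeriv g) ((ξ, θ), 0) = -(b ξ * (m * sin (m * θ))) := by
    filter_upwards [hc, ball_mem_nhds ξ0 hδ] with ξ h2 hξ θ; refine ⟨fun j hj => ?_, ?_⟩
    · exact iterate_radialDeriv_angularDeriv hg hξ hδ j (fun θ => (h2 θ).1 j hj)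
        (fun θ => hasDerivAt_const θ _) θ
    · refine iterate_radialDeriv_angularDeriv hg hξ hδ m (fun θ => (h2 θ).2)
        (c' := fun θ => -(b ξ * (m * sin (m * θ)))) (fun θ => ?_) θ
      refine ((((hlin θ).cos).const_mul (b ξ)).const_add (A ξ)).congr_deriv ?_; ring
  have h2 : ∀ᶠ ξ in 𝓝 ξ0, ∀ θ, (∀ j < m, radialDeriv^[j] (angularDeriv (angularDeriv g)) ((ξ, θ), 0)
    = 0) ∧ radialDeriv^[m] (angularDeriv (angularDeriv g)) ((ξ, θ), 0) = -(b ξ * (m * (m * cos (m *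
    θ)))) := by
    filter_upwards [h1, ball_mem_nhds ξ0 hδ] with ξ h2 hξ θ; refine ⟨fun j hj => ?_, ?_⟩
    · exact iterate_radialDeriv_angularDeriv hg1 hξ hδ j (fun θ => (h2 θ).1 j hj)
        (fun θ => hasDerivAt_const θ _) θ
    · refine iterate_radialDeriv_angularDeriv hg1 hξ hδ m (fun θ => (h2 θ).2)
        (c' := fun θ => -(b ξ * (m * (m * cos (m * θ))))) (fun θ => ?_) θ
      refine (((((hlin θ).sin).const_mul (m : ℝ)).const_mul (b ξ)).neg).congr_deriv ?_; ring
  exact ⟨exists_leading hg1 hδ h1 θ0, exists_leading (contDiffOn_dirDeriv isOpen_polarDomain hg1 ((0, 1), 0)) hδ h2 θ0⟩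

lemma eventually_angular_zero (hm : m ≠ 0) (hb : ContinuousAt b ξ0) (hb0 : b ξ0 ≠ 0) (hc : ∀ᶠ ξ in 𝓝
    ξ0, ∀ θ, (∀ j < m, radialDeriv^[j] g ((ξ, θ), 0) = radialDeriv^[j] g ((ξ, 0), 0)) ∧
    radialDeriv^[m] g ((ξ, θ), 0) = A ξ + b ξ * cos (m * θ)) (hrefl : ∀ ξ θ r, |ξ - ξ0| < δ →
    |r| < δ → sin (m * θ) = 0 → angularDeriv g ((ξ, θ), r) = 0) : ∀ᶠ p : ℝ × ℝ in 𝓝 (ξ0, 0), ∀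
    θ ∈ Set.Icc (-π) π, 0 < p.2 → angularDeriv g ((p.1, θ), p.2) = 0 → sin (m * θ) = 0 := by
  have hm' : (m : ℝ) ≠ 0 := Nat.cast_ne_zero.2 hm
  have hbc : ∀ θ0 : ℝ, ContinuousAt (fun p => b p.1) (ξ0, θ0) := fun θ0 =>
    ContinuousAt.comp hb continuousAt_fst
  have local_zero : ∀ θ0 : ℝ, ∀ᶠ z : (ℝ × ℝ) × ℝ in 𝓝 ((ξ0, θ0), 0), 0 < z.2 → angularDeriv g z = 0
    → sin (m * z.1.2) = 0 := by
    intro θ0; obtain ⟨e1, e2⟩ := exists_angular_leading hg hδ hc θ0; by_cases hs : sin (m * θ0) = 0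
    · have hcos : cos (m * θ0) ≠ 0 := fun h => by
        have := sin_sq_add_cos_sq (m * θ0); grind
      obtain ⟨ε, hε, hball⟩ := eventually_nhds_iff_ball.1 ((eventually_sign (c := fun ξ θ => -(b ξ *
        (m * (m * cos (m * θ))))) e2 (by have := hbc θ0; fun_prop) (by simp [hb0, hm', hcos])).and
        (isOpen_polarDomain.mem_nhds (show _ ∈ polarDomain ξ0 δ by simpa [polarDomain] using hδ)))
      filter_upwards [ball_mem_nhds ((ξ0, θ0), 0) hε] with ⟨⟨ξ, θ⟩, r⟩ hz hr h0
      simp only at hr h0 ⊢; rw [mem_ball, Prod.dist_eq, Prod.dist_eq, max_lt_iff, max_lt_iff] at hz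
      simp only at hz; have hmem : ∀ x ∈ Set.uIcc θ0 θ, ((ξ, x), r) ∈ ball ((ξ0, θ0), 0) ε :=
        fun x hx => by
          rw [mem_ball, Prod.dist_eq, Prod.dist_eq, max_lt_iff, max_lt_iff]
          refine ⟨⟨hz.1.1, lt_of_le_of_lt ?_ hz.1.2⟩, hz.2⟩; rw [dist_eq, dist_eq]
          exact Set.abs_sub_left_of_mem_uIcc hx
      have hdom := (hball _ (hmem θ Set.right_mem_uIcc)).2
      have hder : ∀ x, HasDerivAt (fun θ => angularDeriv g ((ξ, θ), r)) (angularDeriv (angularDeriv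
        g) ((ξ, x), r)) x := fun x =>
        hasDerivAt_angular (contDiffOn_dirDeriv isOpen_polarDomain hg ((0, 1), 0)) hdom.1 hdom.2
      have h00 := hrefl ξ θ0 r hdom.1 hdom.2 hs
      have hne : ∀ x ∈ Set.uIcc θ0 θ, angularDeriv (angularDeriv g) ((ξ, x), r) ≠ 0 :=
        fun x hx h => by
          have h2 := (hball _ (hmem x hx)).1 hr; rw [h, mul_zero] at h2; exact lt_irrefl _ h2
      have heq : θ = θ0 := by
        rcases lt_trichotomy θ θ0 with hlt | heq | hlt
        · obtain ⟨x, hx, hx0⟩ := exists_hasDerivAt_eq_zero hlt (fun x _ => (hder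
            x).continuousAt.continuousWithinAt) (h0.trans h00.symm) (fun x _ => hder x)
          exact (hne x (by rw [Set.uIcc_of_ge hlt.le]; exact Set.Ioo_subset_Icc_self hx) hx0).elim
        · exact heq
        · obtain ⟨x, hx, hx0⟩ := exists_hasDerivAt_eq_zero hlt (fun x _ => (hder
            x).continuousAt.continuousWithinAt) (h00.trans h0.symm) (fun x _ => hder x)
          exact (hne x (by rw [Set.uIcc_of_le hlt.le]; exact Set.Ioo_subset_Icc_self hx) hx0).elim
      rw [heq]; exact hs
    · filter_upwards [eventually_sign (c := fun ξ θ => -(b ξ * (m * sin (m * θ)))) e1 (by have := hbc θ0; fun_prop) (by simp [hb0, hm', hs])] with z h2 hr h0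
      have h3 := h2 hr; rw [h0, mul_zero] at h3; exact (lt_irrefl _ h3).elim
  refine IsCompact.eventually_forall_of_forall_eventually isCompact_Icc fun θ0 _ => ?_
  have h1 : ContinuousAt (fun y : (ℝ × ℝ) × ℝ => ((y.1.1, y.2), y.1.2)) ((ξ0, 0), θ0) := by fun_prop
  exact h1.eventually (local_zero θ0)

end

end Polar

lemma exists_homogeneous_form {V : Type*} [NormedAddCommGroup V] [NormedSpace ℝ V] {n : ℕ} (D :
    ContinuousMultilinearMap ℝ (fun _ : Fin n => V) ℝ) (x y : V) : ∃ a : ℕ → ℝ, ∀ s t : ℝ, D (fun _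
    => s • x + t • y) = ∑ k ∈ Finset.range (n + 1), a k * (s ^ k * t ^ (n - k)) := by
  classical
  refine ⟨fun k => ∑ A ∈ Finset.powersetCard k (Finset.univ : Finset (Fin n)),
    D (A.piecewise (fun _ => x) fun _ => y), fun s t => ?_⟩
  have h2 : ∀ A : Finset (Fin n), D (A.piecewise (fun _ => s • x) fun _ => t • y) = s ^ A.card * t ^
    (n - A.card) * D (A.piecewise (fun _ => x) fun _ => y) := by
    intro A; have h3 : A.piecewise (fun _ => s • x) (fun _ => t • y) = fun i => (if i ∈ A then s
      else t) • A.piecewise (fun _ => x) (fun _ => y) i := by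
      funext i; by_cases hi : i ∈ A <;> simp [hi]
    rw [h3, D.map_smul_univ, Finset.prod_ite, Finset.prod_const, Finset.prod_const, smul_eq_mul]
    congr 3
    · congr 1; simp
    · rw [Finset.filter_not, Finset.card_sdiff_of_subset (Finset.filter_subset _ _)]; simp
  have h4 : D (fun _ => s • x + t • y) = ∑ A : Finset (Fin n), D (A.piecewise (fun _ => s • x) fun _
    => t • y) := D.toMultilinearMap.map_add_univ (fun _ => s • x) (fun _ => t • y)
  rw [h4, ← Finset.powerset_univ, Finset.sum_powerset, Finset.card_univ, Fintype.card_fin]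
  refine sum_congr rfl fun k _ => ?_
  rw [Finset.sum_mul]
  refine sum_congr rfl fun A hA => ?_
  grind

section Trigonometric

variable {p : ℝ → ℝ} {a : ℕ → ℝ} {β : ℝ}

lemma cubic_form (hp : ∀ θ, p θ = ∑ k ∈ Finset.range 4, a k * (cos θ ^ k * sin θ ^ (3 - k))) (heven
    : ∀ θ, p (-θ) = p θ) (hrot : ∀ θ, p (θ + β) = p θ) (hβ : cos β = -1 / 2) (θ : ℝ) : p θ = p 0 *
    cos (3 * θ) := by
  have h1 : ∀ θ, p θ = a 1 * (cos θ * sin θ ^ 2) + a 3 * cos θ ^ 3 := fun θ => by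
    have h2 := heven θ; rw [hp, hp] at h2; rw [hp]; simp [sum_range_succ] at h2 ⊢
    linear_combination (-1 / 2) * h2
  have hs : ∀ θ, sin θ ^ 2 = 1 - cos θ ^ 2 := fun θ => by
    linarith [sin_sq_add_cos_sq θ]
  have h3 := hrot 0
  rw [zero_add, h1, h1 0, hs, hs, hβ, cos_zero] at h3
  rw [h1, h1 0, hs, hs, Real.cos_three_mul, cos_zero]
  grind

lemma quartic_form (hp : ∀ θ, p θ = ∑ k ∈ Finset.range 5, a k * (cos θ ^ k * sin θ ^ (4 - k)))
    (heven : ∀ θ, p (-θ) = p θ) (hrot : ∀ θ, p (θ + β) = p θ) (hβ : cos β ^ 2 = 1 / 4) (θ : ℝ) : p θ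
    = p 0 := by
  have hs : ∀ θ, sin θ ^ 2 = 1 - cos θ ^ 2 := fun θ => by
    linarith [sin_sq_add_cos_sq θ]
  have h1 : ∀ θ, p θ = a 0 * (1 - cos θ ^ 2) ^ 2 + a 2 * (cos θ ^ 2 * (1 - cos θ ^ 2)) + a 4 * (cos
    θ ^ 2) ^ 2 := fun θ => by
    have h2 := heven θ; rw [← hs]; rw [hp, hp] at h2; rw [hp]; simp [sum_range_succ] at h2 ⊢
    linear_combination (-1 / 2) * h2
  have h3 := hrot 0
  have h4 := hrot (π / 2)
  have hc : cos (π / 2 + β) ^ 2 = 3 / 4 := by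
    rw [add_comm, Real.cos_add_pi_div_two, neg_sq, hs, hβ]; norm_num
  rw [zero_add, h1, h1 0, hβ, cos_zero] at h3
  rw [h1, h1 (π / 2), hc, Real.cos_pi_div_two] at h4
  grind

lemma sextic_form (hp : ∀ θ, p θ = ∑ k ∈ Finset.range 7, a k * (cos θ ^ k * sin θ ^ (6 - k))) (heven
    : ∀ θ, p (-θ) = p θ) (hrot : ∀ θ, p (θ + β) = p θ) (hβ : cos β ^ 2 = 1 / 4) (θ : ℝ) : p θ = p 0
    * cos (3 * θ) ^ 2 + p (π / 2) * sin (3 * θ) ^ 2 := by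
  have hs : ∀ θ, sin θ ^ 2 = 1 - cos θ ^ 2 := fun θ => by
    linarith [sin_sq_add_cos_sq θ]
  have h1 : ∀ θ, p θ = a 0 * (1 - cos θ ^ 2) ^ 3 + a 2 * (cos θ ^ 2 * (1 - cos θ ^ 2) ^ 2) + a 4 *
    ((cos θ ^ 2) ^ 2 * (1 - cos θ ^ 2)) + a 6 * (cos θ ^ 2) ^ 3 := fun θ => by
      have h2 := heven θ; rw [← hs]; rw [hp, hp] at h2; rw [hp]; simp [sum_range_succ] at h2 ⊢
      linear_combination (-1 / 2) * h2
  have h3 := hrot 0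
  have h4 := hrot (π / 2)
  have hc : cos (π / 2 + β) ^ 2 = 3 / 4 := by
    rw [add_comm, Real.cos_add_pi_div_two, neg_sq, hs, hβ]; norm_num
  rw [zero_add, h1, h1 0, hβ, cos_zero] at h3
  rw [h1, h1 (π / 2), hc, Real.cos_pi_div_two] at h4
  have e2 : a 2 = 9 * a 6 - 6 * a 0 := by linarith
  have e4 : a 4 = 9 * a 0 - 6 * a 6 := by linarith
  rw [h1, h1 0, h1 (π / 2), cos_zero, Real.cos_pi_div_two, e2, e4, hs (3 * θ), Real.cos_three_mul]
  ring

end Trigonometric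

namespace SymmetricFamily

lemma norm_dir (θ : ℝ) : ‖dir θ‖ = 1 := by
  rw [norm_eq, Fin.sum_univ_two]
  simp [dir]

lemma plane_ext {u v : Conf 2} (h0 : u 0 = v 0) (h1 : u 1 = v 1) : u = v := PiLp.ext fun i => by
    fin_cases i
    · exact h0
    · exact h1

lemma exists_eq_norm_smul_dir (u : Conf 2) : ∃ θ ∈ Set.Icc (-π) π, u = ‖u‖ • dir θ := by
  obtain ⟨z, hz⟩ : ∃ z : ℂ, z = ⟨u 0, u 1⟩ := ⟨_, rfl⟩
  have hn : ‖z‖ = ‖u‖ := by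
    rw [hz, norm_eq, Fin.sum_univ_two, Complex.norm_eq_sqrt_sq_add_sq]; simp
  refine ⟨z.arg, ⟨(Complex.neg_pi_lt_arg z).le, Complex.arg_le_pi z⟩, plane_ext ?_ ?_⟩
  · change u 0 = ‖u‖ * cos z.arg; rw [← hn, Complex.norm_mul_cos_arg, hz]
  · change u 1 = ‖u‖ * sin z.arg; rw [← hn, Complex.norm_mul_sin_arg, hz]

lemma contDiff_dir : Smooth dir := by
  rw [contDiff_euclidean]
  intro i
  fin_cases i
  · exact Real.contDiff_cos
  · exact Real.contDiff_sin

lemma hasDerivAt_dir (θ : ℝ) : HasDerivAt dir (dir (θ + π / 2)) θ := by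
  have h1 : dir = fun θ => cos θ • dir 0 + sin θ • dir (π / 2) :=
    funext fun θ => plane_ext (by simp [dir]) (by simp [dir])
  have h2 := ((Real.hasDerivAt_cos θ).smul_const (dir 0)).add
    ((Real.hasDerivAt_sin θ).smul_const (dir (π / 2)))
  have h3 : HasDerivAt (fun θ => cos θ • dir 0 + sin θ • dir (π / 2)) (-sin θ • dir 0 + cos θ • dir
    (π / 2)) θ := h2
  rw [← h1] at h3
  refine h3.congr_deriv (plane_ext ?_ ?_)
  · simp [dir, Real.cos_add_pi_div_two]
  · simp [dir, Real.sin_add_pi_div_two]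

lemma dir_add_pi (θ : ℝ) : dir (θ + π) = -dir θ := plane_ext (by simp [dir]) (by simp [dir])

lemma dir_eq_iff {a b : ℝ} : dir a = dir b ↔ ∃ k : ℤ, a - b = 2 * π * k := by
  rw [← Real.Angle.angle_eq_iff_two_pi_dvd_sub]
  constructor
  · intro h; exact Real.Angle.cos_sin_inj (congrArg (fun u => u 0) h) (congrArg (fun u => u 1) h)
  · intro h; have h0 : cos a = cos b := by rw [← Real.Angle.cos_coe, h, Real.Angle.cos_coe]
    have h1 : sin a = sin b := by rw [← Real.Angle.sin_coe, h, Real.Angle.sin_coe]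
    exact plane_ext h0 h1

lemma toEuclideanLin_rotMatrix_dir (α θ : ℝ) :
    toEuclideanLin (rotMatrix α) (dir θ) = dir (θ + α) := by
  refine plane_ext ?_ ?_
  · rw [toEuclideanLin_coord, Fin.sum_univ_two]; simp [rotMatrix, dir, Real.cos_add]; ring
  · rw [toEuclideanLin_coord, Fin.sum_univ_two]; simp [rotMatrix, dir, Real.sin_add]; ring

lemma toEuclideanLin_reflection_dir (θ : ℝ) :
    toEuclideanLin !![(1 : ℝ), 0; 0, -1] (dir θ) = dir (-θ) := by
  refine plane_ext ?_ ?_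
  · rw [toEuclideanLin_coord, Fin.sum_univ_two]; simp [dir]
  · rw [toEuclideanLin_coord, Fin.sum_univ_two]; simp [dir]

lemma eq_smul_dir_add (θ : ℝ) (v : Conf 2) : v = (v 0 * cos θ + v 1 * sin θ) • dir θ + (v 1 * cos θ
    - v 0 * sin θ) • dir (θ + π / 2) := by
  refine plane_ext ?_ ?_
  · change v 0 = _ * cos θ + _ * cos (θ + π / 2); rw [Real.cos_add_pi_div_two]
    linear_combination (-v 0) * sin_sq_add_cos_sq θ
  · change v 1 = _ * sin θ + _ * sin (θ + π / 2); rw [Real.sin_add_pi_div_two]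
    linear_combination (-v 1) * sin_sq_add_cos_sq θ

/-- The reduced action in a two-dimensional representation, in which `B` is the rotation by
`2 π / m` and `S` a reflection. -/
structure IsPlanar {N : ℕ} (F : SymmetricFamily N) (ξ0 : ℝ) (κ : ℝ → ℝ) (φ : ℝ → Fin 2 → Loop N)
    (w : ℝ → Conf 2 → Loop N)
    (AB AS : Conf 2 →ₗ[ℝ] Conf 2) (δ : ℝ) (m : ℕ) : Prop
    extends F.IsReduced ξ0 κ φ w AB AS δ where
  order_ne : m ≠ 0
  lin_B : ∀ θ, AB (dir θ) = dir (θ + 2 * π / m)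
  lin_S : ∀ θ, AS (dir θ) = dir (-θ)

namespace IsPlanar

variable {N : ℕ} {F : SymmetricFamily N} {ξ0 : ℝ} {κ : ℝ → ℝ} {φ : ℝ → Fin 2 → Loop N}
  {w : ℝ → Conf 2 → Loop N}
  {AB AS : Conf 2 →ₗ[ℝ] Conf 2} {δ : ℝ} {m : ℕ}
local notation "Λ" => F.SLS φ w
local notation "Γ" => F.coeff φ w

section

variable (R : F.IsPlanar ξ0 κ φ w AB AS δ m) (r θ : ℝ)
include R r θ

lemma iterate_B (j : ℕ) : AB^[j] (r • dir θ) = r • dir (θ + 2 * π / m * j) := by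
  induction j with
  | zero => simp
  | succ j ih =>
    rw [Function.iterate_succ_apply', ih, map_smul, R.lin_B]; congr 2; push_cast; ring

lemma iterate_S (i : ℕ) : AS^[i] (r • dir θ) = r • dir ((-1) ^ i * θ) := by
  induction i with
  | zero => simp
  | succ j ih =>
    rw [Function.iterate_succ_apply', ih, map_smul, R.lin_S]; congr 2; ring

end

lemma smul_mem {ξ r : ℝ} (hξ : |ξ - ξ0| < δ) (hr : |r| < δ) (θ : ℝ) : (ξ, r • dir θ) ∈ ball (ξ0, (0
    : Conf 2)) δ := (smul_mem_ball_iff (norm_dir θ)).2 ⟨hξ, hr⟩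

section

variable (R : F.IsPlanar ξ0 κ φ w AB AS δ m) {ξ r : ℝ} (hξ : |ξ - ξ0| < δ) (hr : |r| < δ) (θ : ℝ)
include R ξ r hξ hr θ

lemma SLS_rot (k : ℤ) : Λ ξ (r • dir (θ + 2 * π / m * k)) = Λ ξ (r • dir θ) := by
  have h1 : ∀ θ, Λ ξ (r • dir (θ + 2 * π / m)) = Λ ξ (r • dir θ) := fun θ => by
    rw [← R.SLS_B ξ _ (smul_mem hξ hr θ), map_smul, R.lin_B]
  induction k using Int.induction_on with
  | zero => simp
  | succ k ih =>
    rw [← ih, ← h1 (θ + 2 * π / m * (k : ℤ))]; congr 3; push_cast; ring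
  | pred k ih =>
    rw [← ih, ← h1]; congr 3; push_cast; ring

lemma SLS_reflect : Λ ξ (r • dir (-θ)) = Λ ξ (r • dir θ) := by
  rw [← R.SLS_S ξ _ (smul_mem hξ hr θ), map_smul, R.lin_S]

end

lemma coeff_congr {ξ : ℝ} {e e' : Conf 2} (hδ : 0 < δ) (h : ∀ r : ℝ, |r| < δ → Λ ξ (r • e) = Λ ξ (r
    • e')) (n : ℕ) : Γ n ξ e = Γ n ξ e' := by
  refine EventuallyEq.iteratedDeriv_eq n ?_
  filter_upwards [ball_mem_nhds 0 hδ] with r hr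
  rw [mem_ball, dist_eq, sub_zero] at hr
  exact h r hr

section

variable (R : F.IsPlanar ξ0 κ φ w AB AS δ m) {ξ : ℝ} (hξ : |ξ - ξ0| < δ) (n : ℕ)
include R ξ hξ n

lemma coeff_rot (θ : ℝ) : Γ n ξ (dir (θ + 2 * π / m)) = Γ n ξ (dir θ) :=
  coeff_congr R.pos (fun r hr => by simpa using R.SLS_rot hξ hr θ 1) n

lemma coeff_reflect (θ : ℝ) : Γ n ξ (dir (-θ)) = Γ n ξ (dir θ) :=
  coeff_congr R.pos (fun _ hr => R.SLS_reflect hξ hr θ) n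

lemma exists_coeff_form : ∃ a : ℕ → ℝ, ∀ θ, Γ n ξ (dir θ) = ∑ k ∈ Finset.range (n + 1), a
    k * (cos θ ^ k * sin θ ^ (n - k)) := by
  have hs : SmoothOn (Λ ξ) (ball 0 δ) := fun u hu =>
    (R.contDiffAt (mem_ball_iff.2 ⟨hξ, by simpa using hu⟩)).contDiffWithinAt
  obtain ⟨a, ha⟩ := exists_homogeneous_form (iteratedFDeriv ℝ n (Λ ξ) 0) (dir 0) (dir (π / 2))
  refine ⟨a, fun θ => ?_⟩
  have h1 : dir θ = cos θ • dir 0 + sin θ • dir (π / 2) := plane_ext (by simp [dir]) (by simp [dir])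
  have h2 := iteratedDeriv_line Metric.isOpen_ball hs 0 (dir θ) n 0 (by simpa using R.pos)
  simp at h2
  rw [coeff, h2, ← ha, ← h1]

end

lemma coeff_four (R : F.IsPlanar ξ0 κ φ w AB AS δ m) (hm : m = 3 ∨ m = 6) {ξ : ℝ}
    (hξ : |ξ - ξ0| < δ) (θ : ℝ) : Γ 4 ξ (dir θ) = Γ 4 ξ (dir 0) := by
  obtain ⟨a, ha⟩ := R.exists_coeff_form hξ 4
  refine quartic_form ha (R.coeff_reflect hξ 4) (R.coeff_rot hξ 4) ?_ θ
  rcases hm with rfl | rfl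
  · rw [show 2 * π / (3 : ℕ) = π - π / 3 by push_cast; ring, Real.cos_pi_sub, Real.cos_pi_div_three]
    norm_num
  · rw [show 2 * π / (6 : ℕ) = π / 3 by push_cast; ring, Real.cos_pi_div_three]
    norm_num

lemma coeff_three (R : F.IsPlanar ξ0 κ φ w AB AS δ 3) {ξ : ℝ} (hξ : |ξ - ξ0| < δ) (θ : ℝ) :
    Γ 3 ξ (dir θ) = Γ 3 ξ (dir 0) * cos (3 * θ) := by
  obtain ⟨a, ha⟩ := R.exists_coeff_form hξ 3
  refine cubic_form ha (R.coeff_reflect hξ 3) (R.coeff_rot hξ 3) ?_ θ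
  rw [show 2 * π / (3 : ℕ) = π - π / 3 by push_cast; ring, Real.cos_pi_sub, Real.cos_pi_div_three]
  norm_num

section

variable (R : F.IsPlanar ξ0 κ φ w AB AS δ 6) {ξ : ℝ} (hξ : |ξ - ξ0| < δ)
include R ξ hξ

lemma coeff_six (θ : ℝ) : Γ 6 ξ (dir θ) = Γ 6 ξ (dir 0) * cos (3 * θ) ^ 2 +
    Γ 6 ξ (dir (π / 2)) * sin (3 * θ) ^ 2 := by
  obtain ⟨a, ha⟩ := R.exists_coeff_form hξ 6
  refine sextic_form ha (R.coeff_reflect hξ 6) (R.coeff_rot hξ 6) ?_ θ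
  rw [show 2 * π / (6 : ℕ) = π / 3 by push_cast; ring, Real.cos_pi_div_three]
  norm_num

lemma coeff_odd {n : ℕ} (hn : Odd n) (θ : ℝ) : Γ n ξ (dir θ) = 0 := by
  refine iteratedDeriv_eq_zero_of_even ?_ hn
  filter_upwards [ball_mem_nhds 0 R.pos] with r hr
  rw [mem_ball, dist_eq, sub_zero] at hr
  rw [← R.SLS_rot hξ hr θ 3, neg_smul, ← smul_neg, ← dir_add_pi]
  congr 3
  push_cast
  ring

end

end IsPlanar

end SymmetricFamily

section Hessian

variable {V : Type} [NormedAddCommGroup V] [NormedSpace ℝ V] {f : V → ℝ} {a : V}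

lemma hess_eq (hf : SmoothAt f a) (v : V) : hess f a v = fderiv ℝ (fderiv ℝ f) a v v := by
  rw [hess, iteratedDeriv_two_comp (γ := fun s => a + s • v) (by simpa using hf) (by fun_prop), iteratedDeriv_succ, iteratedDeriv_one, funext fun r => (hasDerivAt_line a v r).deriv]
  simp

lemma hess_smul (hf : SmoothAt f a) (c : ℝ) (v : V) : hess f a (c • v) = c ^ 2 * hess f a v := by
  rw [hess_eq hf, hess_eq hf]
  simp
  ring

lemma hess_neg (f : V → ℝ) (a v : V) : hess (fun x => -f x) a v = -hess f a v :=
  iteratedDeriv_fun_neg 2 (fun s => f (a + s • v)) 0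

lemma eventually_sndDeriv_nonneg [FiniteDimensional ℝ V] {D : V → V →L[ℝ] V →L[ℝ] ℝ}
    (hD : ContinuousAt D a) (hpos : ∀ v, v ≠ 0 → 0 < D a v v) : ∀ᶠ x in 𝓝 a, ∀ v, 0 ≤ D x v v := by
  have h1 : ∀ᶠ x in 𝓝 a, ∀ e ∈ Metric.sphere 0 1, 0 < D x e e := by
    refine IsCompact.eventually_forall_of_forall_eventually (isCompact_sphere 0 1) fun e he => ?_
    have h2 : ContinuousAt (fun z => D z.1 z.2 z.2) (a, e) := by
      exact ((ContinuousAt.comp hD continuousAt_fst).clm_apply continuousAt_snd).clm_apply continuousAt_snd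
    exact h2.eventually (lt_mem_nhds (hpos e (by
      rintro rfl; simp at he)))
  filter_upwards [h1] with x hx v
  by_cases hv : v = 0
  · simp [hv]
  · have h3 := hx (‖v‖⁻¹ • v) (by simp [norm_smul, norm_ne_zero_iff.2 hv])
    simp at h3; have h4 : 0 < ‖v‖⁻¹ := by positivity
    exact (pos_of_mul_pos_right (pos_of_mul_pos_right h3 h4.le) h4.le).le

lemma le_of_sndDeriv_nonneg {g g' g'' : ℝ → ℝ} (h1 : ∀ t ∈ Set.Icc (0 : ℝ) 1, HasDerivAt g (g' t) t)
    (h2 : ∀ t ∈ Set.Icc (0 : ℝ) 1, HasDerivAt g' (g'' t) t) (h0 : g' 0 = 0)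
    (hpos : ∀ t ∈ Set.Icc (0 : ℝ) 1, 0 ≤ g'' t) : g 0 ≤ g 1 := by
  have hmono := monotoneOn_of_deriv_nonneg (convex_Icc 0 1) (fun t ht => (h2 t
    ht).continuousAt.continuousWithinAt) (fun t ht => (h2 t (interior_subset
    ht)).differentiableAt.differentiableWithinAt) fun t ht => by
      rw [(h2 t (interior_subset ht)).deriv]; exact hpos t (interior_subset ht)
  have hmono' := monotoneOn_of_deriv_nonneg (convex_Icc 0 1) (fun t ht => (h1 t
    ht).continuousAt.continuousWithinAt) (fun t ht => (h1 t (interior_subset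
    ht)).differentiableAt.differentiableWithinAt) fun t ht => by
      rw [(h1 t (interior_subset ht)).deriv, ← h0]
      exact hmono (Set.left_mem_Icc.2 zero_le_one) (interior_subset ht) (interior_subset ht).1
  exact hmono' (Set.left_mem_Icc.2 zero_le_one) (Set.right_mem_Icc.2 zero_le_one) zero_le_one

lemma hasDerivAt_fderiv_line {v : V} {t : ℝ} (hf : ContDiffAt ℝ 2 f (a + t • v)) : HasDerivAt (fun t
    : ℝ => fderiv ℝ f (a + t • v) v) (fderiv ℝ (fderiv ℝ f) (a + t • v) v v) t := by
  exact ((ContinuousLinearMap.apply ℝ ℝ v).hasFDerivAt.comp_hasDerivAt t (comp_hasDerivAt_of_eq t (((hf.fderiv_right (m := 1) (by norm_num)).toFDeriv)) (hasDerivAt_line a v t) rfl))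

lemma isLocalMin_of_hess_pos [FiniteDimensional ℝ V] (hf : SmoothAt f a) (h0 : HasFDerivAt f (0 : V
    →L[ℝ] ℝ) a) (hpos : ∀ v, v ≠ 0 → 0 < hess f a v) : IsLocalMin f a := by
  have h2 := eventually_sndDeriv_nonneg (((hf.fderiv_right (m := ∞) (by simp)).fderiv_right (m := ∞) (by simp)).continuousAt) fun v hv => by
    rw [← hess_eq hf]; exact hpos v hv
  have h3 : ∀ᶠ x in 𝓝 a, ContDiffAt ℝ 2 f x := (hf.of_le (by norm_cast)).eventually (by simp)
  obtain ⟨ε, hε, hball⟩ := eventually_nhds_iff_ball.1 (h2.and h3)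
  filter_upwards [ball_mem_nhds a hε] with y hy
  obtain ⟨v, rfl⟩ : ∃ v, y = a + v := ⟨y - a, by abel⟩
  rw [mem_ball, dist_eq_norm, add_sub_cancel_left] at hy
  have hmem : ∀ t ∈ Set.Icc (0 : ℝ) 1, a + t • v ∈ ball a ε := fun t ht => by
    rw [mem_ball, dist_eq_norm, add_sub_cancel_left, norm_smul, norm_eq_abs, abs_of_nonneg ht.1]
    exact (mul_le_of_le_one_left (norm_nonneg _) ht.2).trans_lt hy
  have key := le_of_sndDeriv_nonneg (g'' := fun t => fderiv ℝ (fderiv ℝ f) (a + t • v) v v) (fun t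
    ht => (((hball _ (hmem t ht)).2.toFDeriv)).comp_hasDerivAt t
    (hasDerivAt_line a v t)) (fun t ht => hasDerivAt_fderiv_line (hball _ (hmem t ht)).2) (by simp
    only [zero_smul, add_zero, h0.fderiv, _root_.zero_apply]) (fun t ht => (hball _ (hmem t ht)).1
    v)
  simpa using key

lemma isNondegMin_of_hess_pos [FiniteDimensional ℝ V] (hf : SmoothAt f a)
    (h0 : HasFDerivAt f (0 : V →L[ℝ] ℝ) a) (hpos : ∀ v, v ≠ 0 → 0 < hess f a v) :
    IsNondegMin f a := ⟨h0, isLocalMin_of_hess_pos hf h0 hpos, hpos⟩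

lemma isNondegMax_of_hess_neg [FiniteDimensional ℝ V] (hf : SmoothAt f a) (h0 : HasFDerivAt f (0 : V
    →L[ℝ] ℝ) a) (hneg : ∀ v, v ≠ 0 → hess f a v < 0) : IsNondegMax f a := by
  refine ⟨h0, ?_, hneg⟩
  have h1 := isLocalMin_of_hess_pos hf.neg (by
    have h := h0.fun_neg; rwa [neg_zero] at h)
    fun v hv => by
      rw [hess_neg]; exact neg_pos.2 (hneg v hv)
  simpa using h1.neg

end Hessian

namespace SymmetricFamily

namespace IsPlanar

variable {N : ℕ} {F : SymmetricFamily N} {ξ0 : ℝ} {κ : ℝ → ℝ} {φ : ℝ → Fin 2 → Loop N}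
  {w : ℝ → Conf 2 → Loop N}
  {AB AS : Conf 2 →ₗ[ℝ] Conf 2} {δ : ℝ} {m : ℕ}
local notation "Λ" => F.SLS φ w

def polar (F : SymmetricFamily N) (φ : ℝ → Fin 2 → Loop N)
    (w : ℝ → Conf 2 → Loop N) (z : (ℝ × ℝ) × ℝ) : ℝ :=
  F.SLS φ w z.1.1 (z.2 • dir z.1.2)

section

variable (R : F.IsPlanar ξ0 κ φ w AB AS δ m)
include R

lemma contDiffOn_polar : SmoothOn (polar F φ w) (polarDomain ξ0 δ) := by
  have h1 : Smooth (fun z : (ℝ × ℝ) × ℝ => (z.1.1, z.2 • dir z.1.2)) := by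
    have h2 : Smooth (fun z : (ℝ × ℝ) × ℝ => dir z.1.2) := contDiff_dir.comp (by fun_prop)
    fun_prop
  exact R.smooth.comp h1.contDiffOn fun z hz => smul_mem hz.1 hz.2 _

lemma iterate_radialDeriv_polar {ξ : ℝ} (hξ : |ξ - ξ0| < δ) (j : ℕ) (θ : ℝ) : radialDeriv^[j] (polar
    F φ w) ((ξ, θ), 0) = F.coeff φ w j ξ (dir θ) :=
  (iteratedDeriv_eq_iterate_dirDeriv isOpen_polarDomain R.contDiffOn_polar j ⟨hξ, by simpa using R.pos⟩).symm

lemma continuousAt_coeff (j : ℕ) (θ : ℝ) : ContinuousAt (fun ξ => F.coeff φ w j ξ (dir θ)) ξ0 := by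
  have h0 : ((ξ0, θ), (0 : ℝ)) ∈ polarDomain ξ0 δ := by simpa [polarDomain] using R.pos
  have h1 := ContinuousAt.comp (f := fun ξ => ((ξ, θ), 0)) (g := radialDeriv^[j] (polar F φ w))
    ((contDiffOn_iterate_dirDeriv isOpen_polarDomain R.contDiffOn_polar _ j).contDiffAt
    (isOpen_polarDomain.mem_nhds h0)).continuousAt (by fun_prop)
  refine h1.congr ?_
  filter_upwards [ball_mem_nhds ξ0 R.pos] with ξ hξ
  exact R.iterate_radialDeriv_polar hξ j θ

end

section

variable (R : F.IsPlanar ξ0 κ φ w AB AS δ m) {ξ r : ℝ} (hξ : |ξ - ξ0| < δ) (hr : |r| < δ)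
include R ξ r hξ hr

lemma SLS_axis {θ : ℝ} (hθ : sin (m * θ) = 0) (τ : ℝ) : Λ ξ (r • dir (θ - τ)) = F.SLS φ
    w ξ (r • dir (θ + τ)) := by
  obtain ⟨k, hk⟩ := Real.sin_eq_zero_iff.1 hθ
  have hm : (m : ℝ) ≠ 0 := Nat.cast_ne_zero.2 R.order_ne
  rw [← R.SLS_reflect hξ hr (θ + τ), ← R.SLS_rot hξ hr (-(θ + τ)) k]
  grind

lemma angularDeriv_polar (θ : ℝ) : angularDeriv (polar F φ w) ((ξ, θ), r) = r * fderiv ℝ (Λ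
    ξ) (r • dir θ) (dir (θ + π / 2)) := by
  have h2 := comp_hasDerivAt_of_eq θ (R.hasFDerivAt (smul_mem hξ hr θ)) ((hasDerivAt_dir θ).const_smul r) rfl
  rw [map_smul, smul_eq_mul] at h2
  exact (hasDerivAt_angular R.contDiffOn_polar hξ hr).unique h2

lemma angularDeriv_axis {θ : ℝ} (hθ : sin (m * θ) = 0) : angularDeriv (polar F φ w) ((ξ, θ), r)
    = 0 := by
  have h1 := hasDerivAt_angular (θ := θ) R.contDiffOn_polar hξ hr
  have h3 := HasDerivAt.comp_const_sub θ 0 (by rwa [sub_zero])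
  have h4 : (fun τ => polar F φ w ((ξ, θ - τ), r)) = fun τ => polar F φ w ((ξ, θ + τ), r) :=
    funext fun τ => R.SLS_axis hξ hr hθ τ
  rw [h4] at h3
  linarith [(HasDerivAt.comp_const_add θ 0 (by rwa [add_zero])).unique h3]

lemma hasFDerivAt_zero_iff (hr0 : r ≠ 0) (θ : ℝ) : HasFDerivAt (Λ ξ) O₂ (r • dir θ) ↔ deriv (fun r : ℝ => Λ ξ (r • dir θ)) r = 0 ∧ angularDeriv
    (polar F φ w) ((ξ, θ), r) = 0 := by
  have hp := smul_mem (ξ0 := ξ0) hξ hr θ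
  rw [(R.hasDerivAt_ray hp).deriv, R.angularDeriv_polar hξ hr, mul_eq_zero, or_iff_right hr0]
  refine ⟨fun h => by rw [h.fderiv]; exact ⟨rfl, rfl⟩, fun h => ?_⟩
  have h1 : fderiv ℝ (Λ ξ) (r • dir θ) = 0 := by
    ext v; rw [eq_smul_dir_add θ v, map_add, map_smul, map_smul, h.1, h.2]; simp
  rw [← h1]
  exact R.hasFDerivAt hp

lemma iteratedDeriv_angular (θ : ℝ) : iteratedDeriv 2 (fun θ => Λ ξ (r • dir θ)) θ =
    angularDeriv (angularDeriv (polar F φ w)) ((ξ, θ), r) :=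
  iteratedDeriv_two_eq (of_forall fun _ => hasDerivAt_angular R.contDiffOn_polar hξ hr)
    (hasDerivAt_angular (contDiffOn_dirDeriv isOpen_polarDomain R.contDiffOn_polar _) hξ hr)

end

lemma hess_radial (ξ r θ : ℝ) : hess (Λ ξ) (r • dir θ) (dir θ)
    = iteratedDeriv 2 (fun r : ℝ => Λ ξ (r • dir θ)) r := by
  have h2 : (fun s => Λ ξ (r • dir θ + s • dir θ)) = fun s => (fun r => Λ ξ (r • dir θ)) (r + s) :=
    funext fun s => by simp only [add_smul]
  rw [hess, h2, iteratedDeriv_add_right (fun r => Λ ξ (r • dir θ)), add_zero]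

section

variable (R : F.IsPlanar ξ0 κ φ w AB AS δ m) {ξ r : ℝ} (hξ : |ξ - ξ0| < δ) (hr : |r| < δ) {θ : ℝ}
include R ξ r hξ hr θ

lemma hess_angular (h0 : HasFDerivAt (Λ ξ) O₂ (r • dir θ)) : r ^ 2 * hess (Λ ξ) (r • dir θ) (dir (θ
    + π / 2)) = angularDeriv (angularDeriv (polar F φ w)) ((ξ, θ), r) := by
  have hp := R.contDiffAt (smul_mem (ξ0 := ξ0) hξ hr θ)
  have h1 : deriv (fun θ => r • dir θ) = fun θ => r • dir (θ + π / 2) :=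
    funext fun θ => ((hasDerivAt_dir θ).const_smul r).deriv
  have h2 := iteratedDeriv_two_comp (γ := fun θ => r • dir θ) hp
    (contDiff_dir.const_smul r).contDiffAt
  rw [R.iteratedDeriv_angular hξ hr, h1, h0.fderiv, _root_.zero_apply, add_zero] at h2
  rw [h2, ← hess_eq hp, hess_smul hp]

lemma hess_axis (hθ : sin (m * θ) = 0) (x y : ℝ) : hess (Λ ξ) (r • dir θ) (x • dir θ +
    y • dir (θ + π / 2)) = x ^ 2 * hess (Λ ξ) (r • dir θ) (dir θ) + y ^ 2 * hess (Λ
    ξ) (r • dir θ) (dir (θ + π / 2)) := by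
  have hp := R.contDiffAt (smul_mem (ξ0 := ξ0) hξ hr θ)
  have hrefl : ∀ x y : ℝ, ‖x • dir θ + y • dir (θ + π / 2)‖ < δ → Λ ξ (x • dir θ + (-y) • dir (θ + π
    / 2)) = Λ ξ (x • dir θ + y • dir (θ + π / 2)) := by
    intro x y hxy; obtain ⟨τ, -, hτ⟩ := exists_eq_norm_smul_dir !₂[x, y]
    obtain ⟨ρ, hρ⟩ : ∃ ρ, ρ = ‖!₂[x, y]‖ := ⟨_, rfl⟩; rw [← hρ] at hτ
    have hx : x = ρ * cos τ := congrArg (fun u => u 0) hτ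
    have hy : y = ρ * sin τ := congrArg (fun u => u 1) hτ
    have h1 : ∀ τ, (ρ * cos τ) • dir θ + (ρ * sin τ) • dir (θ + π / 2) = ρ • dir (θ + τ) := fun τ =>
      by
      refine plane_ext ?_ ?_
      · change _ * cos θ + _ * cos (θ + π / 2) = ρ * cos (θ + τ)
        rw [Real.cos_add_pi_div_two, Real.cos_add]; ring
      · change _ * sin θ + _ * sin (θ + π / 2) = ρ * sin (θ + τ)
        rw [Real.sin_add_pi_div_two, Real.sin_add]; ring
    have h2 := h1 (-τ); rw [Real.cos_neg, Real.sin_neg, mul_neg, ← hx, ← hy] at h2; have h3 := h1 τ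
    rw [← hx, ← hy] at h3; rw [h3, norm_smul, norm_dir, mul_one, norm_eq_abs] at hxy
    rw [h2, h3, ← sub_eq_add_neg]; exact R.SLS_axis hξ hxy hθ τ
  have hsym : hess (Λ ξ) (r • dir θ) (x • dir θ + (-y) • dir (θ + π / 2)) = hess (Λ ξ) (r • dir θ)
    (x • dir θ + y • dir (θ + π / 2)) := by
    refine EventuallyEq.iteratedDeriv_eq 2 ?_
    have h1 : ContinuousAt (fun s => ‖(r + s * x) • dir θ + (s * y) • dir (θ + π / 2)‖)
      0 := by fun_prop
    have h2 : ‖(r + 0 * x) • dir θ + (0 * y) • dir (θ + π / 2)‖ < δ := by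
      rw [zero_mul, zero_mul, zero_smul, add_zero, add_zero, norm_smul, norm_dir, mul_one]; exact hr
    filter_upwards [h1.eventually (gt_mem_nhds h2)] with s hs
    have e1 : r • dir θ + s • (x • dir θ + (-y) • dir (θ + π / 2)) = (r + s * x) • dir θ + (-(s *
      y)) • dir (θ + π / 2) := by module
    have e2 : r • dir θ + s • (x • dir θ + y • dir (θ + π / 2)) = (r + s * x) • dir θ + (s * y) •
      dir (θ + π / 2) := by module
    rw [e1, e2, hrefl _ _ hs]
  rw [hess_eq hp, hess_eq hp] at hsym
  rw [hess_eq hp, hess_eq hp, hess_eq hp]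
  simp at hsym ⊢
  linarith

lemma hess_axis_apply (hθ : sin (m * θ) = 0) {σ : ℝ} (h1 : 0 < σ * hess (Λ ξ) (r • dir
    θ) (dir θ)) (h2 : 0 < σ * hess (Λ ξ) (r • dir θ) (dir (θ + π / 2))) {v : Conf 2} (hv : v
    ≠ 0) : 0 < σ * hess (Λ ξ) (r • dir θ) v := by
  obtain ⟨x, y, hxy⟩ : ∃ x y : ℝ, v = x • dir θ + y • dir (θ + π / 2) := ⟨_, _, eq_smul_dir_add θ v⟩
  rw [hxy, R.hess_axis hξ hr hθ, mul_add, mul_left_comm, mul_left_comm σ]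
  by_cases hx : x = 0
  · have hy : y ≠ 0 := by
      rintro rfl; apply hv; rw [hxy, hx, zero_smul, zero_smul, add_zero]
    positivity
  · positivity

lemma isExtremal (hθ : sin (m * θ) = 0) (h0 : HasFDerivAt (Λ ξ) O₂ (r • dir θ)) {σ : ℝ} (h1 : 0 < σ * hess (Λ ξ) (r • dir θ) (dir θ)) (h2
    : 0 < σ * hess (Λ ξ) (r • dir θ) (dir (θ + π / 2))) : IsExtremal σ (Λ ξ) (r •
    dir θ) := by
  have hp := R.contDiffAt (smul_mem (ξ0 := ξ0) hξ hr θ)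
  have h3 := fun v hv => R.hess_axis_apply hξ hr hθ h1 h2 (v := v) hv
  exact ⟨fun hσ => isNondegMin_of_hess_pos hp h0 fun v hv => pos_of_mul_pos_right (h3 v hv) hσ.le,
    fun hσ => isNondegMax_of_hess_neg hp h0 fun v hv => by
      by_contra hcon
      exact absurd (h3 v hv) (not_lt.2 (mul_nonpos_of_nonpos_of_nonneg hσ.le (not_lt.1 hcon)))⟩

end

lemma isSaddle {f : EuclideanSpace ℝ (Fin 2) → ℝ} {a u v : EuclideanSpace ℝ (Fin 2)} (h0 :
    HasFDerivAt f O₂ a) (h : hess f a u * hess f a v < 0) : IsSaddle f a := by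
  rcases mul_neg_iff.1 h with ⟨h1, h2⟩ | ⟨h1, h2⟩
  · exact ⟨h0, ⟨v, h2⟩, u, h1⟩
  · exact ⟨h0, ⟨u, h1⟩, v, h2⟩

end IsPlanar

end SymmetricFamily

lemma eventually_pos_of_isBigO {l : Filter ℝ} {f κ : ℝ → ℝ} {c : ℝ} (hκ : Tendsto κ l (𝓝 0))
    (hne : ∀ᶠ ξ in l, κ ξ ≠ 0) (hc : c ≠ 0) (h : (fun ξ => f ξ - c * κ ξ) =O[l] fun ξ => κ ξ ^ 2) :
    ∀ᶠ ξ in l, 0 < c * κ ξ * f ξ := by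
  obtain ⟨K, hK⟩ := h.bound
  have h1 : Tendsto (fun ξ => |c| * K * |κ ξ|) l (𝓝 0) := by
    have := hκ.abs.const_mul (|c| * K); rwa [abs_zero, mul_zero] at this
  filter_upwards [hK, hne, h1.eventually (gt_mem_nhds (show 0 < c ^ 2 by positivity))] with ξ h2 h3 h4
  rw [norm_eq_abs, norm_pow, norm_eq_abs] at h2
  have h5 : |c * κ ξ * (f ξ - c * κ ξ)| ≤ |c| * |κ ξ| * (K * |κ ξ| ^ 2) := by
    rw [abs_mul, abs_mul]; exact mul_le_mul_of_nonneg_left h2 (by positivity)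
  have h6 : 0 < |κ ξ| ^ 2 := by positivity
  have h7 := mul_lt_mul_of_pos_right h4 h6
  have h8 : c * κ ξ * f ξ = c ^ 2 * |κ ξ| ^ 2 + c * κ ξ * (f ξ - c * κ ξ) := by
    rw [sq_abs]; ring
  have h9 : |c| * |κ ξ| * (K * |κ ξ| ^ 2) = |c| * K * |κ ξ| * |κ ξ| ^ 2 := by ring
  linarith [(abs_le.1 h5).1]

namespace SymmetricFamily

namespace IsPlanar

variable {N : ℕ} {F : SymmetricFamily N} {ξ0 : ℝ} {κ : ℝ → ℝ} {φ : ℝ → Fin 2 → Loop N}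
  {w : ℝ → Conf 2 → Loop N} {AB AS : Conf 2 →ₗ[ℝ] Conf 2} {δ : ℝ} {m : ℕ}
local notation "Λ" => F.SLS φ w
local notation "Γ" => F.coeff φ w
local notation "Ψ" => F.point φ w
local notation "bothSides" => along ξ0 fun ξ => κ ξ ≠ 0
local notation "oneSide" => along ξ0 fun ξ => κ ξ * F.coeff φ w 4 ξ0 (dir 0) < 0

section

variable (R : F.IsPlanar ξ0 κ φ w AB AS δ m)
include R

lemma ray_rot {ξ r : ℝ} (hξ : |ξ - ξ0| < δ) (hr : |r| < δ) (θ : ℝ) (k : ℤ) : (fun r : ℝ => Λ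
    ξ (r • dir (θ + 2 * π / m * k))) =ᶠ[𝓝 r] fun r => Λ ξ (r • dir θ) := by
  filter_upwards [continuous_abs.continuousAt.eventually (gt_mem_nhds hr)] with x hx
  exact R.SLS_rot hξ hx θ k

lemma sin_axis_rot {θ : ℝ} (hθ : sin (m * θ) = 0) (k : ℤ) : sin (m * (θ + 2 * π / m * k)) = 0 := by
  have hm : (m : ℝ) ≠ 0 := Nat.cast_ne_zero.2 R.order_ne
  have h1 : m * (θ + 2 * π / m * k) = m * θ + k * (2 * π) := by field_simp
  rw [h1, Real.sin_add_int_mul_two_pi, hθ]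

end

section

variable (R : F.IsPlanar ξ0 κ φ w AB AS δ m) {ξ r : ℝ} (hξ : |ξ - ξ0| < δ) (hr : |r| < δ)
include R ξ r hξ hr

lemma critical_rot (hr0 : r ≠ 0) {θ : ℝ} (hθ : sin (m * θ) = 0) (k : ℤ) : HasFDerivAt (F.SLS φ w ξ)
    O₂ (r • dir (θ + 2 * π / m * k)) ↔ deriv (fun r : ℝ => Λ ξ (r • dir θ)) r = 0 := by
  rw [R.hasFDerivAt_zero_iff hξ hr hr0, R.angularDeriv_axis hξ hr (R.sin_axis_rot hθ k),
    (R.ray_rot hξ hr θ k).deriv_eq]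
  simp

lemma critical_axis (hr0 : r ≠ 0) {θ : ℝ} (hθ : sin (m * θ) = 0) : HasFDerivAt (Λ ξ) (0 :
    EuclideanSpace ℝ (Fin 2) →L[ℝ] ℝ) (r • dir θ) ↔ deriv (fun r : ℝ => Λ ξ (r • dir θ)) r = 0 := by
  simpa using R.critical_rot hξ hr hr0 hθ 0

lemma hess_radial_rot (θ : ℝ) (k : ℤ) : hess (Λ ξ) (r • dir (θ + 2 * π / m * k)) (dir (θ + 2
    * π / m * k)) = hess (Λ ξ) (r • dir θ) (dir θ) := by
  rw [hess_radial, hess_radial, (R.ray_rot hξ hr θ k).iteratedDeriv_eq]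

lemma hess_angular_rot (hr0 : r ≠ 0) {θ : ℝ} (hθ : sin (m * θ) = 0) (h0 : HasFDerivAt (F.SLS φ w ξ)
    O₂ (r • dir θ)) (k : ℤ) : hess (Λ ξ) (r • dir (θ + 2 * π / m * k)) (dir (θ + 2 * π / m * k + π /
    2)) = hess (Λ ξ) (r • dir θ) (dir (θ + π / 2)) := by
  refine mul_left_cancel₀ (pow_ne_zero 2 hr0) ?_
  rw [R.hess_angular hξ hr ((R.critical_rot hξ hr hr0 hθ k).2 ((R.critical_axis hξ hr hr0 hθ).1 h0)), R.hess_angular hξ hr h0, ← R.iteratedDeriv_angular hξ hr,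
    ← R.iteratedDeriv_angular hξ hr, add_comm θ,
    ← iteratedDeriv_add_right (fun θ => Λ ξ (r • dir θ))]
  congr 1
  funext τ
  rw [add_comm _ τ, R.SLS_rot hξ hr]

end

section

variable (R : F.IsPlanar ξ0 κ φ w AB AS δ m)
include R

lemma exists_list {η : ℝ} (hη : 0 < η) (hηδ : η ≤ δ) : ∃ ε > 0, ∀ᶠ ξ in 𝓝 ξ0, |ξ - ξ0| < η ∧ F.q ξ ∈
    F.nearSolutions ξ ε ∧ ∀ x ∈ F.nearSolutions ξ ε, x = F.q ξ ∨ ∃ r ∈ Set.Ioo 0 η, ∃ θ ∈ Set.Icc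
    (-π) π, HasFDerivAt (Λ ξ) O₂ (r • dir θ) ∧ x = Ψ ξ (r • dir θ) := by
  obtain ⟨ε, hε, h⟩ := R.near η hη
  refine ⟨ε, hε, ?_⟩
  filter_upwards [h, R.eventually_q_mem_near hε, ball_mem_nhds ξ0 hη] with ξ h1 h2 h3
  have h3' := lt_of_lt_of_le h3 hηδ
  refine ⟨h3, h2, fun x hx => ?_⟩
  obtain ⟨u, hu, rfl⟩ := h1 x hx
  by_cases hu0 : u = 0
  · left; rw [hu0, R.point_zero ξ h3']
  · right; obtain ⟨θ, hθ, hθu⟩ := exists_eq_norm_smul_dir u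
    refine ⟨‖u‖, ⟨norm_pos_iff.2 hu0, hu⟩, θ, hθ, ?_, by rw [← hθu]⟩
    rw [← hθu]; exact (R.critical ξ u (mem_ball_iff.2 ⟨h3', hu.trans_le hηδ⟩)).2 hx.1

lemma exists_list_axis {A b : ℝ → ℝ} (hb : ContinuousAt b ξ0) (hb0 : b ξ0 ≠ 0) (hc : ∀ᶠ ξ in 𝓝 ξ0, ∀
    θ, (∀ j < m, Γ j ξ (dir θ) = Γ j ξ (dir 0)) ∧ Γ m ξ (dir θ) = A ξ + b ξ * cos (m * θ)) : ∃ η0 >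
    0, ∀ η > 0, η ≤ η0 → η ≤ δ → ∃ ε > 0, ∀ᶠ ξ in 𝓝 ξ0, |ξ - ξ0| < δ ∧ F.q ξ ∈ F.nearSolutions ξ ε ∧
    ∀ x ∈ F.nearSolutions ξ ε, x = F.q ξ ∨ ∃ r ∈ Set.Ioo 0 η, ∃ θ, sin (m * θ) = 0 ∧ deriv (fun r :
    ℝ => Λ ξ (r • dir θ)) r = 0 ∧ x = Ψ ξ (r • dir θ) := by
  have h1 := eventually_angular_zero R.contDiffOn_polar R.pos R.order_ne hb hb0 (by
    filter_upwards [hc, ball_mem_nhds ξ0 R.pos] with ξ h2 h3 θ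
    simp only [R.iterate_radialDeriv_polar h3]
    exact h2 θ) fun ξ θ r hξ hr hθ => R.angularDeriv_axis hξ hr hθ
  obtain ⟨η0, hη0, hball⟩ := eventually_nhds_iff_ball.1 h1
  refine ⟨η0, hη0, fun η hη hηη hηδ => ?_⟩
  obtain ⟨ε, hε, h⟩ := R.exists_list hη hηδ
  refine ⟨ε, hε, h.mono fun ξ h2 => ⟨h2.1.trans_le hηδ, h2.2.1, fun x hx => ?_⟩⟩
  rcases h2.2.2 x hx with h3 | ⟨r, hr, θ, hθ, h4, h5⟩
  · exact Or.inl h3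
  · have hrabs : |r| < η := by rw [abs_of_pos hr.1]; exact hr.2
    have h6 := (R.hasFDerivAt_zero_iff (h2.1.trans_le hηδ) (hrabs.trans_le hηδ) hr.1.ne' θ).1 h4
    refine Or.inr ⟨r, hr, θ, hball (ξ, r) ?_ θ hθ hr.1 h6.2, h6.1, h5⟩
    rw [mem_ball, Prod.dist_eq, max_lt_iff, dist_eq, dist_eq, sub_zero]
    exact ⟨h2.1.trans_le hηη, hrabs.trans_le hηη⟩

lemma exists_hess_angular_le {A b : ℝ → ℝ} (hc : ∀ᶠ ξ in 𝓝 ξ0, ∀ θ, (∀ j < m, Γ j ξ (dir θ) = Γ j ξ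
    (dir 0)) ∧ Γ m ξ (dir θ) = A ξ + b ξ * cos (m * θ)) (θ0 : ℝ) : ∃ K, 0 ≤ K ∧ ∀ᶠ z : (ℝ × ℝ) × ℝ
    in 𝓝 ((ξ0, θ0), 0), |angularDeriv (angularDeriv (polar F φ w)) z - -(b z.1.1 * (m * (m * cos (m
    * z.1.2)))) * z.2 ^ m / m.factorial| ≤ K * |z.2| ^ (m + 1) :=
  (exists_angular_leading R.contDiffOn_polar R.pos (by
    filter_upwards [hc, ball_mem_nhds ξ0 R.pos] with ξ h2 h3 θ
    simp only [R.iterate_radialDeriv_polar h3]; exact h2 θ) θ0).2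

end

lemma dir_rot_eq_iff (hm : m ≠ 0) (θ : ℝ) (j : ℤ) :
    dir (θ + 2 * π / m * j) = dir θ ↔ (m : ℤ) ∣ j := by
  have hm' : (m : ℝ) ≠ 0 := Nat.cast_ne_zero.2 hm
  rw [dir_eq_iff]
  refine exists_congr fun k => ?_
  rw [add_sub_cancel_left]
  constructor
  · intro h; have h1 : (j : ℝ) = m * k := by
      field_simp at h; linarith
    exact_mod_cast h1
  · intro h; rw [h]; push_cast; field_simp

lemma smul_dir_inj {r a b : ℝ} (hr : r ≠ 0) : r • dir a = r • dir b ↔ dir a = dir b :=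
  ⟨fun h => smul_right_injective _ hr h, fun h => by rw [h]⟩

section

variable (R : F.IsPlanar ξ0 κ φ w AB AS δ m) {ξ r : ℝ} (hξ : |ξ - ξ0| < δ) (hr : |r| < δ)
include R ξ r hξ hr

lemma ρ_B_pow_dir (θ : ℝ) (j : ℕ) : F.ρ (B ^ j) (Ψ ξ (r • dir θ)) = Ψ ξ (r • dir
    (θ + 2 * π / m * j)) := by
  rw [R.ρ_B_pow (smul_mem hξ hr θ), R.iterate_B]

lemma point_dir_inj (hr0 : r ≠ 0) {a b : ℝ} (h : Ψ ξ (r • dir a) = Ψ ξ (r • dir b)) : dir a = dir b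
    := (smul_dir_inj hr0).1 (R.injective _ _ _ (smul_mem hξ hr a) (smul_mem hξ hr b) h)

lemma ρ_eq_iff (hr0 : r ≠ 0) (θ : ℝ) (i j : ℕ) : F.ρ (S ^ i * B ^ j) (Ψ ξ (r • dir θ)) =
    Ψ ξ (r • dir θ) ↔ dir ((-1) ^ i * (θ + 2 * π / m * j)) = dir θ := by
  rw [R.ρ_apply_eq_iff (smul_mem hξ hr θ), R.iterate_B, R.iterate_S, smul_dir_inj hr0]

end

section

variable (R : F.IsPlanar ξ0 κ φ w AB AS δ 3)
include R

lemma leading_V : ∀ᶠ ξ in 𝓝 ξ0, ∀ θ, (∀ j < 3, Γ j ξ (dir θ) = Γ j ξ (dir 0)) ∧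
    Γ 3 ξ (dir θ) = 0 + Γ 3 ξ (dir 0) * cos ((3 : ℕ) * θ) := by
  filter_upwards [ball_mem_nhds ξ0 R.pos] with ξ hξ θ
  refine ⟨fun j hj => ?_, ?_⟩
  · have h1 := R.coeff ξ hξ (dir θ) (norm_dir θ); have h2 := R.coeff ξ hξ (dir 0) (norm_dir 0)
    grind
  · rw [zero_add]; exact R.coeff_three hξ θ

lemma ρ_eq_iff_mem_D2 {ξ r : ℝ} (hξ : |ξ - ξ0| < δ) (hr : |r| < δ) (hr0 : r ≠ 0) (g : D6) : F.ρ g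
    (Ψ ξ (r • dir 0)) = Ψ ξ (r • dir 0) ↔ g ∈ D2 := by
  obtain ⟨i, j, rfl⟩ := exists_eq_S_pow_mul_B_pow g
  rw [R.ρ_eq_iff hξ hr hr0, mem_D2_iff]
  rcases Nat.even_or_odd i with hi | hi
  · rw [hi.neg_one_pow, one_mul]; have h := dir_rot_eq_iff R.order_ne 0 j; push_cast at h ⊢; rw [h]
    omega
  · rw [hi.neg_one_pow]
    have e : (-1 : ℝ) * (0 + 2 * π / (3 : ℕ) * j) = 0 + 2 * π / (3 : ℕ) * (-j : ℤ) := by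
      push_cast; ring
    rw [e, dir_rot_eq_iff R.order_ne 0 (-j)]; omega

end

lemma exists_axis_V {θ : ℝ} (hθ : sin ((3 : ℕ) * θ) = 0) : ∃ (j : ℤ) (σ : ℝ),
    (σ = 1 ∨ σ = -1) ∧ dir θ = σ • dir (0 + 2 * π / (3 : ℕ) * j) := by
  obtain ⟨k, hk⟩ := Real.sin_eq_zero_iff.1 hθ
  have hθk : θ = k * π / 3 := by
    push_cast at hk; linarith
  rcases Int.even_or_odd' k with ⟨j, rfl | rfl⟩
  · refine ⟨j, 1, Or.inl rfl, ?_⟩; rw [one_smul, hθk]; congr 1; push_cast; ring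
  · refine ⟨j + 2, -1, Or.inr rfl, ?_⟩; rw [neg_one_smul, ← dir_add_pi, dir_eq_iff]; refine ⟨-1, ?_⟩
    rw [hθk]; push_cast; ring

lemma patternV (R : F.IsPlanar ξ0 κ φ w AB AS δ 3) : F.PatternV ξ0 κ φ w := by
  have hball0 : ∀ᶠ ξ in 𝓝 ξ0, |ξ - ξ0| < δ := ball_mem_nhds ξ0 R.pos
  refine ⟨hball0.mono fun ξ hξ θ => ⟨R.coeff_three hξ θ, R.coeff_four (Or.inl rfl) hξ θ⟩,
    fun hne => ?_⟩
  have hsin : sin ((3 : ℕ) * 0) = 0 := by simp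
  have hmid : 1 = 2 → ∀ᶠ ξ in 𝓝 ξ0, Γ 3 ξ (dir 0) = 0 ∧ Γ 5 ξ (dir 0) = 0 := by
    simp
  have hrad := R.isRadial (norm_dir 0) (Or.inl rfl) hmid hne
  obtain ⟨η0, hη0, hlist⟩ := R.exists_list_axis (R.continuousAt_coeff 3 0) hne R.leading_V
  obtain ⟨η, hη, hηle, r, hr, h1, h2⟩ := hrad.exists_branch_both (lt_min R.pos hη0)
  have hηδ : η ≤ δ := hηle.trans (min_le_left _ _)
  have hl : (bothSides) ≤ 𝓝 ξ0 := nhdsWithin_le_nhds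
  have hκ : Tendsto κ (bothSides) (𝓝 0) := R.kappa_tendsto.mono_left hl
  have hκ0 : ∀ᶠ ξ in bothSides, κ ξ ≠ 0 := self_mem_nhdsWithin
  have hcrit : ∀ᶠ ξ in bothSides, (|ξ - ξ0| < δ ∧ |r ξ| < δ) ∧ r ξ ≠ 0 ∧ HasFDerivAt (Λ ξ) O₂ (r ξ •
    dir 0) := by
    filter_upwards [h1, hl hball0] with ξ h3 h4; have h5 := h3.2.1.trans_le hηδ
    exact ⟨⟨h4, h5⟩, h3.1, (R.critical_axis h4 h5 h3.1 hsin).2 h3.2.2.1⟩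
  have hz : ∀ᶠ ξ in bothSides, r ξ ≠ 0 ∧ deriv (fun r : ℝ => Λ ξ (r • dir 0)) (r ξ) = 0 := h1.mono
    fun ξ h => ⟨h.1, h.2.2.1⟩
  have hbranch : F.IsBranch φ w ξ0 κ (bothSides) 1 (dir 0) D2 r := R.isBranch (norm_dir 0) (Or.inl
    rfl) hmid hne hl hr (hcrit.mono fun ξ h => h.2) (hcrit.mono fun ξ h g => R.ρ_eq_iff_mem_D2 h.1.1
    h.1.2 h.2.1 g)
  have hang : (fun ξ => hess (Λ ξ) (r ξ • dir 0) (dir (π / 2)) - 3 * κ ξ) =O[bothSides] fun ξ => κ ξ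
    ^ 2 := by
    have e1 : (fun ξ => hess (Λ ξ) (r ξ • dir 0) (dir (π / 2)) + 3 / 2 * (Γ 3 ξ (dir 0) * r ξ))
      =O[bothSides] fun ξ => r ξ ^ 2 := by
      obtain ⟨K, hK, h3⟩ := R.exists_hess_angular_le R.leading_V 0; refine of_bound K ?_
      have h4 : Tendsto (fun ξ => ((ξ, (0 : ℝ)), r ξ)) (bothSides) (𝓝 ((ξ0, 0), 0)) :=
        ((tendsto_id.mono_left hl).prodMk_nhds tendsto_const_nhds).prodMk_nhds hr
      filter_upwards [h4.eventually h3, hcrit] with ξ h5 h6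
      have h7 := R.hess_angular h6.1.1 h6.1.2 h6.2.2; rw [zero_add] at h7; rw [← h7] at h5
      refine le_of_mul_le_mul_left ?_ (pow_pos (abs_pos.2 h6.2.1) 2)
      rw [norm_eq_abs, norm_eq_abs, ← abs_pow, ← abs_mul, abs_pow]
      refine le_of_eq_of_le ?_ (h5.trans (le_of_eq ?_))
      · congr 1; simp [Nat.factorial]; ring
      · ring
    have e3 := (hrad.isBigO_pow hl hr hz).pow 2; simp at e3
    refine ((e1.sub (((hrad.isBigO_order hl hr hz).const_mul_left 3))).trans e3).congr_left fun ξ => ?_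
    simp [Nat.factorial]; ring
  have hsig1 : ∀ᶠ ξ in bothSides, 0 < (-1) * κ ξ * hess (Λ ξ) (r ξ • dir 0) (dir 0) :=
    eventually_pos_of_isBigO hκ hκ0 (by norm_num) (hbranch.radial.congr_left fun ξ => by
      push_cast; ring)
  have hC : ∀ {ξ x : ℝ}, |ξ - ξ0| < δ → |x| < δ → ∀ k : ℕ, F.ρ (C ^ k) (Ψ ξ (x • dir 0)) = Ψ ξ (x •
    dir (0 + 2 * π / (3 : ℕ) * (2 * k : ℤ))) := by
    intro ξ x hξ hx k; rw [C, ← pow_mul, R.ρ_B_pow_dir hξ hx]; push_cast; rfl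
  have hangle : ∀ k : ℕ, 4 * π / 3 * k = 0 + 2 * π / (3 : ℕ) * (2 * k : ℤ) := fun k => by
    push_cast; ring
  refine ⟨r, hbranch, ?_, hang, ?_⟩
  · filter_upwards [hcrit, hκ0, hsig1, eventually_pos_of_isBigO hκ hκ0 (by norm_num) hang] with ξ h3 h4 h5 h6
    refine ⟨fun k k' hkk => ?_, fun k => ⟨?_, ?_⟩⟩
    · simp only [hC h3.1.1 h3.1.2] at hkk
      have h8 := (dir_rot_eq_iff R.order_ne (0 + 2 * π / (3 : ℕ) * (2 * (k' : ℕ) : ℤ))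
        (2 * (k : ℕ) - 2 * (k' : ℕ) : ℤ)).1 (by
          rw [← (R.point_dir_inj h3.1.1 h3.1.2 h3.2.1 hkk)]; congr 1; push_cast; ring)
      ext; omega
    · rw [hC h3.1.1 h3.1.2, hangle]
    · rw [hangle]; refine isSaddle ((R.critical_rot h3.1.1 h3.1.2 h3.2.1 hsin _).2 ((R.critical_axis
        h3.1.1 h3.1.2 h3.2.1 hsin).1 h3.2.2)) (u := dir (0 + 2 * π / (3 : ℕ) * (2 * k : ℤ))) (v :=
        dir (0 + 2 * π / (3 : ℕ) * (2 * k : ℤ) + π / 2)) ?_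
      rw [R.hess_radial_rot h3.1.1 h3.1.2, R.hess_angular_rot h3.1.1 h3.1.2 h3.2.1 hsin h3.2.2,
        zero_add]
      have h7 := mul_pos h5 h6; have h8 : 0 < κ ξ ^ 2 := by positivity
      by_contra hcon; nlinarith [mul_nonneg h8.le (not_lt.1 hcon)]
  · obtain ⟨ε, hε, h3⟩ := hlist η hη (hηle.trans (min_le_right _ _)) hηδ
    have hall : ∀ᶠ ξ in 𝓝 ξ0, |ξ - ξ0| < δ ∧ F.q ξ ∈ F.nearSolutions ξ ε ∧ ∀ x ∈ F.nearSolutions ξ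
      ε, x = F.q ξ ∨ ∃ y : ℝ, y ≠ 0 ∧ |y| < η ∧ deriv (fun r : ℝ => Λ ξ (r • dir 0)) y = 0 ∧ ∃ j :
      ℤ, x = Ψ ξ (y • dir (0 + 2 * π / (3 : ℕ) * j)) := by
      refine h3.mono fun ξ h4 => ⟨h4.1, h4.2.1, fun x hx => (h4.2.2 x hx).imp_right ?_⟩
      rintro ⟨ρ, hρ, θ, hθ, h5, rfl⟩; obtain ⟨j, σ, hσ, hdir⟩ := exists_axis_V hθ
      have hσ1 : |σ| = 1 := by rcases hσ with rfl | rfl <;> simp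
      have hσ0 : σ ≠ 0 := by rcases hσ with rfl | rfl <;> norm_num
      have hy : |ρ * σ| < η := by rw [abs_mul, hσ1, mul_one, abs_of_pos hρ.1]; exact hρ.2
      have h6 := (R.critical_axis h4.1 (by rw [abs_of_pos hρ.1]; exact hρ.2.trans_le hηδ) hρ.1.ne' hθ).2 h5
      rw [hdir, smul_smul] at h6 ⊢
      exact ⟨ρ * σ, mul_ne_zero hρ.1.ne' hσ0, hy, (R.critical_rot h4.1 (hy.trans_le hηδ)
        (mul_ne_zero hρ.1.ne' hσ0) hsin j).1 h6, j, rfl⟩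
    have hcopy : ∀ k : ℕ, ∀ᶠ ξ in bothSides, Ψ ξ (r ξ • dir (0 + 2 * π / (3 : ℕ) * (2 * k : ℤ))) ∈
      F.nearSolutions ξ ε := fun k => by
      filter_upwards [hcrit, R.eventually_mem_near hε hl hr
        (e := dir (0 + 2 * π / (3 : ℕ) * (2 * k : ℤ)))] with ξ h4 h5
      exact h5 ((R.critical _ _ (smul_mem h4.1.1 h4.1.2 _)).1 ((R.critical_rot h4.1.1 h4.1.2 h4.2.1
        hsin _).2 ((R.critical_axis h4.1.1 h4.1.2 h4.2.1 hsin).1 h4.2.2)))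
    refine ⟨ε, hε, ?_, ?_⟩
    · filter_upwards [hl hall, h1, hcrit, eventually_all.2 fun k : Fin 3 => hcopy k]
        with ξ h4 h5 h6 h7
      ext x; simp only [Set.mem_insert_iff, Set.mem_range, hC h6.1.1 h6.1.2]
      refine ⟨fun hx => (h4.2.2 x hx).imp_right ?_, ?_⟩
      · rintro ⟨y, hy0, hy, hy1, j, rfl⟩; rw [(h5.2.2.2 y hy hy1).resolve_left hy0]
        refine ⟨⟨((2 * j) % 3).toNat, by omega⟩, ?_⟩
        congr 2; have h8 : (((2 * j) % 3).toNat : ℤ) = (2 * j) % 3 := Int.toNat_of_nonneg (by omega)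
        rw [← ((dir_rot_eq_iff R.order_ne (0 + 2 * π / (3 : ℕ) * j) (2 * (((2 * j) % 3).toNat : ℤ) - j)).2 (by omega))]
        congr 1; push_cast; ring
      · rintro (rfl | ⟨k, rfl⟩)
        · exact h4.2.1
        · exact h7 k
    · filter_upwards [nhdsWithin_le_nhds hall, h2] with ξ h4 h5; ext x; rw [mem_singleton_iff]
      refine ⟨fun hx => (h4.2.2 x hx).resolve_right ?_, ?_⟩
      · rintro ⟨y, hy0, hy, hy1, -⟩; exact hy0 (h5 y hy hy1)
      · rintro rfl; exact h4.2.1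

lemma leading_VI (R : F.IsPlanar ξ0 κ φ w AB AS δ 6) : ∀ᶠ ξ in 𝓝 ξ0, ∀ θ, (∀ j < 6, Γ j ξ (dir θ) =
    Γ j ξ (dir 0)) ∧ Γ 6 ξ (dir θ) = (Γ 6 ξ (dir 0) + Γ 6 ξ (dir (π / 2))) / 2 + (Γ 6 ξ (dir 0) - Γ
    6 ξ (dir (π / 2))) / 2 * cos ((6 : ℕ) * θ) := by
  filter_upwards [ball_mem_nhds ξ0 R.pos] with ξ hξ θ
  refine ⟨fun j hj => ?_, ?_⟩
  · have h1 := R.coeff ξ hξ (dir θ) (norm_dir θ); have h2 := R.coeff ξ hξ (dir 0) (norm_dir 0)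
    interval_cases j
    · rw [h1.1, h2.1]
    · rw [h1.2.1, h2.2.1]
    · rw [h1.2.2, h2.2.2]
    · rw [R.coeff_odd hξ (by decide), R.coeff_odd hξ (by decide)]
    · exact R.coeff_four (Or.inr rfl) hξ θ
    · rw [R.coeff_odd hξ (by decide), R.coeff_odd hξ (by decide)]
  · rw [R.coeff_six hξ θ, show ((6 : ℕ) : ℝ) * θ = 2 * (3 * θ) by push_cast; ring, Real.cos_two_mul,
      Real.sin_sq]
    ring

section

variable (R : F.IsPlanar ξ0 κ φ w AB AS δ 6) (hne : F.coeff φ w 4 ξ0 (dir 0) ≠ 0)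
include R hne

lemma eventually_radial_ne_zero : ∀ᶠ p : ℝ × ℝ in 𝓝 (ξ0, 0), ∀ θ ∈ Set.Icc (-π) π, 0 < p.2 → 0 ≤ κ
    p.1 * Γ 4 ξ0 (dir 0) → deriv (fun r : ℝ => Λ p.1 (r • dir θ)) p.2 ≠ 0 := by
  have hlocal : ∀ θ0 : ℝ, ∀ᶠ z : (ℝ × ℝ) × ℝ in 𝓝 ((ξ0, θ0), 0), 0 < z.2 → 0 ≤ κ z.1.1 * Γ 4 ξ0 (dir
    0) → deriv (fun r : ℝ => Λ z.1.1 (r • dir z.1.2)) z.2 ≠ 0 := by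
    intro θ0
    have hmem : ((ξ0, θ0), (0 : ℝ)) ∈ polarDomain ξ0 δ := by simpa [polarDomain] using R.pos
    have hdom := isOpen_polarDomain.mem_nhds hmem
    have hexp : ∃ K, 0 ≤ K ∧ ∀ᶠ z : (ℝ × ℝ) × ℝ in 𝓝 ((ξ0, θ0), 0),
        |(radialDeriv (polar F φ w) z - κ z.1.1 * z.2)
          - Γ 4 z.1.1 (dir 0) * z.2 ^ 3 / (3 : ℕ).factorial| ≤ K * |z.2| ^ (3 + 1) := by
      obtain ⟨K, hK, h1⟩ := exists_remainder_le isOpen_polarDomain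
        (contDiffOn_dirDeriv isOpen_polarDomain R.contDiffOn_polar (0, 1)) 4 hmem
      refine ⟨K, hK, ?_⟩; filter_upwards [h1, hdom] with ⟨⟨ξ, θ⟩, r⟩ h2 ⟨h3, h4⟩
      refine le_of_eq_of_le ?_ h2; simp only at h3
      have h5 : ∀ j, radialDeriv^[j] (radialDeriv (polar F φ w)) ((ξ, θ), 0) = Γ (j + 1) ξ (dir θ)
        := fun j => by
        rw [← iterate_succ_apply, R.iterate_radialDeriv_polar h3]
      have h6 := R.coeff ξ h3 (dir θ) (norm_dir θ)
      simp only [remainder, sum_range_succ, Finset.sum_range_zero, h5]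
      simp only [zero_add, Nat.reduceAdd]
      rw [h6.2.1, h6.2.2, R.coeff_odd h3 (n := 3) (by decide), R.coeff_four (Or.inr rfl) h3 θ]
      congr 1; simp [Nat.factorial]; ring
    have hcont := ContinuousAt.comp (x := (ξ0, θ0)) (R.continuousAt_coeff 4 0) continuousAt_fst
    filter_upwards [eventually_sign (c := fun ξ _ => Γ 4 ξ (dir 0)) hexp hcont hne, hdom]
      with ⟨⟨ξ, θ⟩, r⟩ h1 h2 hr h3 h4
    have h5 : deriv (fun r => Λ ξ (r • dir θ)) r = radialDeriv (polar F φ w) ((ξ, θ), r) := by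
      have h6 := iteratedDeriv_eq_iterate_dirDeriv isOpen_polarDomain R.contDiffOn_polar 1 h2
      rwa [iteratedDeriv_one] at h6
    have h6 := h1 hr; simp only at h3 h4 hr h6; rw [← h5, h4] at h6; nlinarith [mul_nonneg h3 hr.le]
  refine IsCompact.eventually_forall_of_forall_eventually isCompact_Icc fun θ0 _ => ?_
  have h1 : ContinuousAt (fun y : (ℝ × ℝ) × ℝ => ((y.1.1, y.2), y.1.2)) ((ξ0, 0), θ0) := by fun_prop
  exact h1.eventually (hlocal θ0)

lemma exists_no_branch : ∃ ε > 0, ∀ᶠ ξ in along ξ0 fun ξ => 0 ≤ κ ξ * Γ 4 ξ0 (dir 0),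
    F.nearSolutions ξ ε = {F.q ξ} := by
  obtain ⟨η0, hη0, hball⟩ := eventually_nhds_iff_ball.1 (R.eventually_radial_ne_zero hne)
  obtain ⟨ε, hε, hlist⟩ := R.exists_list (lt_min hη0 R.pos) (min_le_right _ _)
  refine ⟨ε, hε, ?_⟩
  filter_upwards [nhdsWithin_le_nhds hlist, self_mem_nhdsWithin] with ξ h1 h2
  ext x
  rw [mem_singleton_iff]
  refine ⟨fun hx => (h1.2.2 x hx).resolve_right ?_, ?_⟩
  · rintro ⟨r, hr, θ, hθ, h3, -⟩; have hrη : |r| < min η0 δ := by rw [abs_of_pos hr.1]; exact hr.2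
    refine hball (ξ, r) ?_ θ hθ hr.1 h2 ((R.hasFDerivAt_zero_iff (h1.1.trans_le (min_le_right _ _)) (hrη.trans_le (min_le_right _ _)) hr.1.ne' θ).1 h3).1
    rw [mem_ball, Prod.dist_eq, max_lt_iff, dist_eq, dist_eq, sub_zero]
    exact ⟨h1.1.trans_le (min_le_left _ _), hrη.trans_le (min_le_left _ _)⟩
  · rintro rfl; exact h1.2.1

lemma exists_branch_VI {θ0 : ℝ} (hθ0 : sin ((6 : ℕ) * θ0) = 0) {G : Set D6} (hG : ∀ i j : ℕ, dir
    ((-1) ^ i * (θ0 + 2 * π / (6 : ℕ) * j)) = dir θ0 ↔ S ^ i * B ^ j ∈ G) : ∃ η > 0, η ≤ δ ∧ ∃ r : ℝ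
    → ℝ, F.IsBranch φ w ξ0 κ (oneSide) 2 (dir θ0) G r ∧ ∀ᶠ ξ in oneSide, (|ξ - ξ0| < δ ∧ |r ξ| < δ)
    ∧ 0 < r ξ ∧ HasFDerivAt (Λ ξ) O₂ (r ξ • dir θ0) ∧ ∀ x ∈ Set.Ioo 0 η, deriv (fun r : ℝ => Λ ξ (r
    • dir θ0)) x = 0 → x = r ξ := by
  have hball0 : ∀ᶠ ξ in 𝓝 ξ0, |ξ - ξ0| < δ := ball_mem_nhds ξ0 R.pos
  have hmid : 2 = 2 → ∀ᶠ ξ in 𝓝 ξ0, Γ 3 ξ (dir θ0) = 0 ∧ Γ 5 ξ (dir θ0) = 0 :=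
    fun _ => hball0.mono fun ξ hξ =>
      ⟨R.coeff_odd hξ (by decide) θ0, R.coeff_odd hξ (by decide) θ0⟩
  have h4 : Γ 4 ξ0 (dir θ0) = Γ 4 ξ0 (dir 0) := R.coeff_four (Or.inr rfl) hball0.self_of_nhds θ0
  have hne' : Γ (2 + 2) ξ0 (dir θ0) ≠ 0 := by rw [← h4] at hne; exact hne
  obtain ⟨η, hη, hηδ, r, hr, h1, -⟩ := (R.isRadial (norm_dir θ0) (Or.inr rfl) hmid
    hne').exists_branch R.pos
  simp only [Nat.reduceAdd, h4] at hr h1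
  have hl : (oneSide) ≤ 𝓝 ξ0 := nhdsWithin_le_nhds
  have hcrit : ∀ᶠ ξ in oneSide, (|ξ - ξ0| < δ ∧ |r ξ| < δ) ∧ 0 < r ξ ∧ HasFDerivAt (Λ ξ) O₂ (r ξ •
    dir θ0) ∧ ∀ x ∈ Set.Ioo 0 η, deriv (fun r => Λ ξ (r • dir θ0)) x = 0 → x = r ξ := by
    filter_upwards [h1, hl hball0] with ξ h3 h4
    have h5 : |r ξ| < δ := by rw [abs_of_pos h3.1.1]; exact h3.1.2.trans_le hηδ
    exact ⟨⟨h4, h5⟩, h3.1.1, (R.critical_axis h4 h5 h3.1.1.ne' hθ0).2 h3.2.1, h3.2.2⟩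
  refine ⟨η, hη, hηδ, r, R.isBranch (norm_dir θ0) (Or.inr rfl) hmid hne' hl hr
    (hcrit.mono fun ξ h => ⟨h.2.1.ne', h.2.2.1⟩) (hcrit.mono fun ξ h g => ?_), hcrit⟩
  obtain ⟨i, j, rfl⟩ := exists_eq_S_pow_mul_B_pow g
  rw [R.ρ_eq_iff h.1.1 h.1.2 h.2.1.ne', hG]

end

section

variable (R : F.IsPlanar ξ0 κ φ w AB AS δ m) {ξ r : ℝ} (hξ : |ξ - ξ0| < δ) (hr : |r| < δ)
include R ξ r hξ hr

lemma injective_copies (hr0 : r ≠ 0) (θ0 : ℝ) : Injective fun k : Fin m => F.ρ (B ^ (k :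
    ℕ)) (Ψ ξ (r • dir θ0)) := by
  intro k k' hkk
  simp only [R.ρ_B_pow_dir hξ hr] at hkk
  have h2 := (dir_rot_eq_iff R.order_ne (θ0 + 2 * π / m * (k' : ℕ)) ((k : ℕ) - (k' : ℕ) : ℤ)).1 (by
    rw [← (R.point_dir_inj hξ hr hr0 hkk)]; congr 1; push_cast; ring)
  ext
  obtain ⟨c, hc⟩ := h2
  have h3 := k.isLt
  have h4 := k'.isLt
  have hc0 : c = 0 := by
    by_contra hne; rcases lt_or_gt_of_ne hne with h | h <;> nlinarith
  rw [hc0] at hc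
  omega

lemma exists_copy (θ0 : ℝ) (j : ℤ) : ∃ k : Fin m, F.ρ (B ^ (k : ℕ)) (Ψ ξ (r • dir θ0)) =
    Ψ ξ (r • dir (θ0 + 2 * π / m * j)) := by
  have hm : (0 : ℤ) < m := by
    have := R.order_ne; omega
  have h2 := Int.emod_lt_of_pos j hm
  refine ⟨⟨(j % m).toNat, by omega⟩, ?_⟩
  rw [R.ρ_B_pow_dir hξ hr]
  congr 2
  rw [← ((dir_rot_eq_iff R.order_ne (θ0 + 2 * π / m * j) (((j % m).toNat : ℤ) - j)).2 ⟨-(j / m), by rw [Int.toNat_of_nonneg (Int.emod_nonneg _ hm.ne'), Int.emod_def]; ring⟩)]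
  congr 1
  push_cast
  ring

lemma isExtremal_rot (hr0 : r ≠ 0) {θ : ℝ} (hθ : sin (m * θ) = 0) (h0 : HasFDerivAt (Λ ξ) O₂ (r •
    dir θ)) {σ : ℝ} (h1 : 0 < σ * hess (Λ ξ) (r • dir θ) (dir θ)) (h2 : 0 < σ * hess (Λ ξ) (r • dir
    θ) (dir (θ + π / 2))) (k : ℤ) : IsExtremal σ (Λ ξ) (r • dir (θ + 2 * π / m * k)) := by
  refine R.isExtremal hξ hr (R.sin_axis_rot hθ k) ((R.critical_rot hξ hr hr0 hθ k).2
    ((R.critical_axis hξ hr hr0 hθ).1 h0)) ?_ ?_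
  · rwa [R.hess_radial_rot hξ hr]
  · rwa [R.hess_angular_rot hξ hr hr0 hθ h0]

lemma isSaddle_rot (hr0 : r ≠ 0) {θ : ℝ} (hθ : sin (m * θ) = 0) (h0 : HasFDerivAt (Λ ξ) O₂ (r • dir
    θ)) (h : hess (Λ ξ) (r • dir θ) (dir θ) * hess (Λ ξ) (r • dir θ) (dir (θ + π / 2)) < 0) (k : ℤ)
    : IsSaddle (Λ ξ) (r • dir (θ + 2 * π / m * k)) := by
  refine isSaddle ((R.critical_rot hξ hr hr0 hθ k).2 ((R.critical_axis hξ hr hr0 hθ).1 h0))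
    (u := dir (θ + 2 * π / m * k)) (v := dir (θ + 2 * π / m * k + π / 2)) ?_
  rwa [R.hess_radial_rot hξ hr, R.hess_angular_rot hξ hr hr0 hθ h0]

end

lemma eventually_hess_angular (R : F.IsPlanar ξ0 κ φ w AB AS δ m) {A b : ℝ → ℝ} (hb : ContinuousAt b
    ξ0) (hc : ∀ᶠ ξ in 𝓝 ξ0, ∀ θ, (∀ j < m, Γ j ξ (dir θ) = Γ j ξ (dir 0)) ∧ Γ m ξ (dir θ) = A ξ + b
    ξ * cos (m * θ)) {θ0 : ℝ} (h0 : b ξ0 * cos (m * θ0) ≠ 0) {l : Filter ℝ} (hl : l ≤ 𝓝 ξ0) {r : ℝ →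
    ℝ} (hr : Tendsto r l (𝓝 0)) (hcrit : ∀ᶠ ξ in l, (|ξ - ξ0| < δ ∧ |r ξ| < δ) ∧ 0 < r ξ ∧
    HasFDerivAt (Λ ξ) O₂ (r ξ • dir θ0)) : ∀ᶠ ξ in l, b ξ0 * cos (m * θ0) * hess (Λ ξ) (r ξ • dir
    θ0) (dir (θ0 + π / 2)) < 0 := by
  have hm : (m : ℝ) ≠ 0 := Nat.cast_ne_zero.2 R.order_ne
  have hbc := ContinuousAt.comp (x := (ξ0, θ0)) hb continuousAt_fst
  have h1 := eventually_sign (c := fun ξ θ => -(b ξ * (m * (m * cos (m * θ)))))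
    (R.exists_hess_angular_le hc θ0) (by fun_prop) (by
      grind)
  have h2 : Tendsto (fun ξ => ((ξ, θ0), r ξ)) l (𝓝 ((ξ0, θ0), 0)) :=
    ((tendsto_id.mono_left hl).prodMk_nhds tendsto_const_nhds).prodMk_nhds hr
  filter_upwards [h2.eventually h1, hcrit] with ξ h3 h4
  have h5 := h3 h4.2.1
  rw [← R.hess_angular h4.1.1 h4.1.2 h4.2.2] at h5
  have h6 : 0 < (m : ℝ) ^ 2 * r ξ ^ 2 := by
    have := h4.2.1; positivity
  by_contra hcon
  nlinarith [mul_nonneg h6.le (not_lt.1 hcon)]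

lemma eventually_hess_radial {a : ℝ} {e : Conf 2} {G : Set D6} {r : ℝ → ℝ} (hκ : Tendsto κ (𝓝 ξ0) (𝓝
    0)) (h : F.IsBranch φ w ξ0 κ (along ξ0 fun ξ => κ ξ * a < 0) 2 e G r) : ∀ᶠ ξ in along ξ0 fun ξ
    => κ ξ * a < 0, 0 < a * hess (Λ ξ) (r ξ • e) e := by
  have h0 : ∀ᶠ ξ in along ξ0 fun ξ => κ ξ * a < 0, κ ξ * a < 0 := self_mem_nhdsWithin
  have h1 := eventually_pos_of_isBigO (c := -2) (hκ.mono_left nhdsWithin_le_nhds)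
    (h0.mono fun ξ h => left_ne_zero_of_mul h.ne) (by norm_num) (h.radial.congr_left fun ξ => by
      push_cast; ring)
  filter_upwards [h0, h1] with ξ h2 h3
  have h4 := mul_neg_of_pos_of_neg h3 h2
  have h5 : 0 ≤ 2 * κ ξ ^ 2 := by positivity
  by_contra hcon
  nlinarith [mul_nonneg h5 (neg_nonneg.2 (not_lt.1 hcon))]

lemma dir_eq_iff_mem_D1 (i j : ℕ) :
    dir ((-1) ^ i * (0 + 2 * π / (6 : ℕ) * j)) = dir 0 ↔ S ^ i * B ^ j ∈ D1 := by
  rw [mem_D1_iff]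
  rcases Nat.even_or_odd i with hi | hi
  · rw [hi.neg_one_pow, one_mul]; have h := dir_rot_eq_iff (m := 6) (by norm_num) 0 j
    push_cast at h ⊢; rw [h]; omega
  · rw [hi.neg_one_pow]
    have e : (-1 : ℝ) * (0 + 2 * π / (6 : ℕ) * j) = 0 + 2 * π / (6 : ℕ) * (-j : ℤ) := by
      push_cast; ring
    rw [e, dir_rot_eq_iff (by norm_num) 0 (-j)]
    omega

lemma dir_eq_iff_mem_D1' (i j : ℕ) : dir ((-1) ^ i * (π / 2 + 2 * π / (6 : ℕ) * j)) = dir (π / 2) ↔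
    S ^ i * B ^ j ∈ D1' := by
  rw [mem_D1'_iff]
  rcases Nat.even_or_odd i with hi | hi
  · rw [hi.neg_one_pow, one_mul]; have h := dir_rot_eq_iff (m := 6) (by norm_num) (π / 2) j
    have hi' := Nat.even_iff.1 hi; push_cast at h ⊢; rw [h]; omega
  · rw [hi.neg_one_pow]; have hi' := Nat.odd_iff.1 hi
    have e : (-1 : ℝ) * (π / 2 + 2 * π / (6 : ℕ) * j) = π / 2 + 2 * π / (6 : ℕ) * (-(j + 3 : ℤ) : ℤ)
      := by
      push_cast; ring
    rw [e, dir_rot_eq_iff (by norm_num) (π / 2) (-(j + 3 : ℤ))]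
    omega

lemma exists_axis_VI {θ : ℝ} (hθ : sin ((6 : ℕ) * θ) = 0) : ∃ j : ℤ,
    θ = 0 + 2 * π / (6 : ℕ) * j ∨ θ = π / 2 + 2 * π / (6 : ℕ) * j := by
  obtain ⟨k, hk⟩ := Real.sin_eq_zero_iff.1 hθ
  have hθk : θ = k * π / 6 := by
    push_cast at hk; linarith
  rcases Int.even_or_odd' k with ⟨j, rfl | rfl⟩
  · grind
  · refine ⟨j - 1, Or.inr ?_⟩; rw [hθk]; push_cast; ring

lemma patternVI (R : F.IsPlanar ξ0 κ φ w AB AS δ 6) : F.PatternVI ξ0 κ φ w := by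
  have hball0 : ∀ᶠ ξ in 𝓝 ξ0, |ξ - ξ0| < δ := ball_mem_nhds ξ0 R.pos
  refine ⟨hball0.mono fun ξ hξ θ => ⟨R.coeff_four (Or.inr rfl) hξ θ, R.coeff_six hξ θ⟩,
    fun hne => ?_⟩
  have hs₁ : sin ((6 : ℕ) * 0) = 0 := by simp
  have hs₂ : sin ((6 : ℕ) * (π / 2)) = 0 := by
    rw [show ((6 : ℕ) : ℝ) * (π / 2) = (3 : ℕ) * π by push_cast; ring, Real.sin_nat_mul_pi]
  have hc₂ : cos ((6 : ℕ) * (π / 2)) = -1 := by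
    rw [show ((6 : ℕ) : ℝ) * (π / 2) = (3 : ℕ) * π by push_cast; ring, Real.cos_nat_mul_pi]
    norm_num
  obtain ⟨η₁, hη₁, hη₁δ, r₁, hb₁, h₁⟩ := R.exists_branch_VI hne hs₁ dir_eq_iff_mem_D1
  obtain ⟨η₂, hη₂, hη₂δ, r₂, hb₂, h₂⟩ := R.exists_branch_VI hne hs₂ dir_eq_iff_mem_D1'
  have hl : (oneSide) ≤ 𝓝 ξ0 := nhdsWithin_le_nhds
  have hangle₁ : ∀ k : ℕ, π / 3 * k = 0 + 2 * π / (6 : ℕ) * (k : ℤ) := fun k => by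
    push_cast; ring
  have hangle₂ : ∀ k : ℕ, π / 2 + π / 3 * k = π / 2 + 2 * π / (6 : ℕ) * (k : ℤ) := fun k => by
    push_cast; ring
  have hbcont : ContinuousAt (fun ξ =>
      (Γ 6 ξ (dir 0) - Γ 6 ξ (dir (π / 2))) / 2) ξ0 :=
    ((R.continuousAt_coeff 6 0).sub (R.continuousAt_coeff 6 (π / 2))).div_const 2
  have hrad₁ := eventually_hess_radial R.kappa_tendsto hb₁
  have hrad₂ := eventually_hess_radial R.kappa_tendsto hb₂
  obtain ⟨b, hb⟩ : ∃ b, b = Γ 6 ξ0 (dir (π / 2)) - Γ 6 ξ0 (dir 0) := ⟨_, rfl⟩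
  have hang₁ : b ≠ 0 → ∀ᶠ ξ in oneSide, 0 < b * hess (Λ ξ) (r₁ ξ • dir 0) (dir (0 + π / 2)) := fun
    hb0 => by
    refine (R.eventually_hess_angular hbcont R.leading_VI (θ0 := 0) ?_ hl hb₁.tendsto
      (h₁.mono fun ξ h => ⟨h.1, h.2.1, h.2.2.1⟩)).mono fun ξ h => ?_
    · rw [mul_zero, cos_zero, mul_one, ← neg_sub, ← hb]; grind
    · rw [mul_zero, cos_zero, mul_one, ← neg_sub, ← hb] at h; linarith
  have hang₂ : b ≠ 0 → ∀ᶠ ξ in oneSide, b * hess (Λ ξ) (r₂ ξ • dir (π / 2)) (dir (π / 2 + π / 2)) <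
    0 := fun hb0 => by
    refine (R.eventually_hess_angular hbcont R.leading_VI (θ0 := π / 2) ?_ hl hb₂.tendsto
      (h₂.mono fun ξ h => ⟨h.1, h.2.1, h.2.2.1⟩)).mono fun ξ h => ?_
    · grind
    · rw [hc₂, ← neg_sub, ← hb] at h; linarith
  obtain ⟨ε, hε, hno⟩ := R.exists_no_branch hne
  refine ⟨r₁, r₂, hb₁, hb₂, ?_, ε, hε, hno, fun h6 => ?_, fun h6 => ?_, fun h6 => ?_⟩
  · filter_upwards [h₁, h₂] with ξ h3 h4; refine ⟨R.injective_copies h3.1.1 h3.1.2 h3.2.1.ne' 0,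
      R.injective_copies h4.1.1 h4.1.2 h4.2.1.ne' (π / 2), fun k => ⟨?_, ?_⟩⟩
    · rw [R.ρ_B_pow_dir h3.1.1 h3.1.2, hangle₁]; rfl
    · rw [R.ρ_B_pow_dir h4.1.1 h4.1.2, hangle₂]; rfl
  · obtain ⟨η0, hη0, hlist⟩ := R.exists_list_axis hbcont
      (div_ne_zero (sub_ne_zero.2 h6) two_ne_zero) R.leading_VI
    obtain ⟨ε₁, hε₁, h3⟩ := hlist (min η0 (min η₁ η₂)) (lt_min hη0 (lt_min hη₁ hη₂))
      (min_le_left _ _) ((min_le_right _ _).trans ((min_le_left _ _).trans hη₁δ))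
    have hcopy₁ : ∀ k : ℕ, ∀ᶠ ξ in oneSide, F.ρ (B ^ k) (Ψ ξ (r₁ ξ • dir 0)) ∈ F.nearSolutions ξ ε₁
      := fun k => by
      filter_upwards [h₁, R.eventually_mem_near hε₁ hl hb₁.tendsto
        (e := dir (0 + 2 * π / (6 : ℕ) * (k : ℤ)))] with ξ h4 h5
      rw [R.ρ_B_pow_dir h4.1.1 h4.1.2]; exact h5 ((R.critical _ _ (smul_mem h4.1.1 h4.1.2 _)).1
        ((R.critical_rot h4.1.1 h4.1.2 h4.2.1.ne' hs₁ _).2 ((R.critical_axis h4.1.1 h4.1.2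
        h4.2.1.ne' hs₁).1 h4.2.2.1)))
    have hcopy₂ : ∀ k : ℕ, ∀ᶠ ξ in oneSide, F.ρ (B ^ k) (Ψ ξ (r₂ ξ • dir (π / 2))) ∈ F.nearSolutions
      ξ ε₁ := fun k => by
      filter_upwards [h₂, R.eventually_mem_near hε₁ hl hb₂.tendsto
        (e := dir (π / 2 + 2 * π / (6 : ℕ) * (k : ℤ)))] with ξ h4 h5
      rw [R.ρ_B_pow_dir h4.1.1 h4.1.2]; exact h5 ((R.critical _ _ (smul_mem h4.1.1 h4.1.2 _)).1
        ((R.critical_rot h4.1.1 h4.1.2 h4.2.1.ne' hs₂ _).2 ((R.critical_axis h4.1.1 h4.1.2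
        h4.2.1.ne' hs₂).1 h4.2.2.1)))
    refine ⟨ε₁, hε₁, ?_⟩; filter_upwards [hl h3, h₁, h₂, eventually_all.2 fun k : Fin 6 => hcopy₁ k,
      eventually_all.2 fun k : Fin 6 => hcopy₂ k] with ξ h4 h5 h6 h7 h8
    ext x; simp only [Set.mem_insert_iff, Set.mem_union, Set.mem_range]
    refine ⟨fun hx => (h4.2.2 x hx).imp_right ?_, ?_⟩
    · rintro ⟨y, hy, θ, hθ, h9, rfl⟩; rw [Set.mem_Ioo, lt_min_iff, lt_min_iff] at hy
      have hyδ : |y| < δ := by rw [abs_of_pos hy.1]; exact hy.2.2.1.trans_le hη₁δ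
      obtain ⟨j, rfl | rfl⟩ := exists_axis_VI hθ
      · rw [(R.ray_rot h4.1 hyδ 0 j).deriv_eq] at h9; rw [h5.2.2.2 y ⟨hy.1, hy.2.2.1⟩ h9]
        exact Or.inl (R.exists_copy h5.1.1 h5.1.2 0 j)
      · rw [(R.ray_rot h4.1 hyδ (π / 2) j).deriv_eq] at h9; rw [h6.2.2.2 y ⟨hy.1, hy.2.2.2⟩ h9]
        exact Or.inr (R.exists_copy h6.1.1 h6.1.2 (π / 2) j)
    · rintro (rfl | ⟨k, rfl⟩ | ⟨k, rfl⟩)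
      · exact h4.2.1
      · exact h7 k
      · exact h8 k
  · rw [← hb] at h6; have hb0 := right_ne_zero_of_mul h6.ne'
    filter_upwards [h₁, h₂, hrad₁, hrad₂, hang₁ hb0, hang₂ hb0] with ξ h3 h4 h5 h6' h7 h8 k
    have hb2 : 0 < b ^ 2 := by positivity
    have ha2 : 0 < Γ 4 ξ0 (dir 0) ^ 2 := by positivity
    rw [hangle₂, hangle₁]; refine ⟨R.isExtremal_rot h3.1.1 h3.1.2 h3.2.1.ne' hs₁ h3.2.2.1 h5 ?_ k,
      R.isSaddle_rot h4.1.1 h4.1.2 h4.2.1.ne' hs₂ h4.2.2.1 ?_ k⟩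
    · have h9 := mul_pos h6 h7; by_contra hcon
      nlinarith [mul_nonneg hb2.le (sub_nonneg.2 (not_lt.1 hcon))]
    · have h9 := mul_neg_of_pos_of_neg h6' h8; by_contra hcon
      nlinarith [mul_nonneg h6.le (not_lt.1 hcon)]
  · rw [← hb] at h6; have hb0 := right_ne_zero_of_mul h6.ne
    filter_upwards [h₁, h₂, hrad₁, hrad₂, hang₁ hb0, hang₂ hb0] with ξ h3 h4 h5 h6' h7 h8 k
    have hb2 : 0 < b ^ 2 := by positivity
    rw [hangle₂, hangle₁]; refine ⟨R.isSaddle_rot h3.1.1 h3.1.2 h3.2.1.ne' hs₁ h3.2.2.1 ?_ k,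
      R.isExtremal_rot h4.1.1 h4.1.2 h4.2.1.ne' hs₂ h4.2.2.1 h6' ?_ k⟩
    · have h9 := mul_pos h5 h7; by_contra hcon
      nlinarith [mul_nonneg (neg_nonneg.2 h6.le) (not_lt.1 hcon)]
    · have h9 := mul_pos_of_neg_of_neg h6 h8; by_contra hcon
      nlinarith [mul_nonneg hb2.le (sub_nonneg.2 (not_lt.1 hcon))]

end IsPlanar

end SymmetricFamily

namespace SymmetricFamily

variable {N : ℕ} {F : SymmetricFamily N} {ξ0 : ℝ} {κ : ℝ → ℝ}

lemma IsReduced.pattern {t : Irrep} {φ : ℝ → Fin t.dim → Loop N} {w : ℝ → Conf t.dim → Loop N} {δ :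
    ℝ} (R : F.IsReduced ξ0 κ φ w t.linB t.linS δ) : F.Pattern ξ0 κ t φ w := by
  cases t with
  | I => exact IsReduced.patternI R toEuclideanLin_one_apply toEuclideanLin_one_apply
  | II => exact IsReduced.patternII R toEuclideanLin_one_apply toEuclideanLin_neg_one_apply
  | III => exact IsReduced.patternIII R toEuclideanLin_neg_one_apply toEuclideanLin_one_apply
  | IV => exact IsReduced.patternIV R toEuclideanLin_neg_one_apply toEuclideanLin_neg_one_apply
  | V =>
    refine IsPlanar.patternV (δ := δ) ⟨R, by norm_num, fun θ => ?_, toEuclideanLin_reflection_dir⟩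
    exact_mod_cast toEuclideanLin_rotMatrix_dir (2 * π / 3) θ
  | VI =>
    refine IsPlanar.patternVI (δ := δ) ⟨R, by norm_num, fun θ => ?_, toEuclideanLin_reflection_dir⟩
    rw [show 2 * π / (6 : ℕ) = π / 3 by push_cast; ring]
    exact toEuclideanLin_rotMatrix_dir (π / 3) θ

end SymmetricFamily

end D6Bifurcation

end

theorem mainTheorem4 {N : ℕ} (F : D6Bifurcation.SymmetricFamily N) (ξ₀ : ℝ) (κ : ℝ → ℝ)
    (hcrit : F.IsCritical ξ₀ κ) :
    (∃! t : D6Bifurcation.Irrep, ∃ (J₁ : Set ℝ) (φ : ℝ → Fin t.dim → D6Bifurcation.Loop N),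
      F.IsCriticalFrame ξ₀ κ t J₁ φ) ∧
    ∀ (t : D6Bifurcation.Irrep) (J₁ : Set ℝ) (φ : ℝ → Fin t.dim → D6Bifurcation.Loop N),
      F.IsCriticalFrame ξ₀ κ t J₁ φ →
        (∃ w, F.IsLyapunovSchmidt φ w ξ₀) ∧
        ∀ w, F.IsLyapunovSchmidt φ w ξ₀ →
          F.ReducedExpansion φ w ξ₀ κ ∧ F.Pattern ξ₀ κ t φ w := by
  refine ⟨?_, fun t J₁ φ hφ => ?_⟩
  · obtain ⟨t, J₁, φ, hφ⟩ := hcrit.exists_isCriticalFrame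
    refine ⟨t, ⟨J₁, φ, hφ⟩, ?_⟩
    rintro t' ⟨J', φ', hφ'⟩
    exact (hφ'.isFrame hφ'.mem).eq (hφ.isFrame hφ.mem) hcrit hcrit.mem
  · obtain ⟨n, v, hv⟩ := F.exists_isZeroBasis ξ₀
    have H : F.Setting ξ₀ κ t J₁ φ v := ⟨hcrit, hφ, hv⟩
    refine ⟨?_, fun w hw => ?_⟩
    · obtain ⟨Q, ψ, R⟩ := H.exists_isReduction
      exact R.exists_isLyapunovSchmidt H
    · obtain ⟨Q, ψ, L⟩ := H.exists_isLocal hw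
      obtain ⟨δ, R⟩ := L.exists_isReduced H
      exact ⟨L.reducedExpansion H, R.pattern⟩
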